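/- **Theorem (charts on broken trajectories).** Let $a,b,c\in\mathbb R^N$ be mutually different, let $0=\delta_0<\delta_1<\delta_2<\cdots$ be real weights, and let $\beta:\mathbb R\to[0,1]$ be smooth with $\beta(s)=1$ for $s\le -1$, $\beta'<0$ on $(-1,1)$ and $\beta(s)+\beta(-s)=1$. *Spaces.* Let $H^{k,\delta}$ be the space of $f:\mathbb R\to\mathbb R^N$ with weak derivatives up to order $k$ such that $e^{\delta|s|}f^{(j)}\in L^2$ for $j\le k$. The scale $E_m=H^{m+2,\delta_m}$ is a sc-structure on $E_0=H^2(\mathbb R,\mathbb R^N)$, and $E_\infty=\bigcap_m E_m$. For $p\ne q$ let $\hat X(p,q)=\varphi+H^2$, with $\varphi$ smooth, $\varphi=p$ near $-\infty$ and $\varphi=q$ near $+\infty$, and let $X(p,q)=\hat X(p,q)/\mathbb R$ be its quotient by time shifts, with the quotient topology. A smooth path is an element $u$ of $\varphi+E_\infty$ with $u'(0)\neq0$. The charts of the sc-manifold $X(p,q)$ are the inverses of the maps $h\mapsto[u+h]$, where $u$ is a smooth path and $h\in H_u=\{h\in E_0: h(0)\perp u'(0)\}$, on open neighborhoods of $0$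 that are mapped homeomorphically onto open sets. *Gluing.* Put $R=e^{1/r}-e$ for $r\in(0,1]$, and $R=\infty$ for $r=0$. For $R<\infty$ let $$\oplus_R(f,g)(s)=\beta(s-\tfrac R2)f(s)+(1-\beta(s-\tfrac R2))g(s-R),$$ $$\ominus_R(f,g)(s)=-(1-\beta(s-\tfrac R2))f(s)+\beta(s-\tfrac R2)g(s-R),$$ and let $\oplus_\infty(f,g)=(f,g)$, $\ominus_\infty=0$. Let $\bar X(a,c)=(X(a,b)\times X(b,c))\cup X(a,c)$ with the finest topology such that $X(a,c)\to\bar X(a,c)$ is continuous and $(r,u,v)\mapsto[\oplus_R(u,v)]$ is continuous on $[0,1)\times\hat X(a,b)\times\hat X(b,c)$. *Splicing.* For smooth paths $u$ from $a$ to $b$ and $v$ from $b$ to $c$ let $E=H_u\oplus H_v$, let $V=[0,r_0)$ with $e^{1/r_0}-e=2$, and let $\pi_r$, $r\in V$, be the projection of $E$ onto $\ker\ominus_R$ along $\ker\oplus_R$ (so $\pi_0=\mathrm{id}$). Let $K=\{(r,h,k)\in V\oplus E:\pi_r(h,k)=(h,k)\}$ be the splicing core. *Claim.* 1. For all smooth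 paths $u$ from $a$ to $b$ and $v$ from $b$ to $c$, $(\pi,E,V)$ is a sc-smooth splicing, and the map $$(r,h,k)\mapsto[\oplus_R(u+h,v+k)]$$ is a homeomorphism from an open neighborhood of $0$ in $K$ onto an open subset of $\bar X(a,c)$. Likewise, for every smooth path $u$ from $a$ to $c$ the map $h\mapsto[u+h]$ is a homeomorphism from an open neighborhood of $0$ in $H_u$ onto an open subset of $X(a,c)$. 2. The space $\bar X(a,c)$ is second countable and Hausdorff. The charts given by the inverses of the maps in 1 (for all smooth $u,v$ and all open neighborhoods of $0$ that are mapped homeomorphically onto open sets), together with the charts of $X(a,c)$, cover $\bar X(a,c)$, and any two of them are sc-smoothly compatible. Hence they are contained in a maximal atlas, i.e. they give an M-polyfold structure on $\bar X(a,c)$. 3. The topology of $\bar X(a,c)$ induces the given topologies on $X(a,c)$ and on $X(a,b)\times X(b,c)$, and $X(a,c)$ is open and dense in $\bar X(a,c)$. -/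

import Mathlib

open MeasureTheory Filter Topology Set
open scoped ContDiff ENNReal

noncomputable section

/-- `ℝ^N` with its Euclidean norm. -/
abbrev Vec (N : ℕ) : Type := EuclideanSpace ℝ (Fin N)

/-- `g` is the weak derivative of `f` on the real line. -/
def IsWeakDeriv {N : ℕ} (f g : ℝ → Vec N) : Prop :=
  LocallyIntegrable f ∧ LocallyIntegrable g ∧
    ∀ η : ℝ → ℝ, ContDiff ℝ ∞ η → HasCompactSupport η →
      ∫ s, deriv η s • f s = - ∫ s, η s • g s

lemma IsWeakDeriv.add {N : ℕ} {f g f' g' : ℝ → Vec N}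
    (h : IsWeakDeriv f g) (h' : IsWeakDeriv f' g') : IsWeakDeriv (f + f') (g + g') := by
  refine ⟨h.1.add h'.1, h.2.1.add h'.2.1, fun η hη hc => ?_⟩
  have hd : Continuous (deriv η) := hη.continuous_deriv (by simp)
  simp only [Pi.add_apply, smul_add]
  rw [integral_add (h.1.integrable_smul_left_of_hasCompactSupport hd hc.deriv)
      (h'.1.integrable_smul_left_of_hasCompactSupport hd hc.deriv),
    integral_add (h.2.1.integrable_smul_left_of_hasCompactSupport hη.continuous hc)
      (h'.2.1.integrable_smul_left_of_hasCompactSupport hη.continuous hc),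
    h.2.2 η hη hc, h'.2.2 η hη hc]
  abel

lemma IsWeakDeriv.const_smul {N : ℕ} {f g : ℝ → Vec N}
    (h : IsWeakDeriv f g) (c : ℝ) : IsWeakDeriv (c • f) (c • g) := by
  refine ⟨h.1.smul c, h.2.1.smul c, fun η hη hc => ?_⟩
  simp only [Pi.smul_apply, smul_comm _ c, integral_smul]
  rw [h.2.2 η hη hc, smul_neg]

lemma IsWeakDeriv.unique {N : ℕ} {f f' g g' : ℝ → Vec N} (hf : f =ᵐ[volume] f')
    (h : IsWeakDeriv f g) (h' : IsWeakDeriv f' g') : g =ᵐ[volume] g' := by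
  refine ae_eq_of_integral_contDiff_smul_eq h.2.1 h'.2.1 fun η hη hc => ?_
  have h1 := h.2.2 η hη hc
  have h2 := h'.2.2 η hη hc
  have h3 : ∫ s, deriv η s • f s = ∫ s, deriv η s • f' s :=
    integral_congr_ae (hf.mono fun s hs => by simp only [hs])
  rw [← neg_inj, ← h1, ← h2, h3]

lemma IsWeakDeriv.shift {N : ℕ} {f g : ℝ → Vec N} (h : IsWeakDeriv f g) (R : ℝ) :
    IsWeakDeriv (fun s => f (s - R)) (fun s => g (s - R)) := by
  have key : ∀ f : ℝ → Vec N, LocallyIntegrable f → LocallyIntegrable (fun s => f (s - R)) := by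
    intro f hf
    have := locallyIntegrable_map_homeomorph (Homeomorph.subRight R) (f := f) (μ := volume)
    have hm : Measure.map (Homeomorph.subRight R) (volume : Measure ℝ) = volume := by
      have := (measurePreserving_sub_right (volume : Measure ℝ) R).map_eq
      exact this
    rw [hm] at this
    exact this.1 hf
  refine ⟨key f h.1, key g h.2.1, fun η hη hc => ?_⟩
  have h1 := h.2.2 (fun s => η (s + R)) (hη.comp (contDiff_id.add contDiff_const))
    (hc.comp_homeomorph (Homeomorph.addRight R))
  rw [← integral_sub_right_eq_self _ R, ← integral_sub_right_eq_self (fun s => η (s + R) • g s) R] at h1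
  simpa [deriv_comp_add_const] using h1

lemma IsWeakDeriv.mul {N : ℕ} {f g : ℝ → Vec N} (h : IsWeakDeriv f g) {χ : ℝ → ℝ}
    (hχ : ContDiff ℝ ∞ χ) :
    IsWeakDeriv (fun s => χ s • f s) (fun s => deriv χ s • f s + χ s • g s) := by
  have hd : Continuous (deriv χ) := hχ.continuous_deriv (by simp)
  have hdc : ContDiff ℝ ∞ (deriv χ) := by
    exact ((contDiff_infty_iff_deriv (𝕜 := ℝ)).1 hχ).2
  have key : ∀ (f : ℝ → Vec N) (χ : ℝ → ℝ), Continuous χ → LocallyIntegrable f →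
      LocallyIntegrable (fun s => χ s • f s) := by
    intro f χ hχ hf
    rw [← locallyIntegrableOn_univ] at hf ⊢
    exact hf.continuousOn_smul isOpen_univ.isLocallyClosed hχ.continuousOn
  refine ⟨key f χ hχ.continuous h.1, (key f _ hd h.1).add (key g _ hχ.continuous h.2.1),
    fun η hη hc => ?_⟩
  have h1 := h.2.2 (fun s => η s * χ s) (hη.mul hχ) hc.mul_right
  have e1 : ∀ s, deriv (fun s => η s * χ s) s = deriv η s * χ s + η s * deriv χ s := by
    intro s
    exact deriv_fun_mul (hη.differentiable (by simp) s) (hχ.differentiable (by simp) s)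
  have hηd : Continuous (deriv η) := hη.continuous_deriv (by simp)
  simp only [e1, add_smul, mul_smul] at h1
  simp only [smul_add]
  have i1 := (key f _ hχ.continuous h.1).integrable_smul_left_of_hasCompactSupport hηd hc.deriv
  have i2 := (key f _ hd h.1).integrable_smul_left_of_hasCompactSupport hη.continuous hc
  have i3 := (key g _ hχ.continuous h.2.1).integrable_smul_left_of_hasCompactSupport hη.continuous hc
  rw [integral_add i1 i2] at h1
  rw [integral_add i2 i3, eq_neg_iff_add_eq_zero]
  rw [eq_neg_iff_add_eq_zero] at h1
  rw [← h1]
  abel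

/-- `g 0 = f, g 1, …, g k` are the successive weak derivatives of `f`, and
`s ↦ exp (δ |s|) g j s` is square integrable for every `j ≤ k`. -/
def IsSobolevJet {N : ℕ} (k : ℕ) (δ : ℝ) (f : ℝ → Vec N) (g : ℕ → ℝ → Vec N) : Prop :=
  g 0 = f ∧ (∀ j < k, IsWeakDeriv (g j) (g (j + 1))) ∧
    ∀ j ≤ k, MemLp (fun s => Real.exp (δ * |s|) • g j s) 2 volume

lemma IsSobolevJet.add {N : ℕ} {k : ℕ} {δ : ℝ} {f f' : ℝ → Vec N} {g g' : ℕ → ℝ → Vec N}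
    (h : IsSobolevJet k δ f g) (h' : IsSobolevJet k δ f' g') :
    IsSobolevJet k δ (f + f') (g + g') := by
  refine ⟨by simp [h.1, h'.1], fun j hj => (h.2.1 j hj).add (h'.2.1 j hj), fun j hj => ?_⟩
  exact ((h.2.2 j hj).add (h'.2.2 j hj)).ae_eq (ae_of_all _ fun s => by simp [smul_add])

lemma IsSobolevJet.const_smul {N : ℕ} {k : ℕ} {δ : ℝ} {f : ℝ → Vec N} {g : ℕ → ℝ → Vec N}
    (h : IsSobolevJet k δ f g) (c : ℝ) : IsSobolevJet k δ (c • f) (c • g) := by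
  refine ⟨by simp [h.1], fun j hj => (h.2.1 j hj).const_smul c, fun j hj => ?_⟩
  exact ((h.2.2 j hj).const_smul c).ae_eq (ae_of_all _ fun s => by simp [smul_comm c])

lemma IsSobolevJet.unique {N : ℕ} {k : ℕ} {δ : ℝ} {f : ℝ → Vec N} {g g' : ℕ → ℝ → Vec N}
    (h : IsSobolevJet k δ f g) (h' : IsSobolevJet k δ f g') :
    ∀ j ≤ k, g j =ᵐ[volume] g' j := by
  intro j
  induction j with
  | zero => intro _; rw [h.1, h'.1]
  | succ j ih => intro hj; exact (h.2.1 j hj).unique (ih (by omega)) (h'.2.1 j hj)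

/-- The weighted Sobolev space `H^{k,δ}(ℝ, ℝ^N)`, `k ≥ 1`, as a space of functions: every class
is represented by its continuous representative. -/
def sobolev (N k : ℕ) (δ : ℝ) : Submodule ℝ (ℝ → Vec N) where
  carrier := {f | Continuous f ∧ ∃ g, IsSobolevJet k δ f g}
  zero_mem' := ⟨continuous_const, 0, rfl, fun j _ =>
    ⟨locallyIntegrable_zero, locallyIntegrable_zero, fun η _ _ => by simp⟩,
    fun j _ => by simp⟩
  add_mem' := by
    rintro f f' ⟨hc, g, hg⟩ ⟨hc', g', hg'⟩
    exact ⟨hc.add hc', g + g', hg.add hg'⟩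
  smul_mem' := by
    rintro c f ⟨hc, g, hg⟩
    exact ⟨hc.const_smul c, c • g, hg.const_smul c⟩

/-- `H^{k,δ}(ℝ, ℝ^N)` as a type; it is normed below. -/
def Sob (N k : ℕ) (δ : ℝ) : Type := sobolev N k δ

instance (N k : ℕ) (δ : ℝ) : AddCommGroup (Sob N k δ) :=
  inferInstanceAs (AddCommGroup (sobolev N k δ))

instance (N k : ℕ) (δ : ℝ) : Module ℝ (Sob N k δ) :=
  inferInstanceAs (Module ℝ (sobolev N k δ))

/-- The successive weak derivatives of `f`, each unique almost everywhere. -/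
def Sob.jet {N k : ℕ} {δ : ℝ} (f : Sob N k δ) : ℕ → ℝ → Vec N := f.2.2.choose

lemma Sob.jet_spec {N k : ℕ} {δ : ℝ} (f : Sob N k δ) : IsSobolevJet k δ f.1 f.jet :=
  f.2.2.choose_spec

lemma Sob.memLp_jet {N k : ℕ} {δ : ℝ} (f : Sob N k δ) (j : Fin (k + 1)) :
    MemLp (fun s => Real.exp (δ * |s|) • f.jet j s) 2 volume :=
  f.jet_spec.2.2 j (by omega)

/-- `f ↦ (exp (δ |s|) f^{(j)})_{j ≤ k}`, with values in `L²(ℝ)^{k+1}`. -/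
def Sob.toL2 (N k : ℕ) (δ : ℝ) :
    Sob N k δ →ₗ[ℝ] PiLp 2 (fun _ : Fin (k + 1) => Lp (Vec N) 2 (volume : Measure ℝ)) where
  toFun f := WithLp.toLp 2 fun j => (f.memLp_jet j).toLp _
  map_add' f f' := by
    ext1 j
    simp only [PiLp.add_apply]
    rw [← MemLp.toLp_add]
    refine (MemLp.toLp_eq_toLp_iff _ _).2 ?_
    have := (f + f').jet_spec.unique (f.jet_spec.add f'.jet_spec) j (by omega)
    filter_upwards [this] with s hs
    simp [hs, smul_add]
  map_smul' c f := by
    ext1 j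
    simp only [PiLp.smul_apply, RingHom.id_apply]
    rw [← MemLp.toLp_const_smul]
    refine (MemLp.toLp_eq_toLp_iff _ _).2 ?_
    have := (c • f).jet_spec.unique (f.jet_spec.const_smul c) j (by omega)
    filter_upwards [this] with s hs
    simp [hs, smul_comm c]

lemma Sob.toL2_injective (N k : ℕ) (δ : ℝ) : Function.Injective (Sob.toL2 N k δ) := by
  rw [injective_iff_map_eq_zero]
  intro f hf
  have h0 : (f.memLp_jet 0).toLp _ = 0 := congrArg (fun p => p 0) hf
  rw [Lp.eq_zero_iff_ae_eq_zero] at h0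
  have h0 := (f.memLp_jet 0).coeFn_toLp.symm.trans h0
  have h1 : f.1 =ᵐ[volume] (0 : ℝ → Vec N) := by
    filter_upwards [h0] with s hs
    have h2 : f.jet 0 = f.1 := f.jet_spec.1
    simpa [h2, (Real.exp_pos _).ne'] using hs
  exact Subtype.ext ((f.2.1.ae_eq_iff_eq volume continuous_const).1 h1)

/-- The norm of `H^{k,δ}`: `‖f‖² = ∑_{j ≤ k} ∫ |f^{(j)}(s)|² exp (2 δ |s|) ds`. -/
instance (N k : ℕ) (δ : ℝ) : NormedAddCommGroup (Sob N k δ) :=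
  NormedAddCommGroup.induced _ _ (Sob.toL2 N k δ) (Sob.toL2_injective N k δ)

instance (N k : ℕ) (δ : ℝ) : NormedSpace ℝ (Sob N k δ) :=
  NormedSpace.induced ℝ _ _ (Sob.toL2 N k δ)


/-- The inclusion `H^{k+1,δ'} → H^{k,δ}` for `δ ≤ δ'`. -/
def Sob.incl (N k : ℕ) {δ δ' : ℝ} (hδ : δ ≤ δ') : Sob N (k + 1) δ' →L[ℝ] Sob N k δ :=
  have hexp : ∀ s, Real.exp (δ * |s|) ≤ Real.exp (δ' * |s|) := fun s =>
    Real.exp_le_exp.2 (mul_le_mul_of_nonneg_right hδ (abs_nonneg s))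
  have hjet : ∀ f : Sob N (k + 1) δ', IsSobolevJet k δ f.1 f.jet := fun f => by
    refine ⟨f.jet_spec.1, fun j hj => f.jet_spec.2.1 j (by omega), fun j hj => ?_⟩
    have h1 := f.jet_spec.2.2 j (by omega)
    refine h1.of_le ?_ (ae_of_all _ fun s => ?_)
    · have h2 : (fun s => Real.exp (δ * |s|) • f.jet j s) =
          fun s => Real.exp ((δ - δ') * |s|) • (Real.exp (δ' * |s|) • f.jet j s) := by
        funext s
        rw [smul_smul, ← Real.exp_add]
        ring_nf
      rw [h2]
      have h3 : Continuous fun s : ℝ => Real.exp ((δ - δ') * |s|) := by fun_prop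
      exact h3.aestronglyMeasurable.smul h1.1
    · rw [norm_smul, norm_smul, Real.norm_of_nonneg (Real.exp_pos _).le,
        Real.norm_of_nonneg (Real.exp_pos _).le]
      exact mul_le_mul_of_nonneg_right (hexp s) (norm_nonneg _)
  LinearMap.mkContinuous
    { toFun := fun f => ⟨f.1, f.2.1, f.jet, hjet f⟩
      map_add' := fun _ _ => rfl
      map_smul' := fun _ _ => rfl } 1 (fun f => by
    rw [one_mul]
    change ‖Sob.toL2 N k δ _‖ ≤ ‖Sob.toL2 N (k + 1) δ' f‖
    rw [PiLp.norm_eq_of_L2, PiLp.norm_eq_of_L2]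
    refine Real.sqrt_le_sqrt ?_
    rw [Fin.sum_univ_castSucc (n := k + 1)]
    refine le_trans (Finset.sum_le_sum fun j _ => ?_) (le_add_of_nonneg_right (sq_nonneg _))
    refine pow_le_pow_left₀ (norm_nonneg _) (Lp.norm_le_norm_of_ae_le ?_) 2
    have hu := (Sob.jet_spec (⟨f.1, f.2.1, f.jet, hjet f⟩ : Sob N k δ)).unique (hjet f) j
      (by omega)
    filter_upwards [hu, (Sob.memLp_jet (⟨f.1, f.2.1, f.jet, hjet f⟩ : Sob N k δ) j).coeFn_toLp,
      (f.memLp_jet j.castSucc).coeFn_toLp] with s h1 h2 h3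
    refine (congrArg norm h2).trans_le (le_of_le_of_eq ?_ (congrArg norm h3).symm)
    rw [h1, norm_smul, norm_smul, Real.norm_of_nonneg (Real.exp_pos _).le,
      Real.norm_of_nonneg (Real.exp_pos _).le]
    exact mul_le_mul_of_nonneg_right (hexp s) (norm_nonneg _))

/-- `w ↦ w s`. -/
def Sob.eval (N k : ℕ) (δ s : ℝ) : Sob N k δ →ₗ[ℝ] Vec N where
  toFun f := f.1 s
  map_add' _ _ := rfl
  map_smul' _ _ := rfl


lemma sobolev_shift {N k : ℕ} {d : ℝ} {f : ℝ → Vec N} (hf : f ∈ sobolev N k d) (R : ℝ) :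
    (fun s => f (s - R)) ∈ sobolev N k d := by
  obtain ⟨hc, g, h0, h1, h2⟩ := hf
  refine ⟨hc.comp (continuous_id.sub continuous_const), fun j s => g j (s - R), ?_,
    fun j hj => (h1 j hj).shift R, fun j hj => ?_⟩
  · simp [h0]
  · have h3 := (h2 j hj).comp_measurePreserving (measurePreserving_sub_right volume R)
    have hcont : Continuous fun s : ℝ => Real.exp (d * |s| - d * |s - R|) := by fun_prop
    have h4 : (fun s => Real.exp (d * |s|) • g j (s - R)) =
        fun s => Real.exp (d * |s| - d * |s - R|) • (Real.exp (d * |s - R|) • g j (s - R)) := by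
      funext s
      rw [smul_smul, ← Real.exp_add]
      ring_nf
    rw [h4]
    refine (h3.const_smul (Real.exp (|d| * |R|))).of_le
      (hcont.aestronglyMeasurable.smul h3.1) (ae_of_all _ fun s => ?_)
    have h5 : d * |s| - d * |s - R| ≤ |d| * |R| := by
      have h6 : |(|s| - |s - R|)| ≤ |R| := by
        have := abs_abs_sub_abs_le_abs_sub s (s - R)
        simpa using this
      calc d * |s| - d * |s - R| = d * (|s| - |s - R|) := by ring
        _ ≤ |d * (|s| - |s - R|)| := le_abs_self _
        _ = |d| * |(|s| - |s - R|)| := abs_mul _ _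
        _ ≤ |d| * |R| := mul_le_mul_of_nonneg_left h6 (abs_nonneg _)
    simp only [Pi.smul_apply, Function.comp_apply]
    rw [norm_smul, norm_smul (Real.exp (|d| * |R|)), Real.norm_of_nonneg (Real.exp_pos _).le,
      Real.norm_of_nonneg (Real.exp_pos _).le]
    exact mul_le_mul_of_nonneg_right (Real.exp_le_exp.2 h5) (norm_nonneg _)

lemma sobolev_mul {N : ℕ} {d : ℝ} {f : ℝ → Vec N} (hf : f ∈ sobolev N 2 d) {χ : ℝ → ℝ}
    (hχ : ContDiff ℝ ∞ χ) {C : ℝ} (hb0 : ∀ s, |χ s| ≤ C) (hb1 : ∀ s, |deriv χ s| ≤ C)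
    (hb2 : ∀ s, |deriv (deriv χ) s| ≤ C) : (fun s => χ s • f s) ∈ sobolev N 2 d := by
  obtain ⟨hc, g, h0, h1, h2⟩ := hf
  have hχ1 : ContDiff ℝ ∞ (deriv χ) := ((contDiff_infty_iff_deriv (𝕜 := ℝ)).1 hχ).2
  have hχ2 : ContDiff ℝ ∞ (deriv (deriv χ)) := ((contDiff_infty_iff_deriv (𝕜 := ℝ)).1 hχ1).2
  have hm : ∀ j ≤ 2, ∀ η : ℝ → ℝ, Continuous η → (∀ s, |η s| ≤ C) →
      MemLp (fun s => Real.exp (d * |s|) • (η s • g j s)) 2 volume := by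
    intro j hj η hη hb
    have h3 := h2 j hj
    have h4 : (fun s => Real.exp (d * |s|) • (η s • g j s)) =
        fun s => η s • (Real.exp (d * |s|) • g j s) := by
      funext s
      rw [smul_comm]
    rw [h4]
    refine (h3.const_smul C).of_le (hη.aestronglyMeasurable.smul h3.1) (ae_of_all _ fun s => ?_)
    simp only [Pi.smul_apply]
    rw [norm_smul, norm_smul C]
    exact mul_le_mul_of_nonneg_right ((hb s).trans (le_abs_self C)) (norm_nonneg _)
  have d0 := h1 0 (by norm_num)
  have d1 := h1 1 (by norm_num)
  let G : ℕ → ℝ → Vec N := fun j => match j with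
    | 0 => fun s => χ s • g 0 s
    | 1 => fun s => deriv χ s • g 0 s + χ s • g 1 s
    | _ => (fun s => deriv (deriv χ) s • g 0 s + deriv χ s • g 1 s) +
        fun s => deriv χ s • g 1 s + χ s • g 2 s
  refine ⟨hχ.continuous.smul hc, G, by simp [G, h0], fun j hj => ?_, fun j hj => ?_⟩
  · interval_cases j
    · exact d0.mul hχ
    · exact (d0.mul hχ1).add (d1.mul hχ)
  · interval_cases j
    · exact hm 0 (by norm_num) χ hχ.continuous hb0
    · exact ((hm 0 (by norm_num) _ hχ1.continuous hb1).add
        (hm 1 (by norm_num) _ hχ.continuous hb0)).ae_eq (ae_of_all _ fun s => by simp [G])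
    · exact (((hm 0 (by norm_num) _ hχ2.continuous hb2).add
        (hm 1 (by norm_num) _ hχ1.continuous hb1)).add
        ((hm 1 (by norm_num) _ hχ1.continuous hb1).add
        (hm 2 (by norm_num) _ hχ.continuous hb0))).ae_eq (ae_of_all _ fun s => by simp [G])

/-! ### sc-structures and sc-smooth maps -/

/-- A scale of normed spaces `⋯ → E_2 → E_1 → E_0`. -/
structure ScScale : Type 1 where
  L : ℕ → Type
  [grp : ∀ m, NormedAddCommGroup (L m)]
  [spc : ∀ m, NormedSpace ℝ (L m)]
  incl : ∀ m, L (m + 1) →L[ℝ] L m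

attribute [instance] ScScale.grp ScScale.spc

/-- The inclusion `E_m → E_0`. -/
def ScScale.toZero (E : ScScale) : ∀ m, E.L m →L[ℝ] E.L 0
  | 0 => ContinuousLinearMap.id ℝ _
  | m + 1 => (E.toZero m).comp (E.incl m)

/-- The scale is a sc-smooth structure on the Banach space `E_0`: all levels are Banach spaces,
`E_{m+1} → E_m` is injective and compact, and `E_∞ = ⋂ E_n` is dense in every `E_m`. -/
structure IsScBanach (E : ScScale) : Prop where
  complete : ∀ m, CompleteSpace (E.L m)
  injective : ∀ m, Function.Injective (E.incl m)
  compact : ∀ m, IsCompactOperator (E.incl m)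
  dense : ∀ m, Dense {x : E.L m | ∀ n, ∃ y : E.L n, E.toZero n y = E.toZero m x}

/-- A normed space with the constant scale. -/
def ScScale.const (A : Type) [NormedAddCommGroup A] [NormedSpace ℝ A] : ScScale where
  L _ := A
  incl _ := ContinuousLinearMap.id ℝ A

/-- The direct sum `E ⊕ F`. -/
def ScScale.sum (E F : ScScale) : ScScale where
  L m := E.L m × F.L m
  incl m := (E.incl m).prodMap (F.incl m)

/-- The tangent `TE = E^1 ⊕ E`, with `(TE)_m = E_{m+1} ⊕ E_m`. -/
def ScScale.tangent (E : ScScale) : ScScale where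
  L m := E.L (m + 1) × E.L m
  incl m := (E.incl (m + 1)).prodMap (E.incl m)

/-- The scale of subspaces `p m ⊆ E_m`. -/
def ScScale.sub (E : ScScale) (p : ∀ m, Submodule ℝ (E.L m))
    (hp : ∀ m, ∀ x ∈ p (m + 1), E.incl m x ∈ p m) : ScScale where
  L m := p m
  incl m := ((E.incl m).comp (p (m + 1)).subtypeL).codRestrict (p m) fun x => hp m x x.2

/-- The levels `U_m = U ∩ E_m` of a subset `U ⊆ E_0`. -/
def ScScale.level (E : ScScale) (U : Set (E.L 0)) (m : ℕ) : Set (E.L m) :=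
  E.toZero m ⁻¹' U

/-- `f : U → F` is sc⁰: it induces continuous maps `U_m → F_m` for all `m`. -/
def ScContOn (E F : ScScale) (U : Set (E.L 0)) (f : E.L 0 → F.L 0) : Prop :=
  ∀ m, ∃ g : E.L m → F.L m, ContinuousOn g (E.level U m) ∧
    ∀ x ∈ E.level U m, F.toZero m (g x) = f (E.toZero m x)

/-- The tangent `TU = {(x, h) : x ∈ U_1, h ∈ E_0}`. -/
def ScScale.tangentSet (E : ScScale) (U : Set (E.L 0)) : Set (E.tangent.L 0) :=
  {p : E.L 1 × E.L 0 | E.incl 0 p.1 ∈ U}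

/-- `Tf (x, h) = (f x, Df(x) h)` on `TU`, where `Df(x) : E_0 → F_0` is bounded linear and
`‖f(x + h) - f(x) - Df(x) h‖_0 / ‖h‖_1 → 0` as `h → 0` in `E_1`, `x + h ∈ U`. -/
def IsScTangentMap (E F : ScScale) (U : Set (E.L 0)) (f : E.L 0 → F.L 0)
    (Tf : E.tangent.L 0 → F.tangent.L 0) : Prop :=
  ∀ x : E.L 1, E.incl 0 x ∈ U → ∃ D : E.L 0 →L[ℝ] F.L 0,
    (∀ h : E.L 0, F.incl 0 (Tf (x, h)).1 = f (E.incl 0 x) ∧ (Tf (x, h)).2 = D h) ∧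
    (fun h : E.L 1 => f (E.incl 0 (x + h)) - f (E.incl 0 x) - D (E.incl 0 h))
      =o[𝓝[{h : E.L 1 | E.incl 0 (x + h) ∈ U}] 0] fun h => h

/-- `f : U → F` is of class sc^k: it is sc⁰ and, if `k ≥ 1`, has a tangent map `Tf : TU → TF`
of class sc^(k-1). -/
def ScDiffOn : ℕ → ∀ E F : ScScale, Set (E.L 0) → (E.L 0 → F.L 0) → Prop
  | 0, E, F, U, f => ScContOn E F U f
  | k + 1, E, F, U, f => ScContOn E F U f ∧ ∃ Tf : E.tangent.L 0 → F.tangent.L 0,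
      IsScTangentMap E F U f Tf ∧ ScDiffOn k E.tangent F.tangent (E.tangentSet U) Tf

/-- `f : U → F` is sc-smooth. -/
def ScSmoothOn (E F : ScScale) (U : Set (E.L 0)) (f : E.L 0 → F.L 0) : Prop :=
  ∀ k, ScDiffOn k E F U f

/-! ### Splicings and M-polyfolds -/

/-- A partial cone: linearly isomorphic to `[0,∞)^k × ℝ^(n-k)`. -/
def IsPartialCone {A : Type} [NormedAddCommGroup A] [NormedSpace ℝ A] (C : Set A) : Prop :=
  ∃ (n k : ℕ) (T : A ≃ₗ[ℝ] (Fin n → ℝ)), k ≤ n ∧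
    T '' C = {x | ∀ i : Fin n, i.val < k → 0 ≤ x i}

/-- The data `(π, E, V)` of a splicing, with `V` a subset of `C ⊆ A`. -/
structure Splicing : Type 1 where
  A : Type
  [grpA : NormedAddCommGroup A]
  [spcA : NormedSpace ℝ A]
  C : Set A
  V : Set A
  E : ScScale
  proj : A → E.L 0 →ₗ[ℝ] E.L 0

attribute [instance] Splicing.grpA Splicing.spcA

/-- The sc-space `A ⊕ E`. -/
def Splicing.total (S : Splicing) : ScScale := (ScScale.const S.A).sum S.E

/-- `(π, E, V)` is a sc-smooth splicing: `V` is relatively open in the partial cone `C`, `E` is a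
sc-Banach space, every `π_v` is a sc-projection (linear, idempotent, bounded on every level), and
`(v, e) ↦ π_v e` is sc-smooth on `V ⊕ E`. -/
structure IsScSplicing (S : Splicing) : Prop where
  cone : IsPartialCone S.C
  isOpen : ∃ W : Set S.A, IsOpen W ∧ S.V = S.C ∩ W
  banach : IsScBanach S.E
  idem : ∀ v ∈ S.V, ∀ e, S.proj v (S.proj v e) = S.proj v e
  scOperator : ∀ v ∈ S.V, ∀ m, ∃ T : S.E.L m →L[ℝ] S.E.L m,
    ∀ e, S.E.toZero m (T e) = S.proj v (S.E.toZero m e)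
  smooth : ScSmoothOn S.total S.E {p : S.A × S.E.L 0 | p.1 ∈ S.V} fun p => S.proj p.1 p.2

/-- The splicing core `K = {(v, e) : v ∈ V, π_v e = e}`. -/
def Splicing.core (S : Splicing) : Set (S.A × S.E.L 0) :=
  {p | p.1 ∈ S.V ∧ S.proj p.1 p.2 = p.2}

/-- The retraction `(v, e) ↦ (v, π_v e)` of `V ⊕ E` onto the splicing core. -/
def Splicing.retract (S : Splicing) (p : S.A × S.E.L 0) : S.A × S.E.L 0 :=
  (p.1, S.proj p.1 p.2)

/-- A chart of `X`, given through its inverse `ψ : O → X` with `O` a subset of a splicing core. -/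
structure PolyfoldChart (X : Type) : Type 1 where
  S : Splicing
  O : Set (S.A × S.E.L 0)
  ψ : S.A × S.E.L 0 → X

/-- `O` is open in the core of a sc-smooth splicing and `ψ` is a homeomorphism of `O` onto an open
subset of `X`; so the inverse of `ψ` is an M-polyfold chart. -/
structure IsPolyfoldChart {X : Type} [TopologicalSpace X] (c : PolyfoldChart X) : Prop where
  splicing : IsScSplicing c.S
  isOpen : ∃ W : Set (c.S.A × c.S.E.L 0), IsOpen W ∧ c.O = c.S.core ∩ W
  openEmbedding : Topology.IsOpenEmbedding fun p : c.O => c.ψ p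

/-- The transition map `f = ψ'⁻¹ ∘ ψ` from `O ∩ ψ⁻¹(ψ'(O'))` to `O'` is sc-smooth. For a map `f`
between open subsets of splicing cores this means that `(v, e) ↦ f (v, π_v e)` is sc-smooth where
it is defined; as the tangent of `f` is the restriction of the tangent of this map to the tangent
core, this is the same as requiring it for `f` and all its iterated tangents. -/
def IsScTransition {X : Type} (c c' : PolyfoldChart X) : Prop :=
  ScSmoothOn c.S.total c'.S.total
    {p : c.S.A × c.S.E.L 0 | p.1 ∈ c.S.V ∧ c.S.retract p ∈ c.O ∧
      c.ψ (c.S.retract p) ∈ c'.ψ '' c'.O}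
    fun p => Function.invFunOn c'.ψ c'.O (c.ψ (c.S.retract p))

/-- A set of pairwise sc-smoothly compatible M-polyfold charts that cover the second countable
Hausdorff space `X`. -/
structure IsPolyfoldAtlas {X : Type} [TopologicalSpace X] (𝒜 : Set (PolyfoldChart X)) : Prop where
  t2 : T2Space X
  secondCountable : SecondCountableTopology X
  chart : ∀ c ∈ 𝒜, IsPolyfoldChart c
  compatible : ∀ c ∈ 𝒜, ∀ c' ∈ 𝒜, IsScTransition c c' ∧ IsScTransition c' c
  cover : ∀ x : X, ∃ c ∈ 𝒜, x ∈ c.ψ '' c.O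

/-- An M-polyfold structure: a maximal atlas. -/
def IsPolyfoldStructure {X : Type} [TopologicalSpace X] (𝓜 : Set (PolyfoldChart X)) : Prop :=
  Maximal IsPolyfoldAtlas 𝓜

/-! ### Spaces of paths -/

/-- A smooth cut-off function `β : ℝ → [0,1]` as used for gluing. -/
structure Cutoff where
  toFun : ℝ → ℝ
  smooth : ContDiff ℝ ∞ toFun
  mem_Icc : ∀ s, toFun s ∈ Icc (0 : ℝ) 1
  eq_one : ∀ s ≤ -1, toFun s = 1
  deriv_neg : ∀ s ∈ Ioo (-1 : ℝ) 1, deriv toFun s < 0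
  symm : ∀ s, toFun s + toFun (-s) = 1

/-- Gluing `⊕_R (f, g)(s) = β(s - R/2) f(s) + (1 - β(s - R/2)) g(s - R)`. -/
def glue {N : ℕ} (β : Cutoff) (R : ℝ) :
    (ℝ → Vec N) × (ℝ → Vec N) →ₗ[ℝ] (ℝ → Vec N) where
  toFun p s := β.toFun (s - R / 2) • p.1 s + (1 - β.toFun (s - R / 2)) • p.2 (s - R)
  map_add' p q := by
    funext s
    simp only [Prod.fst_add, Prod.snd_add, Pi.add_apply, smul_add]
    abel
  map_smul' c p := by
    funext s
    simp only [Prod.smul_fst, Prod.smul_snd, Pi.smul_apply, RingHom.id_apply, smul_add,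
      smul_comm c]

/-- Anti-gluing `⊖_R (h, k)(s) = -(1 - β(s - R/2)) h(s) + β(s - R/2) k(s - R)`. -/
def antiglue {N : ℕ} (β : Cutoff) (R : ℝ) :
    (ℝ → Vec N) × (ℝ → Vec N) →ₗ[ℝ] (ℝ → Vec N) where
  toFun p s := -((1 - β.toFun (s - R / 2)) • p.1 s) + β.toFun (s - R / 2) • p.2 (s - R)
  map_add' p q := by
    funext s
    simp only [Prod.fst_add, Prod.snd_add, Pi.add_apply, smul_add]
    abel
  map_smul' c p := by
    funext s
    simp only [Prod.smul_fst, Prod.smul_snd, Pi.smul_apply, RingHom.id_apply, smul_add, smul_neg,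
      smul_comm c]

lemma Cutoff.eq_zero (β : Cutoff) {s : ℝ} (hs : 1 ≤ s) : β.toFun s = 0 := by
  have := β.symm s
  rw [β.eq_one (-s) (by linarith)] at this
  linarith

lemma Cutoff.exists_bound (β : Cutoff) : ∃ C, (∀ s, |β.toFun s| ≤ C) ∧
    (∀ s, |deriv β.toFun s| ≤ C) ∧ ∀ s, |deriv (deriv β.toFun) s| ≤ C := by
  have h1 : ContDiff ℝ ∞ (deriv β.toFun) := ((contDiff_infty_iff_deriv (𝕜 := ℝ)).1 β.smooth).2
  have h2 : ContDiff ℝ ∞ (deriv (deriv β.toFun)) := ((contDiff_infty_iff_deriv (𝕜 := ℝ)).1 h1).2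
  have hc : HasCompactSupport (deriv β.toFun) := by
    refine HasCompactSupport.intro (isCompact_Icc (a := (-1 : ℝ)) (b := 1)) fun s hs => ?_
    rw [Set.mem_Icc, not_and_or, not_le, not_le] at hs
    rcases hs with hs | hs
    · have : β.toFun =ᶠ[𝓝 s] fun _ => 1 :=
        mem_of_superset (Iio_mem_nhds hs) fun t ht => β.eq_one t (le_of_lt ht)
      rw [this.deriv_eq, deriv_const]
    · have : β.toFun =ᶠ[𝓝 s] fun _ => 0 :=
        mem_of_superset (Ioi_mem_nhds hs) fun t ht => β.eq_zero (le_of_lt ht)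
      rw [this.deriv_eq, deriv_const]
  obtain ⟨C1, hC1⟩ := hc.exists_bound_of_continuous h1.continuous
  obtain ⟨C2, hC2⟩ := hc.deriv.exists_bound_of_continuous h2.continuous
  refine ⟨max 1 (max C1 C2), fun s => ?_, fun s => ?_, fun s => ?_⟩
  · rw [abs_of_nonneg (β.mem_Icc s).1]
    exact (β.mem_Icc s).2.trans (le_max_left _ _)
  · exact (hC1 s).trans ((le_max_left _ _).trans (le_max_right _ _))
  · exact (hC2 s).trans ((le_max_right _ _).trans (le_max_right _ _))

lemma glue_mem_sobolev {N : ℕ} (β : Cutoff) (R : ℝ) {d : ℝ} {f g : ℝ → Vec N}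
    (hf : f ∈ sobolev N 2 d) (hg : g ∈ sobolev N 2 d) : glue β R (f, g) ∈ sobolev N 2 d := by
  obtain ⟨C, hC0, hC1, hC2⟩ := β.exists_bound
  have hs : ContDiff ℝ ∞ fun s => β.toFun (s - R / 2) :=
    β.smooth.comp (contDiff_id.sub contDiff_const)
  have e1 : deriv (fun s => β.toFun (s - R / 2)) = fun s => deriv β.toFun (s - R / 2) := by
    funext s
    exact deriv_comp_sub_const ..
  have e2 : deriv (fun s => deriv β.toFun (s - R / 2)) =
      fun s => deriv (deriv β.toFun) (s - R / 2) := by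
    funext s
    exact deriv_comp_sub_const ..
  have hmul : ∀ f : ℝ → Vec N, f ∈ sobolev N 2 d →
      (fun s => β.toFun (s - R / 2) • f s) ∈ sobolev N 2 d := fun f hf =>
    sobolev_mul hf hs (C := C) (fun s => hC0 _) (fun s => by rw [e1]; exact hC1 _)
      (fun s => by rw [e1, e2]; exact hC2 _)
  have hg' := sobolev_shift hg R
  have : glue β R (f, g) = (fun s => β.toFun (s - R / 2) • f s) +
      ((fun s => g (s - R)) - fun s => β.toFun (s - R / 2) • g (s - R)) := by
    funext s
    simp [glue, sub_smul]
  rw [this]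
  exact Submodule.add_mem _ (hmul f hf) (Submodule.sub_mem _ hg' (hmul _ hg'))

/-- A smooth map that is equal to `a` near `-∞` and to `b` near `+∞`. -/
def IsTransition {N : ℕ} (a b : Vec N) (φ : ℝ → Vec N) : Prop :=
  ContDiff ℝ ∞ φ ∧ (∀ᶠ s in atBot, φ s = a) ∧ ∀ᶠ s in atTop, φ s = b

lemma IsTransition.glue {N : ℕ} {a b c : Vec N} {φ ψ : ℝ → Vec N} (hφ : IsTransition a b φ)
    (hψ : IsTransition b c ψ) (β : Cutoff) (R : ℝ) : IsTransition a c (glue β R (φ, ψ)) := by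
  have hs : ContDiff ℝ ∞ fun s => β.toFun (s - R / 2) :=
    β.smooth.comp (contDiff_id.sub contDiff_const)
  refine ⟨?_, ?_, ?_⟩
  · exact (hs.smul hφ.1).add
      ((contDiff_const.sub hs).smul (hψ.1.comp (contDiff_id.sub contDiff_const)))
  · filter_upwards [hφ.2.1, eventually_le_atBot (R / 2 - 1)] with s h1 h2
    simp [_root_.glue, h1, β.eq_one (s - R / 2) (by linarith)]
  · have h3 : Tendsto (fun s : ℝ => s - R) atTop atTop := tendsto_atTop_add_const_right _ _ tendsto_id
    filter_upwards [h3.eventually hψ.2.2, eventually_ge_atTop (R / 2 + 1)] with s h1 h2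
    simp [_root_.glue, h1, β.eq_zero (s := s - R / 2) (by linarith)]

/-- The space `φ + H^{2,d}(ℝ, ℝ^N)` of parametrized paths from `a` to `b`, where `φ` is smooth,
equal to `a` near `-∞` and to `b` near `+∞`; it does not depend on `φ`. -/
def PathSpace {N : ℕ} (d : ℝ) (a b : Vec N) : Type :=
  {w : ℝ → Vec N // ∃ φ, IsTransition a b φ ∧ w - φ ∈ sobolev N 2 d}

/-- The path `w + h`. -/
def PathSpace.add {N : ℕ} {d : ℝ} {a b : Vec N} (w : PathSpace d a b) (h : Sob N 2 d) :
    PathSpace d a b :=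
  ⟨w.1 + h.1, by
    obtain ⟨φ, hφ, hw⟩ := w.2
    exact ⟨φ, hφ, by rw [add_sub_right_comm]; exact Submodule.add_mem _ hw h.2⟩⟩

/-- The affine topology of `φ + H^{2,d}`: a neighborhood of `w` contains all `w + h` with `h` small
in `H^{2,d}`. -/
instance {N : ℕ} (d : ℝ) (a b : Vec N) : TopologicalSpace (PathSpace d a b) where
  IsOpen U := ∀ w ∈ U, ∀ᶠ h : Sob N 2 d in 𝓝 0, w.add h ∈ U
  isOpen_univ _ _ := Eventually.of_forall fun _ => trivial
  isOpen_inter _ _ h h' w hw := (h w hw.1).and (h' w hw.2)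
  isOpen_sUnion _ h w hw := by
    obtain ⟨U, hU, hwU⟩ := hw
    exact (h U hU w hwU).mono fun _ hx => ⟨U, hU, hx⟩

/-- The glued path `⊕_R (u, v)`. -/
def PathSpace.glue {N : ℕ} {d : ℝ} {a b c : Vec N} (β : Cutoff) (R : ℝ) (u : PathSpace d a b)
    (v : PathSpace d b c) : PathSpace d a c :=
  ⟨_root_.glue β R (u.1, v.1), by
    obtain ⟨φ, hφ, hu⟩ := u.2
    obtain ⟨ψ, hψ, hv⟩ := v.2
    refine ⟨_root_.glue β R (φ, ψ), hφ.glue hψ β R, ?_⟩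
    rw [← map_sub]
    exact glue_mem_sobolev β R hu hv⟩

/-- Two paths are equivalent if they differ by a time shift. -/
instance shiftSetoid {N : ℕ} (d : ℝ) (a b : Vec N) : Setoid (PathSpace d a b) where
  r w w' := ∃ t : ℝ, ∀ s, w'.1 s = w.1 (s + t)
  iseqv :=
    { refl := fun w => ⟨0, fun s => by rw [add_zero]⟩
      symm := fun {w w'} ⟨t, ht⟩ => ⟨-t, fun s => by rw [ht]; ring_nf⟩
      trans := fun {w w' w''} ⟨t, ht⟩ ⟨t', ht'⟩ => ⟨t' + t, fun s => by rw [ht', ht]; ring_nf⟩ }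

/-- `X(a,b)`, the quotient of the space of parametrized paths by time shift, with the quotient
topology. -/
def Traj {N : ℕ} (d : ℝ) (a b : Vec N) : Type := Quotient (shiftSetoid d a b)

instance {N : ℕ} (d : ℝ) (a b : Vec N) : TopologicalSpace (Traj d a b) :=
  inferInstanceAs (TopologicalSpace (Quotient (shiftSetoid d a b)))

/-- The class `[w]`. -/
def PathSpace.cls {N : ℕ} {d : ℝ} {a b : Vec N} (w : PathSpace d a b) : Traj d a b :=
  Quotient.mk (shiftSetoid d a b) w

/-- The exponential gluing profile `R = exp (1/r) - e`, `r ∈ (0,1]`. -/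
def gluingLength (r : ℝ) : ℝ := Real.exp (1 / r) - Real.exp 1

/-- The set `(X(a,b) × X(b,c)) ∪ X(a,c)`. The cut-off function enters its topology only. -/
inductive BrokenTraj {N : ℕ} (β : Cutoff) (d : ℝ) (a b c : Vec N) : Type
  | broken : Traj d a b → Traj d b c → BrokenTraj β d a b c
  | unbroken : Traj d a c → BrokenTraj β d a b c

/-- `(r, u, v) ↦ [⊕_R (u, v)]`, with `R = ∞` and `⊕_∞ (u, v) = (u, v)` for `r = 0`. -/
def glueClass {N : ℕ} (β : Cutoff) {d : ℝ} {a b c : Vec N} (r : ℝ) (u : PathSpace d a b)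
    (v : PathSpace d b c) : BrokenTraj β d a b c :=
  open Classical in
  if r = 0 then .broken u.cls v.cls else .unbroken (u.glue β (gluingLength r) v).cls

/-- The topology on the set of broken and unbroken trajectories: the finest one for which
`X(a,c)` includes continuously and `[⊕_R (u, v)]` depends continuously on `(r, u, v)`, for
`0 ≤ r < 1` and all paths `u` from `a` to `b` and `v` from `b` to `c`. -/
instance {N : ℕ} (β : Cutoff) (d : ℝ) (a b c : Vec N) :
    TopologicalSpace (BrokenTraj β d a b c) :=
  TopologicalSpace.coinduced (BrokenTraj.unbroken : Traj d a c → BrokenTraj β d a b c)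
      inferInstance ⊔
    TopologicalSpace.coinduced
      (fun p : Ico (0 : ℝ) 1 × PathSpace d a b × PathSpace d b c =>
        glueClass β p.1.1 p.2.1 p.2.2) inferInstance

/-! ### The charts -/

/-- `H²(ℝ, ℝ^N)` with the sc-structure `E_m = H^{m+2,δ_m}`. -/
def sobolevScale (N : ℕ) {δ : ℕ → ℝ} (hδ : StrictMono δ) : ScScale where
  L m := Sob N (m + 2) (δ m)
  incl m := Sob.incl N (m + 2) (hδ (Nat.lt_succ_self m)).le

/-- The sc-subspace of all `h` such that `h 0` lies in the hyperplane orthogonal to `n`. -/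
def sliceScale {N : ℕ} {δ : ℕ → ℝ} (hδ : StrictMono δ) (n : Vec N) : ScScale :=
  (sobolevScale N hδ).sub
    (fun m => LinearMap.ker ((innerₛₗ ℝ n).comp (Sob.eval N (m + 2) (δ m) 0)))
    fun _ _ hx => hx

/-- An element of `E_0` of the sc-subspace as an element of `H^{2,δ_0}`. -/
def sliceSob {N : ℕ} {δ : ℕ → ℝ} {hδ : StrictMono δ} {n : Vec N}
    (h : (sliceScale hδ n).L 0) : Sob N 2 (δ 0) := Subtype.val h

/-- An element of `E_0` of the sc-subspace as a function. -/
def sliceFun {N : ℕ} {δ : ℕ → ℝ} (hδ : StrictMono δ) (n : Vec N) :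
    (sliceScale hδ n).L 0 →ₗ[ℝ] (ℝ → Vec N) where
  toFun h := (sliceSob h).1
  map_add' _ _ := rfl
  map_smul' _ _ := rfl

/-- A smooth path: an element of `φ + E_∞`, parametrized such that its velocity at time `0` is
nonzero. -/
def IsSmoothPath {N : ℕ} (δ : ℕ → ℝ) {a b : Vec N} (u : PathSpace (δ 0) a b) : Prop :=
  (∃ φ, IsTransition a b φ ∧ ∀ m, u.1 - φ ∈ sobolev N (m + 2) (δ m)) ∧ deriv u.1 0 ≠ 0

/-- The splicing with one-point parameter space and `π = id`; its core is the sc-space `E`. -/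
def trivialSplicing (E : ScScale) : Splicing where
  A := Fin 0 → ℝ
  C := univ
  V := univ
  E := E
  proj _ := LinearMap.id

section Gluing

variable {N : ℕ} (β : Cutoff) {δ : ℕ → ℝ} (hδ : StrictMono δ) (n n' : Vec N)

/-- The space `E` of pairs `(h, k)` with `h 0 ⊥ n` and `k 0 ⊥ n'`. -/
def pairScale : ScScale := (sliceScale hδ n).sum (sliceScale hδ n')

/-- `ker ⊕_R ⊆ E`, where `R = ∞` and `ker ⊕_∞ = 0` for `r = 0`. -/
def kerGlue (r : ℝ) : Submodule ℝ ((pairScale hδ n n').L 0) :=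
  open Classical in
  if r = 0 then ⊥ else
    LinearMap.ker ((glue β (gluingLength r)).comp ((sliceFun hδ n).prodMap (sliceFun hδ n')))

/-- `ker ⊖_R ⊆ E`, where `R = ∞` and `ker ⊖_∞ = E` for `r = 0`. -/
def kerAntiglue (r : ℝ) : Submodule ℝ ((pairScale hδ n n').L 0) :=
  open Classical in
  if r = 0 then ⊤ else
    LinearMap.ker ((antiglue β (gluingLength r)).comp ((sliceFun hδ n).prodMap (sliceFun hδ n')))

/-- The projection `π_r` of `E` onto `ker ⊖_R` along `ker ⊕_R`. -/
def gluingProj (r : ℝ) : (pairScale hδ n n').L 0 →ₗ[ℝ] (pairScale hδ n n').L 0 :=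
  open Classical in
  if h : IsCompl (kerAntiglue β hδ n n' r) (kerGlue β hδ n n' r) then
    Submodule.projection _ _ h
  else 0

/-- The splicing `(π, E, V)`. Here `V = [0, r₀)` consists of `r = 0` and of all gluing parameters
with gluing length `R > 2`; for these `R` the projection onto `ker ⊖_R` along `ker ⊕_R` respects
the conditions on `h 0` and `k 0`. -/
def gluingSplicing : Splicing where
  A := ℝ
  C := Ici 0
  V := Ico 0 (1 / Real.log (2 + Real.exp 1))
  E := pairScale hδ n n'
  proj := gluingProj β hδ n n'

end Gluing

/-- `(r, h, k) ↦ [⊕_R (u + h, v + k)]` on a subset `O` of the splicing core, where `h 0` and `k 0`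
are orthogonal to `u' 0` and `v' 0`. -/
def brokenChart {N : ℕ} (β : Cutoff) {δ : ℕ → ℝ} (hδ : StrictMono δ) {a b c : Vec N}
    (u : PathSpace (δ 0) a b) (v : PathSpace (δ 0) b c)
    (O : Set (ℝ × (pairScale hδ (deriv u.1 0) (deriv v.1 0)).L 0)) :
    PolyfoldChart (BrokenTraj β (δ 0) a b c) where
  S := gluingSplicing β hδ (deriv u.1 0) (deriv v.1 0)
  O := O
  ψ p := glueClass β p.1 (u.add (sliceSob p.2.1)) (v.add (sliceSob p.2.2))

/-- `h ↦ [u + h]` on a subset `O` of the sc-space of all `h` with `h 0` orthogonal to `u' 0`. -/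
def trajChart {N : ℕ} {δ : ℕ → ℝ} (hδ : StrictMono δ) {a b : Vec N} (u : PathSpace (δ 0) a b)
    (O : Set ((Fin 0 → ℝ) × (sliceScale hδ (deriv u.1 0)).L 0)) :
    PolyfoldChart (Traj (δ 0) a b) where
  S := trivialSplicing (sliceScale hδ (deriv u.1 0))
  O := O
  ψ p := (u.add (sliceSob p.2)).cls

/-- The charts of `X̄(a,c)` at broken trajectories: the maps `(r, h, k) ↦ [⊕_R (u + h, v + k)]`,
for smooth `u` and `v`, on all those open neighborhoods of `0` in the splicing core which they map
homeomorphically onto an open set. -/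
def brokenCharts {N : ℕ} (β : Cutoff) {δ : ℕ → ℝ} (hδ : StrictMono δ) (a b c : Vec N) :
    Set (PolyfoldChart (BrokenTraj β (δ 0) a b c)) :=
  {κ | ∃ (u : PathSpace (δ 0) a b) (v : PathSpace (δ 0) b c)
      (O : Set (ℝ × (pairScale hδ (deriv u.1 0) (deriv v.1 0)).L 0)),
    IsSmoothPath δ u ∧ IsSmoothPath δ v ∧ 0 ∈ O ∧
    IsPolyfoldChart (brokenChart β hδ u v O) ∧ κ = brokenChart β hδ u v O}

/-- The charts of the sc-manifold `X(a,b)`: the maps `h ↦ [u + h]`, for smooth `u`, on all those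
open neighborhoods of `0` which they map homeomorphically onto an open subset of `X(a,b)`. -/
def trajCharts {N : ℕ} {δ : ℕ → ℝ} (hδ : StrictMono δ) (a b : Vec N) :
    Set (PolyfoldChart (Traj (δ 0) a b)) :=
  {κ | ∃ (u : PathSpace (δ 0) a b)
      (O : Set ((Fin 0 → ℝ) × (sliceScale hδ (deriv u.1 0)).L 0)),
    IsSmoothPath δ u ∧ 0 ∈ O ∧ IsPolyfoldChart (trajChart hδ u O) ∧ κ = trajChart hδ u O}

/-- A chart of `X(a,c)` as a chart of `X̄(a,c)`. -/
def PolyfoldChart.unbroken {N : ℕ} {β : Cutoff} {d : ℝ} {a b c : Vec N}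
    (κ : PolyfoldChart (Traj d a c)) : PolyfoldChart (BrokenTraj β d a b c) where
  S := κ.S
  O := κ.O
  ψ p := .unbroken (κ.ψ p)

/-- All charts of `X̄(a,c)`. -/
def allCharts {N : ℕ} (β : Cutoff) {δ : ℕ → ℝ} (hδ : StrictMono δ) (a b c : Vec N) :
    Set (PolyfoldChart (BrokenTraj β (δ 0) a b c)) :=
  brokenCharts β hδ a b c ∪ PolyfoldChart.unbroken '' trajCharts hδ a c

end

open Real (exp)
noncomputable section
set_option hygiene false
local notation "ℓ" => gluingLength
local notation "Λ" => ScScale.const ℝ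
local notation "𝓥" => ScScale.const (Vec N)
local notation "Θ" => Weights.scale W N
local notation "ϑ" => Sob N (W.k 0) (W.δ 0)
local notation "Ω₁" => Sob N (W.k 1) (W.δ 1)
local notation "Ω" => Sob N 2 (δ 0)
local notation "ΩΩ" => Sob N 2 (δ 0) × Sob N 2 (δ 0)
local notation "Δ" => Weights.std d o
local notation "Ψ" => PathSpace (δ 0)
local notation "𝓧" => BrokenTraj β (δ 0) a b c
local notation "𝓔u" => sliceScale d (deriv u.1 0)
local notation "𝓔v" => sliceScale d (deriv v.1 0)
local notation "𝓐" => pairAt d u v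
local notation "𝓚" => splicingAt (β := β) d u v
local notation "φL" => isTransition_refL β a b
local notation "φR" => isTransition_refR β b c
local notation "φU" => isTransition_refU β a b c
local notation "dot" => inner ℝ
local notation "Ξ" => ℝ × Sob N 2 (δ 0) × Sob N 2 (δ 0)
local notation "Υ" => chartPt β d u v
local notation "𝓒" => gcls β a b c
local notation "𝓤" => ucls β a b c
local notation "𝓖" => glueCoord β d o b c
local notation "ΔΘ" => Weights.scale (Weights.std d o) N
local notation "𝓛" => Lp (Vec N) 2 (volume : Measure ℝ)
local notation "Φ" => ℝ → Vec N
local notation "ϖ" => Weights.one_le W 0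
local notation "𝓟" => (Fin 0 → ℝ) × ScScale.L (𝓔u) 0
local notation "𝓠" => ℝ × ScScale.L (𝓐) 0
local notation "𝓞" => parScale N δ d o
local notation "𝓗" => Sob N (W.k m) (W.δ m)
variable {ι : Type*} {N k k' i j : ℕ} {E E' F G T : ScScale} {β : Cutoff} {C r s t t' t₀ ε κ : ℝ} {δ : ℕ → ℝ} {R L : ℝ} {P : Set ℝ} {U : Set (E.L 0)} {V : Set (F.L 0)} {U' : Set (E.L 0)} {l : Filter ι} {a b c n : Vec N} {φ ψ : Φ} {f f' : E.L 0 → F.L 0} {f₀ f₁ : Ω} {g : Φ} {q : Ξ} {Tf : E.tangent.L 0 → F.tangent.L 0} {u : Ψ a b} {v : Ψ b c}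

instance : CoeFun Cutoff fun _ => ℝ → ℝ := ⟨Cutoff.toFun⟩

lemma norm_exp (x : ℝ) : ‖exp x‖ = exp x := Real.norm_of_nonneg (Real.exp_pos _).le

/-! ### Abstract sc-calculus -/

namespace ScScale

/-- The shifted scale `E^1`. -/
def up (E : ScScale) : ScScale where
  L m := E.L (m + 1)
  incl m := E.incl (m + 1)

lemma toZero_succ (E : ScScale) (m : ℕ) (x : E.L (m + 1)) : E.toZero (m + 1) x = E.toZero m (E.incl m x) := rfl

lemma sum_toZero (E F : ScScale) : ∀ (m : ℕ) (x : E.L m) (y : F.L m), (E.sum F).toZero m (x, y) = (E.toZero m x, F.toZero m y)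
  | 0, _, _ => rfl
  | m + 1, x, y => sum_toZero E F m (E.incl m x) (F.incl m y)

lemma const_toZero (A : Type) [NormedAddCommGroup A] [NormedSpace ℝ A] : ∀ (m : ℕ) (x : A), (ScScale.const A).toZero m x = x
  | 0, _ => rfl
  | m + 1, x => const_toZero A m x

end ScScale

/-- The properties of a sc-structure used in the calculus. -/
class ScGood (E : ScScale) : Prop where
  complete : ∀ m, CompleteSpace (E.L m)
  injective : ∀ m, Function.Injective (E.incl m)
  compact : ∀ m, IsCompactOperator (E.incl m)
  dense : ∀ m, DenseRange (E.incl m)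

lemma ScScale.toZero_injective (E : ScScale) [ScGood E] : ∀ m, Function.Injective (E.toZero m)
  | 0 => fun _ _ h => h
  | m + 1 => (toZero_injective E m).comp (ScGood.injective m)

lemma IsScBanach.scGood (h : IsScBanach E) : ScGood E where
  complete := h.complete
  injective := h.injective
  compact := h.compact
  dense m := by
    have hinj : ∀ m, Function.Injective (E.toZero m) := by
      intro m
      induction m with
      | zero => exact fun _ _ h => h
      | succ m ih => exact ih.comp (h.injective m)
    refine (h.dense m).mono fun x hx => ?_; obtain ⟨y, hy⟩ := hx (m + 1); exact ⟨y, hinj m hy⟩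

lemma compactOp_prodMap {E F E' F' : Type*} [NormedAddCommGroup E] [NormedSpace ℝ E]
    [NormedAddCommGroup F] [NormedSpace ℝ F] [NormedAddCommGroup E'] [NormedSpace ℝ E']
    [NormedAddCommGroup F'] [NormedSpace ℝ F'] {f : E →L[ℝ] E'} {g : F →L[ℝ] F'}
    (hf : IsCompactOperator f) (hg : IsCompactOperator g) :
    IsCompactOperator (f.prodMap g) := by
  have h1 : IsCompactOperator ((ContinuousLinearMap.inl ℝ E' F') ∘ (f ∘ Prod.fst : E × F → E')) :=
    (hf.comp_clm (ContinuousLinearMap.fst ℝ E F)).clm_comp _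
  have h2 : IsCompactOperator ((ContinuousLinearMap.inr ℝ E' F') ∘ (g ∘ Prod.snd : E × F → F')) :=
    (hg.comp_clm (ContinuousLinearMap.snd ℝ E F)).clm_comp _
  have : (f.prodMap g : E × F → E' × F') = (ContinuousLinearMap.inl ℝ E' F') ∘ (f ∘ Prod.fst) +
      (ContinuousLinearMap.inr ℝ E' F') ∘ (g ∘ Prod.snd) := by
    funext x; exact Prod.ext (by simp) (by simp)
  rw [this]; exact h1.add h2

instance ScGood.sum [hE : ScGood E] [hF : ScGood F] : ScGood (E.sum F) where
  complete m := by
    have := hE.complete m; have := hF.complete m; exact inferInstanceAs (CompleteSpace (E.L m × F.L m))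
  injective m := Function.Injective.prodMap (hE.injective m) (hF.injective m)
  compact m := compactOp_prodMap (hE.compact m) (hF.compact m)
  dense m := DenseRange.prodMap (hE.dense m) (hF.dense m)

instance ScGood.up [hE : ScGood E] : ScGood E.up where
  complete m := hE.complete (m + 1)
  injective m := hE.injective (m + 1)
  compact m := hE.compact (m + 1)
  dense m := hE.dense (m + 1)

instance ScGood.tangent [hE : ScGood E] : ScGood E.tangent := inferInstanceAs (ScGood (E.up.sum E))

instance ScGood.const {A : Type} [NormedAddCommGroup A] [NormedSpace ℝ A] [FiniteDimensional ℝ A] : ScGood (ScScale.const A) where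
  complete _ := FiniteDimensional.complete ℝ A
  injective _ := Function.injective_id
  compact _ := by
    have : ProperSpace A := FiniteDimensional.proper_real A
    exact (isCompactOperator_id_iff_locallyCompactSpace (E := A)).2 inferInstance
  dense _ := Function.surjective_id.denseRange

/-- Domains on which tangent maps are unique: relatively open subsets of convex sets with
nonempty interior. -/
def ScDom (E : ScScale) (U : Set (E.L 0)) : Prop := ∃ C W : Set (E.L 0), Convex ℝ C ∧ (interior C).Nonempty ∧ IsOpen W ∧ U = C ∩ W

lemma IsOpen.scDom (hU : IsOpen U) : ScDom E U := ⟨univ, U, convex_univ, by simp, hU, by simp⟩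

lemma ScDom.inter {W : Set (E.L 0)} (hU : ScDom E U) (hW : IsOpen W) : ScDom E (U ∩ W) := by
  obtain ⟨C, W', hC, hi, hW', rfl⟩ := hU; exact ⟨C, W' ∩ W, hC, hi, hW'.inter hW, by rw [inter_assoc]⟩

lemma ScDom.tangent [hE : ScGood E] (hU : ScDom E U) : ScDom E.tangent (E.tangentSet U) := by
  obtain ⟨C, W, hC, hi, hW, rfl⟩ := hU
  let q : E.L 1 × E.L 0 →L[ℝ] E.L 0 := (E.incl 0).comp (ContinuousLinearMap.fst ℝ _ _)
  refine ⟨q ⁻¹' C, q ⁻¹' W, hC.linear_preimage q.toLinearMap, ?_, hW.preimage q.continuous, rfl⟩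
  obtain ⟨e, he⟩ := (hE.dense 0).exists_mem_open isOpen_interior hi
  exact ⟨(e, 0), preimage_interior_subset_interior_preimage q.continuous he⟩

/-! ### Linear sc-operators -/

/-- A sc-operator. -/
structure ScOp (E F : ScScale) where
  map : ∀ m, E.L m →L[ℝ] F.L m
  comm : ∀ m x, F.incl m (map (m + 1) x) = map m (E.incl m x)

namespace ScOp

lemma toZero (T : ScOp E F) : ∀ (m : ℕ) (x : E.L m), F.toZero m (T.map m x) = T.map 0 (E.toZero m x)
  | 0, _ => rfl
  | m + 1, x => by
    rw [ScScale.toZero_succ, T.comm, T.toZero m]; rfl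

def up (T : ScOp E F) : ScOp E.up F.up := ⟨fun m => T.map (m + 1), fun m => T.comm (m + 1)⟩

def prodMap {F' : ScScale} (T : ScOp E F) (T' : ScOp E' F') : ScOp (E.sum E') (F.sum F') where
  map m := (T.map m).prodMap (T'.map m)
  comm m x := Prod.ext (T.comm m x.1) (T'.comm m x.2)

def tangent (T : ScOp E F) : ScOp E.tangent F.tangent := T.up.prodMap T

def comp (T' : ScOp F G) (T : ScOp E F) : ScOp E G where
  map m := (T'.map m).comp (T.map m)
  comm m x := by
    simp only [ContinuousLinearMap.comp_apply]; rw [T'.comm, T.comm]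

def prod (T : ScOp E F) (T' : ScOp E G) : ScOp E (F.sum G) where
  map m := (T.map m).prod (T'.map m)
  comm m x := Prod.ext (T.comm m x) (T'.comm m x)

def fst : ScOp (E.sum F) E := ⟨fun _ => ContinuousLinearMap.fst ℝ _ _, fun _ _ => rfl⟩

def snd : ScOp (E.sum F) F := ⟨fun _ => ContinuousLinearMap.snd ℝ _ _, fun _ _ => rfl⟩

def id (E : ScScale) : ScOp E E := ⟨fun _ => ContinuousLinearMap.id ℝ _, fun _ _ => rfl⟩

/-- The inclusion `E^1 → E`. -/
def incl (E : ScScale) : ScOp E.up E := ⟨fun m => E.incl m, fun _ _ => rfl⟩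

def add (T T' : ScOp E F) : ScOp E F := ⟨fun m => T.map m + T'.map m, fun m x => by
    simp only [_root_.add_apply, map_add, T.comm, T'.comm]⟩

def smul (c : ℝ) (T : ScOp E F) : ScOp E F := ⟨fun m => c • T.map m, fun m x => by
    simp only [_root_.smul_apply, map_smul, T.comm]⟩

/-- A linear map between constant scales. -/
def const {A B : Type} [NormedAddCommGroup A] [NormedSpace ℝ A] [NormedAddCommGroup B]
    [NormedSpace ℝ B] (T : A →L[ℝ] B) : ScOp (ScScale.const A) (ScScale.const B) :=
  ⟨fun _ => T, fun _ _ => rfl⟩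

end ScOp

/-- A point of `E_∞`. -/
structure ScPt (F : ScScale) where
  pt : ∀ m, F.L m
  comm : ∀ m, F.incl m (pt (m + 1)) = pt m

lemma ScPt.toZero (p : ScPt F) : ∀ m, F.toZero m (p.pt m) = p.pt 0
  | 0 => rfl
  | m + 1 => by rw [ScScale.toZero_succ, p.comm, p.toZero m]

/-! ### Elementary properties of sc-differentiability -/

lemma ScContOn.continuousOn (h : ScContOn E F U f) : ContinuousOn f U := by
  obtain ⟨g, hg, he⟩ := h 0; exact hg.congr fun x hx => (he x hx).symm

lemma ScContOn.comp {g : F.L 0 → G.L 0} (hg : ScContOn F G V g) (hf : ScContOn E F U f) (hm : MapsTo f U V) :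
    ScContOn E G U (g ∘ f) := by
  intro m; obtain ⟨f', hf', hfe⟩ := hf m; obtain ⟨g', hg', hge⟩ := hg m
  have hm' : MapsTo f' (E.level U m) (F.level V m) := fun x hx => by
    change F.toZero m (f' x) ∈ V; rw [hfe x hx]; exact hm hx
  refine ⟨g' ∘ f', hg'.comp hf' hm', fun x hx => ?_⟩; rw [Function.comp_apply, hge _ (hm' hx), hfe x hx]
  rfl

lemma ScContOn.mono (h : ScContOn E F U f) (hU : U' ⊆ U) : ScContOn E F U' f := fun m => by
  obtain ⟨g, hg, he⟩ := h m; exact ⟨g, hg.mono fun x hx => hU hx, fun x hx => he x (hU hx)⟩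

lemma ScContOn.congr (h : ScContOn E F U f) (he : ∀ x ∈ U, f' x = f x) : ScContOn E F U f' := fun m => by
  obtain ⟨g, hg, hge⟩ := h m; exact ⟨g, hg, fun x hx => by rw [hge x hx, he _ hx]⟩

lemma ScDiffOn.scContOn (h : ScDiffOn k E F U f) : ScContOn E F U f := by
  cases k with
  | zero => exact h
  | succ k => exact h.1

lemma IsScTangentMap.mono (h : IsScTangentMap E F U f Tf) (hU : U' ⊆ U) :
    IsScTangentMap E F U' f Tf := fun x hx => by
  obtain ⟨D, h1, h2⟩ := h x (hU hx); exact ⟨D, h1, h2.mono (nhdsWithin_mono _ fun y hy => hU hy)⟩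

lemma ScDiffOn.mono (h : ScDiffOn k E F U f) (hU : U' ⊆ U) : ScDiffOn k E F U' f := by
  induction k generalizing E F with
  | zero => exact ScContOn.mono h hU
  | succ k ih =>
    obtain ⟨h0, Tf, hT, hd⟩ := h; exact ⟨h0.mono hU, Tf, hT.mono hU, ih hd fun x hx => hU hx⟩

lemma ScDiffOn.congr (h : ScDiffOn k E F U f) (he : ∀ x ∈ U, f' x = f x) : ScDiffOn k E F U f' := by
  cases k with
  | zero => exact ScContOn.congr h he
  | succ k =>
    obtain ⟨h0, Tf, hT, hd⟩ := h; refine ⟨h0.congr he, Tf, fun x hx => ?_, hd⟩; obtain ⟨D, h1, h2⟩ := hT x hx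
    refine ⟨D, fun h => ⟨by rw [(h1 h).1, he _ hx], (h1 h).2⟩, h2.congr' ?_ (by rfl)⟩
    filter_upwards [self_mem_nhdsWithin] with h hh; rw [he _ hx, he _ hh]

lemma ScSmoothOn.mono (h : ScSmoothOn E F U f) (hU : U' ⊆ U) : ScSmoothOn E F U' f := fun k => (h k).mono hU

lemma ScSmoothOn.congr (h : ScSmoothOn E F U f) (he : ∀ x ∈ U, f' x = f x) : ScSmoothOn E F U f' := fun k => (h k).congr he

lemma ScSmoothOn.continuousOn (h : ScSmoothOn E F U f) : ContinuousOn f U := ScContOn.continuousOn (h 0)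

lemma ScOp.scContOn (T : ScOp E F) (U : Set (E.L 0)) : ScContOn E F U (T.map 0) := fun m =>
  ⟨T.map m, (T.map m).continuous.continuousOn, fun x _ => T.toZero m x⟩

lemma ScOp.scDiffOn (k : ℕ) (T : ScOp E F) (U : Set (E.L 0)) : ScDiffOn k E F U (T.map 0) := by
  induction k generalizing E F with
  | zero => exact T.scContOn U
  | succ k ih =>
    refine ⟨T.scContOn U, T.tangent.map 0, fun x _ => ⟨T.map 0, fun h => ⟨T.comm 0 x, rfl⟩, ?_⟩, ih _ _⟩
    refine (Asymptotics.isLittleO_zero _ _).congr_left fun h => ?_; rw [map_add, map_add]; simp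

lemma ScOp.smooth (T : ScOp E F) (U : Set (E.L 0)) : ScSmoothOn E F U (T.map 0) := fun k => T.scDiffOn k U

lemma ScPt.smooth (E : ScScale) (p : ScPt F) (U : Set (E.L 0)) : ScSmoothOn E F U (fun _ => p.pt 0) := by
  intro k; have hc : ∀ {E F : ScScale} (p : ScPt F) (U : Set (E.L 0)), ScContOn E F U (fun _ => p.pt 0) :=
    fun p U m => ⟨fun _ => p.pt m, continuousOn_const, fun x _ => p.toZero m⟩
  induction k generalizing E F with
  | zero => exact hc p U
  | succ k ih =>
    let p' : ScPt F.tangent := ⟨fun m => (p.pt (m + 1), 0), fun m =>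
      Prod.ext (p.comm (m + 1)) (map_zero (F.incl m))⟩
    refine ⟨hc p U, fun _ => p'.pt 0, fun x _ => ⟨0, fun h => ⟨p.comm 0, rfl⟩, ?_⟩, ih _ p' _⟩
    exact (Asymptotics.isLittleO_zero _ _).congr_left fun h => by simp

/-! ### The chain rule -/

lemma ScDom.ev_segment (hV : ScDom F V) {y : F.L 1}
    (hy : F.incl 0 y ∈ V) : ∀ᶠ k in 𝓝 (0 : F.L 1), F.incl 0 (y + k) ∈ V → ∀ τ ∈ Icc (0 : ℝ) 1, F.incl 0 (y + τ • k) ∈ V := by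
  obtain ⟨C, W, hC, -, hW, rfl⟩ := hV; have h1 := hW.preimage (F.incl 0).continuous
  obtain ⟨ε, hε, hb⟩ := Metric.isOpen_iff.1 h1 y hy.2
  filter_upwards [Metric.ball_mem_nhds (0 : F.L 1) hε] with k hk hyk τ hτ; refine ⟨?_, hb ?_⟩
  · have := hC hy.1 hyk.1 (sub_nonneg.2 hτ.2) hτ.1 (by ring); convert this using 1
    simp only [map_add, map_smul, smul_add, sub_smul, one_smul]; abel
  · simp only [Metric.mem_ball, dist_self_add_left, norm_smul, Real.norm_eq_abs, abs_of_nonneg hτ.1]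
    rw [mem_ball_zero_iff] at hk; nlinarith [hτ.2, hτ.1, norm_nonneg k]

lemma IsScTangentMap.norm_sub_le {g : F.L 0 → G.L 0}
    {Tg : F.tangent.L 0 → G.tangent.L 0} (hg : IsScTangentMap F G V g Tg) {y k : F.L 1}
    (hs : ∀ τ ∈ Icc (0 : ℝ) 1, F.incl 0 (y + τ • k) ∈ V) (z : G.L 0) {c : ℝ}
    (hc : ∀ τ ∈ Icc (0 : ℝ) 1, ‖(Tg (y + τ • k, F.incl 0 k)).2 - z‖ ≤ c) :
    ‖g (F.incl 0 (y + k)) - g (F.incl 0 y) - z‖ ≤ c := by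
  have hd : ∀ τ ∈ Icc (0 : ℝ) 1, HasDerivWithinAt (fun τ : ℝ => g (F.incl 0 (y + τ • k)) - τ • z)
      ((Tg (y + τ • k, F.incl 0 k)).2 - z) (Icc 0 1) τ := by
    intro τ hτ; obtain ⟨D, hD, ho⟩ := hg (y + τ • k) (hs τ hτ)
    have h1 : HasDerivWithinAt (fun τ : ℝ => g (F.incl 0 (y + τ • k))) (Tg (y + τ • k, F.incl 0 k)).2 (Icc 0 1) τ := by
      rw [hasDerivWithinAt_iff_isLittleO, (hD _).2]
      have ht : Tendsto (fun σ : ℝ => (σ - τ) • k) (𝓝[Icc 0 1] τ) (𝓝[{h : F.L 1 | F.incl 0 (y + τ • k + h) ∈ V}] 0) := by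
        refine tendsto_nhdsWithin_iff.2 ⟨?_, ?_⟩
        · have : Continuous fun σ : ℝ => (σ - τ) • k := by fun_prop
          refine (this.tendsto' τ 0 (by simp)).mono_left nhdsWithin_le_nhds
        · filter_upwards [self_mem_nhdsWithin] with σ hσ; have := hs σ hσ
          change F.incl 0 (y + τ • k + (σ - τ) • k) ∈ V; rw [add_assoc, ← add_smul]; simpa using this
      have h2 := ho.comp_tendsto ht; have h3 : (fun σ : ℝ => (σ - τ) • k) =O[𝓝[Icc 0 1] τ] fun σ => σ - τ :=
        Asymptotics.isBigO_iff.2 ⟨‖k‖, Eventually.of_forall fun σ => by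
          rw [norm_smul, mul_comm]⟩
      refine (h2.trans_isBigO h3).congr_left fun σ => ?_; simp only [Function.comp_apply, map_smul]
      rw [add_assoc, ← add_smul, add_sub_cancel]
    have h4 : HasDerivWithinAt (fun τ : ℝ => τ • z) z (Icc 0 1) τ := by
      simpa using ((hasDerivAt_id τ).smul_const z).hasDerivWithinAt
    exact h1.sub h4
  have := Convex.norm_image_sub_le_of_norm_hasDerivWithin_le hd hc (convex_Icc 0 1)
    (left_mem_Icc.2 zero_le_one) (right_mem_Icc.2 zero_le_one)
  simp only [zero_smul, add_zero, one_smul, sub_zero, norm_one, mul_one] at this; rwa [sub_right_comm]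

lemma exists_bound_of_linear {X E F : Type*} [TopologicalSpace X] [NormedAddCommGroup E]
    [NormedSpace ℝ E] [NormedAddCommGroup F] [NormedSpace ℝ F] {Q : X → E → F} {s : Set X} {y : X}
    (hsm : ∀ z ∈ s, ∀ (c : ℝ) e, Q z (c • e) = c • Q z e)
    (hy : y ∈ s)
    (hc : ContinuousWithinAt (fun p : X × E => Q p.1 p.2) (s ×ˢ univ) (y, 0)) :
    ∃ C > 0, ∀ᶠ z in 𝓝[s] y, ∀ e, ‖Q z e‖ ≤ C * ‖e‖ := by
  have h0 := fun z hz => by simpa using hsm z hz 0 0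
  have h1 : ∀ᶠ p : X × E in 𝓝[s ×ˢ univ] (y, 0), ‖Q p.1 p.2‖ < 1 := by
    have := hc.norm.eventually (gt_mem_nhds (show ‖Q (y, (0 : E)).1 (y, (0 : E)).2‖ < 1 by
      simp [h0 y hy]))
    exact this
  rw [nhdsWithin_prod_eq, nhdsWithin_univ, eventually_prod_iff] at h1
  obtain ⟨pa, ha, pb, hb, hab⟩ := h1; obtain ⟨ε, hε, hball⟩ := Metric.eventually_nhds_iff.1 hb
  refine ⟨2 / ε, by positivity, ?_⟩; filter_upwards [ha, self_mem_nhdsWithin] with z hz hzs e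
  rcases eq_or_ne e 0 with rfl | he
  · simp [h0 z hzs]
  have hn : 0 < ‖e‖ := norm_pos_iff.2 he; have h2 := hab hz (hball (y := (ε / 2 / ‖e‖) • e) (by
    rw [dist_zero_right, norm_smul, Real.norm_of_nonneg (by positivity), div_mul_cancel₀ _ hn.ne']; linarith))
  simp only at h2; rw [hsm z hzs, norm_smul, Real.norm_of_nonneg (by positivity)] at h2
  have h3 : ‖Q z e‖ = (2 / ε * ‖e‖) * (ε / 2 / ‖e‖ * ‖Q z e‖) := by
    field_simp
  rw [h3]; exact mul_le_of_le_one_right (by positivity) h2.le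

lemma IsScTangentMap.fst_eq [hF : ScGood F] (hf : IsScTangentMap E F U f Tf)
    {x : E.L 1} (hx : E.incl 0 x ∈ U) {y : F.L 1} (hy : F.incl 0 y = f (E.incl 0 x)) (h : E.L 0) :
    (Tf (x, h)).1 = y := by obtain ⟨D, hD, -⟩ := hf x hx; exact hF.injective 0 ((hD h).1.trans hy.symm)

lemma IsScTangentMap.mapsTo (hf : IsScTangentMap E F U f Tf) (hm : MapsTo f U V) : MapsTo Tf (E.tangentSet U) (F.tangentSet V) := by
  rintro ⟨x, h⟩ hx; obtain ⟨D, hD, -⟩ := hf x hx; change F.incl 0 (Tf (x, h)).1 ∈ V; rw [(hD h).1]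
  exact hm hx

lemma IsScTangentMap.comp [hE : ScGood E] [hF : ScGood F] {g : F.L 0 → G.L 0} {Tg : F.tangent.L 0 → G.tangent.L 0}
    (hV : ScDom F V) (hg : IsScTangentMap F G V g Tg) (hf : IsScTangentMap E F U f Tf)
    (hfc : ScContOn E F U f) (hTg : ContinuousOn Tg (F.tangentSet V)) (hm : MapsTo f U V) :
    IsScTangentMap E G U (g ∘ f) (Tg ∘ Tf) := by
  intro x hx; obtain ⟨f1, hf1c, hf1⟩ := hfc 1; have hf1x := hf1 x hx; set y := f1 x with hydef
  have hyi : F.incl 0 y = f (E.incl 0 x) := hf1x; have hyV : F.incl 0 y ∈ V := by rw [hyi]; exact hm hx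
  have hfst : ∀ h, (Tf (x, h)).1 = y := hf.fst_eq hx hyi; obtain ⟨Df, hDf, hfo⟩ := hf x hx
  obtain ⟨Dg, hDg, hgo⟩ := hg y hyV
  have hTf : ∀ h, Tf (x, h) = (y, Df h) := fun h => Prod.ext (hfst h) (hDf h).2
  refine ⟨Dg.comp Df, fun h => ?_, ?_⟩
  · have h1 : (Tg ∘ Tf) (x, h) = Tg (y, Df h) := congrArg Tg (hTf h); rw [h1]
    refine ⟨((hDg (Df h)).1).trans ?_, (hDg (Df h)).2⟩; rw [hyi]; rfl
  set l := 𝓝[{h : E.L 1 | E.incl 0 (x + h) ∈ U}] (0 : E.L 1) with hl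
  let V1 : Set (F.L 1) := {z | F.incl 0 z ∈ V}; let Q : F.L 1 → F.L 0 → G.L 0 := fun z e => (Tg (z, e)).2
  have hQc : ContinuousOn (fun p : F.L 1 × F.L 0 => Q p.1 p.2) (V1 ×ˢ univ) := by
    have h1 : ContinuousOn (fun p => (Tg p).2) (F.tangentSet V) := continuous_snd.comp_continuousOn hTg
    exact h1.mono fun p hp => hp.1
  have hQadd : ∀ z ∈ V1, ∀ e e', Q z (e + e') = Q z e + Q z e' := by
    intro z hz e e'; obtain ⟨D, hD, -⟩ := hg z hz; simp only [Q, (hD _).2, map_add]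
  have hQsmul : ∀ z ∈ V1, ∀ (c : ℝ) e, Q z (c • e) = c • Q z e := by
    intro z hz c e; obtain ⟨D, hD, -⟩ := hg z hz; simp only [Q, (hD _).2, map_smul]
  have hQy : ∀ e, Q y e = Dg e := fun e => (hDg e).2
  obtain ⟨C, hC, hCb⟩ := exists_bound_of_linear (Q := Q) hQsmul hyV (hQc _ ⟨hyV, trivial⟩)
  obtain ⟨K, hK, hKs⟩ := (hE.compact 0).image_closedBall_subset_compact (f := (E.incl 0 : E.L 1 →ₗ[ℝ] E.L 0)) 1
  have hK' := hK.image Df.continuous; rw [Asymptotics.isLittleO_iff]; intro ε hε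
  set ε1 := ε / 2 with hε1; set ε2 := ε / 2 / (C + ‖Dg‖ + ‖Dg‖) with hε2; have hε1p : 0 < ε1 := by positivity
  have hε2p : 0 < ε2 := by positivity
  have hunif : ∀ᶠ z in 𝓝[V1] y, ∀ e ∈ Df '' K, ‖Q z e - Q y e‖ ≤ ε1 := by
    rw [eventually_nhdsWithin_iff]; have := hK'.eventually_forall_of_forall_eventually (x₀ := y)
      (P := fun z e => z ∈ V1 → ‖Q z e - Q y e‖ ≤ ε1) (fun e _ => by
        have h1 : ContinuousWithinAt (fun p : F.L 1 × F.L 0 => Q p.1 p.2 - Dg p.2) (V1 ×ˢ univ) (y, e) :=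
          (hQc (y, e) ⟨hyV, trivial⟩).sub (Dg.continuous.comp continuous_snd).continuousWithinAt
        have h2 := h1.norm.eventually (gt_mem_nhds (show ‖Q (y, e).1 (y, e).2 - Dg (y, e).2‖ < ε1 by
          simp [hQy, hε1p]))
        rw [eventually_nhdsWithin_iff] at h2; filter_upwards [h2] with p hp hpV; rw [hQy]
        exact (hp ⟨hpV, trivial⟩).le)
    filter_upwards [this] with z hz hzV e he using hz e he hzV

  have hk : Tendsto (fun h => f1 (x + h) - y) l (𝓝 0) := by
    have h1 : ContinuousWithinAt f1 (E.level U 1) x := hf1c x hx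
    have h2 : Tendsto (fun h : E.L 1 => x + h) l (𝓝[E.level U 1] x) := by
      refine tendsto_nhdsWithin_iff.2 ⟨?_, ?_⟩
      · exact ((continuous_const.add continuous_id).tendsto' 0 x (by simp)).mono_left nhdsWithin_le_nhds
      · filter_upwards [self_mem_nhdsWithin] with h hh using hh
    have h3 := (h1.tendsto.comp h2).sub_const y; rwa [sub_self] at h3
  have hseg := hk.eventually (hV.ev_segment hyV)
  have hgood := hunif.and hCb
  rw [eventually_nhdsWithin_iff] at hgood; obtain ⟨ρ, hρ, hρb⟩ := Metric.eventually_nhds_iff.1 hgood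
  have hkρ := hk.eventually (Metric.ball_mem_nhds _ hρ); have hrem := (Asymptotics.isLittleO_iff.1 hfo) hε2p
  filter_upwards [hseg, hkρ, hrem, self_mem_nhdsWithin] with h h1 h2 h3 hU
  set k := f1 (x + h) - y with hkdef; have hyk : y + k = f1 (x + h) := by rw [hkdef]; abel
  have hfk : F.incl 0 (y + k) = f (E.incl 0 (x + h)) := by
    rw [hyk]; exact hf1 (x + h) hU
  have hkV : F.incl 0 (y + k) ∈ V := by rw [hfk]; exact hm hU
  have hs := h1 hkV; set rem := f (E.incl 0 (x + h)) - f (E.incl 0 x) - Df (E.incl 0 h) with hremdef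
  have hik : F.incl 0 k = Df (E.incl 0 h) + rem := by
    rw [hremdef, hkdef, map_sub, hyi, ← hyk, hfk]; abel
  have hbound : ∀ τ ∈ Icc (0 : ℝ) 1, ‖Q (y + τ • k) (F.incl 0 k) - Dg (F.incl 0 k)‖ ≤ (ε1 + (C + ‖Dg‖) * ε2) * ‖h‖ := by
    intro τ hτ; have hz : y + τ • k ∈ V1 := hs τ hτ; have hd : dist (y + τ • k) y < ρ := by
      rw [dist_self_add_left, norm_smul, Real.norm_of_nonneg hτ.1]; rw [dist_zero_right] at h2
      nlinarith [hτ.2, hτ.1, norm_nonneg k]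
    obtain ⟨b1, b2⟩ := hρb hd hz
    have b3 : ‖Q (y + τ • k) (Df (E.incl 0 h)) - Dg (Df (E.incl 0 h))‖ ≤ ε1 * ‖h‖ := by
      rcases eq_or_ne h 0 with rfl | hh
      · have : Q (y + τ • k) 0 = 0 := by simpa using hQsmul _ hz 0 0
        simp [this]
      have hn : ‖h‖ ≠ 0 := norm_ne_zero_iff.2 hh; have h4 := b1 (Df (E.incl 0 (‖h‖⁻¹ • h))) ⟨_, hKs ⟨_, by
        rw [mem_closedBall_zero_iff, norm_smul, norm_inv, norm_norm, inv_mul_cancel₀ hn], rfl⟩, rfl⟩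
      rw [hQy] at h4; simp only [map_smul] at h4
      rw [hQsmul _ hz, ← smul_sub, norm_smul, norm_inv, norm_norm, inv_mul_le_iff₀ (by positivity)] at h4
      linarith
    rw [hik, hQadd _ hz, map_add]
    calc _ = ‖(Q (y + τ • k) (Df (E.incl 0 h)) - Dg (Df (E.incl 0 h))) + (Q (y + τ • k) rem - Dg rem)‖ := by congr 1; abel
      _ ≤ ε1 * ‖h‖ + (C * ‖rem‖ + ‖Dg‖ * ‖rem‖) := (norm_add_le _ _).trans (add_le_add b3 ((_root_.norm_sub_le _ _).trans
          (add_le_add (b2 _) (Dg.le_opNorm _))))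
      _ ≤ ε1 * ‖h‖ + (C * (ε2 * ‖h‖) + ‖Dg‖ * (ε2 * ‖h‖)) := by gcongr
      _ = _ := by ring
  have hmv := hg.norm_sub_le hs (Dg (F.incl 0 k)) hbound; rw [hfk, hyi] at hmv
  have hlast : ‖Dg rem‖ ≤ ‖Dg‖ * (ε2 * ‖h‖) := (Dg.le_opNorm _).trans (by gcongr)
  have : (g ∘ f) (E.incl 0 (x + h)) - (g ∘ f) (E.incl 0 x) - (Dg.comp Df) (E.incl 0 h) =
      (g (f (E.incl 0 (x + h))) - g (f (E.incl 0 x)) - Dg (F.incl 0 k)) + Dg rem := by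
    rw [hik, Dg.map_add]; simp only [Function.comp_apply, ContinuousLinearMap.comp_apply]; abel
  rw [this]; have hfin : (C + ‖Dg‖ + ‖Dg‖) * ε2 = ε / 2 := by
    rw [hε2]; field_simp
  refine (norm_add_le _ _).trans ((add_le_add hmv hlast).trans (le_of_eq ?_))
  calc _ = (ε1 + (C + ‖Dg‖ + ‖Dg‖) * ε2) * ‖h‖ := by ring
    _ = _ := by rw [hfin, hε1]; ring

lemma ScDiffOn.comp [ScGood E] [ScGood F] {g : F.L 0 → G.L 0} (hg : ScDiffOn k F G V g)
    (hf : ScDiffOn k E F U f) (hV : ScDom F V) (hm : MapsTo f U V) :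
    ScDiffOn k E G U (g ∘ f) := by induction k generalizing E F G with | zero => exact ScContOn.comp hg hf hm | succ k ih =>
    obtain ⟨hg0, Tg, hTg, hdg⟩ := hg; obtain ⟨hf0, Tf, hTf, hdf⟩ := hf
    exact ⟨hg0.comp hf0 hm, Tg ∘ Tf, hTg.comp hV hTf hf0 hdg.scContOn.continuousOn hm, ih hdg hdf hV.tangent (hTf.mapsTo hm)⟩

lemma ScSmoothOn.comp [ScGood E] [ScGood F] {g : F.L 0 → G.L 0} (hg : ScSmoothOn F G V g)
    (hf : ScSmoothOn E F U f) (hV : ScDom F V) (hm : MapsTo f U V) :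
    ScSmoothOn E G U (g ∘ f) := fun k => (hg k).comp (hf k) hV hm

lemma ScDiffOn.comp_univ [ScGood E] [ScGood F] {g : F.L 0 → G.L 0} (hg : ScDiffOn k F G univ g) (hf : ScDiffOn k E F U f) :
    ScDiffOn k E G U (g ∘ f) := hg.comp hf isOpen_univ.scDom (mapsTo_univ _ _)

lemma ScSmoothOn.comp_univ [ScGood E] [ScGood F] {g : F.L 0 → G.L 0} (hg : ScSmoothOn F G univ g) (hf : ScSmoothOn E F U f) :
    ScSmoothOn E G U (g ∘ f) := hg.comp hf isOpen_univ.scDom (mapsTo_univ _ _)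

lemma ScOp.comp_smooth [ScGood E] [ScGood F] (T : ScOp F G) (hf : ScSmoothOn E F U f) : ScSmoothOn E G U (fun x => T.map 0 (f x)) :=
  (T.smooth univ).comp_univ hf

lemma ScOp.comp_scDiffOn [ScGood E] [ScGood F] (T : ScOp F G) (hf : ScDiffOn k E F U f) : ScDiffOn k E G U (fun x => T.map 0 (f x)) :=
  (T.scDiffOn k univ).comp_univ hf

/-! ### Pairs, sums and products -/

lemma ScContOn.pair {g : E.L 0 → G.L 0} (hf : ScContOn E F U f) (hg : ScContOn E G U g) :
    ScContOn E (F.sum G) U (fun x => (f x, g x)) := fun m => by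
  obtain ⟨f', h1, h2⟩ := hf m; obtain ⟨g', h3, h4⟩ := hg m
  exact ⟨fun x => _, h1.prodMk h3, fun x hx => by rw [ScScale.sum_toZero, h2 x hx, h4 x hx]⟩

/-- `T(F ⊕ G) = TF ⊕ TG`. -/
def ScOp.tangentSum (F G : ScScale) : ScOp (F.tangent.sum G.tangent) (F.sum G).tangent where
  map m := ((((ContinuousLinearMap.fst ℝ _ _).comp (ContinuousLinearMap.fst ℝ (F.L (m + 1) × F.L m) (G.L (m + 1) × G.L m))).prod
      ((ContinuousLinearMap.fst ℝ _ _).comp (ContinuousLinearMap.snd ℝ _ _))).prod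
    (((ContinuousLinearMap.snd ℝ _ _).comp (ContinuousLinearMap.fst ℝ _ _)).prod
      ((ContinuousLinearMap.snd ℝ _ _).comp (ContinuousLinearMap.snd ℝ _ _))))
  comm _ _ := rfl

lemma ScDiffOn.pair [ScGood E] [ScGood F] [ScGood G] {g : E.L 0 → G.L 0} (hf : ScDiffOn k E F U f) (hg : ScDiffOn k E G U g) :
    ScDiffOn k E (F.sum G) U (fun x => (f x, g x)) := by
  induction k generalizing E F G with
  | zero => exact ScContOn.pair hf hg
  | succ k ih =>
    obtain ⟨hf0, Tf, hTf, hdf⟩ := hf; obtain ⟨hg0, Tg, hTg, hdg⟩ := hg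
    refine ⟨hf0.pair hg0, _, ?_, (ScOp.tangentSum F G).comp_scDiffOn (ih hdf hdg)⟩; intro x hx
    obtain ⟨D, h1, h2⟩ := hTf x hx; obtain ⟨D', h1', h2'⟩ := hTg x hx
    exact ⟨D.prod D', fun h => ⟨Prod.ext (h1 h).1 (h1' h).1, Prod.ext (h1 h).2 (h1' h).2⟩, h2.prod_left h2'⟩

lemma ScSmoothOn.pair [ScGood E] [ScGood F] [ScGood G] {g : E.L 0 → G.L 0} (hf : ScSmoothOn E F U f) (hg : ScSmoothOn E G U g) :
    ScSmoothOn E (F.sum G) U (fun x => (f x, g x)) := fun k => (hf k).pair (hg k)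

def ScOp.sumAdd (F : ScScale) : ScOp (F.sum F) F := ScOp.add ScOp.fst ScOp.snd

lemma ScDiffOn.add [ScGood E] [ScGood F] {g : E.L 0 → F.L 0} (hf : ScDiffOn k E F U f) (hg : ScDiffOn k E F U g) :
    ScDiffOn k E F U (fun x => f x + g x) := (ScOp.sumAdd F).comp_scDiffOn (hf.pair hg)

lemma ScSmoothOn.add [ScGood E] [ScGood F] {g : E.L 0 → F.L 0} (hf : ScSmoothOn E F U f) (hg : ScSmoothOn E F U g) :
    ScSmoothOn E F U (fun x => f x + g x) := fun k => (hf k).add (hg k)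

lemma ScSmoothOn.neg [ScGood E] [ScGood F] (hf : ScSmoothOn E F U f) : ScSmoothOn E F U (fun x => - f x) := by
  refine ((ScOp.smul (-1) (ScOp.id F)).comp_smooth hf).congr fun x _ => ?_; change _ = (-1 : ℝ) • f x; simp

lemma ScSmoothOn.sub [ScGood E] [ScGood F] {g : E.L 0 → F.L 0} (hf : ScSmoothOn E F U f) (hg : ScSmoothOn E F U g) :
    ScSmoothOn E F U (fun x => f x - g x) := (hf.add hg.neg).congr fun x _ => sub_eq_add_neg _ _

/-- `(c, dc) ↦ c` and similar projections on `T(A ⊕ F)`. -/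
def ScOp.tangentFst (E : ScScale) : ScOp E.tangent E.up := ScOp.fst (E := E.up) (F := E)

def ScOp.tangentSnd (E : ScScale) : ScOp E.tangent E := ScOp.snd (E := E.up) (F := E)

/-- The shift of a constant scale. -/
def ScOp.upConst (A : Type) [NormedAddCommGroup A] [NormedSpace ℝ A] : ScOp (ScScale.const A).up (ScScale.const A) := ScOp.incl _

lemma scDiffOn_smul (k : ℕ) (F : ScScale) [ScGood F] : ScDiffOn k ((Λ).sum F) F univ (fun p : ℝ × F.L 0 => p.1 • p.2) := by
  have h0 : ∀ (F : ScScale), ScContOn ((Λ).sum F) F univ (fun p : ℝ × F.L 0 => p.1 • p.2) := fun F m =>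
    ⟨fun p : ℝ × F.L m => p.1 • p.2, (continuous_fst.smul continuous_snd : Continuous fun p : ℝ × F.L m => p.1 • p.2).continuousOn,
      fun (x : ℝ × F.L m) _ => by
        have h := ScScale.sum_toZero Λ F m x.1 x.2; rw [ScScale.const_toZero] at h
        exact (map_smul (F.toZero m) x.1 x.2).trans (congrArg (fun p : ℝ × F.L 0 => p.1 • p.2) h).symm⟩
  induction k generalizing F with
  | zero => exact h0 F
  | succ k ih =>
    let Z := ((Λ).sum F).tangent; let P : ScOp Z ((Λ).sum F).up := ScOp.tangentFst _
    let P' : ScOp Z ((Λ).sum F) := ScOp.tangentSnd _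
    let c : ScOp Z Λ := (ScOp.upConst ℝ).comp ((ScOp.fst (F := F)).up.comp P)
    let y : ScOp Z F.up := (ScOp.snd (E := Λ) (F := F)).up.comp P
    let dc : ScOp Z Λ := ScOp.fst.comp P'; let dy : ScOp Z F := ScOp.snd.comp P'
    let c0 : Z.L 0 → ℝ := c.map 0; let dc0 : Z.L 0 → ℝ := dc.map 0
    let T1 : Z.L 0 → F.up.L 0 := fun z => c0 z • y.map 0 z
    let T2 : Z.L 0 → F.L 0 := fun z => c0 z • dy.map 0 z + dc0 z • (ScOp.incl F).map 0 (y.map 0 z)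
    have d1 : ScDiffOn k Z F.up (ScScale.tangentSet _ univ) T1 := (ih F.up).comp_univ ((c.scDiffOn k _).pair (y.scDiffOn k _))
    have d2 : ScDiffOn k Z F (ScScale.tangentSet _ univ) T2 := ((ih F).comp_univ ((c.scDiffOn k _).pair (dy.scDiffOn k _))).add
      ((ih F).comp_univ ((dc.scDiffOn k _).pair (((ScOp.incl F).comp y).scDiffOn k _)))
    refine ⟨h0 F, fun z => (T1 z, T2 z), ?_, d1.pair d2⟩; rintro ⟨(r : ℝ), x⟩ -
    change ∃ D : ℝ × F.L 0 →L[ℝ] F.L 0, (∀ h : ℝ × F.L 0, F.incl 0 (r • x) = r • F.incl 0 x ∧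
      r • h.2 + h.1 • F.incl 0 x = D h) ∧ (fun h : ℝ × F.L 1 =>
        (r + h.1) • F.incl 0 (x + h.2) - r • F.incl 0 x - D (h.1, F.incl 0 h.2)) =o[_] fun h => h
    refine ⟨r • ContinuousLinearMap.snd ℝ ℝ (F.L 0) +
      (ContinuousLinearMap.fst ℝ ℝ (F.L 0)).smulRight (F.incl 0 x), fun h => ⟨map_smul _ _ _, by simp⟩, ?_⟩
    have h1 : (fun h : ℝ × F.L 1 => h.1 • F.incl 0 h.2) =o[𝓝 0] fun h => h := by
      have h2 : (fun h : ℝ × F.L 1 => h.1) =o[𝓝 0] fun _ => (1 : ℝ) :=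
        (Asymptotics.isLittleO_one_iff ℝ).2 (continuous_fst.tendsto' 0 0 rfl)
      have h3 : (fun h : ℝ × F.L 1 => F.incl 0 h.2) =O[𝓝 0] fun h => h :=
        ((F.incl 0).comp (ContinuousLinearMap.snd ℝ ℝ (F.L 1))).isBigO_id _
      have h4 := h2.smul_isBigO h3; refine h4.trans_isBigO ?_
      exact Asymptotics.isBigO_of_le _ fun h => by simp
    refine (h1.mono nhdsWithin_le_nhds).congr_left fun h => ?_
    simp only [map_add, smul_add, add_smul, _root_.add_apply, _root_.smul_apply,
      ContinuousLinearMap.smulRight_apply, ContinuousLinearMap.coe_fst', ContinuousLinearMap.coe_snd']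
    abel

lemma ScDiffOn.smul [ScGood E] [ScGood F] {c : E.L 0 → ℝ} (hc : ScDiffOn k E Λ U c)
    (hf : ScDiffOn k E F U f) : ScDiffOn k E F U (fun x => c x • f x) :=
  (scDiffOn_smul k F).comp_univ (hc.pair hf)

/-! ### Uniqueness of tangent maps and locality -/

lemma eq_of_isLittleO [hE : ScGood E] (hU : ScDom E U) {x : E.L 1} (hx : E.incl 0 x ∈ U) {f : E.L 1 → F.L 0} {D D' : E.L 0 →L[ℝ] F.L 0}
    (h : (fun h : E.L 1 => f h - D (E.incl 0 h)) =o[𝓝[{h : E.L 1 | E.incl 0 (x + h) ∈ U}] 0] fun h => h)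
    (h' : (fun h : E.L 1 => f h - D' (E.incl 0 h)) =o[𝓝[{h : E.L 1 | E.incl 0 (x + h) ∈ U}] 0] fun h => h) :
    D = D' := by
  obtain ⟨C, W, hC, hi, hW, rfl⟩ := hU; set L := D - D' with hL
  have h1 : (fun h : E.L 1 => L (E.incl 0 h)) =o[𝓝[{h : E.L 1 | E.incl 0 (x + h) ∈ C ∩ W}] 0]
      fun h => h := (h'.sub h).congr_left fun h => by simp [hL]
  have key : ∀ v : E.L 1, E.incl 0 v ∈ C → L (E.incl 0 v) = L (E.incl 0 x) := by
    intro v hv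
    have ht : Tendsto (fun τ : ℝ => τ • (v - x)) (𝓝[>] 0) (𝓝[{h : E.L 1 | E.incl 0 (x + h) ∈ C ∩ W}] 0) := by
      refine tendsto_nhdsWithin_iff.2 ⟨((continuous_id.smul continuous_const).tendsto' 0 0 (by simp)).mono_left nhdsWithin_le_nhds, ?_⟩
      have c1 : Continuous fun τ : ℝ => E.incl 0 (x + τ • (v - x)) := by fun_prop
      have c2 : ∀ᶠ τ : ℝ in 𝓝 0, E.incl 0 (x + τ • (v - x)) ∈ W := c1.continuousAt.eventually_mem (hW.mem_nhds (by simpa using hx.2))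
      filter_upwards [nhdsWithin_le_nhds c2, self_mem_nhdsWithin, nhdsWithin_le_nhds (Iio_mem_nhds (zero_lt_one' ℝ))] with τ h1 h2 h3
      refine ⟨?_, h1⟩; have := hC hx.1 hv (sub_nonneg.2 (le_of_lt h3)) (le_of_lt h2) (by ring)
      convert this using 1; simp only [map_add, map_smul, map_sub, smul_sub, sub_smul, one_smul]; abel
    have h2 := h1.comp_tendsto ht; have h3 : Tendsto (fun τ : ℝ => L (E.incl 0 (v - x))) (𝓝[>] 0) (𝓝 0) := by
      have h4 : (fun τ : ℝ => τ • (v - x)) =O[𝓝[>] 0] fun τ => τ := Asymptotics.isBigO_iff.2 ⟨‖v - x‖, Eventually.of_forall fun τ => by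
          rw [norm_smul, mul_comm]⟩
      have h5 := (h2.trans_isBigO h4)
      have h6 : (fun τ : ℝ => L (E.incl 0 (v - x))) =o[𝓝[>] 0] fun _ => (1 : ℝ) := by
        have h7 := (Asymptotics.isBigO_refl (fun τ : ℝ => τ⁻¹) (𝓝[>] 0)).smul_isLittleO h5
        refine h7.congr' ?_ ?_
        · filter_upwards [self_mem_nhdsWithin] with τ hτ; simp only [Function.comp_apply, map_smul]
          rw [smul_smul, inv_mul_cancel₀ (ne_of_gt (mem_Ioi.1 hτ)), one_smul]
        · filter_upwards [self_mem_nhdsWithin] with τ hτ; exact inv_mul_cancel₀ (ne_of_gt (mem_Ioi.1 hτ))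
      exact (Asymptotics.isLittleO_one_iff ℝ).1 h6
    have h8 := tendsto_nhds_unique h3 tendsto_const_nhds
    rw [map_sub, map_sub, eq_comm, sub_eq_zero] at h8; exact h8
  have key2 : ∀ w ∈ interior C, L w = L (E.incl 0 x) := by
    intro w hw
    have hcl : w ∈ closure (interior C ∩ range (E.incl 0)) := (hE.dense 0).open_subset_closure_inter isOpen_interior hw
    have hcl2 : closure (interior C ∩ range (E.incl 0)) ⊆ {w | L w = L (E.incl 0 x)} := by
      refine closure_minimal ?_ (isClosed_eq L.continuous continuous_const); rintro _ ⟨hv, v, rfl⟩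
      exact key v (interior_subset hv)
    exact hcl2 hcl
  obtain ⟨w0, hw0⟩ := hi; have h9 : ∀ e, L e = 0 := by
    intro e; have c1 : Continuous fun τ : ℝ => w0 + τ • e := by fun_prop
    have c2 : ∀ᶠ τ : ℝ in 𝓝[>] 0, w0 + τ • e ∈ interior C :=
      nhdsWithin_le_nhds (c1.continuousAt.eventually_mem (isOpen_interior.mem_nhds (by simpa using hw0)))
    obtain ⟨τ, hτ, hτ0⟩ := (c2.and self_mem_nhdsWithin).exists
    have h10 := (key2 _ hτ).trans (key2 _ hw0).symm; rw [map_add, add_eq_left, map_smul] at h10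
    exact (smul_eq_zero.1 h10).resolve_left (ne_of_gt hτ0)
  rw [← sub_eq_zero]; exact ContinuousLinearMap.ext h9

lemma IsScTangentMap.eqOn [ScGood E] [hF : ScGood F] (hU : ScDom E U) {Tf' : E.tangent.L 0 → F.tangent.L 0}
    (h : IsScTangentMap E F U f Tf) (h' : IsScTangentMap E F U f Tf') :
    EqOn Tf Tf' (E.tangentSet U) := by
  rintro ⟨x, e⟩ hx; obtain ⟨D, h1, h2⟩ := h x hx; obtain ⟨D', h1', h2'⟩ := h' x hx
  exact Prod.ext (hF.injective 0 ((h1 e).1.trans (h1' e).1.symm)) ((h1 e).2.trans ((eq_of_isLittleO hU hx h2 h2') ▸ (h1' e).2.symm))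

lemma ScContOn.of_local [ScGood F] (h : ∀ x ∈ U, ∃ W, IsOpen W ∧ x ∈ W ∧ ScContOn E F (U ∩ W) f) : ScContOn E F U f := by
  intro m; have hex : ∀ x : E.L m, ∃ y : F.L m, x ∈ E.level U m → F.toZero m y = f (E.toZero m x) := by
    intro x
    by_cases hx : x ∈ E.level U m
    · obtain ⟨W, -, hxW, hc⟩ := h _ hx; obtain ⟨g, -, hg⟩ := hc m; exact ⟨g x, fun _ => hg x ⟨hx, hxW⟩⟩
    · exact ⟨0, fun h => absurd h hx⟩
  choose g hg using hex; refine ⟨g, fun x hx => ?_, fun x hx => hg x hx⟩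
  obtain ⟨W, hW, hxW, hc⟩ := h _ hx; obtain ⟨g', hg'c, hg'⟩ := hc m; have h1 := hg'c x ⟨hx, hxW⟩
  have heq := fun y hy =>
    F.toZero_injective m ((hg y hy.1).trans (hg' y hy).symm)
  exact (continuousWithinAt_inter ((hW.preimage (E.toZero m).continuous).mem_nhds hxW)).1 (h1.congr heq (heq x ⟨hx, hxW⟩))

lemma ScDiffOn.of_local [ScGood E] [ScGood F] (hU : ScDom E U)
    (h : ∀ x ∈ U, ∃ W, IsOpen W ∧ x ∈ W ∧ ScDiffOn k E F (U ∩ W) f) : ScDiffOn k E F U f := by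
  induction k generalizing E F with
  | zero => exact ScContOn.of_local h
  | succ k ih =>
    choose! W hW hxW hd using h; choose! hc Tg hT hdT using hd
    let Tf := fun p => Tg (E.incl 0 p.1) p
    have hTf : IsScTangentMap E F U f Tf := by
      intro x hx; obtain ⟨D, h1, h2⟩ := hT _ hx x ⟨hx, hxW _ hx⟩; refine ⟨D, h1, ?_⟩
      have hWo : IsOpen {h : E.L 1 | E.incl 0 (x + h) ∈ W (E.incl 0 x)} :=
        (hW _ hx).preimage ((E.incl 0).continuous.comp (continuous_const.add continuous_id))
      have h3 : {h : E.L 1 | E.incl 0 (x + h) ∈ U ∩ W (E.incl 0 x)} =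
        {h : E.L 1 | E.incl 0 (x + h) ∈ U} ∩ {h : E.L 1 | E.incl 0 (x + h) ∈ W (E.incl 0 x)} := rfl
      have h0 : (0 : E.L 1) ∈ {h : E.L 1 | E.incl 0 (x + h) ∈ W (E.incl 0 x)} := by
        change E.incl 0 (x + 0) ∈ W (E.incl 0 x); rw [add_zero]; exact hxW _ hx
      rw [h3, inter_comm, nhdsWithin_inter_of_mem (nhdsWithin_le_nhds (hWo.mem_nhds h0))] at h2; exact h2
    refine ⟨ScContOn.of_local fun x hx => ⟨W x, hW x hx, hxW x hx, hc x hx⟩, Tf, hTf, ih hU.tangent ?_⟩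
    rintro ⟨x, e⟩ hx; let q : E.L 1 × E.L 0 →L[ℝ] E.L 0 := (E.incl 0).comp (ContinuousLinearMap.fst ℝ _ _)
    refine ⟨q ⁻¹' W (E.incl 0 x), (hW _ hx).preimage q.continuous, hxW _ hx, ?_⟩
    exact (hdT _ hx).congr (IsScTangentMap.eqOn (hU.inter (hW _ hx)) (hTf.mono inter_subset_left) (hT _ hx))

lemma ScSmoothOn.of_local [ScGood E] [ScGood F] (hU : ScDom E U)
    (h : ∀ x ∈ U, ∃ W, IsOpen W ∧ x ∈ W ∧ ScSmoothOn E F (U ∩ W) f) : ScSmoothOn E F U f :=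
  fun k => ScDiffOn.of_local hU fun x hx => by
    obtain ⟨W, h1, h2, h3⟩ := h x hx; exact ⟨W, h1, h2, h3 k⟩

/-! ### Smooth functions of finitely many real variables -/

lemma ContDiffOn.scSmoothOn {A B : Type} [NormedAddCommGroup A] [NormedSpace ℝ A]
    [FiniteDimensional ℝ A] [NormedAddCommGroup B] [NormedSpace ℝ B] [FiniteDimensional ℝ B]
    {U : Set A} (hU : IsOpen U) {f : A → B} (hf : ContDiffOn ℝ ∞ f U) :
    ScSmoothOn (ScScale.const A) (ScScale.const B) U f := by
  intro k
  have h0 : ∀ {A B : Type} [NormedAddCommGroup A] [NormedSpace ℝ A] [NormedAddCommGroup B] [NormedSpace ℝ B]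
      {U : Set A} {f : A → B} (_ : ContDiffOn ℝ ∞ f U),
      ScContOn (ScScale.const A) (ScScale.const B) U f := by
    intro A B _ _ _ _ U f hf m; have hl : (ScScale.const A).level U m = U := by
      ext x; exact iff_of_eq (congrArg (fun y : A => y ∈ U) (ScScale.const_toZero A m x))
    rw [hl]; exact ⟨f, hf.continuousOn, fun x _ =>
      (ScScale.const_toZero B m _).trans (congrArg f (ScScale.const_toZero A m x)).symm⟩
  induction k generalizing A B with
  | zero => exact h0 hf
  | succ k ih =>
    let Tf : A × A → B × B := fun p => (f p.1, fderiv ℝ f p.1 p.2)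
    have hT : ContDiffOn ℝ ∞ Tf (U ×ˢ univ) := by
      have h1 : ContDiffOn ℝ ∞ (fun p : A × A => f p.1) (U ×ˢ univ) := hf.comp contDiff_fst.contDiffOn fun p hp => hp.1
      have h2 : ContDiffOn ℝ ∞ (fun p : A × A => fderiv ℝ f p.1) (U ×ˢ univ) :=
        (hf.fderiv_of_isOpen hU (by simp)).comp contDiff_fst.contDiffOn fun p hp => hp.1
      exact h1.prodMk (h2.clm_apply contDiff_snd.contDiffOn)
    let i : ScOp (ScScale.const A).tangent (ScScale.const (A × A)) := ⟨fun _ => ContinuousLinearMap.id ℝ _, fun _ _ => rfl⟩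
    let j : ScOp (ScScale.const (B × B)) (ScScale.const B).tangent := ⟨fun _ => ContinuousLinearMap.id ℝ _, fun _ _ => rfl⟩
    have h3 := ih (hU.prod isOpen_univ) hT
    have h4 := j.comp_scDiffOn (h3.comp (i.scDiffOn k ((ScScale.const A).tangentSet U))
      (hU.prod isOpen_univ).scDom fun p hp => ⟨hp, trivial⟩)
    refine ⟨h0 hf, _, fun x hx => ?_, h4⟩; refine ⟨fderiv ℝ f x, fun h => ⟨rfl, rfl⟩, ?_⟩
    have h5 := ((hf.differentiableOn (by simp)).differentiableAt (hU.mem_nhds hx)).hasFDerivAt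
    exact (hasFDerivAt_iff_isLittleO_nhds_zero.1 h5).mono nhdsWithin_le_nhds

/-! ### Families of linear operators depending on a real parameter -/

/-- A family of linear sc-operators. -/
structure OpFam (E F : ScScale) where
  map : ∀ m, ℝ → E.L m →L[ℝ] F.L m
  comm : ∀ m r x, F.incl m (map (m + 1) r x) = map m r (E.incl m x)

namespace OpFam

def up (A : OpFam E F) : OpFam E.up F.up := ⟨fun m => A.map (m + 1), fun m => A.comm (m + 1)⟩

lemma toZero (A : OpFam E F) (r : ℝ) : ∀ (m : ℕ) (x : E.L m), F.toZero m (A.map m r x) = A.map 0 r (E.toZero m x)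
  | 0, _ => rfl
  | m + 1, x => by
    rw [ScScale.toZero_succ, A.comm, A.toZero r m]; rfl

def add (A A' : OpFam E F) : OpFam E F := ⟨fun m r => A.map m r + A'.map m r, fun m r x => by
    simp only [_root_.add_apply, map_add, A.comm, A'.comm]⟩

def smul (c : ℝ) (A : OpFam E F) : OpFam E F := ⟨fun m r => c • A.map m r, fun m r x => by
    simp only [_root_.smul_apply, map_smul, A.comm]⟩

def comp (A : OpFam E F) (T : ScOp E' E) : OpFam E' F := ⟨fun m r => (A.map m r).comp (T.map m), fun m r x => by
    simp only [ContinuousLinearMap.comp_apply, A.comm, T.comm]⟩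

/-- Joint continuity on all levels. -/
def IsCont (P : Set ℝ) (A : OpFam E F) : Prop := ∀ m, ContinuousOn (fun p : ℝ × E.L m => A.map m p.1 p.2) (P ×ˢ univ)

/-- `A_r h - A_{r₀} h = ∫ B_σ h dσ` for `h ∈ E_1`. -/
def HasDeriv (P : Set ℝ) (A : OpFam E F) (B : OpFam E.up F) : Prop := ∀ h : E.L 1, ∀ r₀ ∈ P, ∀ r ∈ P,
    A.map 0 r (E.incl 0 h) - A.map 0 r₀ (E.incl 0 h) = ∫ σ in r₀..r, B.map 0 σ h

/-- `k` times differentiable families, with loss of one level for every derivative. -/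
def SF (P : Set ℝ) : ℕ → ∀ {E F : ScScale}, OpFam E F → Prop
  | 0, _, _, A => A.IsCont P
  | k + 1, E, F, A => A.IsCont P ∧ ∃ B : OpFam E.up F, A.HasDeriv P B ∧ SF P k B

lemma SF.isCont {A : OpFam E F} (h : A.SF P k) : A.IsCont P := by
  cases k with
  | zero => exact h
  | succ k => exact h.1

lemma SF.of_succ {A : OpFam E F} (h : A.SF P (k + 1)) : A.SF P k := by
  induction k generalizing E F with
  | zero => exact h.1
  | succ k ih =>
    obtain ⟨h0, B, hB, hk⟩ := h; exact ⟨h0, B, hB, ih hk⟩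

lemma IsCont.intervalIntegrable (hP : P.OrdConnected) {A : OpFam E F}
    (hA : A.IsCont P) (m : ℕ) (h : E.L m) {r' : ℝ} (hr : r ∈ P) (hr' : r' ∈ P) :
    IntervalIntegrable (fun σ => A.map m σ h) volume r r' := by
  refine ContinuousOn.intervalIntegrable ?_
  have : ContinuousOn (fun σ : ℝ => ((σ, h) : ℝ × E.L m)) (uIcc r r') := (Continuous.prodMk_left h).continuousOn
  exact (hA m).comp this fun σ hσ => ⟨hP.uIcc_subset hr hr' hσ, trivial⟩

lemma SF.up (hP : P.OrdConnected) [hF : ScGood F] {A : OpFam E F} (h : A.SF P k) : A.up.SF P k := by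
  induction k generalizing E F with
  | zero => exact fun m => h (m + 1)
  | succ k ih =>
    obtain ⟨h0, B, hB, hk⟩ := h; refine ⟨fun m => h0 (m + 1), B.up, fun x r₀ hr₀ r hr => ?_, ih hk⟩
    refine hF.injective 0 ?_; have := hF.complete 0; have := hF.complete 1
    have h1 := (F.incl 0).intervalIntegral_comp_comm (hk.isCont.intervalIntegrable hP 1 x hr₀ hr)
    change F.incl 0 (A.map 1 r (E.incl 1 x) - A.map 1 r₀ (E.incl 1 x)) = F.incl 0 (∫ σ in r₀..r, B.map 1 σ x)
    rw [map_sub, A.comm, A.comm, ← h1]; simp only [B.comm]; exact hB (E.incl 1 x) r₀ hr₀ r hr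

lemma IsCont.add {A A' : OpFam E F} (h : A.IsCont P) (h' : A'.IsCont P) : (A.add A').IsCont P := fun m => (h m).add (h' m)

lemma IsCont.comp {A : OpFam E F} (h : A.IsCont P) (T : ScOp E' E) : (A.comp T).IsCont P := fun m => by
  have : Continuous fun p : ℝ × E'.L m => ((p.1, T.map m p.2) : ℝ × E.L m) := by fun_prop
  exact (h m).comp this.continuousOn fun p hp => ⟨hp.1, trivial⟩

lemma SF.add (hP : P.OrdConnected) {A A' : OpFam E F} (h : A.SF P k) (h' : A'.SF P k) : (A.add A').SF P k := by
  induction k generalizing E F with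
  | zero => exact IsCont.add h h'
  | succ k ih =>
    obtain ⟨h0, B, hB, hk⟩ := h; obtain ⟨h0', B', hB', hk'⟩ := h'
    refine ⟨h0.add h0', B.add B', fun x r₀ hr₀ r hr => ?_, ih hk hk'⟩
    have h1 := intervalIntegral.integral_add (hk.isCont.intervalIntegrable hP 0 x hr₀ hr) (hk'.isCont.intervalIntegrable hP 0 x hr₀ hr)
    change (A.map 0 r _ + A'.map 0 r _) - (A.map 0 r₀ _ + A'.map 0 r₀ _) = ∫ σ in r₀..r, (B.map 0 σ x + B'.map 0 σ x)
    rw [h1, ← hB x r₀ hr₀ r hr, ← hB' x r₀ hr₀ r hr]; abel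

lemma SF.smul {A : OpFam E F} (c : ℝ) (h : A.SF P k) : (A.smul c).SF P k := by
  induction k generalizing E F with
  | zero => exact fun m => (h m).const_smul c
  | succ k ih =>
    obtain ⟨h0, B, hB, hk⟩ := h
    refine ⟨fun m => (h0 m).const_smul c, B.smul c, fun x r₀ hr₀ r hr => ?_, ih hk⟩
    change c • A.map 0 r _ - c • A.map 0 r₀ _ = ∫ σ in r₀..r, c • B.map 0 σ x
    rw [intervalIntegral.integral_smul, ← hB x r₀ hr₀ r hr, smul_sub]

lemma SF.comp {A : OpFam E F} (h : A.SF P k) (T : ScOp E' E) : (A.comp T).SF P k := by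
  induction k generalizing E E' F with
  | zero => exact IsCont.comp h T
  | succ k ih =>
    obtain ⟨h0, B, hB, hk⟩ := h; refine ⟨h0.comp T, B.comp T.up, fun x r₀ hr₀ r hr => ?_, ih hk _⟩
    have := hB (T.map 1 x) r₀ hr₀ r hr; rw [T.comm] at this; exact this

lemma HasDeriv.isScTangentMap (hP : P.OrdConnected) [hF : ScGood F] {A : OpFam E F}
    {B : OpFam E.up F} (hAB : A.HasDeriv P B) (hB : B.IsCont P) :
    IsScTangentMap ((Λ).sum E) F {p : ℝ × E.L 0 | p.1 ∈ P} (fun p : ℝ × E.L 0 => A.map 0 p.1 p.2)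
      (fun p : (ℝ × E.L 1) × (ℝ × E.L 0) => (A.map 1 p.1.1 p.1.2, A.map 0 p.1.1 p.2.2 + p.2.1 • B.map 0 p.1.1 p.1.2)) := by
  rintro ⟨(r : ℝ), x⟩ hr; change r ∈ P at hr
  change ∃ D : ℝ × E.L 0 →L[ℝ] F.L 0, (∀ h : ℝ × E.L 0, F.incl 0 (A.map 1 r x) = A.map 0 r (E.incl 0 x) ∧
      A.map 0 r h.2 + h.1 • B.map 0 r x = D h) ∧ (fun h : ℝ × E.L 1 =>
        A.map 0 (r + h.1) (E.incl 0 (x + h.2)) - A.map 0 r (E.incl 0 x) - D (h.1, E.incl 0 h.2))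
          =o[𝓝[{h : ℝ × E.L 1 | r + h.1 ∈ P}] 0] fun h => h
  refine ⟨(A.map 0 r).comp (ContinuousLinearMap.snd ℝ ℝ (E.L 0)) + (ContinuousLinearMap.fst ℝ ℝ (E.L 0)).smulRight (B.map 0 r x),
      fun h => ⟨A.comm 0 r x, by simp⟩, ?_⟩
  have := hF.complete 0; rw [Asymptotics.isLittleO_iff]; intro ε hε
  have h1 : ∀ᶠ p : ℝ × E.L 1 in 𝓝[P ×ˢ univ] (r, x), ‖B.map 0 p.1 p.2 - B.map 0 r x‖ < ε := by
    have h2 := ((hB 0 (r, x) ⟨hr, trivial⟩).sub_const (B.map 0 r x)).norm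
    exact h2.eventually (gt_mem_nhds (by simpa using hε))
  obtain ⟨ρ, hρ, hb⟩ := Metric.mem_nhdsWithin_iff.1 h1
  filter_upwards [self_mem_nhdsWithin, nhdsWithin_le_nhds (Metric.ball_mem_nhds (0 : ℝ × E.L 1) hρ)] with h hhP hh
  change r + h.1 ∈ P at hhP; rw [mem_ball_zero_iff] at hh
  have e1 : A.map 0 (r + h.1) (E.incl 0 (x + h.2)) - A.map 0 r (E.incl 0 x) - (A.map 0 r (E.incl 0 h.2) + h.1 • B.map 0 r x) =
      ∫ σ in r..(r + h.1), (B.map 0 σ (x + h.2) - B.map 0 r x) := by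
    have i1 := intervalIntegral.integral_sub (hB.intervalIntegrable hP 0 (x + h.2 : E.L 1) hr hhP)
      (intervalIntegrable_const (c := B.map 0 r x))
    refine Eq.trans ?_ i1.symm
    refine Eq.trans ?_ (congrArg₂ (· - ·) (hAB (x + h.2) r hr _ hhP) (intervalIntegral.integral_const _).symm)
    rw [(E.incl 0).map_add, (A.map 0 r).map_add, add_sub_cancel_left]; abel
  have e2 : ∀ σ ∈ uIoc r (r + h.1), ‖B.map 0 σ (x + h.2) - B.map 0 r x‖ ≤ ε := by
    intro σ hσ; have hσ' := uIoc_subset_uIcc hσ; have h3 : |σ - r| ≤ |h.1| := by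
      have := abs_sub_left_of_mem_uIcc hσ'; rwa [add_sub_cancel_left] at this
    refine (hb (a := (σ, x + h.2)) ⟨?_, hP.uIcc_subset hr hhP hσ', trivial⟩).le
    rw [mem_ball_iff_norm]; refine (max_lt (lt_of_le_of_lt h3 ?_) ?_ : ‖(σ, x + h.2) - (r, x)‖ < ρ)
    · exact (norm_fst_le h).trans_lt hh
    · simpa using (norm_snd_le h).trans_lt hh
  have e3 := intervalIntegral.norm_integral_le_of_norm_le_const e2; rw [← e1, add_sub_cancel_left] at e3
  refine le_trans (le_of_eq ?_) (e3.trans (mul_le_mul_of_nonneg_left (norm_fst_le h) hε.le)); simp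

lemma IsCont.scContOn {A : OpFam E F} (h : A.IsCont P) : ScContOn ((Λ).sum E) F {p : ℝ × E.L 0 | p.1 ∈ P}
      (fun p : ℝ × E.L 0 => A.map 0 p.1 p.2) := by
  intro m; have hz : ∀ x : ℝ × E.L m, ((Λ).sum E).toZero m x = (x.1, E.toZero m x.2) := by
    intro x; have h := ScScale.sum_toZero Λ E m x.1 x.2; rw [ScScale.const_toZero] at h; exact h
  refine ⟨fun p : ℝ × E.L m => A.map m p.1 p.2, (h m).mono fun (p : ℝ × E.L m) hp => ⟨?_, trivial⟩, fun (x : ℝ × E.L m) _ => ?_⟩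
  · have h1 : ((Λ).sum E).toZero m p ∈ {p : ℝ × E.L 0 | p.1 ∈ P} := hp; rw [hz] at h1; exact h1
  · rw [hz, A.toZero]

lemma scDom_of_interior (E : ScScale) (hP : P.OrdConnected) (hi : (interior P).Nonempty) :
    ScDom ((Λ).sum E) {p : ℝ × E.L 0 | p.1 ∈ P} := by
  refine ⟨{p : ℝ × E.L 0 | p.1 ∈ P}, univ, ?_, ?_, isOpen_univ, by simp⟩
  · exact hP.convex.linear_preimage (LinearMap.fst ℝ ℝ (E.L 0))
  · obtain ⟨r, hr⟩ := hi; have h2 : {p : ℝ × E.L 0 | p.1 ∈ P} = P ×ˢ univ := by ext; simp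
    refine ⟨((r, 0) : ℝ × E.L 0), ?_⟩
    have h3 : ((r, 0) : ℝ × E.L 0) ∈ interior (P ×ˢ (univ : Set (E.L 0))) := by
      rw [interior_prod_eq, interior_univ]; exact ⟨hr, trivial⟩
    rwa [← h2] at h3

lemma SF.scDiffOn (hP : P.OrdConnected) (hi : (interior P).Nonempty) [ScGood E] [ScGood F] {A : OpFam E F} (h : A.SF P k) :
    ScDiffOn k ((Λ).sum E) F {p : ℝ × E.L 0 | p.1 ∈ P} (fun p : ℝ × E.L 0 => A.map 0 p.1 p.2) := by
  induction k generalizing E F with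
  | zero => exact IsCont.scContOn h
  | succ k ih =>
    have hup := h.of_succ.up hP; have hk' := h.of_succ; obtain ⟨h0, B, hAB, hB⟩ := h
    let Z := ((Λ).sum E).tangent; let Q : ScOp Z ((Λ).sum E).up := ScOp.tangentFst _
    let Q' : ScOp Z ((Λ).sum E) := ScOp.tangentSnd _
    let c : ScOp Z Λ := (ScOp.upConst ℝ).comp ((ScOp.fst (F := E)).up.comp Q)
    let y : ScOp Z E.up := (ScOp.snd (E := Λ) (F := E)).up.comp Q
    let dc : ScOp Z Λ := ScOp.fst.comp Q'; let dy : ScOp Z E := ScOp.snd.comp Q'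
    let dc0 : Z.L 0 → ℝ := dc.map 0; let U : Set (Z.L 0) := ((Λ).sum E).tangentSet {p : ℝ × E.L 0 | p.1 ∈ P}
    have d1 := (ih hup).comp ((c.prod y).scDiffOn k U) (scDom_of_interior _ hP hi) fun p hp => hp
    have d2 := (ih hk').comp ((c.prod dy).scDiffOn k U) (scDom_of_interior _ hP hi) fun p hp => hp
    have d3 := (ih hB).comp ((c.prod y).scDiffOn k U) (scDom_of_interior _ hP hi) fun p hp => hp
    have d4 : ScDiffOn k Z Λ U dc0 := dc.scDiffOn k U
    exact ⟨h0.scContOn, _, hAB.isScTangentMap hP hB.isCont, d1.pair (d2.add (d4.smul d3))⟩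

lemma scSmoothOn (hP : P.OrdConnected) (hi : (interior P).Nonempty) [ScGood E] [ScGood F] {A : OpFam E F} (h : ∀ k, A.SF P k) :
    ScSmoothOn ((Λ).sum E) F {p : ℝ × E.L 0 | p.1 ∈ P} (fun p : ℝ × E.L 0 => A.map 0 p.1 p.2) := fun k => (h k).scDiffOn hP hi

end OpFam

/-! ### Weak derivatives on the line -/

lemma IsWeakDeriv.congr_ae {f f' g' : Φ} (h : IsWeakDeriv f g) (hf : f =ᵐ[volume] f') (hg : g =ᵐ[volume] g') : IsWeakDeriv f' g' := by
  have key : ∀ {f f' : Φ}, LocallyIntegrable f → f =ᵐ[volume] f' → LocallyIntegrable f' := by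
    intro f f' h he x; obtain ⟨U, hU, hi⟩ := h x; exact ⟨U, hU, hi.congr_fun_ae (ae_restrict_of_ae he)⟩
  refine ⟨key h.1 hf, key h.2.1 hg, fun η hη hc => ?_⟩
  rw [integral_congr_ae (g := fun s => deriv η s • f s) (hf.mono fun s hs => by simp only [hs]),
    integral_congr_ae (f := fun s => η s • g' s) (g := fun s => η s • g s) (hg.mono fun s hs => by simp only [hs])]
  exact h.2.2 η hη hc

lemma isWeakDeriv_of_contDiff {f : Φ} (hf : ContDiff ℝ 1 f) : IsWeakDeriv f (deriv f) := by
  have hd : Continuous (deriv f) := hf.continuous_deriv le_rfl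
  refine ⟨hf.continuous.locallyIntegrable, hd.locallyIntegrable, fun η hη hc => ?_⟩
  have hηd : Continuous (deriv η) := hη.continuous_deriv (by simp)
  have h1 := integral_bilinear_hasDerivAt_right_eq_neg_left_of_integrable
    (L := ContinuousLinearMap.lsmul ℝ ℝ (E := Vec N)) (u := η) (v := f) (u' := deriv η)
    (v' := deriv f) (fun s _ => (hη.differentiable (by simp) s).hasDerivAt)
    (fun s _ => (hf.differentiable one_ne_zero s).hasDerivAt)
    ((hη.continuous.smul hd).integrable_of_hasCompactSupport hc.smul_right)
    ((hηd.smul hf.continuous).integrable_of_hasCompactSupport hc.deriv.smul_right)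
    ((hη.continuous.smul hf.continuous).integrable_of_hasCompactSupport hc.smul_right)
  simp only [ContinuousLinearMap.lsmul_apply] at h1; rw [h1, neg_neg]

lemma IsWeakDeriv.exists_ae_eq_const {f : Φ} (h : IsWeakDeriv f 0) : ∃ c : Vec N, f =ᵐ[volume] fun _ => c := by
  obtain ⟨ψ⟩ : Nonempty (ContDiffBump (0 : ℝ)) := inferInstance; let ψ0 : ℝ → ℝ := ψ.normed volume
  have hψ0 : ContDiff ℝ ∞ ψ0 := ψ.contDiff_normed
  have hψc : HasCompactSupport ψ0 := ψ.hasCompactSupport_normed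
  refine ⟨∫ s, ψ0 s • f s, ae_eq_of_integral_contDiff_smul_eq h.1 continuous_const.locallyIntegrable fun η hη hc => ?_⟩
  let I := ∫ s, η s; let ζ : ℝ → ℝ := fun s => η s - I * ψ0 s
  have hζ : ContDiff ℝ ∞ ζ := hη.sub (contDiff_const.mul hψ0); have hζ0 : ∫ s, ζ s = 0 := by
    rw [integral_sub (hη.continuous.integrable_of_hasCompactSupport hc)
      ((hψ0.continuous.integrable_of_hasCompactSupport hψc).const_mul I), integral_const_mul, ψ.integral_normed, mul_one, sub_self]
  obtain ⟨A, hA⟩ := (hc.sub hψc.mul_left : HasCompactSupport ζ).isCompact.isBounded.subset_ball (0 : ℝ)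
  rw [Real.ball_eq_Ioo, zero_sub, zero_add] at hA
  have hζA {s} (hs : s ∉ Ioo (-A) A) : ζ s = 0 := image_eq_zero_of_notMem_tsupport fun h => hs (hA h)
  let θ : ℝ → ℝ := fun x => ∫ s in (-A)..x, ζ s
  have hθd x : HasDerivAt θ (ζ x) x := (hζ.continuous.integral_hasStrictDerivAt (-A) x).hasDerivAt
  have hθ' : deriv θ = ζ := funext fun x => (hθd x).deriv; have hθs : ContDiff ℝ ∞ θ := by
    rw [contDiff_infty_iff_deriv, hθ']; exact ⟨fun x => (hθd x).differentiableAt, hζ⟩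
  have hθc : HasCompactSupport θ := .intro (isCompact_Icc (a := -A) (b := A)) fun x hx => by
    rcases le_total x (-A) with h | h
    · exact intervalIntegral.integral_zero_ae (ae_of_all _ fun s hs => hζA fun h' => by
        rw [uIoc_of_ge h] at hs; linarith [h'.1, hs.2])
    · refine (intervalIntegral.integral_eq_integral_of_support_subset fun s hs => ?_).trans hζ0; by_contra h'
      exact hs (hζA fun h2 => h' ⟨h2.1, h2.2.le.trans (not_lt.1 fun h3 => hx ⟨h, h3.le⟩)⟩)
  have h3 := h.2.2 θ hθs hθc; rw [hθ'] at h3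
  simp only [Pi.zero_apply, smul_zero, integral_zero, neg_zero, ζ, sub_smul, mul_smul] at h3
  rw [integral_sub (h.1.integrable_smul_left_of_hasCompactSupport hη.continuous hc) (g := fun s => I • ψ0 s • f s)
    ((h.1.integrable_smul_left_of_hasCompactSupport hψ0.continuous hψc).smul I), integral_smul, sub_eq_zero] at h3
  rw [h3, integral_smul_const]

lemma isWeakDeriv_primitive (hg : LocallyIntegrable g) : IsWeakDeriv (fun x => ∫ t in (0 : ℝ)..x, g t) g := by
  have hii {f : Φ} (hf : LocallyIntegrable f) a b : IntervalIntegrable f volume a b :=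
    (hf.integrableOn_isCompact isCompact_uIcc).intervalIntegrable
  have hcont : Continuous fun x => ∫ t in (0 : ℝ)..x, g t := intervalIntegral.continuous_primitive (hii hg) 0
  refine ⟨hcont.locallyIntegrable, hg, fun η hη hc => ?_⟩
  obtain ⟨A, hA0, hA⟩ := hc.isCompact.isBounded.subset_ball_lt 0 (0 : ℝ)
  rw [Real.ball_eq_Ioo, zero_sub, zero_add] at hA
  have hz {s} (hs : s ∉ Ioo (-A) A) : η s = 0 := image_eq_zero_of_notMem_tsupport fun h => hs (hA h)
  have i1 := hg.integrable_smul_left_of_hasCompactSupport hη.continuous hc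
  have i2 : Integrable fun s => deriv η s • ∫ t in (0 : ℝ)..s, g t := ((hη.continuous_deriv (by simp)).smul hcont).integrable_of_hasCompactSupport hc.deriv.smul_right
  have hac {f : Φ} (hf : LocallyIntegrable f) : AbsolutelyContinuousOnInterval (fun x => ∫ t in (0 : ℝ)..x, f t) (-A) A := by
    refine squeeze_zero (fun _ => Finset.sum_nonneg fun _ _ => dist_nonneg) (fun E => Finset.sum_le_sum fun i _ => ?_)
      ((hii hf (-A) A).norm.absolutelyContinuousOnInterval_intervalIntegral (c := 0) (by simp [hA0.le]))
    rw [dist_eq_norm, dist_eq_norm, intervalIntegral.integral_interval_sub_left (hii hf _ _) (hii hf _ _),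
      intervalIntegral.integral_interval_sub_left (hii hf _ _).norm (hii hf _ _).norm]
    exact intervalIntegral.norm_integral_le_abs_integral_norm
  have hi := (i1.add i2).locallyIntegrable
  obtain ⟨C, hC⟩ := (((hη.of_le (by simp)).contDiffOn.absolutelyContinuousOnInterval.smul (hac hg)).sub
    (hac hi)).const_of_ae_hasDerivAt_zero (by
      filter_upwards [LocallyIntegrable.ae_hasDerivAt_integral hg, LocallyIntegrable.ae_hasDerivAt_integral hi] with x h1 h2 _
      simpa using ((hη.differentiable (by simp) x).hasDerivAt.smul (h1 0)).sub (h2 0))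
  have e := (hC A (by simp)).trans (hC (-A) (by simp)).symm
  simp only [Pi.sub_apply, Pi.smul_apply', hz (s := A) (by simp), hz (s := -A) (by simp), zero_smul, zero_sub, neg_inj] at e
  simp only [eq_neg_iff_add_eq_zero]; rw [add_comm, ← integral_add i1 i2, ← sub_eq_zero.2 e,
    intervalIntegral.integral_interval_sub_left (hii hi _ _) (hii hi _ _),
    intervalIntegral.integral_eq_integral_of_support_subset]
  · rfl
  intro s hs; by_contra h; have h' : s ∉ tsupport η := fun h' => h (Ioo_subset_Ioc_self (hA h'))
  exact hs (by simp [image_eq_zero_of_notMem_tsupport h', image_eq_zero_of_notMem_tsupport (f := deriv η) fun h => h' (tsupport_deriv_subset h)])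

lemma IsWeakDeriv.exists_primitive {f : Φ} (h : IsWeakDeriv f g) : ∃ c : Vec N, f =ᵐ[volume] fun x => c + ∫ t in (0 : ℝ)..x, g t := by
  have h1 := h.add ((isWeakDeriv_primitive h.2.1).const_smul (-1)); have h2 : g + (-1 : ℝ) • g = 0 := by simp
  rw [h2] at h1; obtain ⟨c, hc⟩ := h1.exists_ae_eq_const; refine ⟨c, hc.mono fun x hx => ?_⟩
  have hx' : f x + (-1 : ℝ) • ∫ t in (0 : ℝ)..x, g t = c := hx; simp only; rw [← hx']; simp

lemma IsWeakDeriv.sub_eq_integral {f : Φ} (hf : Continuous f) (h : IsWeakDeriv f g) (x y : ℝ) : f y - f x = ∫ t in x..y, g t := by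
  obtain ⟨c, hc⟩ := h.exists_primitive
  have hii : ∀ a b, IntervalIntegrable g volume a b := fun a b => (h.2.1.integrableOn_isCompact isCompact_uIcc).intervalIntegrable
  have hcont : Continuous fun x => c + ∫ t in (0 : ℝ)..x, g t := continuous_const.add (intervalIntegral.continuous_primitive hii 0)
  have he := (hf.ae_eq_iff_eq volume hcont).1 hc; rw [he]; simp only
  rw [← intervalIntegral.integral_add_adjacent_intervals (hii 0 x) (hii x y)]; abel

lemma IsWeakDeriv.contDiff_one {f g' : Φ} (hf : Continuous f) (h : IsWeakDeriv f g)
    (h' : IsWeakDeriv g g') : ContDiff ℝ 1 f ∧ g =ᵐ[volume] deriv f := by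
  obtain ⟨c, hc⟩ := h'.exists_primitive
  have hcont : Continuous fun x => c + ∫ t in (0 : ℝ)..x, g' t := continuous_const.add
    (intervalIntegral.continuous_primitive (fun a b => (h'.2.1.integrableOn_isCompact isCompact_uIcc).intervalIntegrable) 0)
  have hd x : HasDerivAt f (c + ∫ t in (0 : ℝ)..x, g' t) x := by
    refine ((hcont.integral_hasStrictDerivAt 0 x).hasDerivAt.const_add (f 0)).congr_of_eventuallyEq (.of_forall fun y => ?_)
    simp only
    rw [← intervalIntegral.integral_congr_ae (f := g) (hc.mono fun t ht _ => ht), ← h.sub_eq_integral hf]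
    abel
  have hde := funext fun x => (hd x).deriv
  exact ⟨contDiff_one_iff_deriv.2 ⟨fun x => (hd x).differentiableAt, hde ▸ hcont⟩, hde ▸ hc⟩

lemma IsWeakDeriv.reflect {f : Φ} (h : IsWeakDeriv f g) : IsWeakDeriv (fun s => f (-s)) (fun s => -g (-s)) := by
  have key : ∀ f : Φ, LocallyIntegrable f → LocallyIntegrable (fun s => f (-s)) := by
    intro f hf; have := locallyIntegrable_map_homeomorph (Homeomorph.neg ℝ) (f := f) (μ := volume)
    have hm : Measure.map (Homeomorph.neg ℝ) (volume : Measure ℝ) = volume :=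
      (Measure.measurePreserving_neg (volume : Measure ℝ)).map_eq
    rw [hm] at this; exact this.1 hf
  refine ⟨key f h.1, (key g h.2.1).neg, fun η hη hc => ?_⟩
  have h1 := h.2.2 (fun s => η (-s)) (hη.comp contDiff_neg) (hc.comp_homeomorph (Homeomorph.neg ℝ))
  rw [← integral_neg_eq_self, ← integral_neg_eq_self (fun s => η (-s) • g s)] at h1
  simp only [deriv_comp_neg, neg_neg, neg_smul, integral_neg, smul_neg] at h1 ⊢; rw [neg_inj] at h1; exact h1

/-! ### Weighted Sobolev norms -/

section SobolevNorm

variable {δ δ' : ℝ}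

lemma Sob.norm_sq (f : Sob N k δ) : ‖f‖ ^ 2 = ∑ j : Fin (k + 1), ‖(f.memLp_jet j).toLp _‖ ^ 2 := by
  change ‖Sob.toL2 N k δ f‖ ^ 2 = _; rw [PiLp.norm_sq_eq_of_L2]
  rfl

lemma IsSobolevJet.eLpNorm_eq {f : Sob N k δ} {g : ℕ → Φ} (h : IsSobolevJet k δ f.1 g) (hj : j ≤ k) : eLpNorm (fun s => exp (δ * |s|) • g j s) 2 volume = ‖(f.memLp_jet ⟨j, by omega⟩).toLp _‖ₑ := by
  rw [Lp.enorm_toLp]; refine eLpNorm_congr_ae ?_; filter_upwards [h.unique f.jet_spec j hj] with s hs; rw [hs]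

lemma IsSobolevJet.eLpNorm_le {f : Sob N k δ} {g : ℕ → Φ} (h : IsSobolevJet k δ f.1 g) (hj : j ≤ k) : eLpNorm (fun s => exp (δ * |s|) • g j s) 2 volume ≤ ‖f‖ₑ := by
  rw [h.eLpNorm_eq hj, ← ofReal_norm, ← ofReal_norm]; refine ENNReal.ofReal_le_ofReal ?_
  refine (pow_le_pow_iff_left₀ (norm_nonneg _) (norm_nonneg _) two_ne_zero).1 ?_; rw [Sob.norm_sq]
  exact Finset.single_le_sum (f := fun j : Fin (k + 1) => ‖(f.memLp_jet j).toLp _‖ ^ 2) (fun i _ => sq_nonneg _) (Finset.mem_univ _)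

lemma IsSobolevJet.le_eLpNorm {f : Sob N k δ} {g : ℕ → Φ} (h : IsSobolevJet k δ f.1 g) :
    ‖f‖ₑ ≤ ∑ j ∈ Finset.range (k + 1), eLpNorm (fun s => exp (δ * |s|) • g j s) 2 volume := by
  have h1 : ∑ j ∈ Finset.range (k + 1), eLpNorm (fun s => exp (δ * |s|) • g j s) 2 volume =
      ∑ j : Fin (k + 1), ‖(f.memLp_jet j).toLp _‖ₑ := by
    rw [Finset.sum_range]; exact Finset.sum_congr rfl fun j _ => h.eLpNorm_eq (by omega)
  rw [h1]; have h2 : ‖f‖ ≤ ∑ j : Fin (k + 1), ‖(f.memLp_jet j).toLp _‖ := by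
    refine (pow_le_pow_iff_left₀ (norm_nonneg _) (Finset.sum_nonneg fun _ _ => norm_nonneg _) two_ne_zero).1 ?_
    rw [Sob.norm_sq]; exact Finset.sum_sq_le_sq_sum_of_nonneg fun _ _ => norm_nonneg _
  rw [← ofReal_norm]; refine (ENNReal.ofReal_le_ofReal h2).trans (le_of_eq ?_)
  rw [ENNReal.ofReal_sum_of_nonneg fun _ _ => norm_nonneg _]; simp only [ofReal_norm]

/-- The weak derivatives of a product `χ g₀`, where `g` is the sequence of derivatives of `g₀`. -/
def mulJet : (ℝ → ℝ) → (ℕ → Φ) → ℕ → Φ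
  | χ, g, 0 => fun s => χ s • g 0 s
  | χ, g, j + 1 => mulJet (deriv χ) g j + mulJet χ (fun i => g (i + 1)) j

lemma ContDiff.deriv_infty {χ : ℝ → ℝ} (hχ : ContDiff ℝ ∞ χ) : ContDiff ℝ ∞ (deriv χ) := ((contDiff_infty_iff_deriv).1 hχ).2

lemma isWeakDeriv_mulJet {χ : ℝ → ℝ} (hχ : ContDiff ℝ ∞ χ) {g : ℕ → Φ} (hg : ∀ i < j + 1, IsWeakDeriv (g i) (g (i + 1))) :
    IsWeakDeriv (mulJet χ g j) (mulJet χ g (j + 1)) := by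
  induction j generalizing χ g with
  | zero => exact (hg 0 (by omega)).mul hχ
  | succ j ih =>
    exact (ih hχ.deriv_infty fun i hi => hg i (by omega)).add (ih hχ fun i hi => hg (i + 1) (by omega))

lemma norm_mulJet_le {χ : ℝ → ℝ} {g : ℕ → Φ} (hC : ∀ i ≤ j, |iteratedDeriv i χ s| ≤ C) :
    ‖mulJet χ g j s‖ ≤ C * 2 ^ j * ∑ i ∈ Finset.range (j + 1), ‖g i s‖ := by
  induction j generalizing χ g with
  | zero =>
    have := hC 0 le_rfl; simp only [iteratedDeriv_zero] at this
    simpa [mulJet, norm_smul] using mul_le_mul_of_nonneg_right this (norm_nonneg (g 0 s))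
  | succ j ih =>
    have hC0 : 0 ≤ C := (abs_nonneg _).trans (hC 0 (by omega))
    have h2 := ih (χ := χ) (g := fun i => g (i + 1)) fun i hi => hC i (by omega)
    have h3 : ∑ i ∈ Finset.range (j + 1), ‖g i s‖ ≤ ∑ i ∈ Finset.range (j + 2), ‖g i s‖ :=
      Finset.sum_le_sum_of_subset_of_nonneg (Finset.range_mono (by omega)) fun _ _ _ => norm_nonneg _
    have h4 : ∑ i ∈ Finset.range (j + 1), ‖g (i + 1) s‖ ≤ ∑ i ∈ Finset.range (j + 2), ‖g i s‖ := by
      rw [Finset.sum_range_succ' _ (j + 1)]; exact le_add_of_nonneg_right (norm_nonneg _)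
    calc ‖mulJet χ g (j + 1) s‖ ≤ ‖mulJet (deriv χ) g j s‖ + ‖mulJet χ _ j s‖ := norm_add_le _ _
      _ ≤ C * 2 ^ j * ∑ i ∈ Finset.range (j + 2), ‖g i s‖ + C * 2 ^ j * ∑ i ∈ Finset.range (j + 2), ‖g i s‖ :=
        add_le_add ((ih (χ := deriv χ) (g := g) fun i hi => by have := hC (i + 1) (by omega); rwa [iteratedDeriv_succ'] at this).trans (mul_le_mul_of_nonneg_left h3 (by positivity))) (h2.trans (mul_le_mul_of_nonneg_left h4 (by positivity)))
      _ = _ := by ring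

/-- The part of the norm of `f` carried by `{s | L ≤ |s|}`. -/
def Sob.etail (L : ℝ) (f : Sob N k δ) : ℝ≥0∞ := ∑ j ∈ Finset.range (k + 1),
    eLpNorm ({s : ℝ | L ≤ |s|}.indicator fun s => exp (δ * |s|) • f.jet j s) 2 volume

lemma Sob.etail_le (L : ℝ) (f : Sob N k δ) : f.etail L ≤ (k + 1 : ℕ) * ‖f‖ₑ := by
  refine (Finset.sum_le_card_nsmul _ _ ‖f‖ₑ fun j hj => ?_).trans (by simp)
  exact (eLpNorm_indicator_le _).trans (f.jet_spec.eLpNorm_le (by grind))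

lemma meas_le_abs (L : ℝ) : MeasurableSet {s : ℝ | L ≤ |s|} := (isClosed_le continuous_const continuous_abs).measurableSet

lemma Sob.etail_add_le (L : ℝ) (f f' : Sob N k δ) : (f + f').etail L ≤ f.etail L + f'.etail L := by
  unfold Sob.etail; rw [← Finset.sum_add_distrib]; refine Finset.sum_le_sum fun j hj => ?_
  have hj' : j ≤ k := by grind
  refine le_trans (le_of_eq ?_) (eLpNorm_add_le ((f.jet_spec.2.2 j hj').1.indicator (meas_le_abs L))
    ((f'.jet_spec.2.2 j hj').1.indicator (meas_le_abs L)) (by norm_num))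
  refine eLpNorm_congr_ae ?_
  filter_upwards [(f + f').jet_spec.unique (f.jet_spec.add f'.jet_spec) j hj'] with s hs
  by_cases hsL : s ∈ {s : ℝ | L ≤ |s|}
  · simp only [indicator_of_mem hsL, Pi.add_apply, hs, smul_add]
  · simp only [indicator_of_notMem hsL, Pi.add_apply, add_zero]

lemma weighted_mulJet_le {χ : ℝ → ℝ} {g : ℕ → Φ} (hC : ∀ i ≤ k, ∀ s, |iteratedDeriv i χ s| ≤ C)
    (hw : ∀ s, ∀ i ≤ k, iteratedDeriv i χ s ≠ 0 → δ * |s| ≤ δ' * |s + t| + κ ∧ L ≤ |s + t|) (hj : j ≤ k) (s : ℝ) :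
    ‖exp (δ * |s|) • mulJet χ (fun i s => g i (s + t)) j s‖ ≤ C * 2 ^ k * exp κ * ∑ i ∈ Finset.range (k + 1),
        ‖{s : ℝ | L ≤ |s|}.indicator (fun s => exp (δ' * |s|) • g i s) (s + t)‖ := by
  have hC0 : 0 ≤ C := (abs_nonneg _).trans (hC 0 (by omega) 0); rw [norm_smul, norm_exp]
  by_cases hs : ∃ i ≤ k, iteratedDeriv i χ s ≠ 0
  · obtain ⟨i0, hi0, hne⟩ := hs; obtain ⟨h1, h2⟩ := hw s i0 hi0 hne
    have h3 := norm_mulJet_le (χ := χ) (g := fun i s => g i (s + t)) (s := s) (j := j) (C := C) fun i hi => hC i (by omega) s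
    have h4 : ∑ i ∈ Finset.range (j + 1), ‖g i (s + t)‖ ≤ ∑ i ∈ Finset.range (k + 1), ‖g i (s + t)‖ :=
      Finset.sum_le_sum_of_subset_of_nonneg (Finset.range_mono (by omega)) fun _ _ _ => norm_nonneg _
    have h5 : ∑ i ∈ Finset.range (k + 1), ‖{s : ℝ | L ≤ |s|}.indicator (fun s => exp (δ' * |s|) • g i s) (s + t)‖ =
        exp (δ' * |s + t|) * ∑ i ∈ Finset.range (k + 1), ‖g i (s + t)‖ := by
      rw [Finset.mul_sum]; refine Finset.sum_congr rfl fun i _ => ?_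
      rw [indicator_of_mem (show s + t ∈ {s : ℝ | L ≤ |s|} from h2), norm_smul, norm_exp]
    have h6 : exp (δ * |s|) ≤ exp (δ' * |s + t|) * exp κ := by
      rw [← Real.exp_add]; exact Real.exp_le_exp.2 h1
    have h7 : (2 : ℝ) ^ j ≤ 2 ^ k := pow_le_pow_right₀ (by norm_num) hj; rw [h5]
    calc _ ≤ _ * (C * 2 ^ k * ∑ i ∈ Finset.range (k + 1), ‖g i (s + t)‖) := by
          refine mul_le_mul h6 (h3.trans ?_) (norm_nonneg _) (by positivity)
          exact mul_le_mul (mul_le_mul_of_nonneg_left h7 hC0) h4 (Finset.sum_nonneg fun _ _ => norm_nonneg _) (by positivity)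
      _ = _ := by ring
  · push Not at hs
    have h4 : ‖mulJet χ (fun i s => g i (s + t)) j s‖ = 0 := le_antisymm (by simpa using (norm_mulJet_le (χ := χ) (s := s) (j := j) (C := 0) fun i hi => by rw [hs i (by omega), abs_zero])) (norm_nonneg _)
    rw [h4, mul_zero]
    exact mul_nonneg (mul_nonneg (mul_nonneg hC0 (by positivity)) (Real.exp_pos _).le) (Finset.sum_nonneg fun _ _ => norm_nonneg _)

lemma eLpNorm_le_of_shift_sum {F : Φ} {w : ℕ → Φ} {K : ℝ} (hm : ∀ i ∈ Finset.range (k + 1), AEStronglyMeasurable (w i) volume)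
    (h : ∀ s, ‖F s‖ ≤ K * ∑ i ∈ Finset.range (k + 1), ‖w i (s + t)‖) :
    eLpNorm F 2 volume ≤ ENNReal.ofReal K * ∑ i ∈ Finset.range (k + 1), eLpNorm (w i) 2 volume := by
  have hmp := measurePreserving_add_right volume t
  let G := fun i s => ‖w i (s + t)‖
  have hG : ∀ i ∈ Finset.range (k + 1), AEStronglyMeasurable (G i) volume := fun i hi =>
    ((hm i hi).comp_measurePreserving hmp).norm
  have h2 : ∀ i ∈ Finset.range (k + 1), eLpNorm (G i) 2 volume = eLpNorm (w i) 2 volume := by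
    intro i hi; have h3 := eLpNorm_comp_measurePreserving (p := 2) (hm i hi) hmp; rw [← h3]
    exact eLpNorm_norm _
  have h4 := eLpNorm_le_mul_eLpNorm_of_ae_le_mul (g := ∑ i ∈ Finset.range (k + 1), G i)
    (μ := volume) (ae_of_all _ fun s => by
      refine (h s).trans (le_of_eq ?_)
      rw [Finset.sum_apply, Real.norm_of_nonneg (Finset.sum_nonneg fun _ _ => norm_nonneg _)]) 2
  have h5 := eLpNorm_sum_le (p := 2) hG (by norm_num); rw [Finset.sum_congr rfl h2] at h5
  exact h4.trans (by gcongr)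

lemma eLpNorm_mulJet_le {χ : ℝ → ℝ} (f : Sob N k' δ') (hk : k ≤ k') (hC : ∀ i ≤ k, ∀ s, |iteratedDeriv i χ s| ≤ C)
    (hw : ∀ s, ∀ i ≤ k, iteratedDeriv i χ s ≠ 0 → δ * |s| ≤ δ' * |s + t| + κ ∧ L ≤ |s + t|) (hj : j ≤ k) :
    eLpNorm (fun s => exp (δ * |s|) • mulJet χ (fun i s => f.jet i (s + t)) j s) 2 volume ≤
      ENNReal.ofReal (C * 2 ^ k * exp κ) * f.etail L := by
  refine (eLpNorm_le_of_shift_sum (fun i hi => (f.jet_spec.2.2 i (by grind)).1.indicator (meas_le_abs L)) (fun s => weighted_mulJet_le hC hw hj s)).trans ?_; have := Finset.range_mono (by omega)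
  unfold Sob.etail; gcongr

lemma IsSobolevJet.mulShift {χ : ℝ → ℝ} (hχ : ContDiff ℝ ∞ χ) {f : Sob N k' δ'} (hk : k ≤ k') (hk1 : 1 ≤ k)
    (hC : ∀ i ≤ k, ∀ s, |iteratedDeriv i χ s| ≤ C)
    (hw : ∀ s, ∀ i ≤ k, iteratedDeriv i χ s ≠ 0 → δ * |s| ≤ δ' * |s + t| + κ ∧ L ≤ |s + t|) :
    IsSobolevJet k δ (fun s => χ s • f.1 (s + t)) (mulJet χ (fun i s => f.jet i (s + t))) := by
  have h1 : ∀ j < k, IsWeakDeriv _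
      (mulJet χ _ (j + 1)) := fun j hj =>
    isWeakDeriv_mulJet hχ fun i hi => by
      simpa using (f.jet_spec.2.1 i (by omega)).shift (-t)
  refine ⟨by funext s; simp [mulJet, f.jet_spec.1], h1, fun j hj => ⟨?_, ?_⟩⟩
  · have h2 : LocallyIntegrable (mulJet χ (fun i s => f.jet i (s + t)) j) := by
      cases j with
      | zero => exact (h1 0 (by omega)).1
      | succ j => exact (h1 j (by omega)).2.1
    have h3 : Continuous fun s : ℝ => exp (δ * |s|) := by fun_prop
    exact h3.aestronglyMeasurable.smul h2.aestronglyMeasurable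
  · refine (eLpNorm_mulJet_le f hk hC hw hj).trans_lt (ENNReal.mul_lt_top ENNReal.ofReal_lt_top ?_)
    exact (f.etail_le L).trans_lt (ENNReal.mul_lt_top (by simp) (by simp))

/-- The part of the norm of `f` carried by `{s | L ≤ |s|}`, as a real number. -/
def Sob.tail (L : ℝ) (f : Sob N k δ) : ℝ := (f.etail L).toReal

lemma Sob.etail_ne_top (L : ℝ) (f : Sob N k δ) : f.etail L ≠ ⊤ := ((f.etail_le L).trans_lt (ENNReal.mul_lt_top (by simp) (by simp))).ne

lemma Sob.tail_nonneg (L : ℝ) (f : Sob N k δ) : 0 ≤ f.tail L := ENNReal.toReal_nonneg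

lemma Sob.tail_le (L : ℝ) (f : Sob N k δ) : f.tail L ≤ (k + 1) * ‖f‖ := by
  have := ENNReal.toReal_mono (ENNReal.mul_ne_top (by simp) (by simp)) (f.etail_le L)
  rw [ENNReal.toReal_mul] at this; exact_mod_cast this

lemma Sob.tail_add_le (L : ℝ) (f f' : Sob N k δ) : (f + f').tail L ≤ f.tail L + f'.tail L := by
  have := ENNReal.toReal_mono (ENNReal.add_ne_top.2 ⟨f.etail_ne_top L, f'.etail_ne_top L⟩) (f.etail_add_le L f')
  rwa [ENNReal.toReal_add (f.etail_ne_top L) (f'.etail_ne_top L)] at this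

lemma tendsto_eLpNorm_tail {w : Φ} (hw : MemLp w 2 volume) :
    Tendsto (fun L : ℝ => eLpNorm ({s : ℝ | L ≤ |s|}.indicator w) 2 volume) atTop (𝓝 0) := by
  rw [ENNReal.tendsto_nhds_zero]; intro ε hε
  obtain ⟨g, hg, he, -, -⟩ := hw.exists_hasCompactSupport_eLpNorm_sub_le (by norm_num) hε.ne'
  obtain ⟨M, hM⟩ := hg.isCompact.isBounded.subset_closedBall (0 : ℝ)
  filter_upwards [eventually_gt_atTop M] with L hL
  have h1 : {s : ℝ | L ≤ |s|}.indicator w = {s : ℝ | L ≤ |s|}.indicator (w - g) := by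
    refine indicator_congr fun s (hs : L ≤ |s|) => ?_; have : g s = 0 := by
      by_contra hne; have := hM (subset_tsupport g hne)
      rw [mem_closedBall_zero_iff, Real.norm_eq_abs] at this; linarith
    simp [this]
  rw [h1]; exact (eLpNorm_indicator_le _).trans he

lemma Sob.tendsto_tail (f : Sob N k δ) : Tendsto (fun L : ℝ => f.tail L) atTop (𝓝 0) := by
  have h1 : Tendsto (fun L : ℝ => f.etail L) atTop (𝓝 0) := by
    have : Tendsto (fun L : ℝ => f.etail L) atTop _ :=
      tendsto_finsetSum _ fun j hj => tendsto_eLpNorm_tail (f.jet_spec.2.2 j (by grind))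
    simpa using this
  have h2 := (ENNReal.tendsto_toReal ENNReal.zero_ne_top).comp h1; rwa [ENNReal.toReal_zero] at h2

lemma Sob.norm_mulShift_le {χ : ℝ → ℝ} (hχ : ContDiff ℝ ∞ χ) {f : Sob N k' δ'} (hk : k ≤ k') (hk1 : 1 ≤ k)
    (hC : ∀ i ≤ k, ∀ s, |iteratedDeriv i χ s| ≤ C)
    (hw : ∀ s, ∀ i ≤ k, iteratedDeriv i χ s ≠ 0 → δ * |s| ≤ δ' * |s + t| + κ ∧ L ≤ |s + t|)
    {F : Sob N k δ} (hF : F.1 = fun s => χ s • f.1 (s + t)) :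
    ‖F‖ ≤ (k + 1) * (C * 2 ^ k * exp κ) * f.tail L := by
  have hC0 : 0 ≤ C := (abs_nonneg _).trans (hC 0 (by omega) 0)
  have h1 := hF ▸ IsSobolevJet.mulShift hχ hk hk1 hC hw
  have h2 := h1.le_eLpNorm.trans (Finset.sum_le_card_nsmul _ _ _ fun j hj =>
    eLpNorm_mulJet_le f hk hC hw (j := j) (by grind))
  rw [Finset.card_range, nsmul_eq_mul] at h2
  have h3 := ENNReal.toReal_mono (ENNReal.mul_ne_top (by simp) (ENNReal.mul_ne_top ENNReal.ofReal_ne_top (f.etail_ne_top L))) h2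
  rw [ENNReal.toReal_mul, ENNReal.toReal_mul, ENNReal.toReal_ofReal (by positivity), toReal_enorm] at h3
  refine h3.trans (le_of_eq ?_); simp only [ENNReal.toReal_natCast, Sob.tail]; push_cast; ring

end SobolevNorm

/-! ### Cut-off functions -/

/-- Smooth functions on `ℝ` that are constant near `-∞` and near `+∞`. -/
structure CutFn where
  toFun : ℝ → ℝ
  smooth : ContDiff ℝ ∞ toFun
  lo : ℝ
  hi : ℝ
  eq_lo_hi : ∃ M, 0 ≤ M ∧ (∀ s ≤ -M, toFun s = lo) ∧ ∀ s ≥ M, toFun s = hi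

instance : CoeFun CutFn fun _ => ℝ → ℝ := ⟨CutFn.toFun⟩

namespace CutFn

def const (c : ℝ) : CutFn := ⟨fun _ => c, contDiff_const, c, c, 0, le_rfl, fun _ _ => rfl, fun _ _ => rfl⟩

/-- A radius outside of which `χ` is constant. -/
def rad (χ : CutFn) : ℝ := χ.eq_lo_hi.choose

lemma rad_nonneg (χ : CutFn) : 0 ≤ χ.rad := χ.eq_lo_hi.choose_spec.1

lemma eq_lo (χ : CutFn) (h : s ≤ -χ.rad) : χ s = χ.lo := χ.eq_lo_hi.choose_spec.2.1 s h

lemma eq_hi (χ : CutFn) (h : χ.rad ≤ s) : χ s = χ.hi := χ.eq_lo_hi.choose_spec.2.2 s h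

def deriv (χ : CutFn) : CutFn where
  toFun := _root_.deriv χ.toFun
  smooth := χ.smooth.deriv_infty
  lo := 0
  hi := 0
  eq_lo_hi := by
    refine ⟨χ.rad + 1, by linarith [χ.rad_nonneg], fun s hs => ?_, fun s hs => ?_⟩
    · have : χ.toFun =ᶠ[𝓝 s] fun _ => χ.lo :=
        mem_of_superset (Iio_mem_nhds (show s < -χ.rad by linarith)) fun t ht => χ.eq_lo (le_of_lt ht)
      rw [this.deriv_eq, deriv_const]
    · have : χ.toFun =ᶠ[𝓝 s] fun _ => χ.hi :=
        mem_of_superset (Ioi_mem_nhds (show χ.rad < s by linarith)) fun t ht => χ.eq_hi (le_of_lt ht)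
      rw [this.deriv_eq, deriv_const]

def shift (χ : CutFn) (c : ℝ) : CutFn where
  toFun s := χ (s - c)
  smooth := χ.smooth.comp (contDiff_id.sub contDiff_const)
  lo := χ.lo
  hi := χ.hi
  eq_lo_hi := ⟨χ.rad + |c|, by linarith [χ.rad_nonneg, abs_nonneg c],
    fun s hs => χ.eq_lo (by linarith [neg_abs_le c]), fun s hs => χ.eq_hi (by linarith [le_abs_self c])⟩

def map₂ (χ χ' : CutFn) (f : ℝ → ℝ → ℝ) (hf : ContDiff ℝ ∞ fun s => f (χ s) (χ'.toFun s)) : CutFn where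
  toFun s := f (χ s) (χ'.toFun s)
  smooth := hf
  lo := f χ.lo χ'.lo
  hi := f χ.hi χ'.hi
  eq_lo_hi := ⟨max χ.rad χ'.rad, le_max_of_le_left χ.rad_nonneg, fun s hs => by
      rw [χ.eq_lo (by linarith [le_max_left χ.rad χ'.rad]), χ'.eq_lo (by linarith [le_max_right χ.rad χ'.rad])],
    fun s hs => by
      rw [χ.eq_hi (by linarith [le_max_left χ.rad χ'.rad]), χ'.eq_hi (by linarith [le_max_right χ.rad χ'.rad])]⟩

def add (χ χ' : CutFn) : CutFn := χ.map₂ χ' (· + ·) (χ.smooth.add χ'.smooth)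

def sub (χ χ' : CutFn) : CutFn := χ.map₂ χ' (· - ·) (χ.smooth.sub χ'.smooth)

def mul (χ χ' : CutFn) : CutFn := χ.map₂ χ' (· * ·) (χ.smooth.mul χ'.smooth)

def div (χ χ' : CutFn) (h : ∀ s, χ'.toFun s ≠ 0) : CutFn := χ.map₂ χ' (· / ·) (χ.smooth.div χ'.smooth h)

/-- `s ↦ χ (-s)`. -/
def refl (χ : CutFn) : CutFn where
  toFun s := χ (-s)
  smooth := χ.smooth.comp contDiff_neg
  lo := χ.hi
  hi := χ.lo
  eq_lo_hi := ⟨χ.rad, χ.rad_nonneg, fun s hs => χ.eq_hi (by linarith), fun s hs => χ.eq_lo (by linarith)⟩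

lemma exists_bound_zero (χ : CutFn) : ∃ C, ∀ s, |χ s| ≤ C := by
  obtain ⟨C, hC⟩ := (isCompact_Icc).exists_bound_of_continuousOn χ.smooth.continuous.continuousOn
  refine ⟨max C (max |χ.lo| |χ.hi|), fun s => ?_⟩; rcases le_or_gt s _ with h | h
  · rw [χ.eq_lo h]; exact (le_max_left _ _).trans (le_max_right _ _)
  rcases le_or_gt χ.rad s with h' | h'
  · rw [χ.eq_hi h']; exact (le_max_right _ _).trans (le_max_right _ _)
  · exact (hC s ⟨h.le, h'.le⟩).trans (le_max_left _ _)

lemma exists_bound (χ : CutFn) (k : ℕ) : ∃ C, ∀ i ≤ k, ∀ s, |iteratedDeriv i χ s| ≤ C := by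
  induction k generalizing χ with
  | zero =>
    obtain ⟨C, hC⟩ := χ.exists_bound_zero; refine ⟨C, fun i hi s => ?_⟩; obtain rfl : i = 0 := by omega
    simpa using hC s
  | succ k ih =>
    obtain ⟨C, hC⟩ := χ.exists_bound_zero; obtain ⟨C', hC'⟩ := ih χ.deriv; refine ⟨max C C', fun i hi s => ?_⟩
    cases i with
    | zero => simpa using Or.inl (hC s)
    | succ i =>
      rw [iteratedDeriv_succ']; exact (hC' i (by omega) s).trans (le_max_right _ _)

/-- A bound of the first `k` derivatives. -/
def bd (χ : CutFn) (k : ℕ) : ℝ := (χ.exists_bound k).choose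

lemma le_bd (χ : CutFn) (hi : i ≤ k) (s : ℝ) : |iteratedDeriv i χ s| ≤ χ.bd k := (χ.exists_bound k).choose_spec i hi s

lemma bd_nonneg (χ : CutFn) (k : ℕ) : 0 ≤ χ.bd k := (abs_nonneg _).trans (χ.le_bd (Nat.zero_le k) 0)

lemma iterDeriv_shift (χ : CutFn) (c : ℝ) (i : ℕ) (s : ℝ) : iteratedDeriv i (χ.shift c).toFun s = iteratedDeriv i χ (s - c) :=
  congrFun (iteratedDeriv_comp_sub_const i χ c) s

lemma neg_rad_le (χ : CutFn) (h : χ.lo = 0) (hs : iteratedDeriv i χ s ≠ 0) : -χ.rad ≤ s := by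
  by_contra! hlt
  have : χ.toFun =ᶠ[𝓝 s] fun _ => 0 := mem_of_superset (Iio_mem_nhds hlt) fun t ht => (χ.eq_lo (le_of_lt ht)).trans h
  exact hs (by rw [this.iteratedDeriv_eq]; simp)

lemma le_rad (χ : CutFn) (h : χ.hi = 0) (hs : iteratedDeriv i χ s ≠ 0) : s ≤ χ.rad := by
  by_contra! hlt
  have : χ.toFun =ᶠ[𝓝 s] fun _ => 0 := mem_of_superset (Ioi_mem_nhds hlt) fun t ht => (χ.eq_hi (le_of_lt ht)).trans h
  exact hs (by rw [this.iteratedDeriv_eq]; simp)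

end CutFn

/-! ### Operators between weighted Sobolev spaces -/

section SobolevOperators

variable {δ δ' : ℝ}

lemma mul_abs_le_add (h : δ ≤ δ') (t s : ℝ) : δ * |s| ≤ δ' * |s + t| + |δ| * |t| := by
  have h1 : δ * |s| - δ * |s + t| ≤ |δ| * |t| := by
    have h6 : |(|s| - |s + t|)| ≤ |t| := by grind
    calc δ * |s| - δ * |s + t| = δ * _ := by ring
      _ ≤ |δ * _| := le_abs_self _
      _ = |δ| * |(|s| - |s + t|)| := abs_mul _ _
      _ ≤ |δ| * |t| := mul_le_mul_of_nonneg_left h6 (abs_nonneg _)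
  nlinarith [mul_le_mul_of_nonneg_right h (abs_nonneg (s + t))]

/-- The operator `f ↦ χ f(· + t)`. -/
def Sob.ms (χ : CutFn) (t : ℝ) (hk1 : 1 ≤ k) (hk : k ≤ k') (d : δ ≤ δ') :
    Sob N k' δ' →L[ℝ] Sob N k δ :=
  LinearMap.mkContinuousOfExistsBound
    { toFun := fun f => ⟨fun s => χ s • f.1 (s + t),
        χ.smooth.continuous.smul (f.2.1.comp (continuous_id.add continuous_const)), _,
        IsSobolevJet.mulShift χ.smooth hk hk1 (fun _ hi s => χ.le_bd hi s)
          (L := 0) fun s _ _ _ => ⟨mul_abs_le_add d t s, abs_nonneg _⟩⟩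
      map_add' := fun f g => Subtype.ext (funext fun s => smul_add (χ s) (f.1 (s + t)) (g.1 (s + t)))
      map_smul' := fun c f => Subtype.ext (funext fun s => smul_comm (χ s) c (f.1 (s + t))) }
    ⟨(k + 1) * (χ.bd k * 2 ^ k * exp (|δ| * |t|)) * (k' + 1), fun f => by
      have := Sob.norm_mulShift_le χ.smooth (f := f) hk hk1 (fun _ hi s => χ.le_bd hi s)
        (L := 0) (fun s _ _ _ => ⟨mul_abs_le_add d t s, abs_nonneg _⟩)
        (F := ⟨fun s => χ s • f.1 (s + t),
          χ.smooth.continuous.smul (f.2.1.comp (continuous_id.add continuous_const)), _,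
          IsSobolevJet.mulShift χ.smooth hk hk1 (fun _ hi s => χ.le_bd hi s)
            (L := 0) fun s _ _ _ => ⟨mul_abs_le_add d t s, abs_nonneg _⟩⟩) rfl
      refine this.trans ?_; rw [mul_assoc _ ((k' : ℝ) + 1)]
      refine mul_le_mul_of_nonneg_left (f.tail_le 0) ?_; have := χ.bd_nonneg k; positivity⟩

@[simp] lemma Sob.ms_apply (χ : CutFn) (t : ℝ) (hk1 : 1 ≤ k) (hk : k ≤ k') (d : δ ≤ δ')
    (f : Sob N k' δ') (s : ℝ) : (Sob.ms χ t hk1 hk d f).1 s = χ s • f.1 (s + t) := rfl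

lemma Sob.norm_ms_le (χ : CutFn) (t : ℝ) (hk1 : 1 ≤ k) (hk : k ≤ k') (d : δ ≤ δ')
    (f : Sob N k' δ') (hC : ∀ i ≤ k, ∀ s, |iteratedDeriv i χ s| ≤ C)
    (hw : ∀ s, ∀ i ≤ k, iteratedDeriv i χ s ≠ 0 → δ * |s| ≤ δ' * |s + t| + κ ∧ L ≤ |s + t|) :
    ‖Sob.ms χ t hk1 hk d f‖ ≤ (k + 1) * (C * 2 ^ k * exp κ) * f.tail L :=
  Sob.norm_mulShift_le χ.smooth hk hk1 hC hw rfl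

lemma Sob.ext {f g : Sob N k δ} (h : ∀ s, f.1 s = g.1 s) : f = g := Subtype.ext (funext h)

lemma Sob.contDiff_one (f : Sob N k δ) (hk : 2 ≤ k) : ContDiff ℝ 1 f.1 ∧ f.jet 1 =ᵐ[volume] deriv f.1 := by
  have h0 := f.jet_spec.2.1 0 (by omega); rw [f.jet_spec.1] at h0
  exact h0.contDiff_one f.2.1 (f.jet_spec.2.1 1 (by omega))

/-- The weak derivatives of `f'`. -/
def Sob.derivJet (f : Sob N k δ) : ℕ → Φ
  | 0 => deriv f.1
  | j + 1 => f.jet (j + 2)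

lemma Sob.jet_deriv (f : Sob N k' δ') (hk1 : 1 ≤ k) (hk : k + 1 ≤ k') (d : δ ≤ δ') : IsSobolevJet k δ (deriv f.1) f.derivJet := by
  have h1 := (f.contDiff_one (by omega)).2
  have hm : ∀ j ≤ k, MemLp (fun s => exp (δ * |s|) • f.jet (j + 1) s) 2 volume := fun j hj => by
    have h2 := f.jet_spec.2.2 (j + 1) (by omega); refine h2.of_le ?_ (ae_of_all _ fun s => ?_)
    · have h3 : Continuous fun s : ℝ => exp (δ * |s|) := by fun_prop
      have h4 := f.jet_spec.2.1 j (by omega); exact h3.aestronglyMeasurable.smul h4.2.1.aestronglyMeasurable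
    · rw [norm_smul, norm_smul, norm_exp, norm_exp]; gcongr
  refine ⟨rfl, fun j hj => ?_, fun j hj => ?_⟩
  · cases j with
    | zero => exact (f.jet_spec.2.1 1 (by omega)).congr_ae h1 (ae_eq_refl _)
    | succ j => exact f.jet_spec.2.1 (j + 2) (by omega)
  · cases j with
    | zero => exact (hm 0 (by omega)).ae_eq (h1.mono fun s hs => congrArg (_ • ·) hs)
    | succ j => exact hm (j + 1) hj

/-- Differentiation `f ↦ f'`. -/
def Sob.D (hk1 : 1 ≤ k) (hk : k + 1 ≤ k') (d : δ ≤ δ') : Sob N k' δ' →L[ℝ] Sob N k δ := LinearMap.mkContinuousOfExistsBound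
    { toFun := fun f => ⟨deriv f.1, (f.contDiff_one (by omega)).1.continuous_deriv le_rfl, _, f.jet_deriv hk1 hk d⟩
      map_add' := fun f g => Subtype.ext (funext fun s =>
        deriv_add ((f.contDiff_one (by omega)).1.differentiable (by simp) s)
          ((g.contDiff_one (by omega)).1.differentiable (by simp) s))
      map_smul' := fun c f => Subtype.ext (funext fun s =>
        deriv_const_smul c ((f.contDiff_one (by omega)).1.differentiable (by simp) s)) }
    ⟨k + 1, fun f => by
      set F : Sob N k δ := ⟨deriv f.1, (f.contDiff_one (by omega)).1.continuous_deriv le_rfl, _, f.jet_deriv hk1 hk d⟩ with hF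
      change ‖F‖ ≤ _; have h1 : IsSobolevJet k δ F.1 _ := f.jet_deriv hk1 hk d
      have h2 : ‖F‖ₑ ≤ (k + 1) • ‖f‖ₑ := by
        refine h1.le_eLpNorm.trans ((Finset.sum_le_card_nsmul _ _ ‖f‖ₑ fun j hj => ?_).trans (by simp))
        rw [Finset.mem_range] at hj; refine le_trans ?_ (f.jet_spec.eLpNorm_le (j := j + 1) (by omega))
        refine eLpNorm_mono_ae ?_; filter_upwards [(f.contDiff_one (by omega)).2] with s hs
        rw [norm_smul, norm_smul, norm_exp, norm_exp]; have h5 : ‖f.derivJet j s‖ = ‖f.jet (j + 1) s‖ := by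
          cases j with
          | zero => exact congrArg norm hs.symm
          | succ j => rfl
        rw [h5]; gcongr
      have h3 := ENNReal.toReal_mono (by rw [nsmul_eq_mul]; finiteness) h2
      rw [nsmul_eq_mul, ENNReal.toReal_mul, toReal_enorm, toReal_enorm, ENNReal.toReal_natCast] at h3
      exact_mod_cast h3⟩

@[simp] lemma Sob.D_apply (hk1 : 1 ≤ k) (hk : k + 1 ≤ k') (d : δ ≤ δ') (f : Sob N k' δ') : (Sob.D hk1 hk d f).1 = deriv f.1 := rfl

lemma IsSobolevJet.reflect {f : Φ} {g : ℕ → Φ} (h : IsSobolevJet k δ f g) :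
    IsSobolevJet k δ (fun s => f (-s)) (fun j s => (-1 : ℝ) ^ j • g j (-s)) := by
  refine ⟨by simp [h.1], fun j hj => ?_, fun j hj => ?_⟩
  · have := (h.2.1 j hj).reflect.const_smul ((-1) ^ j)
    refine this.congr_ae (ae_eq_refl _) (ae_of_all _ fun s => ?_); simp [pow_succ]
  · have h1 := (h.2.2 j hj).comp_measurePreserving (Measure.measurePreserving_neg volume)
    refine (h1.const_smul ((-1 : ℝ) ^ j)).ae_eq (ae_of_all _ fun s => ?_); simp [smul_comm (_ ^ j)]

/-- The reflection `f ↦ f(-·)`. -/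
def Sob.J : Sob N k δ →L[ℝ] Sob N k δ := LinearMap.mkContinuousOfExistsBound
    { toFun := fun f => ⟨fun s => f.1 (-s), f.2.1.comp continuous_neg, _, f.jet_spec.reflect⟩
      map_add' := fun f g => rfl
      map_smul' := fun c f => rfl }
    ⟨k + 1, fun f => by
      set F : Sob N k δ := ⟨fun s => f.1 (-s), f.2.1.comp continuous_neg, _, f.jet_spec.reflect⟩
      change ‖F‖ ≤ _; have h1 : IsSobolevJet k δ F.1 _ := f.jet_spec.reflect
      have h2 : ‖F‖ₑ ≤ (k + 1) • ‖f‖ₑ := by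
        refine h1.le_eLpNorm.trans ((Finset.sum_le_card_nsmul _ _ ‖f‖ₑ fun j hj => ?_).trans (by simp))
        rw [Finset.mem_range] at hj; refine le_trans (le_of_eq ?_) (f.jet_spec.eLpNorm_le (j := j) (by omega))
        rw [← eLpNorm_comp_measurePreserving (f.jet_spec.2.2 j (by omega)).1 (Measure.measurePreserving_neg (volume : Measure ℝ))]
        refine eLpNorm_congr_norm_ae (ae_of_all _ fun s => ?_); simp [norm_smul]
      have h3 := ENNReal.toReal_mono (by rw [nsmul_eq_mul]; finiteness) h2
      rw [nsmul_eq_mul, ENNReal.toReal_mul, toReal_enorm, toReal_enorm, ENNReal.toReal_natCast] at h3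
      exact_mod_cast h3⟩

@[simp] lemma Sob.J_apply (f : Sob N k δ) (s : ℝ) : (Sob.J f).1 s = f.1 (-s) := rfl

/-! ### Pointwise bounds -/

lemma Sob.norm_sub_le (d : 0 ≤ δ) (hk1 : 1 ≤ k) (f : Sob N k δ) (x y : ℝ) : ‖f.1 y - f.1 x‖ ≤ Real.sqrt |y - x| * ‖f‖ := by
  have h0 := f.jet_spec.2.1 0 (by omega); rw [f.jet_spec.1] at h0; rw [h0.sub_eq_integral f.2.1 x y]
  have h1 : ‖∫ t in x..y, f.jet 1 t‖ₑ ≤ ENNReal.ofReal (Real.sqrt |y - x|) * ‖f‖ₑ := by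
    rw [← ofReal_norm, intervalIntegral.norm_intervalIntegral_eq, ofReal_norm]
    refine (enorm_integral_le_lintegral_enorm _).trans ?_; rw [← eLpNorm_one_eq_lintegral_enorm]
    have hm : AEStronglyMeasurable (f.jet 1) (volume.restrict (uIoc x y)) := h0.2.1.aestronglyMeasurable.restrict
    refine (eLpNorm_le_eLpNorm_mul_rpow_measure_univ (p := 1) (q := 2) (by norm_num) hm).trans ?_
    rw [mul_comm]; refine mul_le_mul' (le_of_eq ?_) ?_
    · rw [Measure.restrict_apply_univ, uIoc, Real.volume_Ioc, max_sub_min_eq_abs, Real.sqrt_eq_rpow,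
        ENNReal.ofReal_rpow_of_nonneg (abs_nonneg _) (by norm_num)]
      norm_num
    · refine (eLpNorm_mono_measure _ Measure.restrict_le_self).trans
        ((eLpNorm_mono fun s => ?_).trans (f.jet_spec.eLpNorm_le (j := 1) hk1))
      rw [norm_smul, norm_exp]; exact le_mul_of_one_le_left (norm_nonneg _) (Real.one_le_exp (by positivity))
  have h2 := ENNReal.toReal_mono (by finiteness) h1
  rwa [ENNReal.toReal_mul, toReal_enorm, toReal_enorm, ENNReal.toReal_ofReal (Real.sqrt_nonneg _)] at h2

lemma Sob.norm_apply_le (d : 0 ≤ δ) (hk1 : 1 ≤ k) (f : Sob N k δ) (s : ℝ) : ‖f.1 s‖ ≤ 2 * ‖f‖ := by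
  have h1 : ∀ x ∈ Ioc s (s + 1), ‖f.1 s‖ - ‖f‖ ≤ ‖f.1 x‖ := fun x hx => by
    have h2 := f.norm_sub_le d hk1 x s; have h3 : Real.sqrt |s - x| ≤ 1 := by
      refine Real.sqrt_le_one.2 ?_; rw [abs_le]; constructor <;> linarith [hx.1, hx.2]
    have h4 := _root_.norm_sub_norm_le (f.1 s) (f.1 x); nlinarith [norm_nonneg f]
  by_contra! hlt; have h2 : ENNReal.ofReal (‖f.1 s‖ - ‖f‖) ≤ ‖f‖ₑ := by
    have h3 : eLpNorm (fun _ : ℝ => ‖f.1 s‖ - ‖f‖) 2 (volume.restrict (Ioc s (s + 1))) ≤ ‖f‖ₑ := by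
      refine le_trans (eLpNorm_mono_ae ?_)
        ((eLpNorm_mono_measure _ Measure.restrict_le_self).trans (f.jet_spec.eLpNorm_le (j := 0) (Nat.zero_le _)))
      refine (ae_restrict_mem measurableSet_Ioc).mono fun x hx => ?_
      rw [f.jet_spec.1, norm_smul, norm_exp, Real.norm_of_nonneg (by linarith [norm_nonneg f])]
      exact (h1 x hx).trans (le_mul_of_one_le_left (norm_nonneg _) (Real.one_le_exp (by positivity)))
    rw [eLpNorm_const _ (by norm_num) (by simp)] at h3
    simp only [Measure.restrict_apply_univ, Real.volume_Ioc] at h3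
    simp only [add_sub_cancel_left, ENNReal.ofReal_one, ENNReal.one_rpow, mul_one] at h3
    rwa [← ofReal_norm, Real.norm_of_nonneg (by linarith [norm_nonneg f])] at h3
  have h3 := ENNReal.toReal_mono (by finiteness) h2
  rw [toReal_enorm, ENNReal.toReal_ofReal (by linarith [norm_nonneg f])] at h3; linarith

/-- Evaluation at `s`. -/
def Sob.ev (d : 0 ≤ δ) (hk1 : 1 ≤ k) (s : ℝ) : Sob N k δ →L[ℝ] Vec N :=
  LinearMap.mkContinuous (Sob.eval N k δ s) 2 fun f => f.norm_apply_le d hk1 s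

end SobolevOperators

/-! ### Completeness of the weighted Sobolev spaces -/

section SobolevComplete

variable {δ δ' : ℝ}

lemma cont_integral_smul_Lp {ζ : ℝ → ℝ} (hζ : Continuous ζ) (hc : HasCompactSupport ζ) :
    Continuous fun w : 𝓛 => ∫ s, ζ s • w s := by
  have hm : MemLp ζ 2 volume := hζ.memLp_of_hasCompactSupport hc
  refine (((ContinuousLinearMap.lsmul ℝ ℝ).lpPairing volume 2 2 (hm.toLp ζ)).continuous).congr fun w => ?_; rw [ContinuousLinearMap.lpPairing_eq_integral]
  refine integral_congr_ae ?_; filter_upwards [hm.coeFn_toLp] with s hs; simp [hs]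

lemma cont_exp_abs (δ : ℝ) : Continuous fun s : ℝ => exp (δ * |s|) := by fun_prop

lemma locallyIntegrable_of_memLp (h : MemLp (fun s => exp (δ * |s|) • g s) 2 volume) :
    LocallyIntegrable g := by
  have h1 := h.locallyIntegrable (by norm_num)
  have h2 : g = fun s => exp (-δ * |s|) • (exp (δ * |s|) • g s) := by
    funext s; rw [smul_smul, ← Real.exp_add]; simp
  rw [h2, ← locallyIntegrableOn_univ]; rw [← locallyIntegrableOn_univ] at h1
  exact h1.continuousOn_smul isOpen_univ.isLocallyClosed (cont_exp_abs (-δ)).continuousOn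

lemma Sob.mem_range_toL2 (hk1 : 1 ≤ k) {w : PiLp 2 (fun _ : Fin (k + 1) => 𝓛)}
    (hw : ∀ j : Fin k, ∀ η : ℝ → ℝ, ContDiff ℝ ∞ η → HasCompactSupport η →
      ∫ s, (deriv η s * exp (-δ * |s|)) • w j.castSucc s = - ∫ s, (η s * exp (-δ * |s|)) • w j.succ s) :
    w ∈ range (Sob.toL2 N k δ) := by
  let G : ℕ → Φ := fun j s =>
    if h : j < k + 1 then exp (-δ * |s|) • w ⟨j, h⟩ s else 0
  have hG : ∀ j (h : j < k + 1), (fun s => exp (δ * |s|) • G j s) = w ⟨j, h⟩ := fun j h => by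
    funext s; simp only [G, dif_pos h, smul_smul, ← Real.exp_add]; simp
  have hm : ∀ j (h : j < k + 1), MemLp (fun s => exp (δ * |s|) • G j s) 2 volume := fun j h => by
    rw [hG j h]; exact Lp.memLp _
  have hd : ∀ j < k, IsWeakDeriv (G j) (G (j + 1)) := fun j hj => by
    refine ⟨locallyIntegrable_of_memLp (hm j (by omega)), locallyIntegrable_of_memLp (hm (j + 1) (by omega)), fun η hη hc => ?_⟩
    have := hw ⟨j, hj⟩ η hη hc
    simp only [G, dif_pos (show j < k + 1 by omega), dif_pos (show j + 1 < k + 1 by omega), smul_smul]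
    exact this
  obtain ⟨c, hc⟩ := (hd 0 (by omega)).exists_primitive; set f : Φ := fun x => c + ∫ t in (0 : ℝ)..x, G 1 t with hf
  have hcont : Continuous f := continuous_const.add (intervalIntegral.continuous_primitive (fun a b =>
      ((hd 0 (by omega)).2.1.integrableOn_isCompact isCompact_uIcc).intervalIntegrable) 0)
  let G' : ℕ → Φ := fun j => match j with
    | 0 => f
    | j + 1 => G (j + 1)
  have hGG : ∀ j, G j =ᵐ[volume] G' j := fun j => by
    cases j with
    | zero => exact hc
    | succ j => exact ae_eq_refl _
  have hjet : IsSobolevJet k δ f G' := ⟨rfl, fun j hj => (hd j hj).congr_ae (hGG j) (hGG (j + 1)),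
    fun j hj => (hm j (by omega)).ae_eq ((hGG j).mono fun s hs => by simp only [hs])⟩
  let F : Sob N k δ := ⟨f, hcont, G', hjet⟩; refine ⟨F, ?_⟩
  ext1 j
  refine Lp.ext ?_; have h1 : (Sob.toL2 N k δ F) j = (F.memLp_jet j).toLp _ := rfl; rw [h1]
  filter_upwards [(F.memLp_jet j).coeFn_toLp, F.jet_spec.unique hjet j (by omega), hGG j] with s h2 h3 h4
  rw [h2, h3, ← h4]; exact congrFun (hG j j.2) s

lemma Sob.isClosed_range_toL2 (hk1 : 1 ≤ k) : IsClosed (range (Sob.toL2 N k δ)) := by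
  have : range (Sob.toL2 N k δ) = {w | ∀ j : Fin k, ∀ η : ℝ → ℝ, ContDiff ℝ ∞ η → HasCompactSupport η →
      ∫ s, (deriv η s * exp (-δ * |s|)) • w j.castSucc s = - ∫ s, (η s * exp (-δ * |s|)) • w j.succ s} := by
    refine Subset.antisymm ?_ fun w hw => Sob.mem_range_toL2 hk1 hw; rintro _ ⟨F, rfl⟩ j η hη hc
    have h1 := (F.jet_spec.2.1 j j.2).2.2 η hη hc
    have h2 : ∀ (i : Fin (k + 1)) (ζ : ℝ → ℝ), ∫ s, (ζ s * exp (-δ * |s|)) • (Sob.toL2 N k δ F) i s =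
        ∫ s, ζ s • F.jet i s := fun i ζ => by
      refine integral_congr_ae ?_; filter_upwards [(F.memLp_jet i).coeFn_toLp] with s hs
      have h3 : (Sob.toL2 N k δ F) i s = exp (δ * |s|) • F.jet i s := hs
      rw [h3, smul_smul, mul_assoc, ← Real.exp_add]; simp
    rw [h2, h2]; exact h1
  rw [this]; simp only [ofPred_forall]
  refine isClosed_iInter fun j => isClosed_iInter fun η => isClosed_iInter fun hη => isClosed_iInter fun hc => ?_
  refine isClosed_eq ?_ ?_
  · exact (cont_integral_smul_Lp (((hη.continuous_deriv (by simp))).mul (cont_exp_abs (-δ)))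
      hc.deriv.mul_right).comp (PiLp.continuous_apply 2 _ j.castSucc)
  · exact ((cont_integral_smul_Lp (hη.continuous.mul (cont_exp_abs (-δ))) hc.mul_right).comp (PiLp.continuous_apply 2 _ j.succ)).neg

lemma Sob.isometry_toL2 : Isometry (Sob.toL2 N k δ) := AddMonoidHomClass.isometry_of_norm _ fun _ => rfl

lemma Sob.completeSpace (hk1 : 1 ≤ k) : CompleteSpace (Sob N k δ) := by
  rw [completeSpace_iff_isComplete_range Sob.isometry_toL2.isUniformInducing]
  exact (Sob.isClosed_range_toL2 hk1).isComplete

instance : SecondCountableTopology (Sob N k δ) := by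
  have : Fact ((2 : ℝ≥0∞) ≠ ⊤) := ⟨by simp⟩; have h : SecondCountableTopology 𝓛 := inferInstance
  exact (Sob.isometry_toL2 (N := N) (k := k) (δ := δ)).isEmbedding.isInducing.secondCountableTopology

/-! ### Time shifts -/

lemma mulJet_const (c : ℝ) (g : ℕ → Φ) (j : ℕ) : mulJet (fun _ => c) g j = fun s => c • g j s := by
  induction j generalizing g c with
  | zero => rfl
  | succ j ih => simp only [mulJet, deriv_const']; rw [ih, ih]; funext s; simp

/-- The shift `f ↦ f(· + t)`. -/
def Sob.S (hk1 : 1 ≤ k) (t : ℝ) : Sob N k δ →L[ℝ] Sob N k δ := Sob.ms (CutFn.const 1) t hk1 le_rfl le_rfl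

@[simp] lemma Sob.S_apply (hk1 : 1 ≤ k) (t : ℝ) (f : Sob N k δ) (s : ℝ) : (Sob.S hk1 t f).1 s = f.1 (s + t) := one_smul ℝ _

lemma Real.abs_exp_sub_one_le_exp_abs (x : ℝ) : |exp x - 1| ≤ exp |x| - 1 := by
  rcases le_or_gt 0 x with h | h
  · rw [abs_of_nonneg h, abs_of_nonneg (by linarith [Real.one_le_exp h])]
  · rw [abs_of_neg h, abs_of_nonpos (by linarith [Real.exp_le_one_iff.2 h.le])]
    have h1 := Real.add_one_le_exp x; have h2 : exp x * exp (-x) = 1 := by rw [← Real.exp_add]; simp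
    nlinarith [Real.exp_pos (-x), sq_nonneg (exp x - 1)]

lemma tendsto_eLpNorm_shift_sub {G : Φ} (hG : MemLp G 2 volume) :
    Tendsto (fun t : ℝ => eLpNorm (fun s => G (s + t) - G s) 2 volume) (𝓝 0) (𝓝 0) := by
  let c : C(ℝ × ℝ, ℝ) := ⟨fun p => p.2 + p.1, by fun_prop⟩
  have hmp : ∀ t : ℝ, MeasurePreserving (c.curry t) _ volume := fun t =>
    measurePreserving_add_right volume t
  have h1 : Continuous fun t : ℝ => Lp.compMeasurePreserving (c.curry t) (hmp t) (hG.toLp G) :=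
    Continuous.compMeasurePreservingLp continuous_const c.curry.continuous hmp (by norm_num)
  have h2 := (tendsto_iff_edist_tendsto_0.1 (h1.tendsto 0)); refine h2.congr fun t => ?_
  have e1 := fun t => Lp.toLp_compMeasurePreserving hG (hmp t)
  rw [e1, e1, Lp.edist_toLp_toLp]; refine congrArg (fun F => eLpNorm F 2 volume) ?_; funext s; simp [c]

lemma Sob.tendsto_S (hk1 : 1 ≤ k) (f : Sob N k δ) : Tendsto (fun t => Sob.S hk1 t f) (𝓝 0) (𝓝 f) := by
  rw [tendsto_iff_edist_tendsto_0]
  have hjet : ∀ t, IsSobolevJet k δ (Sob.S hk1 t f - f).1 (fun j s => f.jet j (s + t) - f.jet j s) := by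
    intro t; have h1 : IsSobolevJet k δ (fun s => f.1 (s + t)) (fun j s => f.jet j (s + t)) := by
      have h2 : IsSobolevJet k δ (fun s => (CutFn.const 1).toFun s • f.1 (s + t)) _ :=
        IsSobolevJet.mulShift (CutFn.const 1).smooth le_rfl hk1 (fun _ hi s => (CutFn.const 1).le_bd hi s) (L := 0)
          fun s _ _ _ => ⟨mul_abs_le_add le_rfl t s, abs_nonneg _⟩
      have h3 : ∀ j, mulJet (CutFn.const 1).toFun (fun i s => f.jet i (s + t)) j = fun s => f.jet j (s + t) :=
        fun j => (mulJet_const 1 _ j).trans (funext fun s => one_smul ℝ _)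
      rw [funext h3] at h2; simpa [CutFn.const] using h2
    have h2 := h1.add (f.jet_spec.const_smul (-1))
    have e1 : ((fun s => f.1 (s + t)) + (-1 : ℝ) • f.1) = (Sob.S hk1 t f - f).1 := by
      funext s; change f.1 (s + t) + (-1 : ℝ) • f.1 s = (Sob.S hk1 t f).1 s - f.1 s; simp [sub_eq_add_neg]
    rw [← e1]; convert! h2 using 3; simp [sub_eq_add_neg]
  have hz : Tendsto (fun t : ℝ => ∑ j ∈ Finset.range (k + 1), (ENNReal.ofReal (exp (|δ| * |t|) - 1) * ‖f‖ₑ +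
      eLpNorm (fun s => exp (δ * |s + t|) • f.jet j (s + t) - exp (δ * |s|) • f.jet j s) 2 volume))
      (𝓝 0) (𝓝 0) := by
    have h5 : Tendsto (fun t : ℝ => ENNReal.ofReal (exp (|δ| * |t|) - 1) * ‖f‖ₑ) (𝓝 0) (𝓝 0) := by
      have h3 : Continuous fun t : ℝ => exp (|δ| * |t|) - 1 := by fun_prop
      have h4 := ENNReal.Tendsto.mul_const (b := ‖f‖ₑ) (ENNReal.tendsto_ofReal (h3.tendsto 0)) (Or.inr (by simp))
      simpa using h4
    have h6 : ∀ j ∈ Finset.range (k + 1), Tendsto (fun t : ℝ =>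
        eLpNorm _ 2 volume)
        (𝓝 0) (𝓝 0) := fun j hj => by
      have hj' : j ≤ k := by rw [Finset.mem_range] at hj; omega
      exact tendsto_eLpNorm_shift_sub (f.jet_spec.2.2 j hj')
    have h7 := tendsto_finsetSum (Finset.range (k + 1)) fun j hj => h5.add (h6 j hj)
    rwa [add_zero, Finset.sum_const_zero] at h7
  refine tendsto_of_tendsto_of_tendsto_of_le_of_le tendsto_const_nhds hz (fun _ => zero_le) fun t => ?_
  rw [edist_eq_enorm_sub]; refine (hjet t).le_eLpNorm.trans (Finset.sum_le_sum fun j hj => ?_)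
  have hj' : j ≤ k := by rw [Finset.mem_range] at hj; omega
  have hm := f.jet_spec.2.2 j hj'
  have hmt := hm.comp_measurePreserving (measurePreserving_add_right (volume : Measure ℝ) t)
  have e2 : (fun s => exp (δ * |s|) • (f.jet j (s + t) - f.jet j s)) =
      (fun s => (exp (δ * |s| - δ * |s + t|) - 1) • (exp (δ * |s + t|) • f.jet j (s + t))) +
      fun s => exp (δ * |s + t|) • f.jet j (s + t) - exp (δ * |s|) • f.jet j s := by
    funext s; have h : exp (δ * |s|) = exp (δ * |s| - δ * |s + t|) * exp (δ * |s + t|) := by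
      rw [← Real.exp_add, sub_add_cancel]
    simp only [Pi.add_apply]; rw [h]; module
  rw [e2]; have hcc : Continuous fun s : ℝ => exp (δ * |s| - δ * |s + t|) - 1 := by fun_prop
  refine (eLpNorm_add_le (hcc.aestronglyMeasurable.smul hmt.1) (hmt.1.sub hm.1) (by norm_num)).trans (add_le_add ?_ le_rfl)
  refine (eLpNorm_le_mul_eLpNorm_of_ae_le_mul (c := exp (|δ| * |t|) - 1)
    (g := (fun s => exp (δ * |s|) • f.jet j s) ∘ fun x => x + t) (ae_of_all _ fun s => ?_) 2).trans ?_
  · change ‖(exp (δ * |s| - δ * |s + t|) - 1) • (exp (δ * |s + t|) • f.jet j (s + t))‖ ≤ _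
    rw [norm_smul]; refine mul_le_mul_of_nonneg_right ?_ (norm_nonneg _)
    refine (Real.abs_exp_sub_one_le_exp_abs _).trans (sub_le_sub_right (Real.exp_le_exp.2 ?_) 1)
    rw [← mul_sub, abs_mul]; refine mul_le_mul_of_nonneg_left ?_ (abs_nonneg _)
    simpa using abs_abs_sub_abs_le_abs_sub s (s + t)
  · rw [eLpNorm_comp_measurePreserving hm.1 (measurePreserving_add_right (volume : Measure ℝ) t)]
    gcongr; exact f.jet_spec.eLpNorm_le hj'

lemma Sob.S_add (hk1 : 1 ≤ k) (t t' : ℝ) (f : Sob N k δ) : Sob.S hk1 (t + t') f = Sob.S hk1 t (Sob.S hk1 t' f) :=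
  Sob.ext fun s => by simp [add_assoc]

lemma Sob.norm_S_le (hk1 : 1 ≤ k) : ∃ C, 0 ≤ C ∧ ∀ (t : ℝ) (f : Sob N k δ), ‖Sob.S hk1 t f‖ ≤ C * exp (|δ| * |t|) * ‖f‖ := by
  refine ⟨(k + 1) * ((CutFn.const 1).bd k * 2 ^ k) * (k + 1), ?_, fun t f => ?_⟩
  · have := (CutFn.const 1).bd_nonneg k; positivity
  · refine (Sob.norm_ms_le _ t hk1 le_rfl le_rfl f (fun _ hi s => (CutFn.const 1).le_bd hi s)
      (L := 0) fun s _ _ _ => ⟨mul_abs_le_add le_rfl t s, abs_nonneg _⟩).trans ?_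
    have h1 := f.tail_le 0; have h2 := (CutFn.const 1).bd_nonneg k
    calc _ ≤ (k + 1) * _ * ((k + 1) * ‖f‖) :=
          mul_le_mul_of_nonneg_left h1 (by positivity)
      _ = _ := by ring

lemma Sob.cont_S (hk1 : 1 ≤ k) :
    Continuous fun p : ℝ × Sob N k δ => Sob.S hk1 p.1 p.2 := by
  obtain ⟨C, hC, hS⟩ := Sob.norm_S_le (N := N) (δ := δ) hk1; rw [continuous_iff_continuousAt]
  rintro ⟨t, f⟩; rw [ContinuousAt, tendsto_iff_norm_sub_tendsto_zero]
  have h1 : Tendsto (fun p : ℝ × Sob N k δ => C * exp (|δ| * |p.1|) * ‖p.2 - f‖ +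
      ‖Sob.S hk1 t (Sob.S hk1 (p.1 - t) f) - Sob.S hk1 t f‖) (𝓝 (t, f)) (𝓝 0) := by
    rw [← add_zero (0 : ℝ)]; refine Tendsto.add ?_ ?_
    · have : Continuous fun p : ℝ × Sob N k δ => C * exp (|δ| * |p.1|) * ‖p.2 - f‖ := by fun_prop
      simpa using this.tendsto (t, f)
    · have h2 : Tendsto (fun p : ℝ × Sob N k δ => p.1 - t) (𝓝 (t, f)) (𝓝 0) := by
        have : Continuous fun p : ℝ × Sob N k δ => p.1 - t := by fun_prop
        simpa using this.tendsto (t, f)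
      have h4 := ((((Sob.S hk1 t).continuous.tendsto f).comp ((Sob.tendsto_S hk1 f).comp h2)).sub_const (Sob.S hk1 t f)).norm; simpa using h4
  refine squeeze_zero (fun _ => norm_nonneg _) (fun p => ?_) h1
  have e1 : Sob.S hk1 t (Sob.S hk1 (p.1 - t) f) = Sob.S hk1 p.1 f := by
    rw [← Sob.S_add, add_sub_cancel]
  rw [e1]
  calc ‖Sob.S hk1 p.1 p.2 - Sob.S hk1 t f‖
      = ‖Sob.S hk1 p.1 (p.2 - f) + _‖ := by simp
    _ ≤ _ := (norm_add_le _ _).trans (add_le_add (hS _ _) le_rfl)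

end SobolevComplete

/-! ### Smooth functions with compact support are dense -/

section SobolevDense

variable {δ δ' : ℝ}

lemma isSobolevJet_iterDeriv {f : Φ} (hf : ContDiff ℝ ∞ f) (hc : HasCompactSupport f) :
    IsSobolevJet k δ f (fun j => iteratedDeriv j f) := by
  have hcs : ∀ j, HasCompactSupport (iteratedDeriv j f) := fun j => by
    induction j with
    | zero => simpa using hc
    | succ j ih => rw [iteratedDeriv_succ]; exact ih.deriv
  refine ⟨iteratedDeriv_zero, fun j _ => ?_, fun j _ => ?_⟩
  · have h1 := isWeakDeriv_of_contDiff (hf.iterate_deriv j |>.of_le (by simp))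
    simp only [iteratedDeriv_succ, iteratedDeriv_eq_iterate] at h1 ⊢; exact h1
  · have h1 : Continuous (iteratedDeriv j f) := hf.continuous_iteratedDeriv j (by exact_mod_cast le_top)
    exact ((cont_exp_abs δ).smul h1).memLp_of_hasCompactSupport (hcs j).smul_left

lemma mem_sobolev_of_compactSupp {f : Φ} (hf : ContDiff ℝ ∞ f) (hc : HasCompactSupport f) :
    f ∈ sobolev N k δ := ⟨hf.continuous, _, isSobolevJet_iterDeriv hf hc⟩

/-- A smooth function with values in `[0,1]`, equal to `0` on `(-∞,-1]` and to `1` on `[1,∞)`. -/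
def stepFn : CutFn where
  toFun s := Real.smoothTransition ((s + 1) / 2)
  smooth := Real.smoothTransition.contDiff.comp (by fun_prop)
  lo := 0
  hi := 1
  eq_lo_hi := ⟨1, zero_le_one, fun s hs => Real.smoothTransition.zero_of_nonpos (by linarith),
    fun s hs => Real.smoothTransition.one_of_one_le (by linarith)⟩

lemma stepFn_eq_zero (h : s ≤ -1) : stepFn.toFun s = 0 := Real.smoothTransition.zero_of_nonpos (by linarith)

lemma stepFn_eq_one (h : 1 ≤ s) : stepFn.toFun s = 1 := Real.smoothTransition.one_of_one_le (by linarith)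

lemma Sob.tendsto_cutRight (hk1 : 1 ≤ k) (f : Sob N k δ) :
    Tendsto (fun L : ℝ => Sob.ms (stepFn.shift L) 0 hk1 le_rfl le_rfl f) atTop (𝓝 0) := by
  rw [tendsto_zero_iff_norm_tendsto_zero]
  have h1 : Tendsto (fun L : ℝ => (k + 1) * (stepFn.bd k * 2 ^ k * exp 0) * f.tail (L - stepFn.rad)) atTop (𝓝 0) := by
    have h2 := (f.tendsto_tail.comp (tendsto_atTop_add_const_right atTop (-stepFn.rad) tendsto_id)).const_mul
      ((k + 1 : ℝ) * (stepFn.bd k * 2 ^ k * exp 0))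
    rw [mul_zero] at h2; exact h2
  refine squeeze_zero (fun _ => norm_nonneg _) (fun L => ?_) h1
  refine Sob.norm_ms_le _ 0 hk1 le_rfl le_rfl f (fun i hi s => ?_) fun s i hi hs => ⟨by simp, ?_⟩
  · rw [CutFn.iterDeriv_shift]; exact stepFn.le_bd hi _
  · rw [CutFn.iterDeriv_shift] at hs; have := stepFn.neg_rad_le rfl hs; rw [add_zero]
    linarith [le_abs_self s]

lemma Sob.norm_J_J (f : Sob N k δ) : Sob.J (Sob.J f) = f := Sob.ext fun s => by simp

lemma Sob.tendsto_apply_atTop (d : 0 ≤ δ) (hk1 : 1 ≤ k) (f : Sob N k δ) : Tendsto f.1 atTop (𝓝 0) := by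
  rw [tendsto_zero_iff_norm_tendsto_zero]; have h1 := (tendsto_zero_iff_norm_tendsto_zero.1
    ((f.tendsto_cutRight hk1).comp (tendsto_atTop_add_const_right atTop (-1 : ℝ) tendsto_id))).const_mul 2
  rw [mul_zero] at h1; refine squeeze_zero (fun _ => norm_nonneg _) (fun s => ?_) h1
  refine le_trans (le_of_eq ?_) (Sob.norm_apply_le d hk1 _ s)
  change _ = ‖stepFn.toFun (s - (s + -1)) • f.1 (s + 0)‖; rw [stepFn_eq_one (by linarith), one_smul, add_zero]

lemma Sob.tendsto_apply_atBot (d : 0 ≤ δ) (hk1 : 1 ≤ k) (f : Sob N k δ) : Tendsto f.1 atBot (𝓝 0) := by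
  have h := ((Sob.J f).tendsto_apply_atTop d hk1).comp tendsto_neg_atBot_atTop
  refine h.congr fun s => ?_; simp

lemma Sob.mem_closure_compactSupp (hk1 : 1 ≤ k) (f : Sob N k δ) : f ∈ closure {g : Sob N k δ | HasCompactSupport g.1} := by
  let F : ℝ → Sob N k δ := fun L => f - Sob.ms (stepFn.shift L) 0 hk1 le_rfl le_rfl f
  have hF : Tendsto F atTop (𝓝 f) := by
    simpa using (f.tendsto_cutRight hk1).const_sub f
  have hF' : ∀ L, ∀ s, L + 1 ≤ s → (F L).1 s = 0 := fun L s hs => by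
    change f.1 s - stepFn.toFun (s - L) • f.1 (s + 0) = 0
    rw [stepFn_eq_one (by linarith), one_smul, add_zero, sub_self]
  refine isClosed_closure.mem_of_tendsto hF (Eventually.of_forall fun L => ?_)
  let G : ℝ → Sob N k δ := fun L' => F L - Sob.J (Sob.ms (stepFn.shift L') 0 hk1 le_rfl le_rfl (Sob.J (F L)))
  have hG : Tendsto G atTop (𝓝 (F L)) := by
    have := ((Sob.J (N := N) (k := k) (δ := δ)).continuous.tendsto 0).comp ((Sob.J (F L)).tendsto_cutRight hk1)
    rw [map_zero] at this; simpa using this.const_sub (F L)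
  refine mem_closure_of_tendsto hG (Eventually.of_forall fun L' => ?_)
  refine HasCompactSupport.intro (isCompact_Icc (a := -(L' + 1)) (b := L + 1)) fun s hs => ?_
  change (F L).1 s - stepFn.toFun (-s - L') • (F L).1 (-(-s + 0)) = 0; rw [add_zero, neg_neg]
  rw [mem_Icc, not_and_or, not_le, not_le] at hs; rcases hs with hs | hs
  · rw [stepFn_eq_one (by linarith), one_smul, sub_self]
  · rw [hF' L s hs.le]; simp

open scoped Convolution in
lemma Sob.mem_closure_smooth (d : 0 ≤ δ) (hk1 : 1 ≤ k) (f : Sob N k δ) :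
    f ∈ closure {g : Sob N k δ | ContDiff ℝ ∞ g.1 ∧ HasCompactSupport g.1} := by
  have hcl : {g : Sob N k δ | HasCompactSupport g.1} ⊆ closure {g : Sob N k δ | ContDiff ℝ ∞ g.1 ∧ HasCompactSupport g.1} := by
    intro f hf; have := Sob.completeSpace (N := N) (k := k) (δ := δ) hk1
    rw [Metric.mem_closure_iff]; intro ε hε
    obtain ⟨ρ, hρ, hb⟩ := Metric.tendsto_nhds_nhds.1 (f.tendsto_S hk1) (ε / 2) (half_pos hε)
    let ψ : ContDiffBump (0 : ℝ) := ⟨ρ / 4, ρ / 2, by positivity, by linarith⟩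
    have hc : Continuous fun t : ℝ => ψ.normed volume t • Sob.S hk1 (-t) f :=
      (ψ.continuous_normed).smul ((Sob.cont_S hk1).comp (by fun_prop : Continuous fun t : ℝ => (-t, f)))
    have hi : Integrable fun t : ℝ => ψ.normed volume t • Sob.S hk1 (-t) f :=
      hc.integrable_of_hasCompactSupport ψ.hasCompactSupport_normed.smul_right
    let g : Sob N k δ := ∫ t, ψ.normed volume t • Sob.S hk1 (-t) f
    have hg : g.1 = (ψ.normed volume ⋆[ContinuousLinearMap.lsmul ℝ ℝ, volume] f.1) := by
      funext s; have h1 := (Sob.ev (N := N) (k := k) d hk1 s).integral_comp_comm hi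
      refine Eq.trans h1.symm (integral_congr_ae (ae_of_all _ fun t => ?_))
      change ψ.normed volume t • (Sob.S hk1 (-t) f).1 s = ψ.normed volume t • f.1 (s - t)
      rw [Sob.S_apply, sub_eq_add_neg]
    refine ⟨g, ⟨?_, ?_⟩, ?_⟩
    · rw [hg]
      exact ψ.hasCompactSupport_normed.contDiff_convolution_left _ ψ.contDiff_normed f.2.1.locallyIntegrable
    · rw [hg]; exact ψ.hasCompactSupport_normed.convolution _ hf
    · have h2 : f - g = ∫ t, ψ.normed volume t • (f - Sob.S hk1 (-t) f) := by
        simp only [smul_sub]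
        rw [integral_sub (ψ.integrable_normed.smul_const f) hi, integral_smul_const, ψ.integral_normed, one_smul]
      rw [dist_eq_norm, h2]
      have h3 : ∀ t, ‖ψ.normed volume t • (f - Sob.S hk1 (-t) f)‖ ≤ ψ.normed volume t * (ε / 2) := fun t => by
        rw [norm_smul, Real.norm_of_nonneg (ψ.nonneg_normed t)]
        by_cases ht : ψ.normed volume t = 0
        · simp [ht]
        · have h4 : t ∈ Metric.ball (0 : ℝ) (ρ / 2) := by
            rw [← show ψ.rOut = ρ / 2 from rfl, ← ψ.support_normed_eq (μ := volume)]; exact ht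
          rw [mem_ball_zero_iff] at h4; have h5 := hb (x := -t) (by rw [dist_zero_right, norm_neg]; linarith)
          rw [dist_comm, dist_eq_norm] at h5; exact mul_le_mul_of_nonneg_left h5.le (ψ.nonneg_normed t)
      refine lt_of_le_of_lt (norm_integral_le_of_norm_le (ψ.integrable_normed.mul_const _) (ae_of_all _ h3)) ?_
      rw [integral_mul_const, ψ.integral_normed]; linarith
  exact closure_minimal hcl isClosed_closure (f.mem_closure_compactSupp hk1)

end SobolevDense

/-! ### Compactness of inclusions -/

section SobolevCompact

variable {δ δ' : ℝ}

/-- The general inclusion of weighted Sobolev spaces. -/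
def Sob.inc (hk1 : 1 ≤ k) (hk : k ≤ k') (d : δ ≤ δ') : Sob N k' δ' →L[ℝ] Sob N k δ := Sob.ms (CutFn.const 1) 0 hk1 hk d

@[simp] lemma Sob.inc_apply (hk1 : 1 ≤ k) (hk : k ≤ k') (d : δ ≤ δ') (f : Sob N k' δ') : (Sob.inc hk1 hk d f).1 = f.1 := by
  funext s; change 1 • f.1 _ = f.1 s; rw [one_smul, add_zero]

/-- `f ↦ exp (δ |s|) f^{(j)}`. -/
def Sob.toLpL (j : Fin (k + 1)) : Sob N k δ →L[ℝ] 𝓛 := (PiLp.proj 2 (fun _ : Fin (k + 1) => 𝓛) j : _ →L[ℝ] _).comp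
    ((Sob.toL2 N k δ).mkContinuous 1 fun f => by rw [one_mul]; exact le_rfl)

lemma Sob.coeFn_toLpL_zero (f : Sob N k δ) : Sob.toLpL 0 f =ᵐ[volume] fun s => exp (δ * |s|) • f.1 s := by
  filter_upwards [(f.memLp_jet 0).coeFn_toLp] with s hs
  exact hs.trans (congrArg (fun g : Φ => exp _ • g s) f.jet_spec.1)

lemma compactOp_of_norm_le {E F : Type*} [NormedAddCommGroup E] [NormedSpace ℝ E] [NormedAddCommGroup F] [NormedSpace ℝ F]
    [CompleteSpace F] (A : E →L[ℝ] F) (h : ∀ ε > 0, ∃ (t : Finset ℝ)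
      (P : E →L[ℝ] t → Vec N) (K : ℝ), 0 ≤ K ∧ ∀ v, ‖A v‖ ≤ K * ‖P v‖ + ε * ‖v‖) : IsCompactOperator A := by
  refine (isCompactOperator_iff_isCompact_closure_image_ball (A : E →ₗ[ℝ] F) one_pos).2
    ((TotallyBounded.closure (Metric.totallyBounded_iff.2 fun ε hε => ?_)).isCompact_of_isClosed isClosed_closure)
  obtain ⟨t, P, K, hK, hP⟩ := h (ε / 4) (by positivity)
  obtain ⟨y, hy, hf, hc⟩ := Metric.finite_approx_of_totallyBounded
    ((P.lipschitz.isBounded_image (Metric.isBounded_ball (x := 0) (r := 1))).isCompact_closure.totallyBounded.subset subset_closure) (ε / (2 * (K + 1))) (by positivity)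
  choose! g hg using (show ∀ z ∈ y, ∃ v ∈ Metric.ball 0 1, P v = z from hy)
  refine ⟨(A ∘ g) '' y, hf.image _, ?_⟩; rintro _ ⟨v, hv, rfl⟩
  obtain ⟨z, hz, hvz⟩ := mem_iUnion₂.1 (hc ⟨v, hv, rfl⟩); refine mem_iUnion₂.2 ⟨_, ⟨z, hz, rfl⟩, ?_⟩
  have h1 := hP (v - g z); rw [map_sub, map_sub, (hg z hz).2, ← dist_eq_norm, ← dist_eq_norm] at h1
  have h2 := mem_ball_zero_iff.1 (hg z hz).1; have h3 := norm_sub_le v (g z)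
  rw [mem_ball_zero_iff] at hv; rw [Metric.mem_ball, lt_div_iff₀ (by positivity)] at hvz
  change dist (A v) (A (g z)) < ε; nlinarith [dist_nonneg (x := P v) (y := z)]

lemma Sob.compactOp_toLpL_zero (o : 0 ≤ δ) (d : δ < δ') :
    IsCompactOperator ((Sob.toLpL 0).comp (Sob.inc le_rfl le_rfl d.le) : Sob N 1 δ' →L[ℝ] 𝓛) := by
  refine compactOp_of_norm_le (N := N) _ fun ε hε => ?_
  obtain ⟨n, hn⟩ : ∃ n : ℕ, exp ((δ - δ') * n) < ε / 2 :=
    ((Real.tendsto_exp_atBot.comp (tendsto_natCast_atTop_atTop.const_mul_atTop_of_neg (by linarith))).eventually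
      (gt_mem_nhds (by positivity))).exists
  let C := exp (δ * n) * √(2 * n); have hC : 0 ≤ C := by positivity
  obtain ⟨t, -, ht, hcov⟩ := finite_cover_balls_of_compact (isCompact_Icc (a := (-n : ℝ)) (b := n))
    (e := (ε / (2 * (C + 1))) ^ 2) (by positivity)
  refine ⟨ht.toFinset, .pi fun i => Sob.ev (o.trans d.le) le_rfl i.1, C, hC, fun u => ?_⟩
  change ‖Sob.toLpL 0 (Sob.inc le_rfl le_rfl d.le u)‖ ≤ C * ‖fun i : ht.toFinset => u.1 i‖ + _
  set v := Sob.toLpL 0 (Sob.inc le_rfl le_rfl d.le u)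
  set c := ‖fun i : ht.toFinset => u.1 i‖ + ε / (2 * (C + 1)) * ‖u‖; have hc : 0 ≤ c := by positivity
  have hpt : ∀ᵐ s, ‖v s‖ ≤ ‖(Icc (-n : ℝ) n).indicator (fun _ => exp (δ * n) * c) s +
      exp ((δ - δ') * n) * ‖exp (δ' * |s|) • u.jet 0 s‖‖ := by
    filter_upwards [Sob.coeFn_toLpL_zero (Sob.inc le_rfl le_rfl d.le u)] with s h1
    rw [h1, Sob.inc_apply, u.jet_spec.1, norm_smul, norm_smul, norm_exp, norm_exp, ← mul_assoc, ← Real.exp_add]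
    refine le_trans ?_ (le_abs_self _)
    by_cases hs : s ∈ Icc (-n : ℝ) n
    · rw [indicator_of_mem hs]; obtain ⟨i, hi, hsi⟩ := mem_iUnion₂.1 (hcov hs)
      refine le_add_of_le_of_nonneg (mul_le_mul (Real.exp_le_exp.2 (mul_le_mul_of_nonneg_left (abs_le.2 hs) o)) ?_
        (norm_nonneg _) (Real.exp_pos _).le) (by positivity)
      have h2 := norm_le_pi_norm (fun i : ht.toFinset => u.1 i) ⟨i, ht.mem_toFinset.2 hi⟩
      have h3 := (u.norm_sub_le (o.trans d.le) le_rfl i s).trans (mul_le_mul_of_nonneg_right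
        (Real.sqrt_le_iff.2 ⟨by positivity, hsi.le⟩) (norm_nonneg u))
      exact (norm_le_norm_add_norm_sub' _ _).trans (add_le_add h2 h3)
    · rw [indicator_of_notMem hs, zero_add]
      refine mul_le_mul_of_nonneg_right (Real.exp_le_exp.2 ?_) (norm_nonneg _)
      have := lt_of_not_ge fun h => hs (abs_le.1 h); nlinarith
  have h1 : ‖v‖ₑ ≤ ENNReal.ofReal (exp (δ * n) * c) * ENNReal.ofReal √(2 * n) + ENNReal.ofReal (exp ((δ - δ') * n)) * ‖u‖ₑ := by
    rw [Lp.enorm_def]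
    refine (eLpNorm_mono_ae hpt).trans ((eLpNorm_add_le (aestronglyMeasurable_const.indicator measurableSet_Icc)
      ((u.jet_spec.2.2 0 (Nat.zero_le _)).1.norm.const_mul _) (by norm_num)).trans (add_le_add ?_ ?_))
    · rw [eLpNorm_indicator_const measurableSet_Icc (by norm_num) (by norm_num), Real.enorm_of_nonneg (by positivity),
        Real.volume_Icc, ENNReal.ofReal_rpow_of_nonneg (by linarith [n.cast_nonneg (α := ℝ)]) (by norm_num),
        sub_neg_eq_add, ← two_mul, ENNReal.toReal_ofNat, ← Real.sqrt_eq_rpow]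
    · refine (eLpNorm_le_mul_eLpNorm_of_ae_le_mul (c := exp ((δ - δ') * n))
        (g := fun s => exp (δ' * |s|) • u.jet 0 s) (ae_of_all _ fun s => ?_) 2).trans ?_
      · rw [norm_mul, norm_norm, norm_exp]
      · gcongr; exact u.jet_spec.eLpNorm_le (Nat.zero_le _)
  have h2 := ENNReal.toReal_mono (by finiteness) h1
  rw [ENNReal.toReal_add (by finiteness) (by finiteness), ENNReal.toReal_mul, ENNReal.toReal_mul,
    ENNReal.toReal_ofReal (by positivity), ENNReal.toReal_ofReal (by positivity),
    ENNReal.toReal_ofReal (by positivity), toReal_enorm, toReal_enorm] at h2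
  have h3 : C * (ε / (2 * (C + 1))) ≤ ε / 2 := by
    rw [mul_div_assoc', div_le_div_iff₀ (by positivity) two_pos]; nlinarith
  calc ‖v‖ ≤ C * ‖fun i : ht.toFinset => u.1 i‖ + (C * (ε / (2 * (C + 1))) + exp ((δ - δ') * n)) * ‖u‖ := h2.trans_eq (by ring)
    _ ≤ _ := by gcongr; linarith

lemma Sob.exists_iterate_D (j : ℕ) : ∀ {k' : ℕ}, j + 1 ≤ k' → ∃ T : Sob N k' δ →L[ℝ] Sob N 1 δ, ∀ f, (T f).1 =ᵐ[volume] f.jet j := by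
  induction j with
  | zero =>
    intro k' hk; refine ⟨Sob.inc le_rfl hk le_rfl, fun f => ?_⟩; rw [Sob.inc_apply, f.jet_spec.1]
  | succ j ih =>
    intro k' hk; obtain ⟨k'', rfl⟩ : ∃ k'', k' = k'' + 1 := ⟨k' - 1, by omega⟩
    obtain ⟨T, hT⟩ := ih (k' := k'') (by omega)
    refine ⟨T.comp (Sob.D (by omega) le_rfl le_rfl), fun f => ?_⟩; refine (hT _).trans ?_
    refine ((Sob.jet_spec _).unique (f.jet_deriv (by omega) le_rfl le_rfl) j (by omega)).trans ?_
    cases j with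
    | zero => exact (f.contDiff_one (by omega)).2.symm
    | succ j => exact ae_eq_refl _

lemma Sob.inc_jet (hk1 : 1 ≤ k) (hk : k ≤ k') (d : δ ≤ δ') (f : Sob N k' δ') : IsSobolevJet k δ (Sob.inc hk1 hk d f).1 f.jet := by
  have h2 : IsSobolevJet k δ (fun s => (CutFn.const 1).toFun s • f.1 _) _ :=
    IsSobolevJet.mulShift (CutFn.const 1).smooth hk hk1 (fun _ hi s => (CutFn.const 1).le_bd hi s)
      fun s _ _ _ => ⟨mul_abs_le_add d 0 s, abs_nonneg _⟩
  have h3 : mulJet (CutFn.const 1).toFun (fun i s => f.jet i (s + 0)) = f.jet :=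
    funext fun j => (mulJet_const 1 _ j).trans (funext fun s => by simp)
  rw [h3] at h2; exact h2

lemma Sob.compactOp_inc (o : 0 ≤ δ) (d : δ < δ') (hk1 : 1 ≤ k) (hk : k + 1 ≤ k') :
    IsCompactOperator (Sob.inc hk1 (by omega) d.le : Sob N k' δ' →L[ℝ] Sob N k δ) := by
  set ι : Sob N k' δ' →L[ℝ] Sob N k δ := Sob.inc hk1 (by omega) d.le with hι
  have h1 : ∀ j : Fin (k + 1), IsCompactOperator ((Sob.toLpL j).comp ι) := by
    intro j; obtain ⟨T, hT⟩ := Sob.exists_iterate_D (N := N) (δ := δ') j (k' := k') (by omega)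
    have h2 := (Sob.compactOp_toLpL_zero (N := N) o d).comp_clm T; convert! h2 using 1
    funext f; refine Lp.ext ?_
    have h3 := (ι f).jet_spec.unique (Sob.inc_jet hk1 (by omega) d.le f) j (by omega)
    filter_upwards [h3, hT f, Sob.coeFn_toLpL_zero (Sob.inc le_rfl le_rfl d.le (T f)),
      ((ι f).memLp_jet j).coeFn_toLp] with s h4 h5 h6 h7
    refine (h7.trans ?_).trans h6.symm; rw [h4, Sob.inc_apply, h5]
  choose K hK hK0 using h1
  have hc : Topology.IsClosedEmbedding (Sob.toL2 N k δ) := ⟨Sob.isometry_toL2.isEmbedding, Sob.isClosed_range_toL2 hk1⟩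
  refine ⟨Sob.toL2 N k δ ⁻¹' _, hc.isCompact_preimage
    ((isCompact_univ_pi hK).image (PiLp.continuous_toLp 2 _)), ?_⟩
  refine mem_of_superset (iInter_mem.2 hK0) fun f hf => ?_
  refine ⟨fun j => Sob.toLpL j (ι f), fun j _ => mem_iInter.1 hf j, rfl⟩

end SobolevCompact

/-! ### Scales of weighted Sobolev spaces -/

/-- Orders of differentiability and weights. -/
structure Weights where
  k : ℕ → ℕ
  δ : ℕ → ℝ
  two_le : ∀ m, 2 ≤ k m
  k_lt : ∀ m, k m + 1 ≤ k (m + 1)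
  δ_lt : ∀ m, δ m < δ (m + 1)
  δ_nonneg : ∀ m, 0 ≤ δ m

namespace Weights

def up (W : Weights) : Weights := ⟨fun m => W.k (m + 1), fun m => W.δ (m + 1), fun m => W.two_le (m + 1), fun m => W.k_lt (m + 1),
    fun m => W.δ_lt (m + 1), fun m => W.δ_nonneg (m + 1)⟩

lemma one_le (W : Weights) (m : ℕ) : 1 ≤ W.k m := one_le_two.trans (W.two_le m)

/-- The inclusions of the scale. -/
def incl (W : Weights) (N m : ℕ) : Sob N (W.k (m + 1)) (W.δ (m + 1)) →L[ℝ] 𝓗 :=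
  Sob.inc (W.one_le m) (by have := W.k_lt m; omega) (W.δ_lt m).le

lemma incl_apply (W : Weights) {m : ℕ} (f : Sob N (W.k (m + 1)) (W.δ (m + 1))) : (W.incl N m f).1 = f.1 := Sob.inc_apply _ _ _ f

/-- The scale of the spaces `H^{k_m, δ_m}`. -/
def scale (W : Weights) (N : ℕ) : ScScale where
  L m := 𝓗
  incl m := W.incl N m

end Weights

instance (W : Weights) (N : ℕ) : ScGood Θ where
  complete m := Sob.completeSpace (W.one_le m)
  injective m f g h := by
    have h1 : (W.incl N m f).1 = (W.incl N m g).1 := congrArg Subtype.val h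
    exact Subtype.ext ((W.incl_apply f).symm.trans (h1.trans (W.incl_apply g)))
  compact m := Sob.compactOp_inc (W.δ_nonneg m) (W.δ_lt m) (W.one_le m) (W.k_lt m)
  dense m := by
    intro f; refine closure_mono ?_ (Sob.mem_closure_smooth (W.δ_nonneg m) (W.one_le m) f); rintro g ⟨hg, hc⟩
    exact ⟨⟨g.1, mem_sobolev_of_compactSupp hg hc⟩, Subtype.ext (W.incl_apply _)⟩

/-! ### Families of operators depending on the gluing parameter -/

lemma tendsto_len : Tendsto ℓ (𝓝[>] 0) atTop := by
  have h1 : Tendsto (fun r : ℝ => exp (1 / r)) (𝓝[>] 0) atTop := by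
    simp only [one_div]; exact Real.tendsto_exp_atTop.comp tendsto_inv_nhdsGT_zero
  exact tendsto_atTop_add_const_right _ (-exp 1) h1

lemma hasDerivAt_len (hr : r ≠ 0) : HasDerivAt ℓ (-(exp (1 / r) / r ^ 2)) r := by
  have h1 : HasDerivAt (fun r : ℝ => 1 / r) (-(1 / r ^ 2)) r := by
    simpa [one_div] using hasDerivAt_inv hr
  have h2 := h1.exp.sub_const (exp 1); exact h2.congr_deriv (by ring)

lemma contAt_len (hr : r ≠ 0) : ContinuousAt ℓ r := (hasDerivAt_len hr).continuousAt

lemma tendsto_exp_mul_exp_neg_len (a b : ℕ) {c : ℝ} (hc : 0 < c) :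
    Tendsto (fun r : ℝ => exp (a / r) / r ^ b * exp (-(c * ℓ r))) (𝓝[>] 0) (𝓝 0) := by
  have h1 : Tendsto (fun y : ℝ => (c⁻¹) ^ (a + b) * exp (c * exp 1) * ((c * y) ^ (a + b) * exp (-(c * y)))) atTop (𝓝 0) := by
    have h2 := ((Real.tendsto_pow_mul_exp_neg_atTop_nhds_zero (a + b)).comp
      (tendsto_id.const_mul_atTop hc)).const_mul ((c⁻¹) ^ (a + b) * exp (c * exp 1))
    rw [mul_zero] at h2; exact h2
  have h3 : Tendsto (fun r : ℝ => exp (1 / r)) (𝓝[>] 0) atTop := by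
    simp only [one_div]; exact Real.tendsto_exp_atTop.comp tendsto_inv_nhdsGT_zero
  refine tendsto_of_tendsto_of_tendsto_of_le_of_le' tendsto_const_nhds (h1.comp h3) ?_ ?_
  · filter_upwards [self_mem_nhdsWithin] with r (hr : 0 < r); positivity
  · filter_upwards [self_mem_nhdsWithin] with r (hr : 0 < r); have e1 : exp (a / r) = exp (1 / r) ^ a := by
      rw [← Real.exp_nat_mul]; congr 1; ring
    have e2 : 1 / r ^ b ≤ exp (1 / r) ^ b := by
      rw [← one_div_pow]; exact pow_le_pow_left₀ (by positivity) (by linarith [Real.add_one_le_exp (1 / r)]) b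
    have e3 : exp (-(c * ℓ r)) = exp (c * exp 1) * exp (-(c * exp (1 / r))) := by
      rw [← Real.exp_add, gluingLength]; congr 1; ring
    simp only [Function.comp_apply]
    calc exp (a / r) / r ^ b * exp (-(c * ℓ r)) = exp (1 / r) ^ a * (1 / r ^ b) * exp (-(c * ℓ r)) := by rw [e1]; ring
      _ ≤ exp (1 / r) ^ a * exp (1 / r) ^ b * exp (-(c * ℓ r)) := by gcongr
      _ = _ := by
        rw [e3, mul_pow, ← pow_add]
        have : c⁻¹ ^ (a + b) * c ^ (a + b) = 1 := by rw [← mul_pow, inv_mul_cancel₀ hc.ne', one_pow]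
        linear_combination (-(exp (c * exp 1)) * exp (1 / r) ^ (a + b) * exp (-(c * exp (1 / r)))) * this

section GlueFam

variable {δ δ' : ℝ}

/-- The operator `h ↦ exp (a / r) r^(-b) χ(· - R/2) h(· - ε R)` with `R = exp (1 / r) - e`. -/
def Sob.glueMap (hk1 : 1 ≤ k) (hk : k ≤ k') (d : δ ≤ δ') (a b : ℕ) (χ : CutFn) (ε r : ℝ) : Sob N k' δ' →L[ℝ] Sob N k δ :=
  open Classical in
  if r = 0 then χ.lo • Sob.inc hk1 hk d else
    (exp (a / r) / r ^ b) • Sob.ms (χ.shift (ℓ r / 2)) (-(ε * ℓ r)) hk1 hk d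

lemma Sob.glueMap_zero (hk1 : 1 ≤ k) (hk : k ≤ k') (d : δ ≤ δ') (a b : ℕ) (χ : CutFn) (ε : ℝ)
    (f : Sob N k' δ') (s : ℝ) : (Sob.glueMap hk1 hk d a b χ ε 0 f).1 s = χ.lo • f.1 s := by
  rw [Sob.glueMap, if_pos rfl]; exact congrArg (fun g : Φ => χ.lo • g s) (Sob.inc_apply hk1 hk d f)

lemma Sob.glueMap_pos (hk1 : 1 ≤ k) (hk : k ≤ k') (d : δ ≤ δ') (a b : ℕ) (χ : CutFn) (ε : ℝ)
    (hr : r ≠ 0) (f : Sob N k' δ') (s : ℝ) : (Sob.glueMap hk1 hk d a b χ ε r f).1 s =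
      (exp (a / r) / r ^ b) • (χ (s - ℓ r / 2) • f.1 (s - ε * ℓ r)) := by
  rw [Sob.glueMap, if_neg hr, sub_eq_add_neg s (ε * _)]
  rfl

/-- The conditions under which the families are continuous at `r = 0`. -/
def GlueOK (δ δ' : ℝ) (a b : ℕ) (χ : CutFn) (ε : ℝ) : Prop := (a = 0 ∧ b = 0 ∧ ε = 0) ∨
    (χ.lo = 0 ∧ χ.hi = 0 ∧ (ε = 0 ∨ ε = 1) ∧ ((a = 0 ∧ b = 0) ∨ δ < δ'))

lemma Sob.exists_glueMap_bound (hk1 : 1 ≤ k) (hk : k ≤ k') (o : 0 ≤ δ) (d : δ ≤ δ') {a b : ℕ} {χ : CutFn}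
    (hok : GlueOK δ δ' a b χ ε) : ∃ C M : ℝ, 0 ≤ C ∧ ∀ᶠ r in 𝓝[>] 0, ∀ f : Sob N k' δ',
      ‖Sob.glueMap hk1 hk d a b χ ε r f - Sob.glueMap hk1 hk d a b χ ε 0 f‖ ≤ C * f.tail (ℓ r / 2 - M) := by
  rcases hok with ⟨rfl, rfl, rfl⟩ | ⟨hlo, hhi, hε, hab⟩
  · let χ' := χ.sub (CutFn.const χ.lo); have hlo' : χ'.lo = 0 := sub_self _
    refine ⟨(k + 1) * (χ'.bd k * 2 ^ k * exp 0), χ'.rad, ?_, ?_⟩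
    · have := χ'.bd_nonneg k; positivity
    filter_upwards [self_mem_nhdsWithin] with r (hr : 0 < r) f
    have e1 : Sob.glueMap hk1 hk d 0 0 χ 0 r f - Sob.glueMap hk1 hk d 0 0 χ 0 0 f =
        Sob.ms (χ'.shift (ℓ r / 2)) 0 hk1 hk d f := Sob.ext fun s => by
      change (Sob.glueMap hk1 hk d 0 0 χ 0 r f).1 s - (Sob.glueMap hk1 hk d 0 0 χ 0 0 f).1 s = (χ (s - ℓ r / 2) - χ.lo) • f.1 (s + 0)
      rw [Sob.glueMap_pos _ _ _ _ _ _ _ hr.ne', Sob.glueMap_zero]; simp [sub_smul]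
    rw [e1]; refine Sob.norm_ms_le _ _ _ _ _ _ (fun i hi s => ?_) fun s i hi hs => ⟨?_, ?_⟩
    · rw [CutFn.iterDeriv_shift]; exact χ'.le_bd hi _
    · rw [add_zero, add_zero]; exact mul_le_mul_of_nonneg_right d (abs_nonneg _)
    · rw [CutFn.iterDeriv_shift] at hs; have := χ'.neg_rad_le hlo' hs; rw [add_zero]; linarith [le_abs_self s]
  · obtain ⟨C, hC, hb⟩ : ∃ C : ℝ, 0 ≤ C ∧ ∀ᶠ r in 𝓝[>] 0, exp (a / r) / r ^ b * exp (-((δ' - δ) / 2 * ℓ r)) ≤ C := by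
      rcases hab with ⟨rfl, rfl⟩ | hlt
      · refine ⟨1, zero_le_one, ?_⟩; filter_upwards [tendsto_len.eventually (eventually_ge_atTop 0)] with r hr
        simp only [Nat.cast_zero, zero_div, Real.exp_zero, pow_zero, div_one, one_mul]
        refine Real.exp_le_one_iff.2 ?_
        have : 0 ≤ (δ' - δ) / 2 * ℓ r := mul_nonneg (by linarith) hr; linarith
      · refine ⟨1, zero_le_one, ?_⟩
        filter_upwards [(tendsto_exp_mul_exp_neg_len a b (c := (δ' - δ) / 2) (by linarith)).eventually
          (gt_mem_nhds zero_lt_one)] with r hr using hr.le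
    refine ⟨C * ((k + 1) * (χ.bd k * 2 ^ k * exp ((δ + δ') * χ.rad))), χ.rad, ?_, ?_⟩
    · have := χ.bd_nonneg k; positivity
    filter_upwards [self_mem_nhdsWithin, hb, tendsto_len.eventually (eventually_ge_atTop (2 * χ.rad))] with r (hr : 0 < r) hbr hR f
    have hrad := χ.rad_nonneg; have e0 : Sob.glueMap hk1 hk d a b χ ε 0 f = 0 := Sob.ext fun s => by
      rw [Sob.glueMap_zero, hlo, zero_smul]; rfl
    rw [e0, sub_zero, Sob.glueMap, if_neg hr.ne', _root_.smul_apply, norm_smul, Real.norm_of_nonneg (by positivity)]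
    have h1 := Sob.norm_ms_le (χ.shift (ℓ r / 2)) (-(ε * ℓ r)) hk1 hk d f (C := χ.bd k)
      (κ := -((δ' - δ) / 2 * ℓ r) + (δ + δ') * χ.rad) (L := ℓ r / 2 - χ.rad)
      (fun i hi s => by
        rw [CutFn.iterDeriv_shift]; exact χ.le_bd hi _) (fun s i hi hs => by
        rw [CutFn.iterDeriv_shift] at hs; have h2 := χ.neg_rad_le hlo hs
        have h3 := χ.le_rad hhi hs; have h4 : ℓ r / 2 - χ.rad ≤ |s + -(ε * ℓ r)| := by
          rcases hε with rfl | rfl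
          · rw [zero_mul, neg_zero, add_zero]; exact le_trans (by linarith) (le_abs_self s)
          · exact le_trans (by linarith) (neg_le_abs _)
        have h5 : |s| ≤ ℓ r / 2 + χ.rad := abs_le.2 ⟨by linarith, by linarith⟩; refine ⟨?_, h4⟩
        nlinarith [mul_le_mul_of_nonneg_left h5 o, mul_le_mul_of_nonneg_left h4 (o.trans d)])
    refine (mul_le_mul_of_nonneg_left h1 (by positivity)).trans ?_; rw [Real.exp_add]
    have ht := f.tail_nonneg (ℓ r / 2 - χ.rad); have hbd := χ.bd_nonneg k
    calc _ = (exp (a / r) / r ^ b * exp (-((δ' - δ) / 2 * ℓ r))) *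
          ((k + 1) * (χ.bd k * 2 ^ k * exp ((δ + δ') * χ.rad)) * f.tail (ℓ r / 2 - χ.rad)) := by ring
      _ ≤ C * ((k + 1) * (χ.bd k * 2 ^ k * exp ((δ + δ') * χ.rad)) * f.tail (ℓ r / 2 - χ.rad)) :=
        mul_le_mul_of_nonneg_right hbr (by positivity)
      _ = _ := by ring

lemma Sob.continuous_conj (hk1 : 1 ≤ k) (hk : k ≤ k') (d : δ ≤ δ') (χ : CutFn) :
    Continuous fun p : (ℝ × ℝ × ℝ) × Sob N k' δ' =>
      p.1.1 • Sob.S hk1 p.1.2.1 (Sob.ms χ 0 hk1 hk d (Sob.S (hk1.trans hk) p.1.2.2 p.2)) := by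
  have h1 : Continuous fun p : (ℝ × ℝ × ℝ) × Sob N k' δ' => Sob.S (hk1.trans hk) p.1.2.2 p.2 :=
    (Sob.cont_S (N := N) (δ := δ') (hk1.trans hk)).comp
      ((continuous_snd.comp (continuous_snd.comp continuous_fst)).prodMk continuous_snd)
  have h2 : Continuous fun p : (ℝ × ℝ × ℝ) × Sob N k' δ' =>
      Sob.ms χ 0 hk1 hk d (Sob.S (hk1.trans hk) p.1.2.2 p.2) :=
    (Sob.ms (N := N) χ 0 hk1 hk d).continuous.comp h1
  have h3 : Continuous fun p : (ℝ × ℝ × ℝ) × Sob N k' δ' =>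
      Sob.S hk1 p.1.2.1 (Sob.ms χ 0 hk1 hk d (Sob.S (hk1.trans hk) p.1.2.2 p.2)) :=
    (Sob.cont_S (N := N) (δ := δ) hk1).comp ((continuous_fst.comp (continuous_snd.comp continuous_fst)).prodMk h2)
  exact (continuous_fst.comp continuous_fst).smul h3

lemma Sob.contAt_conj (hk1 : 1 ≤ k) (hk : k ≤ k') (d : δ ≤ δ') (χ : CutFn) {c : ℝ → ℝ × ℝ × ℝ} {r₀ : ℝ}
    (hc : ContinuousAt c r₀) (f₀ : Sob N k' δ') :
    ContinuousAt (fun p : ℝ × Sob N k' δ' => (c p.1).1 • Sob.S hk1 (c p.1).2.1 (Sob.ms χ 0 hk1 hk d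
      (Sob.S (hk1.trans hk) (c p.1).2.2 p.2))) (r₀, f₀) := by
  have h1 : ContinuousAt (fun p : ℝ × Sob N k' δ' => (c p.1, p.2)) (r₀, f₀) :=
    (ContinuousAt.comp (f := Prod.fst) (x := (r₀, f₀)) hc continuousAt_fst).prodMk continuousAt_snd
  exact (Sob.continuous_conj (N := N) hk1 hk d χ).continuousAt.comp h1

lemma Sob.contOn_glueMap (hk1 : 1 ≤ k) (hk : k ≤ k') (o : 0 ≤ δ) (d : δ ≤ δ') {a b : ℕ} {χ : CutFn} (hok : GlueOK δ δ' a b χ ε) :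
    ContinuousOn (fun p : ℝ × Sob N k' δ' => Sob.glueMap hk1 hk d a b χ ε p.1 p.2) (Ici 0 ×ˢ univ) := by
  rintro ⟨r₀, f₀⟩ ⟨hr₀ : 0 ≤ r₀, -⟩; rcases hr₀.eq_or_lt with rfl | hr₀
  · obtain ⟨C, M, hC, hb⟩ := Sob.exists_glueMap_bound (N := N) hk1 hk o d hok
    let G : Sob N k' δ' →L[ℝ] Sob N k δ := Sob.glueMap hk1 hk d a b χ ε 0
    have hlim : Tendsto (fun r => f₀.tail (ℓ r / 2 - M)) (𝓝[>] 0) (𝓝 0) := by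
      refine f₀.tendsto_tail.comp ?_
      exact tendsto_atTop_add_const_right _ (-M) (tendsto_len.atTop_div_const two_pos)
    have h1 : ∀ᶠ p : ℝ × Sob N k' δ' in 𝓝[Ioi 0 ×ˢ univ] (0, f₀), ‖Sob.glueMap hk1 hk d a b χ ε p.1 p.2 - G f₀‖ ≤
          C * (f₀.tail (ℓ p.1 / 2 - M) + (k' + 1) * ‖p.2 - f₀‖) + ‖G (p.2 - f₀)‖ := by
      rw [nhdsWithin_prod_eq]; filter_upwards [hb.prod_inl _] with p hp
      have e1 : Sob.glueMap hk1 hk d a b χ ε p.1 p.2 - G f₀ =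
          (Sob.glueMap hk1 hk d a b χ ε p.1 p.2 - G p.2) + G (p.2 - f₀) := by rw [map_sub]; abel
      rw [e1]
      refine (norm_add_le _ _).trans (add_le_add ((hp p.2).trans (mul_le_mul_of_nonneg_left ?_ hC)) le_rfl)
      have h2 := Sob.tail_add_le (ℓ p.1 / 2 - M) f₀ (p.2 - f₀); rw [add_sub_cancel] at h2
      exact h2.trans (add_le_add le_rfl (Sob.tail_le _ _))
    have h2 : Tendsto (fun p : ℝ × Sob N k' δ' => C * (f₀.tail (ℓ p.1 / 2 - M) + (k' + 1) * ‖p.2 - f₀‖) +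
        ‖G (p.2 - f₀)‖) (𝓝[Ioi 0 ×ˢ univ] (0, f₀)) (𝓝 0) := by
      have h3 : Tendsto (fun p : ℝ × Sob N k' δ' => f₀.tail (ℓ p.1 / 2 - M)) (𝓝[Ioi 0 ×ˢ univ] (0, f₀)) (𝓝 0) := by
        rw [nhdsWithin_prod_eq]; exact hlim.comp tendsto_fst
      have h4 : Tendsto (fun p : ℝ × Sob N k' δ' => ((k' : ℝ) + 1) * ‖p.2 - f₀‖) (𝓝[Ioi 0 ×ˢ univ] (0, f₀)) (𝓝 0) := by
        have : Continuous fun p : ℝ × Sob N k' δ' => ((k' : ℝ) + 1) * ‖p.2 - f₀‖ := by fun_prop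
        simpa using (this.tendsto (0, f₀)).mono_left nhdsWithin_le_nhds
      have h5 : Tendsto (fun p : ℝ × Sob N k' δ' => ‖G (p.2 - f₀)‖) (𝓝[Ioi 0 ×ˢ univ] (0, f₀)) (𝓝 0) := by
        have : Continuous fun p : ℝ × Sob N k' δ' => ‖G (p.2 - f₀)‖ := by fun_prop
        simpa using (this.tendsto (0, f₀)).mono_left nhdsWithin_le_nhds
      simpa using ((h3.add h4).const_mul C).add h5
    have h3 : ContinuousWithinAt (fun p : ℝ × Sob N k' δ' => Sob.glueMap hk1 hk d a b χ ε p.1 p.2) (Ioi 0 ×ˢ univ) (0, f₀) := by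
      rw [ContinuousWithinAt, tendsto_iff_norm_sub_tendsto_zero]
      exact squeeze_zero' (Eventually.of_forall fun _ => norm_nonneg _) h1 h2
    have h4 : ContinuousWithinAt (fun p : ℝ × Sob N k' δ' => Sob.glueMap hk1 hk d a b χ ε p.1 p.2) ({0} ×ˢ univ) (0, f₀) := by
      have h5 : ContinuousWithinAt (fun p : ℝ × Sob N k' δ' => G p.2) ({0} ×ˢ univ) (0, f₀) :=
        (G.continuous.comp continuous_snd).continuousWithinAt
      refine h5.congr (fun p hp => ?_) rfl; have : p.1 = 0 := hp.1; simp only [this]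
      rfl
    have h5 : (Ici (0 : ℝ) ×ˢ (univ : Set (Sob N k' δ'))) = {0} ×ˢ univ ∪ Ioi 0 ×ˢ univ := by
      rw [← union_prod]; congr 1; ext x; simp [le_iff_eq_or_lt, eq_comm]
    rw [h5]; exact h4.union h3
  · have h1 : ContinuousAt (fun p : ℝ × Sob N k' δ' => (exp (a / p.1) / p.1 ^ b) •
        Sob.S hk1 (-(ℓ p.1 / 2)) (Sob.ms χ 0 hk1 hk d (Sob.S (hk1.trans hk) (ℓ p.1 / 2 - ε * ℓ p.1) p.2))) (r₀, f₀) := by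
      have hg : ContinuousAt ℓ r₀ := contAt_len hr₀.ne'
      have h2 : ContinuousAt (fun r : ℝ => (exp (a / r) / r ^ b, -(ℓ r / 2), ℓ r / 2 - ε * ℓ r)) r₀ :=
        (((continuousAt_const.div continuousAt_id hr₀.ne').rexp).div (continuousAt_id.pow b)
          (pow_ne_zero _ hr₀.ne')).prodMk (((hg.div_const 2).neg).prodMk ((hg.div_const 2).sub (continuousAt_const.mul hg)))
      exact Sob.contAt_conj hk1 hk d χ h2 f₀
    refine (h1.congr ?_).continuousWithinAt
    have h2 : ∀ᶠ p : ℝ × Sob N k' δ' in 𝓝 (r₀, f₀), p.1 ≠ 0 := continuousAt_fst.eventually_ne hr₀.ne'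
    filter_upwards [h2] with p hp; refine Sob.ext fun s => ?_; rw [Sob.glueMap_pos _ _ _ _ _ _ _ hp]
    change (exp (a / p.1) / p.1 ^ b) • (Sob.S hk1 (-(ℓ p.1 / 2)) (Sob.ms χ 0 hk1 hk d
          (Sob.S (hk1.trans hk) (ℓ p.1 / 2 - ε * ℓ p.1) p.2))).1 s = _
    rw [Sob.S_apply, Sob.ms_apply, Sob.S_apply]; rw [show s + -(ℓ p.1 / 2) = s - ℓ p.1 / 2 by ring,
      show s - ℓ p.1 / 2 + 0 + (ℓ p.1 / 2 - ε * ℓ p.1) = s - ε * ℓ p.1 by ring]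

end GlueFam

/-! ### Differentiability of the families -/

namespace Weights

/-- Comparison of the levels of two scales. -/
structure Le (W W' : Weights) : Prop where
  k_le : ∀ m, W.k m ≤ W'.k m
  δ_le : ∀ m, W.δ m ≤ W'.δ m

lemma Le.refl (W : Weights) : W.Le W := ⟨fun _ => le_rfl, fun _ => le_rfl⟩

lemma le_up (W : Weights) : W.Le W.up := ⟨fun m => by have := W.k_lt m; change W.k m ≤ W.k (m + 1); omega, fun m => (W.δ_lt m).le⟩

lemma Le.trans {W W' W'' : Weights} (h : W.Le W') (h' : W'.Le W'') : W.Le W'' :=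
  ⟨fun m => (h.1 m).trans (h'.1 m), fun m => (h.2 m).trans (h'.2 m)⟩

/-- The weights of the next level with the orders of the given one. -/
def half (W : Weights) : Weights := ⟨W.k, fun m => W.δ (m + 1), W.two_le, W.k_lt, fun m => W.δ_lt (m + 1), fun m => W.δ_nonneg (m + 1)⟩

lemma le_half (W : Weights) : W.Le W.half := ⟨fun _ => le_rfl, fun m => (W.δ_lt m).le⟩

end Weights

section Families

variable {W W' : Weights}

/-- Differentiation, keeping the gain of weight. -/
def ScOp.D (N : ℕ) (W : Weights) : ScOp (W.up.scale N) (W.half.scale N) where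
  map m := (Sob.D (W.one_le m) (W.k_lt m) le_rfl : Sob N (W.k (m + 1)) (W.δ (m + 1)) →L[ℝ] Sob N (W.k m) (W.δ (m + 1)))
  comm m (x : Sob N (W.k (m + 2)) (W.δ (m + 2))) := by
    refine Subtype.ext ?_; refine (W.half.incl_apply _).trans ?_
    exact congrArg deriv (W.up.incl_apply x).symm

/-- The inclusion of scales. -/
def ScOp.inc (N : ℕ) (h : W.Le W') : ScOp (W'.scale N) Θ where
  map m := (Sob.inc (W.one_le m) (h.1 m) (h.2 m) : Sob N (W'.k m) (W'.δ m) →L[ℝ] 𝓗)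
  comm m (x : Sob N (W'.k (m + 1)) (W'.δ (m + 1))) := by
    refine Subtype.ext ?_; refine (W.incl_apply _).trans ((Sob.inc_apply _ _ _ x).trans ?_)
    exact ((Sob.inc_apply _ _ _ _).trans (W'.incl_apply x)).symm

/-- The family `h ↦ exp (a / r) r^(-b) χ(· - R/2) h(· - ε R)`. -/
def glueFam (N : ℕ) (h : W.Le W') (a b : ℕ) (χ : CutFn) (ε : ℝ) : OpFam (W'.scale N) Θ where
  map m r := (Sob.glueMap (W.one_le m) (h.1 m) (h.2 m) a b χ ε r : Sob N (W'.k m) (W'.δ m) →L[ℝ] 𝓗)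
  comm m r (x : Sob N (W'.k (m + 1)) (W'.δ (m + 1))) := by
    refine Sob.ext fun s => ?_; refine (congrFun (W.incl_apply _) s).trans ?_
    have hx : (W'.incl N m x).1 = x.1 := W'.incl_apply x; rcases eq_or_ne r 0 with rfl | hr
    · refine (Sob.glueMap_zero _ _ _ _ _ _ _ x s).trans ?_
      refine Eq.trans ?_ (Sob.glueMap_zero _ _ _ _ _ _ _ (W'.incl N m x) s).symm; rw [hx]
    · refine (Sob.glueMap_pos _ _ _ _ _ _ _ hr x s).trans ?_
      refine Eq.trans ?_ (Sob.glueMap_pos _ _ _ _ _ _ _ hr (W'.incl N m x) s).symm; rw [hx]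

/-- The shifts. -/
def shiftFam (N : ℕ) (W : Weights) : OpFam Θ Θ where
  map m r := (Sob.S (W.one_le m) r : 𝓗 →L[ℝ] 𝓗)
  comm m r (x : Sob N (W.k (m + 1)) (W.δ (m + 1))) := by
    refine Sob.ext fun s => ?_; refine (congrFun (W.incl_apply _) s).trans ?_
    refine (Sob.S_apply _ _ x s).trans (Eq.trans ?_ (Sob.S_apply _ _ (W.incl N m x) s).symm)
    exact congrFun (W.incl_apply x).symm _

lemma glueFam_isCont (h : W.Le W') {a b : ℕ} {χ : CutFn}
    (hok : ∀ m, GlueOK (W.δ m) (W'.δ m) a b χ ε) : (glueFam N h a b χ ε).IsCont (Ici 0) := fun m =>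
  Sob.contOn_glueMap (W.one_le m) (h.1 m) (W.δ_nonneg m) (h.2 m) (hok m)

lemma shiftFam_isCont : (shiftFam N W).IsCont univ := fun m =>
  (Sob.cont_S (W.one_le m)).continuousOn

lemma hasDeriv_of_pointwise (hP : P.OrdConnected) {A : OpFam E Θ} {B : OpFam E.up Θ} (hA : A.IsCont P) (hB : B.IsCont P)
    (h : ∀ (x : E.L 1) (s : ℝ), ∀ r ∈ interior P, HasDerivAt (fun r => Sob.eval N (W.k 0) (W.δ 0) s (A.map 0 r (E.incl 0 x)))
        (Sob.eval N (W.k 0) (W.δ 0) s (B.map 0 r x)) r) : A.HasDeriv P B := by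
  have key : ∀ x : E.L 1, ∀ r₀ ∈ P, ∀ r ∈ P, r₀ ≤ r →
      A.map 0 r (E.incl 0 x) - A.map 0 r₀ (E.incl 0 x) = ∫ σ in r₀..r, B.map 0 σ x := by
    intro x r₀ hr₀ r hr hle; have := Sob.completeSpace (N := N) (δ := W.δ 0) ϖ
    refine Sob.ext fun s => ?_; let e : ϑ →L[ℝ] Vec N := Sob.ev (W.δ_nonneg 0) ϖ s
    have hi := hB.intervalIntegrable hP 0 x hr₀ hr; have h1 := e.intervalIntegral_comp_comm hi
    refine Eq.trans ?_ h1; have hcA : ContinuousOn (fun σ => e (A.map 0 σ (E.incl 0 x))) (Icc r₀ r) := by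
      have h2 : ContinuousOn (fun σ : ℝ => A.map 0 σ (E.incl 0 x)) (Icc r₀ r) :=
        (hA 0).comp (f := fun σ : ℝ => ((σ, E.incl 0 x) : ℝ × E.L 0)) (Continuous.prodMk_left _).continuousOn
          fun σ hσ => ⟨hP.out hr₀ hr hσ, trivial⟩
      exact e.continuous.comp_continuousOn h2
    have hint : IntervalIntegrable (fun σ => e (B.map 0 σ x)) volume r₀ r := ⟨e.integrable_comp hi.1, e.integrable_comp hi.2⟩
    refine (intervalIntegral.integral_eq_sub_of_hasDerivAt_of_le hle hcA (fun σ hσ => ?_) hint).symm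
    refine h x s σ ?_; exact interior_mono (hP.out hr₀ hr) (by rwa [interior_Icc])
  intro x r₀ hr₀ r hr; rcases le_total r₀ r with hle | hle
  · exact key x r₀ hr₀ r hr hle
  · rw [intervalIntegral.integral_symm, ← key x r hr r₀ hr₀ hle, neg_sub]

lemma Sob.hasDerivAt {δ : ℝ} (hk : 2 ≤ k) (f : Sob N k δ) (s : ℝ) : HasDerivAt f.1 (deriv f.1 s) s :=
  ((f.contDiff_one hk).1.differentiable (by simp) s).hasDerivAt

lemma shiftFam_hasDeriv : (shiftFam N W).HasDeriv univ ((shiftFam N W).comp ((ScOp.inc N W.le_half).comp (ScOp.D N W))) := by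
  refine hasDeriv_of_pointwise ordConnected_univ shiftFam_isCont (shiftFam_isCont.comp _) ?_
  intro x s r _; change HasDerivAt (fun r => (Sob.S ϖ r (W.incl N 0 x)).1 s)
    ((Sob.S ϖ r (Sob.inc ϖ le_rfl (W.δ_lt 0).le (Sob.D ϖ (W.k_lt 0) le_rfl x))).1 s) r
  let y : Ω₁ := x; have h1 : HasDerivAt (fun r => y.1 (s + r)) (deriv y.1 (s + r)) r := by
    exact (y.hasDerivAt (W.two_le 1) (s + r)).comp_const_add s r
  refine (h1.congr_of_eventuallyEq (Eventually.of_forall fun r => ?_)).congr_deriv ?_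
  · change (Sob.S ϖ r (W.incl N 0 y)).1 s = _; rw [Sob.S_apply, W.incl_apply]
  · change _ = (Sob.S ϖ r (Sob.inc ϖ le_rfl (W.δ_lt 0).le (Sob.D ϖ (W.k_lt 0) le_rfl y))).1 s
    rw [Sob.S_apply, Sob.inc_apply, Sob.D_apply]

lemma shiftFam_SF (k : ℕ) : (shiftFam N W).SF univ k := by
  induction k with
  | zero => exact shiftFam_isCont
  | succ k ih => exact ⟨shiftFam_isCont, _, shiftFam_hasDeriv, ih.comp _⟩

lemma hasDerivAt_glue_scalar (a b : ℕ) (hr : r ≠ 0) : HasDerivAt (fun r : ℝ => exp (a / r) / r ^ b)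
      (-a * (exp (a / r) / r ^ (b + 2)) - b * (exp (a / r) / r ^ (b + 1))) r := by
  have h1 : HasDerivAt (fun r : ℝ => (a : ℝ) / r) (-(a / r ^ 2)) r := by
    have := (hasDerivAt_inv hr).const_mul (a : ℝ); exact this.congr_deriv (by ring)
  refine (h1.exp.div (hasDerivAt_pow b r) (pow_ne_zero _ hr)).congr_deriv ?_; rcases b with _ | b
  · field_simp; simp; ring
  · rw [Nat.add_sub_cancel]; field_simp; ring

lemma hasDerivAt_glue_pointwise (a b : ℕ) (χ : CutFn) (ε : ℝ) {f : Φ} (hf : ContDiff ℝ 1 f) (s : ℝ) (hr : r ≠ 0) :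
    HasDerivAt (fun r => (exp (a / r) / r ^ b) • (χ (s - ℓ r / 2) • f (s - ε * ℓ r)))
      ((-a : ℝ) • (exp (a / r) / r ^ (b + 2)) • (χ (s - ℓ r / 2) • f (s - ε * ℓ r)) +
        (-b : ℝ) • (exp (a / r) / r ^ (b + 1)) • (χ (s - ℓ r / 2) • f (s - ε * ℓ r)) +
        (1 / 2 : ℝ) • (exp (((a + 1 : ℕ) : ℝ) / r) / r ^ (b + 2)) • (deriv χ (s - ℓ r / 2) • f (s - ε * ℓ r)) +
        ε • (exp (((a + 1 : ℕ) : ℝ) / r) / r ^ (b + 2)) • (χ (s - ℓ r / 2) • deriv f (s - ε * ℓ r))) r := by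
  have hg := hasDerivAt_len hr; have h1 := hasDerivAt_glue_scalar a b hr
  have h2 : HasDerivAt (fun r => χ (s - ℓ r / 2)) (deriv χ (s - ℓ r / 2) * -(-(exp (1 / r) / r ^ 2) / 2)) r := by
    have := (χ.smooth.differentiable (by simp) (s - ℓ r / 2)).hasDerivAt
    exact this.comp r ((hg.div_const 2).const_sub s)
  have h3 : HasDerivAt (fun r => f (s - ε * ℓ r)) ((-(ε * -(exp (1 / r) / r ^ 2))) • deriv f (s - ε * ℓ r)) r := by
    have := (hf.differentiable (by simp) (s - ε * ℓ r)).hasDerivAt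
    exact this.scomp r ((hg.const_mul ε).const_sub s)
  refine (h1.smul (h2.smul h3)).congr_deriv ?_
  have e : exp (((a + 1 : ℕ) : ℝ) / r) / r ^ (b + 2) = exp (a / r) / r ^ b * (exp (1 / r) / r ^ 2) := by
    rw [show (((a + 1 : ℕ) : ℝ) / r) = a / r + 1 / r by push_cast; ring, Real.exp_add, pow_add]; field_simp
  rw [e, Pi.smul_apply']; module

lemma glueFam_hasDerivAt (h : W.Le W') (a b : ℕ) (χ : CutFn) (ε : ℝ) (x : Sob N (W'.k 1) (W'.δ 1)) (s : ℝ) (hr : r ≠ 0) :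
    HasDerivAt (fun r => (Sob.glueMap ϖ (h.1 0) (h.2 0) a b χ ε r (W'.incl N 0 x)).1 s)
      ((-a : ℝ) • (Sob.glueMap ϖ ((h.trans W'.le_up).1 0) ((h.trans W'.le_up).2 0) a (b + 2) χ ε r x).1 s +
        (-b : ℝ) • (Sob.glueMap ϖ ((h.trans W'.le_up).1 0) ((h.trans W'.le_up).2 0) a (b + 1) χ ε r x).1 s +
        (1 / 2 : ℝ) • (Sob.glueMap ϖ ((h.trans W'.le_up).1 0) ((h.trans W'.le_up).2 0) (a + 1) (b + 2) χ.deriv ε r x).1 s +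
        ε • (Sob.glueMap ϖ ((h.trans W'.le_half).1 0) ((h.trans W'.le_half).2 0) (a + 1) (b + 2) χ ε r
          (Sob.D (W'.one_le 0) (W'.k_lt 0) le_rfl x)).1 s) r := by
  have e1 := Sob.glueMap_pos ϖ ((h.trans W'.le_up).1 0) ((h.trans W'.le_up).2 0) a (b + 2) χ ε hr x s
  have e2 := Sob.glueMap_pos ϖ ((h.trans W'.le_up).1 0) ((h.trans W'.le_up).2 0) a (b + 1) χ ε hr x s
  have e3 := Sob.glueMap_pos ϖ ((h.trans W'.le_up).1 0) ((h.trans W'.le_up).2 0) (a + 1) (b + 2) χ.deriv ε hr x s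
  have e4 := Sob.glueMap_pos ϖ ((h.trans W'.le_half).1 0) ((h.trans W'.le_half).2 0) (a + 1) (b + 2)
    χ ε hr (Sob.D (W'.one_le 0) (W'.k_lt 0) le_rfl x) s
  refine HasDerivAt.congr_deriv (f' := _) ?_ (congrArg₂ (· + ·) (congrArg₂ (· + ·) (congrArg₂ (· + ·)
    (congrArg ((-a : ℝ) • ·) e1) (congrArg ((-b : ℝ) • ·) e2)) (congrArg ((1 / 2 : ℝ) • ·) e3))
    (congrArg (ε • ·) e4)).symm
  refine (hasDerivAt_glue_pointwise a b χ ε ((x.contDiff_one (W'.two_le 1)).1) s hr).congr_of_eventuallyEq ?_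
  filter_upwards [isOpen_ne.mem_nhds hr] with r hr
  refine (Sob.glueMap_pos _ _ _ _ _ _ _ hr _ s).trans ?_; rw [W'.incl_apply]

/-- The derivative of the gluing families with compactly supported cut-off function. -/
def glueFamDeriv (N : ℕ) (h : W.Le W') (a b : ℕ) (χ : CutFn) (ε : ℝ) : OpFam (W'.scale N).up Θ :=
  ((((glueFam N (h.trans W'.le_up) a (b + 2) χ ε).smul (-a)).add ((glueFam N (h.trans W'.le_up) a (b + 1) χ ε).smul (-b))).add
    ((glueFam N (h.trans W'.le_up) (a + 1) (b + 2) χ.deriv ε).smul (1 / 2))).add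
    (((glueFam N (h.trans W'.le_half) (a + 1) (b + 2) χ ε).comp (ScOp.D N W')).smul ε)

lemma glueFam_SF_of_lt (h : W.Le W') (a b : ℕ) {χ : CutFn} (hlo : χ.lo = 0) (hhi : χ.hi = 0)
    (hε : ε = 0 ∨ ε = 1) (hab : (a = 0 ∧ b = 0) ∨ ∀ m, W.δ m < W'.δ m) (k : ℕ) :
    (glueFam N h a b χ ε).SF (Ici 0) k := by
  induction k generalizing W' a b χ with
  | zero => exact glueFam_isCont h fun m => .inr ⟨hlo, hhi, hε, hab.imp_right fun h => h m⟩
  | succ k ih =>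
    have hc : (glueFam N h a b χ ε).IsCont (Ici 0) := glueFam_isCont h fun m => .inr ⟨hlo, hhi, hε, hab.imp_right fun h => h m⟩
    have hup : ∀ m, W.δ m < W'.up.δ m := fun m => (h.2 m).trans_lt (W'.δ_lt m)
    have hhalf : ∀ m, W.δ m < W'.half.δ m := fun m => (h.2 m).trans_lt (W'.δ_lt m)
    have hD : (glueFamDeriv N h a b χ ε).SF (Ici 0) k :=
      OpFam.SF.add ordConnected_Ici (OpFam.SF.add ordConnected_Ici (OpFam.SF.add ordConnected_Ici
        ((ih (h.trans W'.le_up) a (b + 2) hlo hhi (.inr hup)).smul _)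
        ((ih (h.trans W'.le_up) a (b + 1) hlo hhi (.inr hup)).smul _))
        ((ih (h.trans W'.le_up) (a + 1) (b + 2) (χ := χ.deriv) rfl rfl (.inr hup)).smul _))
        (((ih (h.trans W'.le_half) (a + 1) (b + 2) hlo hhi (.inr hhalf)).comp _).smul _)
    refine ⟨hc, glueFamDeriv N h a b χ ε, hasDeriv_of_pointwise ordConnected_Ici hc hD.isCont ?_, hD⟩
    intro x s r hr; rw [interior_Ici] at hr; have hr : r ≠ 0 := ne_of_gt hr
    exact glueFam_hasDerivAt h a b χ ε x s hr

lemma glueFam_SF_of_eps (h : W.Le W') (χ : CutFn) (k : ℕ) : (glueFam N h 0 0 χ 0).SF (Ici 0) k := by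
  have hc : (glueFam N h 0 0 χ 0).IsCont (Ici 0) := glueFam_isCont h fun m => .inl ⟨rfl, rfl, rfl⟩
  cases k with
  | zero => exact hc
  | succ k =>
    have hup : ∀ m, W.δ m < W'.up.δ m := fun m => (h.2 m).trans_lt (W'.δ_lt m)
    have hD : ((glueFam N (h.trans W'.le_up) 1 2 χ.deriv 0).smul (1 / 2)).SF (Ici 0) k :=
      (glueFam_SF_of_lt (h.trans W'.le_up) 1 2 (χ := χ.deriv) rfl rfl (.inl rfl) (.inr hup) k).smul _
    refine ⟨hc, _, hasDeriv_of_pointwise ordConnected_Ici hc hD.isCont ?_, hD⟩; intro x s r hr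
    rw [interior_Ici] at hr; have hr : r ≠ 0 := ne_of_gt hr
    refine (glueFam_hasDerivAt h 0 0 χ 0 x s hr).congr_deriv ?_
    rw [Nat.cast_zero, neg_zero, zero_smul, zero_smul, zero_smul, zero_add, zero_add, add_zero]
    rfl

end Families

/-! ### The sc-Banach spaces of the charts -/

lemma IsScBanach.of_retract (hE : IsScBanach E) (i : ScOp F E) (p : ScOp E F) (h : ∀ m x, p.map m (i.map m x) = x) : IsScBanach F where
  complete m := by
    have := hE.complete m; have hr : IsClosed (range (i.map m)) := by
      have : range (i.map m) = {x | i.map m (p.map m x) = x} := by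
        ext x; refine ⟨?_, fun hx => ⟨_, hx⟩⟩; rintro ⟨y, rfl⟩; simp only [mem_ofPred_eq, h]
      rw [this]; exact isClosed_eq ((i.map m).continuous.comp (p.map m).continuous) continuous_id
    have ha : AntilipschitzWith ‖p.map m‖₊ (i.map m) := (i.map m).antilipschitz_of_bound fun x => by
        conv_lhs => rw [← h m x]
        exact (p.map m).le_opNorm _
    exact ((ha.isUniformEmbedding (i.map m).uniformContinuous).isUniformInducing.completeSpace hr.isComplete)
  injective m x y hxy := by
    have h1 : i.map m (F.incl m x) = i.map m (F.incl m y) := congrArg _ hxy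
    rw [← i.comm, ← i.comm] at h1; have h2 := congrArg (p.map (m + 1)) (hE.injective m h1); rwa [h, h] at h2
  compact m := by
    have h1 : (F.incl m : F.L (m + 1) → F.L m) = (p.map m) ∘ (E.incl m) ∘ (i.map (m + 1)) := by
      funext x; simp only [Function.comp_apply]; rw [← p.comm, h]
    rw [h1]; exact ((hE.compact m).comp_clm (i.map (m + 1))).clm_comp (p.map m)
  dense m := by
    have h1 := (Function.Surjective.denseRange (f := p.map m) fun x => ⟨_, h m x⟩).dense_image (p.map m).continuous (hE.dense m)
    refine h1.mono ?_; rintro _ ⟨x, hx, rfl⟩ n; obtain ⟨y, hy⟩ := hx n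
    exact ⟨p.map n y, by rw [p.toZero, p.toZero, hy]⟩

lemma IsScBanach.sum (hE : IsScBanach E) (hF : IsScBanach F) : IsScBanach (E.sum F) where
  complete m := by
    have := hE.complete m; have := hF.complete m; exact inferInstanceAs (CompleteSpace (E.L m × F.L m))
  injective m := (hE.injective m).prodMap (hF.injective m)
  compact m := compactOp_prodMap (hE.compact m) (hF.compact m)
  dense m := by
    refine ((hE.dense m).prod (hF.dense m)).mono ?_; rintro ⟨x, y⟩ ⟨hx, hy⟩ n
    obtain ⟨x', hx'⟩ := hx n; obtain ⟨y', hy'⟩ := hy n; refine ⟨(x', y'), ?_⟩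
    rw [ScScale.sum_toZero, ScScale.sum_toZero, hx', hy']

lemma Weights.toZero_apply (W : Weights) : ∀ (m : ℕ) (f : 𝓗), ((Θ).toZero m f : ϑ).1 = f.1
  | 0, _ => rfl
  | m + 1, f => by
    refine (congrArg Subtype.val (ScScale.toZero_succ Θ m f)).trans ?_
    exact (W.toZero_apply m (W.incl N m f)).trans (W.incl_apply f)

lemma Weights.banach (W : Weights) (N : ℕ) : IsScBanach Θ where
  complete := ScGood.complete
  injective := ScGood.injective
  compact := ScGood.compact
  dense m := by
    intro f; refine closure_mono ?_ (Sob.mem_closure_smooth (W.δ_nonneg m) (W.one_le m) f)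
    rintro g ⟨h1, h2⟩ n
    refine ⟨(⟨g.1, mem_sobolev_of_compactSupp h1 h2⟩ : Sob N (W.k n) (W.δ n)), Subtype.ext ?_⟩
    exact (W.toZero_apply n _).trans (W.toZero_apply m g).symm

/-- A smooth function with compact support and value `1` at `0`. -/
def bumpFn (s : ℝ) : ℝ := stepFn.toFun (s + 2) * stepFn.toFun (2 - s)

lemma bumpFn_zero : bumpFn 0 = 1 := by
  rw [bumpFn, stepFn_eq_one (by norm_num), stepFn_eq_one (by norm_num), one_mul]

lemma contDiff_bumpFn : ContDiff ℝ ∞ bumpFn :=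
  (stepFn.smooth.comp (contDiff_id.add contDiff_const)).mul (stepFn.smooth.comp (contDiff_const.sub contDiff_id))

lemma compactSupp_bumpFn : HasCompactSupport bumpFn := by
  refine HasCompactSupport.intro (isCompact_Icc (a := (-3 : ℝ)) (b := 3)) fun s hs => ?_
  rw [Set.mem_Icc, not_and_or, not_le, not_le] at hs; rw [bumpFn]; rcases hs with hs | hs
  · rw [stepFn_eq_zero (by linarith), zero_mul]
  · rw [stepFn_eq_zero (s := 2 - s) (by linarith), mul_zero]

/-- The function `s ↦ bumpFn s • v` as an element of all weighted spaces. -/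
def Sob.bump {δ : ℝ} (v : Vec N) : Sob N k δ :=
  ⟨fun s => bumpFn s • v, mem_sobolev_of_compactSupp (contDiff_bumpFn.smul contDiff_const) compactSupp_bumpFn.smul_right⟩

/-- The weights of the scale `H^{m+2,δ_m}`. -/
abbrev Weights.std (d : StrictMono δ) (o : δ 0 = 0) : Weights where
  k m := m + 2
  δ := δ
  two_le m := by omega
  k_lt m := le_rfl
  δ_lt m := d (Nat.lt_succ_self m)
  δ_nonneg m := o ▸ d.monotone (Nat.zero_le m)

section Slices

variable (d : StrictMono δ) (o : δ 0 = 0)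

/-- The projection onto the hyperplane of all `h` with `h 0 ⊥ n`. -/
def Sob.perp {d : ℝ} (hd : 0 ≤ d) (hk : 1 ≤ k) (n : Vec N) : Sob N k d →L[ℝ] Sob N k d :=
  ContinuousLinearMap.id ℝ _ - (((dot n n)⁻¹ • (innerSL ℝ n).comp (Sob.ev hd hk 0)).smulRight (Sob.bump n))

lemma Sob.perp_apply {d : ℝ} (hd : 0 ≤ d) (hk : 1 ≤ k) (n : Vec N) (f : Sob N k d) (s : ℝ) :
    (Sob.perp hd hk n f).1 s = f.1 s - ((dot n n)⁻¹ * dot n (f.1 0)) • bumpFn s • n := rfl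

lemma Sob.inner_perp {d : ℝ} (hd : 0 ≤ d) (hk : 1 ≤ k) (n : Vec N) (f : Sob N k d) : dot n ((Sob.perp hd hk n f).1 0) = 0 := by
  rw [Sob.perp_apply, bumpFn_zero, one_smul, inner_sub_right, inner_smul_right]
  rcases eq_or_ne n 0 with rfl | hn
  · simp
  · have : dot n n ≠ 0 := inner_self_ne_zero.2 hn; field_simp; ring

lemma Sob.perp_eq_self {d : ℝ} (hd : 0 ≤ d) (hk : 1 ≤ k) {f : Sob N k d} (h : dot n (f.1 0) = 0) : Sob.perp hd hk n f = f :=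
  Sob.ext fun s => by rw [Sob.perp_apply, h, mul_zero, zero_smul, sub_zero]

/-- The inclusion of the slice. -/
def slIncl (n : Vec N) : ScOp (sliceScale d n) ΔΘ where
  map m := Submodule.subtypeL (LinearMap.ker ((innerₛₗ ℝ n).comp (Sob.eval N (m + 2) (δ m) 0)))
  comm _ _ := Subtype.ext ((Δ).incl_apply _)

/-- The projection onto the slice. -/
def slProj (n : Vec N) : ScOp ΔΘ (sliceScale d n) where
  map m := (Sob.perp ((Δ).δ_nonneg m) ((Δ).one_le m) n).codRestrict (LinearMap.ker ((innerₛₗ ℝ n).comp (Sob.eval N (m + 2) (δ m) 0)))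
    fun f => Sob.inner_perp ((Δ).δ_nonneg m) ((Δ).one_le m) n f
  comm m x := by
    refine Subtype.ext (Sob.ext fun s => ?_); have h1 : ((Δ).incl N m x).1 = Subtype.val x := (Δ).incl_apply x
    refine (Sob.perp_apply _ _ n x s).trans (Eq.trans ?_ (Sob.perp_apply _ _ n ((Δ).incl N m x) s).symm)
    rw [h1]

lemma slProj_slIncl (n : Vec N) (m : ℕ) (x : (sliceScale d n).L m) : (slProj d o n).map m ((slIncl d o n).map m x) = x :=
  Subtype.ext (Sob.perp_eq_self _ _ x.2)

lemma slIncl_slProj {x : Ω} (h : dot n (x.1 0) = 0) : sliceSob ((slProj d o n).map 0 x) = x := Sob.perp_eq_self _ _ h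

end Slices

lemma banach_sliceScale (d : StrictMono δ) (o : δ 0 = 0) (n : Vec N) : IsScBanach (sliceScale d n) :=
  ((Δ).banach N).of_retract (slIncl d o n) (slProj d o n) (slProj_slIncl d o n)

/-! ### The splicing -/

namespace Cutoff

variable (β : Cutoff)

/-- `β` as a cut-off function. -/
def cut : CutFn := ⟨β.toFun, β.smooth, 1, 0, 1, zero_le_one, β.eq_one, fun _ hs => β.eq_zero hs⟩

/-- `1 - β`. -/
def co : CutFn := (CutFn.const 1).sub β.cut

/-- `β² + (1 - β)²`. -/
def gam : CutFn := (β.cut.mul β.cut).add (β.co.mul β.co)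

lemma gam_pos (s : ℝ) : 0 < β.gam s := by
  change 0 < β s * β s + (1 - β s) * (1 - β s); nlinarith [sq_nonneg (2 * β s - 1)]

lemma gam_ne (s : ℝ) : β.gam s ≠ 0 := (β.gam_pos s).ne'

/-- `β² / γ`. -/
def cutA : CutFn := (β.cut.mul β.cut).div β.gam β.gam_ne

/-- `β (1 - β) / γ`. -/
def cutB : CutFn := (β.cut.mul β.co).div β.gam β.gam_ne

/-- `β / γ`. -/
def cutP : CutFn := β.cut.div β.gam β.gam_ne

/-- `(1 - β) / γ`. -/
def cutQ : CutFn := β.co.div β.gam β.gam_ne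

lemma cutA_lo : β.cutA.lo = 1 := by
  change (1 * 1 : ℝ) / (1 * 1 + (1 - 1) * (1 - 1)) = 1; norm_num

lemma cutB_lo : β.cutB.lo = 0 := by
  change (1 * (1 - 1) : ℝ) / (1 * 1 + (1 - 1) * (1 - 1)) = 0; norm_num

lemma cutB_hi : β.cutB.hi = 0 := by
  change (0 * (1 - 0) : ℝ) / (0 * 0 + (1 - 0) * (1 - 0)) = 0; norm_num

lemma neg_eq (s : ℝ) : β (-s) = 1 - β s := by linarith [β.symm s]

end Cutoff

/-- The reflection as a sc-operator. -/
def ScOp.J (N : ℕ) (W : Weights) : ScOp Θ Θ where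
  map m := (Sob.J : 𝓗 →L[ℝ] 𝓗)
  comm m x := by
    refine Sob.ext fun s => (congrFun (W.incl_apply (N := N) _) s).trans ?_
    exact (congrFun (W.incl_apply (N := N) x) (-s)).symm

lemma Sob.glueMap_zero_zero {δ δ' : ℝ} (hk1 : 1 ≤ k) (hk : k ≤ k') (d : δ ≤ δ') (χ : CutFn) (ε : ℝ)
    (hr : r ≠ 0) (f : Sob N k' δ') (s : ℝ) : (Sob.glueMap hk1 hk d 0 0 χ ε r f).1 s = χ (s - ℓ r / 2) • f.1 (s - ε * ℓ r) := by
  rw [Sob.glueMap_pos _ _ _ _ _ _ _ hr]; simp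

section Splice

variable (N : ℕ) (W : Weights) (β : Cutoff)

/-- `Γ_χ : (r, h) ↦ χ(· - R/2) h`. -/
def gammaFam (χ : CutFn) : OpFam Θ Θ := glueFam N (Weights.Le.refl W) 0 0 χ 0

/-- `Φ_χ : (r, h) ↦ χ(· - R/2) h(· - R)`. -/
def phiFam (χ : CutFn) : OpFam Θ Θ := glueFam N (Weights.Le.refl W) 0 0 χ 1

variable {N W}

lemma gammaFam_SF (χ : CutFn) (k : ℕ) : (gammaFam N W χ).SF (Ici 0) k := glueFam_SF_of_eps _ χ k

lemma phiFam_SF {χ : CutFn} (hlo : χ.lo = 0) (hhi : χ.hi = 0) (k : ℕ) : (phiFam N W χ).SF (Ici 0) k :=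
  glueFam_SF_of_lt _ 0 0 hlo hhi (.inr rfl) (.inl ⟨rfl, rfl⟩) k

lemma gammaFam_zero (χ : CutFn) (f : ϑ) (s : ℝ) :
    ((gammaFam N W χ).map 0 0 f : ϑ).1 s = χ.lo • f.1 s := Sob.glueMap_zero _ _ _ _ _ _ _ f s

lemma phiFam_zero (χ : CutFn) (f : ϑ) (s : ℝ) : ((phiFam N W χ).map 0 0 f : ϑ).1 s = χ.lo • f.1 s := Sob.glueMap_zero _ _ _ _ _ _ _ f s

lemma gammaFam_apply (χ : CutFn) (hr : r ≠ 0) (f : ϑ) (s : ℝ) : ((gammaFam N W χ).map 0 r f : ϑ).1 s = χ (s - ℓ r / 2) • f.1 s := by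
  refine (Sob.glueMap_zero_zero _ _ _ _ _ hr f s).trans ?_; rw [zero_mul, sub_zero]

lemma phiFam_apply (χ : CutFn) (hr : r ≠ 0) (f : ϑ) (s : ℝ) : ((phiFam N W χ).map 0 r f : ϑ).1 s =
      χ (s - ℓ r / 2) • f.1 (s - ℓ r) := by
  refine (Sob.glueMap_zero_zero _ _ _ _ _ hr f s).trans ?_; rw [one_mul]

variable (N W)

/-- The first component of the projection. -/
def projOne : OpFam ((Θ).sum Θ) Θ := ((gammaFam N W β.cutA).comp ScOp.fst).add ((phiFam N W β.cutB).comp ScOp.snd)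

lemma projOne_SF (k : ℕ) : (projOne N W β).SF (Ici 0) k :=
  OpFam.SF.add ordConnected_Ici ((gammaFam_SF _ k).comp _) ((phiFam_SF β.cutB_lo β.cutB_hi k).comp _)

/-- `(h, k) ↦ (J k, J h)`. -/
def ScOp.swapJ : ScOp ((Θ).sum Θ) ((Θ).sum Θ) := ((ScOp.J N W).comp ScOp.snd).prod ((ScOp.J N W).comp ScOp.fst)

/-- The projection onto the kernel of anti-gluing along the kernel of gluing. -/
def projFam (r : ℝ) (m : ℕ) : ((Θ).sum Θ).L m →L[ℝ] ((Θ).sum Θ).L m := ((projOne N W β).map m r).prod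
    (((ScOp.J N W).map m).comp (((projOne N W β).map m r).comp ((ScOp.swapJ N W).map m)))

lemma projFam_toZero (r : ℝ) (m : ℕ) (x : ((Θ).sum Θ).L m) : ((Θ).sum Θ).toZero m (projFam N W β r m x) =
      projFam N W β r 0 (((Θ).sum Θ).toZero m x) := by
  refine (ScScale.sum_toZero _ _ m _ _).trans (Prod.ext ?_ ?_)
  · exact (projOne N W β).toZero r m x
  · change (Θ).toZero m ((ScOp.J N W).map m _) = _
    exact ((ScOp.J N W).toZero m _).trans (congrArg ((ScOp.J N W).map 0)
      (((projOne N W β).toZero r m _).trans (congrArg ((projOne N W β).map 0 r) ((ScOp.swapJ N W).toZero m x))))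

lemma projFam_smooth : ScSmoothOn ((Λ).sum ((Θ).sum Θ)) ((Θ).sum Θ) {p : ℝ × ((Θ).sum Θ).L 0 | p.1 ∈ Ici (0 : ℝ)}
    (fun p : ℝ × ((Θ).sum Θ).L 0 => projFam N W β p.1 0 p.2) := by
  have hi : (interior (Ici (0 : ℝ))).Nonempty := by rw [interior_Ici]; exact ⟨1, mem_Ioi.2 one_pos⟩
  refine ScSmoothOn.pair (OpFam.scSmoothOn ordConnected_Ici hi (projOne_SF N W β)) ((ScOp.J N W).comp_smooth ?_)
  exact OpFam.scSmoothOn ordConnected_Ici hi (A := (projOne N W β).comp (ScOp.swapJ N W)) fun k => (projOne_SF N W β k).comp _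

variable {N W}

lemma projFam_zero (x : ((Θ).sum Θ).L 0) : projFam N W β 0 0 x = x := by
  have h1 : ∀ y : ((Θ).sum Θ).L 0, (projOne N W β).map 0 0 y = y.1 := fun y => by
    refine Sob.ext fun s => ?_
    change ((gammaFam N W β.cutA).map 0 0 y.1 : ϑ).1 s + ((phiFam N W β.cutB).map 0 0 y.2 : ϑ).1 s = _
    refine (congrArg₂ (· + ·) (gammaFam_zero β.cutA y.1 s) (phiFam_zero β.cutB y.2 s)).trans ?_
    rw [β.cutA_lo, β.cutB_lo, one_smul, zero_smul, add_zero]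
  refine Prod.ext (h1 x) ?_
  change (ScOp.J N W).map 0 ((projOne N W β).map 0 0 ((ScOp.swapJ N W).map 0 x)) = x.2; rw [h1]
  exact Sob.norm_J_J (N := N) (k := W.k 0) (δ := W.δ 0) x.2

lemma projOne_apply (hr : r ≠ 0) (f g : ϑ) (s : ℝ) :
    ((projOne N W β).map 0 r ((f, g) : (Θ).L 0 × (Θ).L 0) : ϑ).1 s = β.cutA (s - ℓ r / 2) • f.1 s +
        β.cutB (s - ℓ r / 2) • g.1 (s - ℓ r) :=
  congrArg₂ (· + ·) (gammaFam_apply β.cutA hr f s) (phiFam_apply β.cutB hr g s)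

/-- The first component of the projection. -/
def Sob.projL (r : ℝ) (f g : ϑ) : ϑ := (projFam N W β r 0 ((f, g) : (Θ).L 0 × (Θ).L 0)).1

/-- The second component of the projection. -/
def Sob.projR (r : ℝ) (f g : ϑ) : ϑ := (projFam N W β r 0 ((f, g) : (Θ).L 0 × (Θ).L 0)).2

lemma Sob.projL_apply (hr : r ≠ 0) (f g : ϑ) (s : ℝ) : (Sob.projL β r f g).1 s = β.cutA (s - ℓ r / 2) • f.1 s +
        β.cutB (s - ℓ r / 2) • g.1 (s - ℓ r) := projOne_apply β hr f g s

lemma Sob.projR_apply (hr : r ≠ 0) (f g : ϑ) (s : ℝ) :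
    (Sob.projR β r f g).1 s = β.cutA (-s - ℓ r / 2) • g.1 s + β.cutB (-s - ℓ r / 2) • f.1 (s + ℓ r) := by
  refine (projOne_apply β hr (Sob.J g) (Sob.J f) (-s)).trans ?_
  rw [Sob.J_apply, Sob.J_apply, neg_neg, show -(-s - ℓ r) = s + ℓ r by ring]

lemma glue_apply (R : ℝ) (f g : Φ) (s : ℝ) : glue β R (f, g) s = β (s - R / 2) • f s + (1 - β (s - R / 2)) • g (s - R) := rfl

lemma antiglue_apply (R : ℝ) (f g : Φ) (s : ℝ) :
    antiglue β R (f, g) s = -((1 - β (s - R / 2)) • f s) + β (s - R / 2) • g (s - R) := rfl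

lemma eq_zero_of_glue_antiglue {f g : Φ} (h : glue β R (f, g) = 0)
    (h' : antiglue β R (f, g) = 0) : f = 0 ∧ g = 0 := by
  have key : ∀ s, f s = 0 ∧ g (s - R) = 0 := fun s => by
    have e1 := congrFun h s; have e2 := congrFun h' s; rw [glue_apply, Pi.zero_apply] at e1
    rw [antiglue_apply, Pi.zero_apply] at e2
    have hg : β.gam (s - R / 2) = β (s - R / 2) * β (s - R / 2) +
      (1 - β (s - R / 2)) * (1 - β (s - R / 2)) := rfl
    have hne := β.gam_ne (s - R / 2)
    generalize β (s - R / 2) = x at *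
    constructor
    · refine (smul_eq_zero.1 ?_).resolve_left hne; rw [hg]
      linear_combination (norm := module) x • e1 - (1 - x) • e2
    · refine (smul_eq_zero.1 ?_).resolve_left hne; rw [hg]
      linear_combination (norm := module) (1 - x) • e1 + x • e2
  exact ⟨funext fun s => (key s).1, funext fun s => by simpa using (key (s + R)).2⟩

lemma Sob.projR_sub_apply (hr : r ≠ 0) (f g : ϑ) (s : ℝ) : (Sob.projR β r f g).1 (s - ℓ r) =
      ((1 - β (s - ℓ r / 2)) * (1 - β (s - ℓ r / 2)) / β.gam (s - ℓ r / 2)) • g.1 (s - ℓ r) +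
      ((1 - β (s - ℓ r / 2)) * β (s - ℓ r / 2) / β.gam (s - ℓ r / 2)) • f.1 s := by
  rw [Sob.projR_apply β hr, sub_add_cancel, show -(s - ℓ r) - ℓ r / 2 = -(s - ℓ r / 2) by ring]
  generalize s - ℓ r / 2 = x
  have hg : β.gam (-x) = β.gam x := by
    change β (-x) * β (-x) + (1 - β (-x)) * (1 - β (-x)) = β x * β x + (1 - β x) * (1 - β x)
    rw [β.neg_eq]; ring
  have h1 : β.cutA (-x) = (1 - β x) * (1 - β x) / β.gam x := by
    change β (-x) * β (-x) / β.gam (-x) = _; rw [hg, β.neg_eq]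
  have h2 : β.cutB (-x) = (1 - β x) * β x / β.gam x := by
    change β (-x) * (1 - β (-x)) / β.gam (-x) = _; rw [hg, β.neg_eq]; ring
  rw [h1, h2]

lemma glue_proj (hr : r ≠ 0) (f g : ϑ) : glue β (ℓ r) ((Sob.projL β r f g).1, (Sob.projR β r f g).1) = glue β (ℓ r) (f.1, g.1) := by
  funext s; rw [glue_apply, glue_apply, Sob.projL_apply β hr, Sob.projR_sub_apply β hr]
  have hne := β.gam_ne (s - ℓ r / 2)
  change β _ • ((β _ * β _ / β.gam _) • _ + (β _ * (1 - β _) / β.gam _) • _) + _ = _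
  have hg : β.gam (s - ℓ r / 2) = β (s - ℓ r / 2) * β (s - ℓ r / 2) + (1 - β (s - ℓ r / 2)) * (1 - β (s - ℓ r / 2)) := rfl
  generalize β (s - ℓ r / 2) = x at *
  generalize β.gam (s - ℓ r / 2) = y at *
  match_scalars <;> field_simp <;> rw [hg] <;> ring

lemma antiglue_proj (hr : r ≠ 0) (f g : ϑ) : antiglue β (ℓ r) ((Sob.projL β r f g).1, (Sob.projR β r f g).1) = 0 := by
  funext s; rw [antiglue_apply, Sob.projL_apply β hr, Sob.projR_sub_apply β hr, Pi.zero_apply]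
  change -(_ • ((β _ * β _ / β.gam _) • _ + (β _ * (1 - β _) / β.gam _) • _)) + _ = _
  generalize β (s - ℓ r / 2) = x at *
  generalize β.gam (s - ℓ r / 2) = y at *
  module

lemma Sob.projL_eq (hr : 2 < ℓ r) (hr0 : r ≠ 0) (f g : ϑ) : (Sob.projL β r f g).1 0 = f.1 0 := by
  have e : β (0 - ℓ r / 2) = 1 := β.eq_one _ (by linarith); rw [Sob.projL_apply β hr0]
  change (β _ * β _ / (β _ * β _ + (1 - β _) * (1 - β _))) • _ + (β _ * (1 - β _) / (β _ * β _ + (1 - β _) * (1 - β _))) • _ = _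
  rw [e]; norm_num

lemma Sob.projR_eq (hr : 2 < ℓ r) (hr0 : r ≠ 0) (f g : ϑ) : (Sob.projR β r f g).1 0 = g.1 0 := by
  have e : β (-0 - ℓ r / 2) = 1 := β.eq_one _ (by linarith); rw [Sob.projR_apply β hr0]
  change (β _ * β _ / (β _ * β _ + (1 - β _) * (1 - β _))) • _ + (β _ * (1 - β _) / (β _ * β _ + (1 - β _) * (1 - β _))) • _ = _
  rw [e]; norm_num

end Splice

/-! ### The splicings of the charts -/

lemma isPartialCone_Ici : IsPartialCone (Ici (0 : ℝ)) := by
  refine ⟨1, 1, (LinearEquiv.funUnique (Fin 1) ℝ ℝ).symm, le_rfl, ?_⟩; ext x; constructor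
  · rintro ⟨y, hy, rfl⟩ i _; exact hy
  · intro hx; refine ⟨x 0, hx 0 zero_lt_one, funext fun i => ?_⟩; rw [Subsingleton.elim i 0]
    rfl

lemma isPartialCone_univ : IsPartialCone (univ : Set (Fin 0 → ℝ)) := ⟨0, 0, LinearEquiv.refl ℝ _, le_rfl, by ext x; simp⟩

/-- The upper bound of the gluing parameters of the splicing. -/
def glBound : ℝ := 1 / Real.log (2 + exp 1)

lemma one_lt_log : 1 < Real.log (2 + exp 1) := (Real.lt_log_iff_exp_lt (by positivity)).2 (by linarith)

lemma glBound_pos : 0 < glBound := one_div_pos.2 (one_pos.trans one_lt_log)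

lemma glBound_lt_one : glBound < 1 := (div_lt_one (one_pos.trans one_lt_log)).2 one_lt_log

lemma two_lt_len (h0 : 0 < r) (hr : r < glBound) : 2 < ℓ r := by
  have h1 : Real.log (2 + exp 1) < 1 / r := (lt_one_div h0 (one_pos.trans one_lt_log)).1 hr
  have h2 := (Real.log_lt_iff_lt_exp (by positivity)).1 h1; rw [gluingLength]; linarith

section Splicing

variable (β : Cutoff) (d : StrictMono δ) (o : δ 0 = 0) (n n' : Vec N)

/-- The inclusion of `E` into the pairs of functions. -/
def pairIncl : ScOp (pairScale d n n') ((ΔΘ).sum ΔΘ) := (slIncl d o n).prodMap (slIncl d o n')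

/-- A projection onto `E`. -/
def pairProj : ScOp ((ΔΘ).sum ΔΘ) (pairScale d n n') := (slProj d o n).prodMap (slProj d o n')

variable {n n'}

lemma sliceSob_injective {n : Vec N} : Function.Injective (sliceSob : (sliceScale d n).L 0 → Ω) := Subtype.val_injective

lemma inner_sliceSob {n : Vec N} (x : (sliceScale d n).L 0) : dot n ((sliceSob x).1 0) = 0 := x.2

lemma mem_kerGlue (hr : r ≠ 0) (e : (pairScale d n n').L 0) : e ∈ kerGlue β d n n' r ↔
    glue β (ℓ r) ((sliceSob e.1).1, (sliceSob e.2).1) = 0 := by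
  rw [kerGlue, if_neg hr]; rfl

lemma mem_kerAntiglue (hr : r ≠ 0) (e : (pairScale d n n').L 0) : e ∈ kerAntiglue β d n n' r ↔
    antiglue β (ℓ r) ((sliceSob e.1).1, (sliceSob e.2).1) = 0 := by
  rw [kerAntiglue, if_neg hr]; rfl

/-- The projection given by the explicit formulas. -/
def pairSplice (r : ℝ) (m : ℕ) : (pairScale d n n').L m →L[ℝ] (pairScale d n n').L m :=
  ((pairProj d o n n').map m).comp ((projFam N Δ β r m).comp ((pairIncl d o n n').map m))

lemma sliceSob_pairSplice (h0 : 0 < r) (hr : r < glBound) (e : (pairScale d n n').L 0) :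
    sliceSob (pairSplice β d o r 0 e).1 = Sob.projL (W := Δ) β r (sliceSob (hδ := d) e.1) (sliceSob (hδ := d) e.2) ∧
    sliceSob (pairSplice β d o r 0 e).2 = Sob.projR (W := Δ) β r (sliceSob (hδ := d) e.1) (sliceSob (hδ := d) e.2) := by
  have hR := two_lt_len h0 hr; constructor
  · refine slIncl_slProj d o (x := Sob.projL (W := Δ) β r (sliceSob (hδ := d) e.1) (sliceSob (hδ := d) e.2)) ?_
    exact (congrArg (dot n) (Sob.projL_eq β hR h0.ne' _ _)).trans (inner_sliceSob d e.1)
  · refine slIncl_slProj d o (x := Sob.projR (W := Δ) β r (sliceSob (hδ := d) e.1) (sliceSob (hδ := d) e.2)) ?_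
    exact (congrArg (dot n') (Sob.projR_eq β hR h0.ne' _ _)).trans (inner_sliceSob d e.2)

lemma isCompl_ker (h0 : 0 < r) (hr : r < glBound) :
    IsCompl (kerAntiglue β d n n' r) (kerGlue β d n n' r) ∧ ∀ e : (pairScale d n n').L 0,
      pairSplice β d o r 0 e ∈ kerAntiglue β d n n' r ∧ e - pairSplice β d o r 0 e ∈ kerGlue β d n n' r := by
  have key : ∀ e : (pairScale d n n').L 0,
      pairSplice β d o r 0 e ∈ kerAntiglue β d n n' r ∧ e - pairSplice β d o r 0 e ∈ kerGlue β d n n' r := by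
    intro e; obtain ⟨h1, h2⟩ := sliceSob_pairSplice β d o h0 hr e; constructor
    · rw [mem_kerAntiglue β d h0.ne', h1, h2]; exact antiglue_proj β h0.ne' _ _
    · rw [mem_kerGlue β d h0.ne']
      have h3 := glue_proj (W := Δ) β h0.ne' (sliceSob (hδ := d) e.1) (sliceSob (hδ := d) e.2)
      rw [← h1, ← h2] at h3
      exact (map_sub (glue β (ℓ r)) ((sliceSob e.1).1, (sliceSob e.2).1) (_, _)).trans (sub_eq_zero.2 h3.symm)
  refine ⟨⟨?_, ?_⟩, key⟩
  · rw [Submodule.disjoint_def]; intro e h1 h2; rw [mem_kerAntiglue β d h0.ne'] at h1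
    rw [mem_kerGlue β d h0.ne'] at h2; obtain ⟨h3, h4⟩ := eq_zero_of_glue_antiglue β h2 h1
    exact Prod.ext (sliceSob_injective d (Subtype.ext h3)) (sliceSob_injective d (Subtype.ext h4))
  · rw [codisjoint_iff, eq_top_iff]; intro e _
    exact Submodule.mem_sup.2 ⟨_, (key e).1, _, (key e).2, add_sub_cancel _ _⟩

lemma glProj_eq (h0 : 0 < r) (hr : r < glBound) (e : (pairScale d n n').L 0) : gluingProj β d n n' r e = pairSplice β d o r 0 e := by
  obtain ⟨h1, h2⟩ := isCompl_ker β d o (n := n) (n' := n') h0 hr; rw [gluingProj, dif_pos h1]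
  conv_lhs => rw [← add_sub_cancel (pairSplice β d o r 0 e) e]
  rw [map_add, Submodule.projection_apply_of_mem_left h1 (h2 e).1, (Submodule.projection_apply_eq_zero_iff h1).2 (h2 e).2, add_zero]

lemma glProj_zero (e : (pairScale d n n').L 0) : gluingProj β d n n' 0 e = e := by
  have h1 : IsCompl (kerAntiglue β d n n' 0) (kerGlue β d n n' 0) := by
    rw [kerAntiglue, kerGlue, if_pos rfl, if_pos rfl]; exact isCompl_top_bot
  rw [gluingProj, dif_pos h1, Submodule.projection_apply_of_mem_left h1]; rw [kerAntiglue, if_pos rfl]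
  trivial

lemma pairSplice_zero (e : (pairScale d n n').L 0) : pairSplice β d o 0 0 e = e := by
  have h1 : (pairProj d o n n').map 0 ((pairIncl d o n n').map 0 e) = e :=
    Prod.ext (slProj_slIncl d o n 0 e.1) (slProj_slIncl d o n' 0 e.2)
  exact (congrArg ((pairProj d o n n').map 0) (projFam_zero β _)).trans h1

lemma glProj_eq' (h : r ∈ Ico 0 glBound) (e : (pairScale d n n').L 0) : gluingProj β d n n' r e = pairSplice β d o r 0 e := by
  rcases h.1.eq_or_lt with rfl | h0
  · rw [glProj_zero, pairSplice_zero]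
  · exact glProj_eq β d o h0 h.2 e

lemma glProj_idem (h : r ∈ Ico 0 glBound) (e : (pairScale d n n').L 0) :
    gluingProj β d n n' r (gluingProj β d n n' r e) = gluingProj β d n n' r e := by
  rcases h.1.eq_or_lt with rfl | h0
  · rw [glProj_zero]
  · rw [gluingProj]
    split_ifs with h1
    · exact Submodule.projection_apply_of_mem_left h1 (Submodule.projection_apply_mem h1 e)
    · rfl

lemma banach_pairScale (o : δ 0 = 0) : IsScBanach (pairScale d n n') := (banach_sliceScale d o n).sum (banach_sliceScale d o n')

lemma isScSplicing_glSplicing (o : δ 0 = 0) : IsScSplicing (gluingSplicing β d n n') where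
  cone := isPartialCone_Ici
  isOpen := ⟨(Iio glBound : Set ℝ), (isOpen_Iio : IsOpen (Iio glBound)), rfl⟩
  banach := banach_pairScale d o
  idem r h e := glProj_idem β d h e
  scOperator r h m := by
    refine ⟨pairSplice β d o r m, fun e => ?_⟩; refine Eq.trans ?_ (glProj_eq' β d o h _).symm
    refine ((pairProj d o n n').toZero m _).trans (congrArg ((pairProj d o n n').map 0) ?_)
    exact (projFam_toZero N _ β r m _).trans (congrArg _ ((pairIncl d o n n').toZero m e))
  smooth := by
    have hE : ScGood (pairScale d n n') := (banach_pairScale d o).scGood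
    have hd : ScDom ((Λ).sum ((ΔΘ).sum ΔΘ)) {p : ℝ × ((ΔΘ).sum ΔΘ).L 0 | p.1 ∈ Ici (0 : ℝ)} :=
      OpFam.scDom_of_interior _ ordConnected_Ici (by rw [interior_Ici]; exact ⟨1, mem_Ioi.2 one_pos⟩)
    have h1 := (projFam_smooth N Δ β).comp (((ScOp.id Λ).prodMap (pairIncl d o n n')).smooth
        {p : ℝ × (pairScale d n n').L 0 | p.1 ∈ Ico (0 : ℝ) glBound}) hd fun p hp => hp.1
    refine ((pairProj d o n n').comp_smooth h1).congr fun p hp => ?_; exact glProj_eq' β d o hp _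

lemma isScSplicing_trivialSplicing (hE : IsScBanach E) : IsScSplicing (trivialSplicing E) where
  cone := isPartialCone_univ
  isOpen := ⟨univ, isOpen_univ, (univ_inter _).symm⟩
  banach := hE
  idem _ _ _ := rfl
  scOperator _ _ _ := ⟨ContinuousLinearMap.id ℝ _, fun _ => rfl⟩
  smooth := ScOp.smooth (ScOp.snd (E := ScScale.const (Fin 0 → ℝ)) (F := E)) _

end Splicing

/-! ### Composition with families of operators -/

lemma ScDiffOn.fam [ScGood T] [ScGood E] [ScGood F] {A : OpFam E F}
    (hP : P.OrdConnected) (hi : (interior P).Nonempty) (hA : ∀ k, A.SF P k) {U : Set (T.L 0)} {r : T.L 0 → ℝ}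
    {f : T.L 0 → E.L 0} (hr : ScDiffOn k T Λ U r) (hf : ScDiffOn k T E U f)
    (hm : ∀ x ∈ U, r x ∈ P) : ScDiffOn k T F U fun x => A.map 0 (r x) (f x) :=
  ((OpFam.scSmoothOn hP hi hA) k).comp (hr.pair hf) (OpFam.scDom_of_interior _ hP hi) hm

lemma ScSmoothOn.fam [ScGood T] [ScGood E] [ScGood F] {A : OpFam E F}
    (hP : P.OrdConnected) (hi : (interior P).Nonempty) (hA : ∀ k, A.SF P k) {U : Set (T.L 0)} {r : T.L 0 → ℝ}
    {f : T.L 0 → E.L 0} (hr : ScSmoothOn T Λ U r) (hf : ScSmoothOn T E U f)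
    (hm : ∀ x ∈ U, r x ∈ P) : ScSmoothOn T F U fun x => A.map 0 (r x) (f x) :=
  fun k => (hr k).fam hP hi hA (hf k) hm

lemma interior_Ici_nonempty : (interior (Ici (0 : ℝ))).Nonempty := by
  rw [interior_Ici]; exact ⟨1, mem_Ioi.2 one_pos⟩

lemma ScDiffOn.contDiff [ScGood T] {A B : Type} [NormedAddCommGroup A] [NormedSpace ℝ A]
    [FiniteDimensional ℝ A] [NormedAddCommGroup B] [NormedSpace ℝ B] [FiniteDimensional ℝ B]
    {V : Set A} (hV : IsOpen V) {g : A → B} (hg : ContDiffOn ℝ ∞ g V) {U : Set (T.L 0)} {f : T.L 0 → A}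
    (hf : ScDiffOn k T (ScScale.const A) U f) (hm : MapsTo f U V) :
    ScDiffOn k T (ScScale.const B) U fun x => g (f x) :=
  ((hg.scSmoothOn hV) k).comp hf (IsOpen.scDom (E := ScScale.const A) hV) hm

lemma ScSmoothOn.contDiff [ScGood T] {A B : Type} [NormedAddCommGroup A] [NormedSpace ℝ A]
    [FiniteDimensional ℝ A] [NormedAddCommGroup B] [NormedSpace ℝ B] [FiniteDimensional ℝ B]
    {V : Set A} (hV : IsOpen V) {g : A → B} (hg : ContDiffOn ℝ ∞ g V) {U : Set (T.L 0)} {f : T.L 0 → A}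
    (hf : ScSmoothOn T (ScScale.const A) U f) (hm : MapsTo f U V) :
    ScSmoothOn T (ScScale.const B) U fun x => g (f x) := fun k => (hf k).contDiff hV hg hm

lemma ScDiffOn.prodConst [ScGood T] {A B : Type} [NormedAddCommGroup A] [NormedSpace ℝ A]
    [FiniteDimensional ℝ A] [NormedAddCommGroup B] [NormedSpace ℝ B] [FiniteDimensional ℝ B] {U : Set (T.L 0)}
    {f : T.L 0 → A} {g : T.L 0 → B}
    (hf : ScDiffOn k T (ScScale.const A) U f) (hg : ScDiffOn k T (ScScale.const B) U g) :
    ScDiffOn k T (ScScale.const (A × B)) U fun x => (f x, g x) := hf.pair hg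

lemma ScSmoothOn.prodConst [ScGood T] {A B : Type} [NormedAddCommGroup A] [NormedSpace ℝ A]
    [FiniteDimensional ℝ A] [NormedAddCommGroup B] [NormedSpace ℝ B] [FiniteDimensional ℝ B] {U : Set (T.L 0)}
    {f : T.L 0 → A} {g : T.L 0 → B}
    (hf : ScSmoothOn T (ScScale.const A) U f) (hg : ScSmoothOn T (ScScale.const B) U g) :
    ScSmoothOn T (ScScale.const (A × B)) U fun x => (f x, g x) := fun k => (hf k).prodConst (hg k)

section

variable {W : Weights}

lemma shiftFam_apply (t : ℝ) (f : ϑ) (s : ℝ) : ((shiftFam N W).map 0 t f : ϑ).1 s = f.1 (s + t) := Sob.S_apply ϖ t f s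

lemma ScDiffOn.shift [ScGood T] {U : Set (T.L 0)} {t : T.L 0 → ℝ}
    {f : T.L 0 → (Θ).L 0} (ht : ScDiffOn k T Λ U t) (hf : ScDiffOn k T Θ U f) :
    ScDiffOn k T Θ U fun x => (shiftFam N W).map 0 (t x) (f x) :=
  ht.fam ordConnected_univ (by simp) shiftFam_SF hf fun _ _ => mem_univ _

lemma ScSmoothOn.shift [ScGood T] {U : Set (T.L 0)} {t : T.L 0 → ℝ}
    {f : T.L 0 → (Θ).L 0} (ht : ScSmoothOn T Λ U t) (hf : ScSmoothOn T Θ U f) :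
    ScSmoothOn T Θ U fun x => (shiftFam N W).map 0 (t x) (f x) := fun k => (ht k).shift (hf k)

lemma ScSmoothOn.gamma (χ : CutFn) [ScGood T] {U : Set (T.L 0)} {r : T.L 0 → ℝ}
    {f : T.L 0 → (Θ).L 0} (hr : ScSmoothOn T Λ U r) (hf : ScSmoothOn T Θ U f)
    (hm : ∀ x ∈ U, 0 ≤ r x) : ScSmoothOn T Θ U fun x => (gammaFam N W χ).map 0 (r x) (f x) :=
  hr.fam ordConnected_Ici interior_Ici_nonempty (gammaFam_SF χ) hf hm

lemma ScSmoothOn.phi {χ : CutFn} (hlo : χ.lo = 0) (hhi : χ.hi = 0) [ScGood T] {U : Set (T.L 0)}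
    {r : T.L 0 → ℝ} {f : T.L 0 → (Θ).L 0} (hr : ScSmoothOn T Λ U r)
    (hf : ScSmoothOn T Θ U f) (hm : ∀ x ∈ U, 0 ≤ r x) :
    ScSmoothOn T Θ U fun x => (phiFam N W χ).map 0 (r x) (f x) :=
  hr.fam ordConnected_Ici interior_Ici_nonempty (phiFam_SF hlo hhi) hf hm

/-- Evaluation at `0`. -/
def ScOp.ev0 (N : ℕ) (W : Weights) : ScOp Θ 𝓥 where
  map m := (Sob.ev (W.δ_nonneg m) (W.one_le m) 0 : 𝓗 →L[ℝ] Vec N)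
  comm _ x := (congrFun (W.incl_apply (N := N) x) 0).symm

/-- A smooth function with compact support as a point of `E_∞`. -/
def smoothPt (W : Weights) {f : Φ} (hf : ContDiff ℝ ∞ f) (hc : HasCompactSupport f) : ScPt Θ where
  pt m := (⟨f, mem_sobolev_of_compactSupp hf hc⟩ : 𝓗)
  comm _ := Subtype.ext (W.incl_apply _)

/-! ### Shifts of transition functions -/

lemma IsTransition.contDiff_deriv (hφ : IsTransition a b φ) : ContDiff ℝ ∞ (deriv φ) := ((contDiff_infty_iff_deriv (𝕜 := ℝ)).1 hφ.1).2

lemma compactSupp_of_ev {f : Φ} (h1 : ∀ᶠ s in atBot, f s = 0) (h2 : ∀ᶠ s in atTop, f s = 0) :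
    HasCompactSupport f := by
  obtain ⟨A, hA⟩ := eventually_atBot.1 h1; obtain ⟨B, hB⟩ := eventually_atTop.1 h2
  refine HasCompactSupport.intro (isCompact_Icc (a := A) (b := B)) fun s hs => ?_
  rw [Set.mem_Icc, not_and_or, not_le, not_le] at hs; exact hs.elim (fun h => hA s h.le) fun h => hB s h.le

lemma IsTransition.compactSupp_deriv (hφ : IsTransition a b φ) : HasCompactSupport (deriv φ) := by
  refine compactSupp_of_ev ?_ ?_
  · obtain ⟨A, hA⟩ := eventually_atBot.1 hφ.2.1; filter_upwards [eventually_lt_atBot A] with s hs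
    have : φ =ᶠ[𝓝 s] fun _ => a := by
      filter_upwards [Iio_mem_nhds hs] with x hx using hA x (le_of_lt hx)
    rw [this.deriv_eq, deriv_const]
  · obtain ⟨A, hA⟩ := eventually_atTop.1 hφ.2.2; filter_upwards [eventually_gt_atTop A] with s hs
    have : φ =ᶠ[𝓝 s] fun _ => b := by
      filter_upwards [Ioi_mem_nhds hs] with x hx using hA x (le_of_lt hx)
    rw [this.deriv_eq, deriv_const]

variable (W) {a b : Vec N} {φ : Φ} (hφ : IsTransition a b φ)

/-- The derivative of a transition function. -/
def IsTransition.derivPt : ScPt Θ := smoothPt W hφ.contDiff_deriv hφ.compactSupp_deriv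

/-- `φ(· + t) - φ`. -/
def IsTransition.shDiff (m : ℕ) (t : ℝ) : 𝓗 := ∫ σ in (0 : ℝ)..t, Sob.S (W.one_le m) σ ((hφ.derivPt W).pt m : 𝓗)

lemma IsTransition.cont_integrand (m : ℕ) : Continuous fun σ : ℝ =>
    Sob.S (W.one_le m) σ ((hφ.derivPt W).pt m : 𝓗) :=
  (Sob.cont_S (W.one_le m)).comp (Continuous.prodMk_left _)

lemma IsTransition.cont_shDiff (m : ℕ) : Continuous (hφ.shDiff W m) :=
  intervalIntegral.continuous_primitive (fun _ _ => (hφ.cont_integrand W m).intervalIntegrable _ _) 0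

lemma IsTransition.shDiff_apply (m : ℕ) (t s : ℝ) : (hφ.shDiff W m t).1 s = φ (s + t) - φ s := by
  have := Sob.completeSpace (N := N) (δ := W.δ m) (W.one_le m)
  let e : 𝓗 →L[ℝ] Vec N := Sob.ev (W.δ_nonneg m) (W.one_le m) s
  have h1 := e.intervalIntegral_comp_comm ((hφ.cont_integrand W m).intervalIntegrable (μ := volume) 0 t)
  refine h1.symm.trans ?_
  have h2 : ∀ σ : ℝ, e (Sob.S (W.one_le m) σ ((hφ.derivPt W).pt m : 𝓗)) = deriv φ (s + σ) := fun σ => Sob.S_apply (W.one_le m) σ _ s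
  simp only [h2]; have h3 : ∀ σ ∈ uIcc 0 t, HasDerivAt (fun σ => φ (s + σ)) (deriv φ (s + σ)) σ := fun σ _ =>
    (hφ.1.differentiable (by simp) (s + σ)).hasDerivAt.comp_const_add s σ
  rw [intervalIntegral.integral_eq_sub_of_hasDerivAt h3, add_zero]
  exact (hφ.contDiff_deriv.continuous.comp (continuous_const.add continuous_id)).intervalIntegrable _ _

/-- The family `c ↦ c (φ(· + t) - φ)`. -/
def IsTransition.shiftDiffFam : OpFam Λ Θ where
  map m t := ((ContinuousLinearMap.id ℝ ℝ).smulRight (hφ.shDiff W m t) : ℝ →L[ℝ] 𝓗)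
  comm m t (c : ℝ) := by
    refine Sob.ext fun s => (congrFun (W.incl_apply (N := N) _) s).trans ?_
    change c • (hφ.shDiff W (m + 1) t).1 s = c • (hφ.shDiff W m t).1 s; rw [hφ.shDiff_apply, hφ.shDiff_apply]

/-- The operator `c ↦ c φ'`. -/
def IsTransition.derivOp : ScOp Λ Θ where
  map m := ((ContinuousLinearMap.id ℝ ℝ).smulRight ((hφ.derivPt W).pt m) : ℝ →L[ℝ] (Θ).L m)
  comm m (c : ℝ) := by
    change (Θ).incl m (c • (hφ.derivPt W).pt (m + 1)) = c • (hφ.derivPt W).pt m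
    rw [map_smul, (hφ.derivPt W).comm]

lemma IsTransition.shDiffFam_SF (k : ℕ) : (hφ.shiftDiffFam W).SF univ k := by
  have hc : (hφ.shiftDiffFam W).IsCont univ := fun m => by
    have : Continuous fun p : ℝ × ℝ => p.2 • hφ.shDiff W m p.1 := continuous_snd.smul ((hφ.cont_shDiff W m).comp continuous_fst)
    exact this.continuousOn
  cases k with
  | zero => exact hc
  | succ k =>
    have hD : ((shiftFam N W).comp (hφ.derivOp W)).SF univ k := (shiftFam_SF k).comp _
    refine ⟨hc, (shiftFam N W).comp (hφ.derivOp W), hasDeriv_of_pointwise ordConnected_univ hc hD.isCont fun (c : ℝ) s r _ => ?_, hD⟩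
    have h1 : HasDerivAt (fun r => c • (φ (s + r) - φ s)) (c • deriv φ (s + r)) r :=
      (((hφ.1.differentiable (by simp) (s + r)).hasDerivAt.comp_const_add s r).sub_const _).const_smul c
    refine (h1.congr_of_eventuallyEq (Eventually.of_forall fun r => ?_)).congr_deriv ?_
    · change c • (hφ.shDiff W 0 r).1 s = _; rw [hφ.shDiff_apply]
    · exact (Sob.S_apply ϖ r (((hφ.derivOp W).map 0 c) : ϑ) s).symm

lemma IsTransition.smooth_shDiff [ScGood T] {U : Set (T.L 0)} {t : T.L 0 → ℝ}
    (ht : ScSmoothOn T Λ U t) : ScSmoothOn T Θ U fun x => hφ.shDiff W 0 (t x) := by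
  have h1 := ht.fam ordConnected_univ (by simp) (hφ.shDiffFam_SF W)
    (ScPt.smooth T (F := Λ) ⟨fun _ => (1 : ℝ), fun _ => rfl⟩ U) fun _ _ => mem_univ _
  exact h1.congr fun x _ => (one_smul ℝ (hφ.shDiff W 0 (t x))).symm

end

/-! ### Crossing times -/

section Crossing

variable {W : Weights}

lemma exists_slope (hφ : ContDiff ℝ 1 φ) {δ : ℝ} (d : 0 ≤ δ) (hk : 2 ≤ k) (f₀ : Sob N k δ) (h : 0 < dot n (deriv φ t₀ + deriv f₀.1 t₀)) :
    ∃ κ > 0, ∃ ε > 0, ∀ f : Sob N k δ, ‖f - f₀‖ < ε → ∀ n' : Vec N, ‖n' - n‖ < ε → ∀ s, |s - t₀| ≤ ε →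
      κ ≤ dot n' (deriv φ s + deriv f.1 s) := by
  have hk1 : 1 ≤ k - 1 := by omega
  let D : Sob N k δ →L[ℝ] Sob N (k - 1) δ := Sob.D hk1 (by omega) le_rfl
  have hc : Continuous fun p : Sob N k δ × Vec N × ℝ => dot p.2.1 (deriv φ p.2.2 + deriv p.1.1 p.2.2) := by
    have h1 : Continuous fun p : Sob N (k - 1) δ × ℝ => p.1.1 p.2 := by
      rw [continuous_iff_continuousAt]; rintro ⟨g₀, s₀⟩; rw [ContinuousAt, tendsto_iff_norm_sub_tendsto_zero]
      have h2 : Tendsto (fun p : Sob N (k - 1) δ × ℝ => 2 * ‖p.1 - g₀‖ + ‖g₀.1 p.2 - g₀.1 s₀‖) (𝓝 (g₀, s₀)) (𝓝 0) :=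
        Continuous.tendsto' (by have := g₀.2.1; fun_prop) _ _ (by simp)
      refine squeeze_zero (fun _ => norm_nonneg _) (fun p => ?_) h2
      have h3 := Sob.norm_apply_le d hk1 (p.1 - g₀) p.2; change ‖p.1.1 p.2 - g₀.1 p.2‖ ≤ _ at h3
      refine (norm_sub_le_norm_sub_add_norm_sub _ (g₀.1 p.2) _).trans (by linarith)
    have h2 : Continuous fun p : Sob N k δ × Vec N × ℝ => (D p.1).1 p.2.2 :=
      h1.comp ((D.continuous.comp continuous_fst).prodMk (continuous_snd.comp continuous_snd))
    have h3 : Continuous fun p : Sob N k δ × Vec N × ℝ => deriv φ p.2.2 :=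
      (hφ.continuous_deriv (by simp)).comp (continuous_snd.comp continuous_snd)
    exact (continuous_fst.comp continuous_snd).inner (h3.add h2)
  have h1 : ∀ᶠ p : Sob N k δ × Vec N × ℝ in 𝓝 (f₀, n, t₀), dot n (deriv φ t₀ + deriv f₀.1 t₀) / 2 <
      dot p.2.1 (deriv φ p.2.2 + deriv p.1.1 p.2.2) :=
    (hc.tendsto (f₀, n, t₀)).eventually (lt_mem_nhds (half_lt_self h))
  obtain ⟨ε, hε, hb⟩ := Metric.eventually_nhds_iff.1 h1
  refine ⟨_, half_pos h, ε / 2, half_pos hε, fun f hf n' hn s hs => (hb (y := (f, n', s)) ?_).le⟩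
  rw [Prod.dist_eq, Prod.dist_eq, max_lt_iff, max_lt_iff, dist_eq_norm, dist_eq_norm, Real.dist_eq]
  exact ⟨by linarith, by linarith, by linarith⟩

lemma slope_mul_le {w : Φ} (hw : Differentiable ℝ w)
    (h : ∀ s, |s - t₀| ≤ ε → κ ≤ dot n (deriv w s)) (hs : |s - t₀| ≤ ε) (ht : |t - t₀| ≤ ε)
    (hst : s ≤ t) : κ * (t - s) ≤ dot n (w t) - dot n (w s) := by
  have hd : ∀ x, HasDerivAt (fun x => dot n (w x)) (dot n (deriv w x)) x := fun x => by
    have := (hasDerivAt_const x n).inner ℝ (hw x).hasDerivAt; simpa using this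
  refine (convex_Icc s t).mul_sub_le_image_sub_of_le_deriv (fun x _ => (hd x).continuousAt.continuousWithinAt)
    (fun x _ => (hd x).differentiableAt.differentiableWithinAt) (fun x hx => ?_) s (left_mem_Icc.2 hst) t
    (right_mem_Icc.2 hst) hst
  rw [(hd x).deriv]; rw [interior_Icc] at hx; rw [abs_le] at hs ht
  exact h x (abs_le.2 ⟨by linarith [hx.1], by linarith [hx.2]⟩)

lemma eq_of_slope {w : Φ} (hw : Differentiable ℝ w) (hκ : 0 < κ)
    (h : ∀ s, |s - t₀| ≤ ε → κ ≤ dot n (deriv w s)) (hs : |s - t₀| ≤ ε) (ht : |t - t₀| ≤ ε)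
    (hst : dot n (w s) = dot n (w t)) : s = t := by
  rcases le_total s t with hle | hle
  · have := slope_mul_le hw h hs ht hle; nlinarith
  · have := slope_mul_le hw h ht hs hle; nlinarith

lemma exists_crossing {w : Φ} (hw : Differentiable ℝ w) {p : Vec N} (hε : 0 < ε)
    (h : ∀ s, |s - t₀| ≤ ε → κ ≤ dot n (deriv w s)) (h0 : |dot n (w t₀ - p)| ≤ κ * ε) :
    ∃ t, |t - t₀| ≤ ε ∧ dot n (w t - p) = 0 := by
  have hc : Continuous fun t => dot n (w t - p) := continuous_const.inner (hw.continuous.sub continuous_const)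
  have e1 := slope_mul_le hw h (s := t₀) (t := t₀ + ε) (by simpa using hε.le) (by simp [abs_of_pos hε]) (by linarith)
  have e2 := slope_mul_le hw h (s := t₀ - ε) (t := t₀) (by simp [abs_of_pos hε]) (by simpa using hε.le) (by linarith)
  rw [abs_le, inner_sub_right] at h0
  have h1 : (0 : ℝ) ∈ Icc (dot n (w (t₀ - ε) - p)) (dot n (w (t₀ + ε) - p)) := by
    rw [inner_sub_right, inner_sub_right]; constructor <;> nlinarith
  obtain ⟨t, ht, he⟩ := intermediate_value_Icc (by linarith) hc.continuousOn h1
  exact ⟨t, abs_le.2 ⟨by linarith [ht.1], by linarith [ht.2]⟩, he⟩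

lemma ScDiffOn.eval [ScGood T] {U : Set (T.L 0)} {t : T.L 0 → ℝ} {f : T.L 0 → ϑ} (ht : ScDiffOn k T Λ U t) (hf : ScDiffOn k T Θ U f) :
    ScDiffOn k T 𝓥 U fun x => (f x).1 (t x) :=
  ((ScOp.ev0 N W).comp_scDiffOn (ht.shift hf)).congr fun x _ => by
    have h1 := shiftFam_apply (W := W) (t x) (f x) 0; rw [zero_add] at h1; exact h1.symm

lemma crossing_smooth (hφ : ContDiff ℝ ∞ φ) {p : Vec N} (hκ : 0 < κ) {U : Set ((Θ).L 0)} (hU : IsOpen U) {τ : (Θ).L 0 → ℝ}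
    (hs : ∀ f : ϑ, f ∈ U → ∀ s, |s - t₀| ≤ ε → κ ≤ dot n (deriv φ s + deriv f.1 s))
    (hτ : ∀ f ∈ U, |τ f - t₀| ≤ ε)
    (h0 : ∀ f : ϑ, f ∈ U → dot n (φ (τ f) + f.1 (τ f) - p) = 0) :
    ScSmoothOn Θ Λ U τ := by
  have hdiff : ∀ f : ϑ, Differentiable ℝ (φ + f.1) := fun f =>
    (hφ.differentiable (by simp)).add ((f.contDiff_one (W.two_le 0)).1.differentiable (by simp))
  have hderiv : ∀ (f : ϑ) s, deriv (φ + f.1) s = deriv φ s + deriv f.1 s := fun f s =>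
    deriv_add (hφ.differentiable (by simp) s) ((f.contDiff_one (W.two_le 0)).1.differentiable (by simp) s)
  have hlip : ∀ f g : ϑ, f ∈ U → g ∈ U → |τ f - τ g| ≤ 2 * ‖n‖ / κ * ‖f - g‖ := by
    intro f g hf hg; have h1 : κ * |τ f - τ g| ≤ |dot n ((φ + f.1) (τ f)) - dot n ((φ + f.1) (τ g))| := by
      have hs' : ∀ s, |s - t₀| ≤ ε → κ ≤ dot n (deriv (φ + f.1) s) := fun s h => by
        rw [hderiv]; exact hs f hf s h
      rcases le_total (τ g) (τ f) with hle | hle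
      · rw [abs_of_nonneg (sub_nonneg.2 hle)]
        exact (slope_mul_le (hdiff f) hs' (hτ g hg) (hτ f hf) hle).trans (le_abs_self _)
      · rw [abs_sub_comm, abs_of_nonneg (sub_nonneg.2 hle), abs_sub_comm]
        exact (slope_mul_le (hdiff f) hs' (hτ f hf) (hτ g hg) hle).trans (le_abs_self _)
    have h2 : dot n ((φ + f.1) (τ f)) - dot n ((φ + f.1) (τ g)) = - dot n ((f - g).1 (τ g)) := by
      have e1 := h0 f hf; have e2 := h0 g hg; have e3 : (f - g).1 (τ g) = f.1 (τ g) - g.1 (τ g) := rfl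
      simp only [inner_sub_right, inner_add_right] at e1 e2
      simp only [e3, Pi.add_apply, inner_sub_right, inner_add_right]; linarith
    rw [h2, abs_neg] at h1; have h3 := (abs_real_inner_le_norm n ((f - g).1 (τ g))).trans
      (mul_le_mul_of_nonneg_left (Sob.norm_apply_le (W.δ_nonneg 0) ϖ (f - g) (τ g)) (norm_nonneg _))
    rw [div_mul_eq_mul_div, le_div_iff₀ hκ]; linarith
  have hcont : ContinuousOn τ U := (LipschitzOnWith.of_dist_le_mul (K := ⟨2 * ‖n‖ / κ, by positivity⟩) fun f hf g hg => by
    rw [dist_eq_norm, dist_eq_norm]; exact hlip f g hf hg).continuousOn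
  have hsc0 : ScContOn Θ Λ U τ := fun m =>
    ⟨fun x => τ ((Θ).toZero m x), hcont.comp ((Θ).toZero m).continuous.continuousOn fun x hx => hx,
      fun x _ => ScScale.const_toZero ℝ m _⟩
  let Dop : ScOp (Θ).up Θ := (ScOp.inc N W.le_half).comp (ScOp.D N W)
  have hDop : ∀ (x : Ω₁), (Dop.map 0 x : ϑ).1 = deriv x.1 := fun x =>
    (Sob.inc_apply ϖ le_rfl (W.δ_lt 0).le _).trans (Sob.D_apply ϖ (W.k_lt 0) le_rfl x)
  have hincl : ∀ (x : Ω₁), ((Θ).incl 0 x : ϑ).1 = x.1 := fun x => W.incl_apply x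
  let den : (Θ).L 1 → ℝ := fun x : Ω₁ =>
    dot n (deriv φ (τ ((Θ).incl 0 x)) + deriv x.1 (τ ((Θ).incl 0 x)))
  have hden_pos : ∀ x : Ω₁, (Θ).incl 0 x ∈ U → 0 < den x := fun x hx => by
    have h1 := hs _ hx (τ ((Θ).incl 0 x)) (hτ _ hx); rw [hincl] at h1; exact hκ.trans_le h1
  let num : (Θ).tangent.L 0 → ℝ := fun q : Ω₁ × ϑ =>
    dot n (q.2.1 (τ ((Θ).incl 0 q.1)))
  have hT : IsScTangentMap Θ Λ U τ (fun q : (Θ).L 1 × (Θ).L 0 => ((τ ((Θ).incl 0 q.1), -num q / den q.1) : ℝ × ℝ)) := by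
    intro (x : Ω₁) hx; have hc := hden_pos x hx; set c := den x with hcdef
    let i₀ : Ω₁ →L[ℝ] ϑ := (Θ).incl 0; let t : ℝ := τ (i₀ x); let t' : Ω₁ → ℝ := fun h => τ (i₀ (x + h))
    let D : ϑ →L[ℝ] ℝ := -(c⁻¹ • (innerSL ℝ n).comp (Sob.ev (W.δ_nonneg 0) ϖ t))
    have hD : ∀ h : ϑ, D h = -(c⁻¹ * dot n (h.1 t)) := fun h => rfl; refine ⟨D, fun h => ⟨rfl, ?_⟩, ?_⟩
    · refine Eq.trans ?_ (hD h).symm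
      change -dot n (Subtype.val (p := fun f => f ∈ sobolev N (W.k 0) (W.δ 0)) h t) / c = _
      rw [neg_div, div_eq_inv_mul]
    change (fun h : Ω₁ => t' h - t - D (i₀ h)) =o[𝓝[{h : Ω₁ | i₀ (x + h) ∈ U}] 0] fun h => h
    set l := 𝓝[{h : Ω₁ | i₀ (x + h) ∈ U}] 0 with hl; have hO : (fun h => t' h - t) =O[l] fun h => h := by
      refine Asymptotics.IsBigO.of_bound (2 * ‖n‖ / κ * ‖i₀‖) ?_
      filter_upwards [self_mem_nhdsWithin] with h hh
      have h1 : |t' h - t| ≤ 2 * ‖n‖ / κ * ‖i₀ (x + h) - i₀ x‖ := hlip _ _ hh hx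
      have e1 : i₀ (x + h) - i₀ x = i₀ h := by rw [map_add]; abel
      rw [e1] at h1; refine h1.trans ?_; rw [mul_assoc]
      exact mul_le_mul_of_nonneg_left (i₀.le_opNorm h) (by positivity)
    have hid : Tendsto (fun h : Ω₁ => h) l (𝓝 0) := nhdsWithin_le_nhds
    have ht0 : Tendsto (fun h => t' h - t) l (𝓝 0) := hO.trans_tendsto hid
    have ht : Tendsto t' l (𝓝 t) := by simpa using ht0.add_const t
    have hG : HasDerivAt (fun s => dot n (φ s + x.1 s)) c t := by
      have h1 := (hasDerivAt_const t n).inner ℝ ((hφ.differentiable (by simp) t).hasDerivAt.add (x.hasDerivAt (W.two_le 1) t))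
      refine h1.congr_deriv ?_; rw [inner_zero_left, add_zero]
      rfl
    have hA : (fun h => dot n (φ (t' h) + x.1 (t' h)) - dot n (φ t + x.1 t) - (t' h - t) • c) =o[l] fun h => h :=
      (((hasDerivAt_iff_isLittleO.1 hG).comp_tendsto ht).trans_isBigO hO)
    have hB : (fun h : Ω₁ => dot n ((i₀ h).1 t) - dot n ((i₀ h).1 (t' h))) =o[l] fun h => h := by
      have h1 : Tendsto (fun h => ‖n‖ * (√|t' h - t| * ‖i₀‖)) l (𝓝 0) :=
        (Continuous.tendsto' (f := fun y : ℝ => ‖n‖ * (√|y| * ‖i₀‖)) (by fun_prop) 0 0 (by simp)).comp ht0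
      refine Asymptotics.isLittleO_iff.2 fun e he => ?_
      filter_upwards [h1.eventually (gt_mem_nhds he)] with h hh
      have h2 := Sob.norm_sub_le (W.δ_nonneg 0) ϖ (i₀ h) t (t' h)
      rw [← inner_sub_right, Real.norm_eq_abs]; refine (abs_real_inner_le_norm _ _).trans ?_
      rw [norm_sub_rev]
      calc ‖n‖ * ‖(i₀ h).1 (t' h) - (i₀ h).1 t‖ ≤ ‖n‖ * (√|t' h - t| * (‖i₀‖ * ‖h‖)) :=
            mul_le_mul_of_nonneg_left (h2.trans (mul_le_mul_of_nonneg_left (i₀.le_opNorm h) (Real.sqrt_nonneg _))) (norm_nonneg _)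
        _ = ‖n‖ * (√|t' h - t| * ‖i₀‖) * ‖h‖ := by ring
        _ ≤ e * ‖h‖ := mul_le_mul_of_nonneg_right hh.le (norm_nonneg _)
    have hE := (hB.sub hA).const_mul_left c⁻¹; refine hE.congr' ?_ (Eventually.of_forall fun _ => rfl)
    filter_upwards [self_mem_nhdsWithin] with h hh; have e1 := h0 (i₀ x) hx; have e2 := h0 (i₀ (x + h)) hh
    have e3 : (i₀ (x + h)).1 (t' h) = x.1 (t' h) + (i₀ h).1 (t' h) := by
      rw [map_add]; exact congrArg (· + (i₀ h).1 (t' h)) (congrFun (hincl x) (t' h))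
    change dot n (φ (t' h) + (i₀ (x + h)).1 (t' h) - p) = 0 at e2
    change dot n (φ t + (i₀ x).1 t - p) = 0 at e1; rw [e3] at e2
    rw [show (i₀ x).1 = x.1 from hincl x] at e1; rw [hD]
    simp only [inner_sub_right, inner_add_right, smul_eq_mul] at e1 e2 ⊢; field_simp; linarith
  intro k
  induction k with
  | zero => exact hsc0
  | succ k ih =>
    refine ⟨hsc0, _, hT, ?_⟩; have i1 : ScDiffOn k (Θ).tangent (Θ).up ((Θ).tangentSet U)
      (fun q : (Θ).L 1 × (Θ).L 0 => q.1) := (ScOp.tangentFst Θ).scDiffOn k _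
    have i2 : ScDiffOn k (Θ).tangent Θ ((Θ).tangentSet U) (fun q : (Θ).L 1 × (Θ).L 0 => q.2) := (ScOp.tangentSnd Θ).scDiffOn k _
    have i3 : ScDiffOn k (Θ).tangent Λ ((Θ).tangentSet U) (fun q : (Θ).L 1 × (Θ).L 0 => τ ((Θ).incl 0 q.1)) :=
      ih.comp ((ScOp.incl Θ).comp_scDiffOn i1) hU.scDom fun q hq => hq
    have i4 : ScDiffOn k (Θ).tangent 𝓥 ((Θ).tangentSet U) (fun q : Ω₁ × ϑ => q.2.1 (τ ((Θ).incl 0 q.1))) := i3.eval i2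
    have i5 : ScDiffOn k (Θ).tangent 𝓥 ((Θ).tangentSet U) (fun q : Ω₁ × ϑ => deriv q.1.1 (τ ((Θ).incl 0 q.1))) :=
      (i3.eval (Dop.comp_scDiffOn i1)).congr fun q _ => congrFun (hDop q.1).symm _
    have hg : ContDiffOn ℝ ∞ (fun y : Vec N × Vec N × ℝ => -dot n y.1 / dot n (deriv φ y.2.2 + y.2.1))
        {y | dot n (deriv φ y.2.2 + y.2.1) ≠ 0} := by
      have hd : ContDiff ℝ ∞ fun y : Vec N × Vec N × ℝ => dot n (deriv φ y.2.2 + y.2.1) :=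
        contDiff_const.inner ℝ ((((contDiff_infty_iff_deriv (𝕜 := ℝ)).1 hφ).2.comp
          (contDiff_snd.comp contDiff_snd)).add (contDiff_fst.comp contDiff_snd))
      exact ((contDiff_const.inner ℝ contDiff_fst).neg).contDiffOn.div hd.contDiffOn fun y hy => hy
    have hV : IsOpen {y : Vec N × Vec N × ℝ | dot n (deriv φ y.2.2 + y.2.1) ≠ 0} := by
      refine isOpen_ne_fun ?_ continuous_const
      exact continuous_const.inner (((((contDiff_infty_iff_deriv (𝕜 := ℝ)).1 hφ).2.continuous).comp
        (continuous_snd.comp continuous_snd)).add (continuous_fst.comp continuous_snd))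
    exact ScDiffOn.pair i3 ((i4.prodConst (i5.prodConst i3)).contDiff hV hg fun q hq => (hden_pos q.1 hq).ne')

end Crossing

/-! ### Change of the gluing parameter -/

/-- The gluing parameter whose gluing length is larger by `d`. -/
def recPar (d r : ℝ) : ℝ := r / (1 + r * Real.log (1 + d * expNegInvGlue r))

/-- The domain of `recPar`. -/
def recutDom : Set (ℝ × ℝ) := {p | 0 < 1 + p.1 * expNegInvGlue p.2} ∩ {p | 0 < 1 + p.2 * Real.log (1 + p.1 * expNegInvGlue p.2)}

lemma contDiffOn_recPar : ContDiffOn ℝ ∞ (fun p : ℝ × ℝ => recPar p.1 p.2) recutDom := by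
  have h1 : ContDiff ℝ ∞ fun p : ℝ × ℝ => 1 + p.1 * expNegInvGlue p.2 :=
    contDiff_const.add (contDiff_fst.mul (expNegInvGlue.contDiff.comp contDiff_snd))
  refine contDiff_snd.contDiffOn.div (contDiffOn_const.add (contDiff_snd.contDiffOn.mul
    (h1.contDiffOn.log fun p hp => ne_of_gt hp.1))) fun p hp => ne_of_gt hp.2

lemma isOpen_recutDom : IsOpen recutDom := by
  have h1 : Continuous fun p : ℝ × ℝ => 1 + p.1 * expNegInvGlue p.2 :=
    continuous_const.add (continuous_fst.mul ((expNegInvGlue.contDiff (n := 0)).continuous.comp continuous_snd))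
  refine ContinuousOn.isOpen_inter_preimage
    ?_ (isOpen_Ioi.preimage h1) isOpen_Ioi
  exact continuousOn_const.add (continuous_snd.continuousOn.mul
    (h1.continuousOn.log fun p hp => hp.ne'))

lemma mem_recutDom_zero (d : ℝ) : (d, 0) ∈ recutDom := by
  constructor <;> simp

lemma recPar_zero (d : ℝ) : recPar d 0 = 0 := by simp [recPar]

lemma recPar_pos {d : ℝ} (h : (d, r) ∈ recutDom) (hr : 0 < r) : 0 < recPar d r := div_pos hr h.2

lemma len_recPar {d : ℝ} (h : (d, r) ∈ recutDom) (hr : 0 < r) : ℓ (recPar d r) = ℓ r + d := by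
  have h1 := h.1; have h3 : expNegInvGlue r = exp (-(1 / r)) := by
    rw [expNegInvGlue, if_neg (not_le.2 hr), one_div]
  have h4 : 1 / recPar d r = 1 / r + Real.log (1 + d * expNegInvGlue r) := by
    rw [recPar]; field_simp
  rw [gluingLength, gluingLength, h4, Real.exp_add, Real.exp_log h1, mul_add, h3, mul_left_comm,
    ← Real.exp_add, add_neg_cancel, Real.exp_zero]
  ring

/-- The inverse of `gluingLength`. -/
def glParam (R : ℝ) : ℝ := 1 / Real.log (R + exp 1)

lemma glParam_pos (hR : 0 < R) : 0 < glParam R := one_div_pos.2 (Real.log_pos (by linarith [Real.add_one_le_exp 1]))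

lemma len_glParam (hR : 0 < R) : ℓ (glParam R) = R := by rw [gluingLength, glParam, one_div_one_div, Real.exp_log (by positivity)]; ring

lemma glParam_len (r : ℝ) : glParam (ℓ r) = r := by
  rw [glParam, gluingLength, sub_add_cancel, Real.log_exp, one_div_one_div]

lemma glParam_lt (hR : 2 < R) : glParam R < glBound :=
  one_div_lt_one_div_of_lt (one_pos.trans one_lt_log) (Real.log_lt_log (by positivity) (by linarith))

lemma contDiffOn_glParam : ContDiffOn ℝ ∞ glParam (Ioi 0) := by
  refine contDiffOn_const.div ((contDiff_id.add contDiff_const).contDiffOn.log fun R hR => ?_) fun R (hR : 0 < R) => ?_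
  · exact (add_pos hR (Real.exp_pos 1)).ne'
  · exact (Real.log_pos (show 1 < R + exp 1 by linarith [Real.add_one_le_exp 1])).ne'

lemma contDiffOn_len : ContDiffOn ℝ ∞ ℓ (Ioi 0) :=
  ((contDiffOn_const.div contDiff_id.contDiffOn fun r hr => hr.ne').exp).sub contDiffOn_const

/-! ### Moving the cut -/

section Recut

variable {W : Weights}

/-- A cut-off function that is `1` on `[-A, A]`. -/
def plateau (A : ℝ) : CutFn := (stepFn.shift (-(A + 1))).mul (stepFn.refl.shift (A + 1))

lemma plateau_apply (A s : ℝ) : (plateau A).toFun s = stepFn.toFun (s + (A + 1)) * stepFn.toFun (A + 1 - s) := by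
  change stepFn.toFun _ * stepFn.toFun _ = _; rw [sub_neg_eq_add, neg_sub]

lemma plateau_eq_one {A : ℝ} (h : |s| ≤ A) : (plateau A).toFun s = 1 := by
  rw [abs_le] at h; rw [plateau_apply, stepFn_eq_one (by linarith), stepFn_eq_one (by linarith), one_mul]

lemma plateau_neg (A s : ℝ) : (plateau A).toFun (-s) = (plateau A).toFun s := by
  rw [plateau_apply, plateau_apply, mul_comm, sub_neg_eq_add, add_comm _ s, neg_add_eq_sub]

lemma plateau_lo (A : ℝ) : (plateau A).lo = 0 := zero_mul _

lemma plateau_hi (A : ℝ) : (plateau A).hi = 0 := mul_zero _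

/-- Multiplication with a cut-off function. -/
def ScOp.mulCut (N : ℕ) (W : Weights) (χ : CutFn) : ScOp Θ Θ where
  map m := (Sob.ms χ 0 (W.one_le m) le_rfl le_rfl : 𝓗 →L[ℝ] 𝓗)
  comm m (x : Sob N (W.k (m + 1)) (W.δ (m + 1))) := by
    refine Sob.ext fun s => (congrFun (W.incl_apply (N := N) _) s).trans ?_
    exact congrArg (fun g : Φ => χ s • g (s + 0)) (W.incl_apply x).symm

lemma IsTransition.endPt_aux (hφ : IsTransition a b φ) :
    ContDiff ℝ ∞ (fun s => stepFn.toFun s • (φ s - b)) ∧ HasCompactSupport fun s => stepFn.toFun s • (φ s - b) := by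
  refine ⟨stepFn.smooth.smul (hφ.1.sub contDiff_const), compactSupp_of_ev ?_ ?_⟩
  · filter_upwards [eventually_le_atBot (-1)] with s hs; rw [stepFn_eq_zero hs, zero_smul]
  · filter_upwards [hφ.2.2] with s hs; rw [hs, sub_self, smul_zero]

/-- A smooth function with compact support. -/
def Sob.ofSmooth {δ : ℝ} {f : Φ} (hf : ContDiff ℝ ∞ f) (hc : HasCompactSupport f) : Sob N k δ := ⟨f, mem_sobolev_of_compactSupp hf hc⟩

variable (β : Cutoff)

variable (W) in
/-- The part of the path `φ + f` near `+∞`. -/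
def IsTransition.tailFn (hφ : IsTransition a b φ) (f : ϑ) :
    ϑ :=
  Sob.ofSmooth hφ.endPt_aux.1 hφ.endPt_aux.2 + Sob.ms stepFn 0 ϖ le_rfl le_rfl f

lemma IsTransition.tailFn_apply (hφ : IsTransition a b φ) (f : ϑ) (hs : 1 ≤ s) : (hφ.tailFn W f).1 s = φ s + f.1 s - b := by
  change stepFn.toFun s • _ + stepFn.toFun s • f.1 _ = _
  rw [stepFn_eq_one hs, one_smul, one_smul]; abel_nf

lemma IsTransition.tailFn_smooth (hφ : IsTransition a b φ) [ScGood T] {U : Set (T.L 0)} {f : T.L 0 → ϑ} (hf : ScSmoothOn T Θ U f) :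
    ScSmoothOn T Θ U fun x => hφ.tailFn W (f x) :=
  ScSmoothOn.add (ScPt.smooth T (smoothPt W hφ.endPt_aux.1 hφ.endPt_aux.2) U) ((ScOp.mulCut N W _).comp_smooth hf)

lemma IsTransition.refl (hφ : IsTransition a b φ) : IsTransition b a fun s => φ (-s) :=
  ⟨hφ.1.comp contDiff_neg, tendsto_neg_atBot_atTop.eventually hφ.2.2, tendsto_neg_atTop_atBot.eventually hφ.2.1⟩

/-- `s ↦ (β/γ)(x) (β(x + c) - β(x)) (Y(s) - Z(s - R))` with `x = s - R/2`, cut off for large `x`. -/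
def recutRho (A r c : ℝ) (Y Z : ϑ) : ϑ :=
  let G : (Θ).L 0 := (gammaFam N W (plateau A)).map 0 r Y - (phiFam N W (plateau A)).map 0 r Z
  (gammaFam N W β.cutP).map 0 r ((shiftFam N W).map 0 c ((gammaFam N W β.cut).map 0 r ((shiftFam N W).map 0 (-c) G)) -
      (gammaFam N W β.cut).map 0 r G)

lemma recutRho_smooth (A : ℝ) [ScGood T] {U : Set (T.L 0)} {r c : T.L 0 → ℝ}
    {Y Z : T.L 0 → ϑ} (hr : ScSmoothOn T Λ U r) (h0 : ∀ x ∈ U, 0 ≤ r x)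
    (hc : ScSmoothOn T Λ U c) (hY : ScSmoothOn T Θ U Y) (hZ : ScSmoothOn T Θ U Z) :
    ScSmoothOn T Θ U fun x => recutRho β A (r x) (c x) (Y x) (Z x) := by
  have hG := (hr.gamma (plateau A) hY h0).sub (hr.phi (plateau_lo A) (plateau_hi A) hZ h0)
  exact hr.gamma β.cutP ((hc.shift (hr.gamma β.cut (hc.neg.shift hG) h0)).sub (hr.gamma β.cut hG h0)) h0

lemma recutRho_apply (A : ℝ) (hr : r ≠ 0) (c : ℝ) (Y Z : ϑ) (s : ℝ) :
    (recutRho β A r c Y Z).1 s = (β.cutP.toFun (s - ℓ r / 2) * ((β (s - ℓ r / 2 + c) - β (s - ℓ r / 2)) *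
        (plateau A).toFun (s - ℓ r / 2))) • (Y.1 s - Z.1 (s - ℓ r)) := by
  let G : ϑ := (gammaFam N W (plateau A)).map 0 r Y - (phiFam N W (plateau A)).map 0 r Z
  have hG : ∀ s, G.1 s = (plateau A).toFun _ • (Y.1 s - Z.1 (s - ℓ r)) := fun s => by
    rw [smul_sub, ← gammaFam_apply (plateau A) hr Y s, ← phiFam_apply (plateau A) hr Z s]
    rfl
  refine (gammaFam_apply β.cutP hr _ s).trans ?_
  have h1 : ((shiftFam N W).map 0 c ((gammaFam N W β.cut).map 0 r ((shiftFam N W).map 0 (-c) G)) :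
      ϑ).1 s = β (s - ℓ r / 2 + c) • G.1 s := by
    refine (shiftFam_apply c _ s).trans ((gammaFam_apply β.cut hr _ _).trans ?_)
    refine (congrArg _ (shiftFam_apply (-c) G (s + c))).trans ?_
    rw [add_neg_cancel_right, show s + c - ℓ r / 2 = s - ℓ r / 2 + c by ring]
    rfl
  have h2 : ((gammaFam N W β.cut).map 0 r G : ϑ).1 s = β _ • G.1 s := gammaFam_apply β.cut hr G s
  refine (congrArg _ (congrArg₂ (· - ·) h1 h2)).trans ?_
  simp only [hG]; module

lemma recutRho_zero (A c : ℝ) (Y Z : ϑ) : recutRho β A 0 c Y Z = 0 := by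
  have hG : (gammaFam N W (plateau A)).map 0 0 Y - (phiFam N W (plateau A)).map 0 0 Z = 0 := by
    refine Sob.ext fun s => ?_
    refine (congrArg₂ (· - ·) (gammaFam_zero _ Y s) (phiFam_zero _ Z s)).trans ?_
    rw [plateau_lo, zero_smul, zero_smul, sub_zero]
    rfl
  rw [recutRho]; simp only [hG, map_zero, sub_zero]
  rfl

section

variable (hφ : IsTransition a b φ) (hψ : IsTransition b c ψ)

/-- The first component of the recut pair. -/
def recutL (A r t t' : ℝ) (f g : ϑ) : ϑ := hφ.shDiff W 0 t + Sob.S ϖ t f +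
    recutRho β A (recPar (t' - t) r) ((t + t') / 2) (Sob.S ϖ t (hφ.tailFn W f)) (Sob.J (Sob.S ϖ (-t') (hψ.refl.tailFn W (Sob.J g))))

/-- The second component of the recut pair. -/
def recutR (A r t t' : ℝ) (f g : ϑ) : ϑ := hψ.shDiff W 0 t' + Sob.S ϖ t' g +
    Sob.J (recutRho β A (recPar (t' - t) r) (-((t + t') / 2)) (Sob.S ϖ (-t') (hψ.refl.tailFn W (Sob.J g)))
      (Sob.J (Sob.S ϖ t (hφ.tailFn W f))))

variable [ScGood T] {U : Set (T.L 0)} {r t t' : T.L 0 → ℝ} {f g : T.L 0 → ϑ}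

lemma recPar_smooth (hr : ScSmoothOn T Λ U r) (ht : ScSmoothOn T Λ U t)
    (ht' : ScSmoothOn T Λ U t') (hd : ∀ x ∈ U, (t' x - t x, r x) ∈ recutDom) :
    ScSmoothOn T Λ U fun x => recPar (t' x - t x) (r x) := ((ht'.sub ht).prodConst hr).contDiff isOpen_recutDom contDiffOn_recPar hd

lemma recutL_smooth (A : ℝ) (hr : ScSmoothOn T Λ U r) (h0 : ∀ x ∈ U, 0 ≤ r x) (ht : ScSmoothOn T Λ U t) (ht' : ScSmoothOn T Λ U t')
    (hd : ∀ x ∈ U, (t' x - t x, r x) ∈ recutDom) (hf : ScSmoothOn T Θ U f) (hg : ScSmoothOn T Θ U g) :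
    ScSmoothOn T Θ U fun x => recutL β hφ hψ A (r x) (t x) (t' x) (f x) (g x) := by
  have hc :=
    (ht.prodConst ht').contDiff isOpen_univ
      ((contDiff_fst.add contDiff_snd).div_const 2).contDiffOn (mapsTo_univ _ _)
  exact ((hφ.smooth_shDiff W ht).add (ht.shift hf)).add (recutRho_smooth β A (recPar_smooth hr ht ht' hd) (fun x hx => div_nonneg (h0 x hx) (le_of_lt (hd x hx).2)) hc (ht.shift (hφ.tailFn_smooth hf))
    ((ScOp.J N W).comp_smooth (ht'.neg.shift (hψ.refl.tailFn_smooth ((ScOp.J N W).comp_smooth hg)))))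

lemma recutR_smooth (A : ℝ) (hr : ScSmoothOn T Λ U r) (h0 : ∀ x ∈ U, 0 ≤ r x) (ht : ScSmoothOn T Λ U t) (ht' : ScSmoothOn T Λ U t')
    (hd : ∀ x ∈ U, (t' x - t x, r x) ∈ recutDom) (hf : ScSmoothOn T Θ U f) (hg : ScSmoothOn T Θ U g) :
    ScSmoothOn T Θ U fun x => recutR β hφ hψ A (r x) (t x) (t' x) (f x) (g x) := by
  have hc :=
    (ht.prodConst ht').contDiff isOpen_univ
      ((contDiff_fst.add contDiff_snd).div_const 2).neg.contDiffOn (mapsTo_univ _ _)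
  exact ((hψ.smooth_shDiff W ht').add (ht'.shift hg)).add ((ScOp.J N W).comp_smooth (recutRho_smooth β A (recPar_smooth hr ht ht' hd) (fun x hx => div_nonneg (h0 x hx) (le_of_lt (hd x hx).2)) hc
    (ht'.neg.shift (hψ.refl.tailFn_smooth ((ScOp.J N W).comp_smooth hg)))
    ((ScOp.J N W).comp_smooth (ht.shift (hφ.tailFn_smooth hf)))))

lemma recutL_zero (A t t' : ℝ) (f g : ϑ) (s : ℝ) : (recutL β hφ hψ A 0 t t' f g).1 s = φ (s + t) + f.1 (s + t) - φ s := by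
  rw [recutL, recPar_zero, recutRho_zero, add_zero]; change (hφ.shDiff W 0 t).1 s + (Sob.S ϖ t f).1 s = _
  rw [hφ.shDiff_apply, Sob.S_apply]; abel

lemma recutR_zero (A t t' : ℝ) (f g : ϑ) (s : ℝ) : (recutR β hφ hψ A 0 t t' f g).1 s = ψ (s + t') + g.1 (s + t') - ψ s := by
  rw [recutR, recPar_zero, recutRho_zero, map_zero, add_zero]
  change (hψ.shDiff W 0 t').1 s + (Sob.S ϖ t' g).1 s = _; rw [hψ.shDiff_apply, Sob.S_apply]; abel

lemma glue_recut {A r t t' : ℝ} (hr : 0 < r) (hd : (t' - t, r) ∈ recutDom) (ht : |t| ≤ A) (ht' : |t'| ≤ A)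
    (hR : 4 + 4 * A ≤ ℓ r + (t' - t)) (f g : ϑ) (s : ℝ) :
    glue β (ℓ (recPar (t' - t) r)) (φ + (recutL β hφ hψ (A + 1) r t t' f g).1,
      ψ + (recutR β hφ hψ (A + 1) r t t' f g).1) s = glue β (ℓ r) (φ + f.1, ψ + g.1) (s + t) := by
  have hr' := (recPar_pos hd hr).ne'; have hlen := len_recPar hd hr
  set R := ℓ (recPar (t' - t) r) with hRdef; set x := s - R / 2 with hx
  set c := (t + t') / 2 with hc; have hcA : |c| ≤ A := by
    rw [abs_le] at ht ht' ⊢; constructor <;> linarith [ht.1, ht'.1, ht.2, ht'.2]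
  have eR : ℓ r = R - (t' - t) := by linarith
  let Y : ϑ := Sob.S ϖ t (hφ.tailFn W f); let Z : ϑ := Sob.J (Sob.S ϖ (-t') (hψ.refl.tailFn W (Sob.J g)))
  let d : ℝ := (β (x + c) - β x) * (plateau (A + 1)).toFun x
  have hd1 : (recutL β hφ hψ (A + 1) r t t' f g).1 s = φ (s + t) + f.1 (s + t) - φ s +
      (β.cutP.toFun x * d) • (Y.1 s - Z.1 (s - R)) := by
    have h1 := recutRho_apply β (A + 1) hr' c Y Z s
    have h2 : (hφ.shDiff W 0 t).1 s + (Sob.S ϖ t f).1 s = φ (s + t) + f.1 (s + t) - φ s := by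
      rw [hφ.shDiff_apply, Sob.S_apply]; abel
    exact congrArg₂ (· + ·) h2 h1
  have hd2 : (recutR β hφ hψ (A + 1) r t t' f g).1 (s - R) = ψ (s - R + t') + g.1 (s - R + t') - ψ (s - R) +
      (β.cutP.toFun (-x) * d) • (Y.1 s - Z.1 (s - R)) := by
    have h1 := recutRho_apply β (A + 1) hr' (-c) (Sob.S ϖ (-t') (hψ.refl.tailFn W (Sob.J g))) (Sob.J Y) (-(s - R))
    have h2 : (hψ.shDiff W 0 t').1 (s - R) + (Sob.S ϖ t' g).1 (s - R) = ψ (s - R + t') + g.1 (s - R + t') - ψ (s - R) := by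
      rw [hψ.shDiff_apply, Sob.S_apply]; abel
    refine congrArg₂ (· + ·) h2 (h1.trans ?_)
    rw [← hRdef, show -(s - R) - R / 2 = -x by rw [hx]; ring, Sob.J_apply, plateau_neg,
      show -(-(s - R) - R) = s by ring, ← neg_add, β.neg_eq, β.neg_eq]
    change _ • (Z.1 (s - R) - Y.1 s) = _; rw [← neg_sub (Y.1 s), smul_neg, ← neg_smul]; congr 1
    change _ = _ * ((β (x + c) - β x) * (plateau (A + 1)).toFun x); ring
  have hd3 : d • (Y.1 s - Z.1 (s - R)) = (β (x + c) - β x) • (φ (s + t) + f.1 (s + t) - (ψ (s - R + t') + g.1 (s - R + t'))) := by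
    rcases le_or_gt |x| (A + 1) with hxA | hxA
    · have e1 : d = β (x + c) - β x := by
        change _ * (plateau (A + 1)).toFun x = _; rw [plateau_eq_one hxA, mul_one]
      rw [abs_le] at hxA ht ht'; have e2 : Y.1 s = φ (s + t) + f.1 (s + t) - b := by
        refine (Sob.S_apply _ _ _ _).trans (hφ.tailFn_apply _ ?_); linarith [hxA.1, ht.1]
      have e3 : Z.1 (s - R) = ψ (s - R + t') + g.1 (s - R + t') - b := by
        rw [show Z.1 (s - R) = (Sob.S ϖ (-t') (hψ.refl.tailFn W (Sob.J g))).1 (-(s - R)) from rfl,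
          Sob.S_apply, hψ.refl.tailFn_apply _ (by linarith [hxA.2, ht'.2]), Sob.J_apply,
          show -(-(s - R) + -t') = s - R + t' by ring]
      rw [e1, e2, e3, sub_sub_sub_cancel_right]
    · have e1 : β (x + c) - β x = 0 := by
        rw [abs_le] at hcA; rcases lt_abs.1 hxA with h | h
        · rw [β.eq_zero (by linarith [hcA.1]), β.eq_zero (by linarith [hcA.1, hcA.2]), sub_zero]
        · rw [β.eq_one _ (by linarith [hcA.2]), β.eq_one _ (by linarith [hcA.1, hcA.2]), sub_self]
      have e2 : d = 0 := by
        change (β (x + c) - β x) * _ = 0; rw [e1, zero_mul]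
      rw [e1, e2, zero_smul, zero_smul]
  have hk : β x * β.cutP.toFun x + (1 - β x) * β.cutP.toFun (-x) = 1 := by
    change β x * (β x / (β x * β x + (1 - β x) * (1 - β x))) +
      (1 - β x) * (β (-x) / (β (-x) * β (-x) + (1 - β (-x)) * (1 - β (-x)))) = 1
    have h1 := β.gam_pos x; change 0 < β x * β x + (1 - β x) * (1 - β x) at h1; rw [β.neg_eq, sub_sub_cancel]
    generalize β x = y at h1 ⊢
    rw [show (1 - y) * (1 - y) + y * y = y * y + (1 - y) * (1 - y) by ring, mul_div_assoc', mul_div_assoc', ← add_div, div_self h1.ne']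
  have hl : glue β (ℓ r) (φ + f.1, ψ + g.1) (s + t) = β (x + c) • (φ (s + t) + f.1 (s + t)) +
      (1 - β (x + c)) • (ψ (s - R + t') + g.1 (s - R + t')) := by
    rw [glue_apply, eR, show s + t - (R - (t' - t)) / 2 = x + c by rw [hx, hc]; ring,
      show s + t - (R - (t' - t)) = s - R + t' by ring]
    rfl
  rw [hl, glue_apply]; change β x • (φ s + (recutL β hφ hψ (A + 1) r t t' f g).1 s) + (1 - β x) •
    (ψ (s - R) + (recutR β hφ hψ (A + 1) r t t' f g).1 (s - R)) = _
  rw [hd1, hd2, mul_smul (β.cutP.toFun x) d, mul_smul (β.cutP.toFun (-x)) d, hd3]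
  generalize φ (s + t) + f.1 (s + t) = y
  generalize ψ (s - R + t') + g.1 (s - R + t') = z
  linear_combination (norm := module) ((β (x + c) - β x) * hk) • (y - z)

end

end Recut

/-! ### Path spaces -/

section Paths

variable {d : ℝ} (hφ : IsTransition a b φ)

lemma IsTransition.sub_smooth {φ' : Φ} (hφ : IsTransition a b φ) (hφ' : IsTransition a b φ') :
    ContDiff ℝ ∞ (φ - φ') ∧ HasCompactSupport (φ - φ') := by
  refine ⟨hφ.1.sub hφ'.1, compactSupp_of_ev ?_ ?_⟩
  · filter_upwards [hφ.2.1, hφ'.2.1] with s h h'; rw [Pi.sub_apply, h, h', sub_self]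
  · filter_upwards [hφ.2.2, hφ'.2.2] with s h h'; rw [Pi.sub_apply, h, h', sub_self]

/-- The path `φ + f`. -/
def IsTransition.path (hφ : IsTransition a b φ) (f : Sob N 2 d) : PathSpace d a b :=
  ⟨φ + f.1, φ, hφ, by rw [add_sub_cancel_left]; exact f.2⟩

/-- The inverse of `f ↦ φ + f`. -/
def IsTransition.coord (hφ : IsTransition a b φ) (w : PathSpace d a b) : Sob N 2 d := ⟨w.1 - φ, by
    obtain ⟨φ', hφ', hw⟩ := w.2; rw [← sub_add_sub_cancel w.1 φ' φ]; have h := hφ'.sub_smooth hφ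
    exact Submodule.add_mem _ hw (mem_sobolev_of_compactSupp h.1 h.2)⟩

lemma IsTransition.path_coord (w : PathSpace d a b) :
    hφ.path (hφ.coord w) = w := Subtype.ext (add_sub_cancel _ _)

lemma IsTransition.coord_path (f : Sob N 2 d) :
    hφ.coord (hφ.path f) = f := Subtype.ext (add_sub_cancel_left _ _)

lemma IsTransition.path_add (f h : Sob N 2 d) :
    (hφ.path f).add h = hφ.path (f + h) := Subtype.ext (add_assoc _ _ _)

lemma IsTransition.coord_add (w : PathSpace d a b) (h : Sob N 2 d) :
    hφ.coord (w.add h) = hφ.coord w + h := by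
  rw [← hφ.path_coord w, hφ.path_add, hφ.coord_path, hφ.coord_path]

/-- The affine coordinate on the space of paths. -/
def IsTransition.homeo (hφ : IsTransition a b φ) : Sob N 2 d ≃ₜ PathSpace d a b where
  toFun := hφ.path
  invFun := hφ.coord
  left_inv := hφ.coord_path
  right_inv := hφ.path_coord
  continuous_toFun := by
    refine continuous_def.2 fun U hU => isOpen_iff_mem_nhds.2 fun f hf => ?_
    have h1 : Tendsto (fun g => g - f) (𝓝 f) (𝓝 0) := by
      have h : Tendsto (fun g => g - f) (𝓝 f) (𝓝 (f - f)) := (continuous_id.sub continuous_const).tendsto f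
      rw [sub_self] at h; exact h
    filter_upwards [h1.eventually (hU _ hf)] with g hg; rw [hφ.path_add, add_sub_cancel] at hg; exact hg
  continuous_invFun := by
    refine continuous_def.2 fun U hU w hw => ?_
    have h1 : Tendsto (fun h => hφ.coord w + h) (𝓝 0) (𝓝 (hφ.coord w)) := by
      have h : Tendsto (fun h => hφ.coord w + h) (𝓝 0) (𝓝 (hφ.coord w + 0)) := (continuous_const.add continuous_id).tendsto 0
      rw [add_zero] at h; exact h
    filter_upwards [h1.eventually (hU.mem_nhds hw)] with h hh; rw [mem_preimage, hφ.coord_add]; exact hh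

lemma PathSpace.tendstoUniformly (hd : 0 ≤ d) {u : ι → PathSpace d a b}
    {u₀ : PathSpace d a b} (h : Tendsto u l (𝓝 u₀)) : TendstoUniformly (fun i => (u i).1) u₀.1 l := by
  obtain ⟨φ, hφ, hw⟩ := u₀.2
  have h1 : Tendsto (fun i => hφ.coord (u i)) l (𝓝 (hφ.coord u₀)) := (hφ.homeo.symm.continuous.tendsto u₀).comp h
  refine Metric.tendstoUniformly_iff.2 fun ε hε => ?_
  filter_upwards [Metric.tendsto_nhds.1 h1 (ε / 2) (half_pos hε)] with i hi s
  have h2 := Sob.norm_apply_le hd one_le_two (hφ.coord u₀ - hφ.coord (u i)) s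
  have h3 : (hφ.coord u₀ - hφ.coord (u i)).1 s = u₀.1 s - (u i).1 s := by
    change u₀.1 s - φ s - ((u i).1 s - φ s) = _; abel
  rw [h3, ← dist_eq_norm] at h2; rw [dist_comm, dist_eq_norm] at hi; linarith

lemma PathSpace.contDiff (w : PathSpace d a b) : ContDiff ℝ 1 w.1 := by
  obtain ⟨φ, hφ, hw⟩ := w.2; rw [← hφ.path_coord w]
  exact (hφ.1.of_le (by simp)).add ((hφ.coord w).contDiff_one le_rfl).1

lemma PathSpace.tendsto_atBot (hd : 0 ≤ d) (w : PathSpace d a b) : Tendsto w.1 atBot (𝓝 a) := by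
  obtain ⟨φ, hφ, hw⟩ := w.2
  have h1 : Tendsto (φ + (hφ.coord w).1) atBot (𝓝 (a + 0)) := (tendsto_const_nhds.congr' (hφ.2.1.mono fun s h => h.symm)).add ((hφ.coord w).tendsto_apply_atBot hd one_le_two)
  rw [add_zero] at h1; exact h1.congr fun s => add_sub_cancel _ _

lemma PathSpace.tendsto_atTop (hd : 0 ≤ d) (w : PathSpace d a b) : Tendsto w.1 atTop (𝓝 b) := by
  obtain ⟨φ, hφ, hw⟩ := w.2
  have h1 : Tendsto (φ + (hφ.coord w).1) atTop (𝓝 (b + 0)) := (tendsto_const_nhds.congr' (hφ.2.2.mono fun s h => h.symm)).add ((hφ.coord w).tendsto_apply_atTop hd one_le_two)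
  rw [add_zero] at h1; exact h1.congr fun s => add_sub_cancel _ _

/-- The path `w(· + t)`. -/
def PathSpace.shift (t : ℝ) (w : PathSpace d a b) : PathSpace d a b := ⟨fun s => w.1 (s + t), by
    obtain ⟨φ, hφ, hw⟩ := w.2; refine ⟨fun s => φ (s + t), ⟨hφ.1.comp (contDiff_id.add contDiff_const),
      (tendsto_atBot_add_const_right _ t tendsto_id).eventually hφ.2.1,
      (tendsto_atTop_add_const_right _ t tendsto_id).eventually hφ.2.2⟩, ?_⟩
    have h := sobolev_shift hw (-t); simp only [sub_neg_eq_add] at h; exact h⟩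

lemma PathSpace.cls_eq_iff {w w' : PathSpace d a b} : w.cls = w'.cls ↔ ∃ t : ℝ, ∀ s, w'.1 s = w.1 (s + t) := Quotient.eq

lemma PathSpace.cls_shift (t : ℝ) (w : PathSpace d a b) : (w.shift t).cls = w.cls := (PathSpace.cls_eq_iff.2 ⟨t, fun _ => rfl⟩).symm

lemma PathSpace.cls_surjective : Function.Surjective (PathSpace.cls : PathSpace d a b → Traj d a b) := Quotient.mk_surjective

lemma PathSpace.cont_cls : Continuous (PathSpace.cls : PathSpace d a b → Traj d a b) := continuous_quotient_mk'

lemma IsTransition.coord_shift (d : StrictMono δ) (o : δ 0 = 0) (hφ : IsTransition a b φ) (t : ℝ) (w : Ψ a b) :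
    hφ.coord (w.shift t) = (hφ.shDiff Δ 0 t : Ω) + Sob.S one_le_two t (hφ.coord w) := by
  refine Sob.ext fun s => ?_; have h1 := hφ.shDiff_apply Δ 0 t s
  refine Eq.trans ?_ (congrArg₂ (· + ·) h1 (Sob.S_apply one_le_two t (hφ.coord w) s)).symm
  change w.1 (s + t) - φ s = φ (s + t) - φ s + (w.1 (s + t) - φ (s + t)); abel

lemma PathSpace.cont_shift (d : StrictMono δ) (o : δ 0 = 0) :
    Continuous fun p : ℝ × Ψ a b => p.2.shift p.1 := by
  by_cases hn : Nonempty (Ψ a b)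
  · obtain ⟨φ, hφ, -⟩ := hn.some.2; have h1 : Continuous fun p : ℝ × Ψ a b =>
        (hφ.shDiff Δ 0 p.1 : Ω) + Sob.S one_le_two p.1 (hφ.coord p.2) :=
      ((hφ.cont_shDiff Δ 0).comp continuous_fst).add
        ((Sob.cont_S one_le_two).comp (continuous_fst.prodMk (hφ.homeo.symm.continuous.comp continuous_snd)))
    refine (hφ.homeo.continuous.comp h1).congr fun p => ?_

    exact (congrArg hφ.path (hφ.coord_shift d o p.1 p.2)).symm.trans (hφ.path_coord _)
  · exact continuous_iff_continuousAt.2 fun p => (hn ⟨p.2⟩).elim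

lemma PathSpace.isOpenMap_cls (d : StrictMono δ) (o : δ 0 = 0) : IsOpenMap (PathSpace.cls : Ψ a b → Traj (δ 0) a b) := by
  intro U hU; have h1 : IsOpen (PathSpace.cls ⁻¹' (PathSpace.cls '' U) : Set (Ψ a b)) := by
    have : (PathSpace.cls ⁻¹' (PathSpace.cls '' U) : Set (Ψ a b)) = ⋃ t : ℝ, PathSpace.shift t ⁻¹' U := by
      ext w; simp only [mem_preimage, mem_image, mem_iUnion]; constructor
      · rintro ⟨w', hw', h⟩; obtain ⟨t, ht⟩ := PathSpace.cls_eq_iff.1 h.symm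
        exact ⟨t, by rwa [show w.shift t = w' from Subtype.ext (funext fun s => (ht s).symm)]⟩
      · rintro ⟨t, ht⟩; exact ⟨_, ht, w.cls_shift t⟩
    rw [this]
    exact isOpen_iUnion fun t => hU.preimage ((PathSpace.cont_shift d o).comp (Continuous.prodMk_right t))
  exact h1

/-! ### Control of the time shift -/

/-- Uniform convergence on all left half lines. -/
def TendstoLeft (y : ι → Φ) (l : Filter ι) (u : Φ) : Prop := ∀ M, TendstoUniformlyOn y u l (Iic M)

lemma TendstoLeft.apply {y : ι → Φ} {u : Φ} (h : TendstoLeft y l u)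
    (hu : Continuous u) {τ : ι → ℝ} (hτ : Tendsto τ l (𝓝 t)) : Tendsto (fun i => y i (τ i)) l (𝓝 (u t)) := by
  refine tendsto_comp_of_locally_uniform_limit hu.continuousAt hτ fun v hv => ?_
  exact ⟨Iic (t + 1), Iic_mem_nhds (lt_add_one t), h (t + 1) v hv⟩

lemma TendstoLeft.not_tendsto_atTop [l.NeBot] {y y' : ι → Φ} {u u' : Φ}
    {τ : ι → ℝ} (h : TendstoLeft y l u) (h' : TendstoLeft y' l u') (hu : Continuous u) (ha : Tendsto u' atBot (𝓝 a))
    (hb : Tendsto u atTop (𝓝 b)) (hab : a ≠ b) (hy : ∀ᶠ i in l, ∀ s, y' i s = y i (s + τ i)) : ¬ Tendsto τ l atTop := by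
  intro hτ; have key : ∀ σ, u σ = a := fun σ => by
    have h1 : Tendsto (fun i => y i σ) l (𝓝 (u σ)) := h.apply hu tendsto_const_nhds
    refine tendsto_nhds_unique h1 (Metric.tendsto_nhds.2 fun ε hε => ?_)
    obtain ⟨s₀, hs₀⟩ := eventually_atBot.1 (Metric.tendsto_nhds.1 ha (ε / 2) (half_pos hε))
    filter_upwards [Metric.tendstoUniformlyOn_iff.1 (h' s₀) (ε / 2) (half_pos hε), hy, hτ.eventually_ge_atTop (σ - s₀)] with i h2 h3 h4
    have h5 : σ - τ i ≤ s₀ := by linarith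
    have h6 := h3 (σ - τ i); rw [sub_add_cancel] at h6; rw [← h6]
    calc dist (y' i (σ - τ i)) a ≤ dist (y' i (σ - τ i)) (u' (σ - τ i)) + dist (u' (σ - τ i)) a := dist_triangle _ _ _
      _ < ε / 2 + ε / 2 := add_lt_add (by rw [dist_comm]; exact h2 _ h5) (hs₀ _ h5)
      _ = ε := add_halves ε
  exact hab (tendsto_nhds_unique (tendsto_const_nhds.congr fun s => (key s).symm) hb)

lemma exists_shift (l : Ultrafilter ι) {y y' : ι → Φ} {u u' : Φ} {b' : Vec N}
    {τ : ι → ℝ} (h : TendstoLeft y l u) (h' : TendstoLeft y' l u') (hu : Continuous u) (hu' : Continuous u')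
    (ha : Tendsto u atBot (𝓝 a)) (ha' : Tendsto u' atBot (𝓝 a)) (hb : Tendsto u atTop (𝓝 b))
    (hb' : Tendsto u' atTop (𝓝 b')) (hab : a ≠ b) (hab' : a ≠ b') (hy : ∀ᶠ i in (l : Filter ι), ∀ s, y' i s = y i (s + τ i)) :
    ∃ t, Tendsto τ l (𝓝 t) ∧ ∀ s, u' s = u (s + t) := by
  have hy' : ∀ᶠ i in (l : Filter ι), ∀ s, y i s = y' i (s + -τ i) := hy.mono fun i hi s => by
    rw [hi, neg_add_cancel_right]
  obtain ⟨x, hx⟩ : ∃ x : EReal, Tendsto (fun i => (τ i : EReal)) l (𝓝 x) := by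
    obtain ⟨x, -, hx⟩ := isCompact_univ.ultrafilter_le_nhds (l.map fun i => (τ i : EReal)) (by simp)
    exact ⟨x, hx⟩
  induction x with
  | bot =>
    refine (h'.not_tendsto_atTop h hu' ha hb' hab' hy' ?_).elim
    exact tendsto_neg_atBot_atTop.comp (EReal.tendsto_coe_nhds_bot_iff.1 hx)
  | top => exact (h.not_tendsto_atTop h' hu ha' hb hab hy (EReal.tendsto_coe_nhds_top_iff.1 hx)).elim
  | coe t =>
    refine ⟨t, EReal.tendsto_coe.1 hx, fun s => ?_⟩
    have h1 : Tendsto (fun i => y' i s) l (𝓝 (u' s)) := h'.apply hu' tendsto_const_nhds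
    refine tendsto_nhds_unique h1 ((h.apply hu (tendsto_const_nhds.add (EReal.tendsto_coe.1 hx))).congr' ?_)
    filter_upwards [hy] with i hi; exact (hi s).symm

lemma eq_zero_of_periodic {u : Φ} (ha : Tendsto u atBot (𝓝 a)) (hb : Tendsto u atTop (𝓝 b)) (hab : a ≠ b) (h : ∀ s, u s = u (s + t)) : t = 0 := by
  by_contra ht; have h1 : ∀ (n : ℕ) s, u s = u (s + n * t) := fun n => by
    induction n with
    | zero => simp
    | succ n ih => intro s; rw [ih s, h, Nat.cast_succ, add_one_mul, add_assoc]
  have h2 : ∀ (n : ℕ) s, u s = u (s - n * t) := fun n s => by rw [h1 n (s - n * t), sub_add_cancel]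
  refine hab ?_; have h3 : ∀ s, u s = b ∧ u s = a := fun s => by
    have e1 : Tendsto (fun n : ℕ => (n : ℝ) * |t|) atTop atTop := tendsto_natCast_atTop_atTop.atTop_mul_const (abs_pos.2 ht)
    have e2 : ∀ n : ℕ, u s = u (s + n * |t|) ∧ u s = u (s + -(n * |t|)) := fun n => by
      rcases abs_choice t with h | h <;> rw [h]
      · exact ⟨h1 n s, h2 n s⟩
      · rw [mul_neg, neg_neg]; exact ⟨h2 n s, h1 n s⟩
    exact ⟨tendsto_nhds_unique (tendsto_const_nhds.congr fun n => (e2 n).1) (hb.comp (tendsto_atTop_add_const_left _ s e1)),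
      tendsto_nhds_unique (tendsto_const_nhds.congr fun n => (e2 n).2)
        (ha.comp (tendsto_atBot_add_const_left _ s (tendsto_neg_atTop_atBot.comp e1)))⟩
  exact (h3 0).2.symm.trans (h3 0).1

end Paths

/-! ### Coordinates on the space of broken and unbroken trajectories -/

section Reference

variable (β : Cutoff) (a b c : Vec N)

/-- A transition from `a` to `b` near `x`. -/
def stepPath (x : ℝ) (s : ℝ) : Vec N := β (s - x) • a + (1 - β (s - x)) • b

lemma isTransition_stepPath (x : ℝ) : IsTransition a b (stepPath β a b x) := by
  have h : ContDiff ℝ ∞ fun s => β (s - x) := β.smooth.comp (contDiff_id.sub contDiff_const)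
  refine ⟨(h.smul contDiff_const).add ((contDiff_const.sub h).smul contDiff_const), ?_, ?_⟩
  · filter_upwards [eventually_le_atBot (x - 1)] with s hs; rw [stepPath, β.eq_one _ (by linarith)]; module
  · filter_upwards [eventually_ge_atTop (x + 1)] with s hs; rw [stepPath, β.eq_zero (by linarith)]; module

/-- The reference path from `a` to `b`. -/
def refL : Φ := stepPath β a b (-2)

/-- The reference path from `b` to `c`. -/
def refR : Φ := stepPath β b c 2

/-- The reference path from `a` to `c`. -/
def refU (s : ℝ) : Vec N := refL β a b s + refR β b c s - b

lemma isTransition_refL : IsTransition a b (refL β a b) := isTransition_stepPath β a b _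

lemma isTransition_refR : IsTransition b c (refR β b c) := isTransition_stepPath β b c _

lemma isTransition_refU : IsTransition a c (refU β a b c) := by
  have h1 := φL; have h2 := φR; refine ⟨(h1.1.add h2.1).sub contDiff_const, ?_, ?_⟩
  · filter_upwards [h1.2.1, h2.2.1] with s h h'; rw [refU, h, h', add_sub_cancel_right]
  · filter_upwards [h1.2.2, h2.2.2] with s h h'; rw [refU, h, h', add_sub_cancel_left]

lemma glue_ref (hR : 0 < R) (s : ℝ) : glue β R (refL β a b, refR β b c) s = refL β a b s + refR β b c (s - R) - b := by
  have h1 : (1 - β (s - R / 2)) • (refL β a b s - b) = 0 := by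
    rcases le_or_gt (s - R / 2) (-1) with h | h
    · rw [β.eq_one _ h, sub_self, zero_smul]
    · rw [refL, stepPath, β.eq_zero (s := s - -2) (by linarith)]; module
  have h2 : β (s - R / 2) • (refR β b c (s - R) - b) = 0 := by
    rcases le_or_gt 1 (s - R / 2) with h | h
    · rw [β.eq_zero h, zero_smul]
    · rw [refR, stepPath, β.eq_one (s - R - 2) (by linarith)]; module
  rw [glue_apply]
  linear_combination (norm := module) -h1 - h2

end Reference

lemma len_pos (h0 : 0 < r) (h1 : r < 1) : 0 < ℓ r := sub_pos.2 (Real.exp_lt_exp.2 ((one_lt_div h0).2 h1))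

/-- `χ(· - R/2) f` with `R = exp (1/r) - e`. -/
def Sob.gamma {W : Weights} (χ : CutFn) (r : ℝ) (f : ϑ) : ϑ := (gammaFam N W χ).map 0 r f

section Coords

variable (β : Cutoff) (d : StrictMono δ) (o : δ 0 = 0) (a b c : Vec N)

/-- The domain of the parameters `(r, f, g)`. -/
def brDom (N : ℕ) (δ : ℕ → ℝ) : Set Ξ := {q | q.1 ∈ Ico (0 : ℝ) 1}

/-- The class of an unbroken path in the affine coordinate. -/
def ucls (f : Ω) : 𝓧 := .unbroken ((φU).path f).cls

/-- The class of a glued path in the affine coordinates. -/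
def gcls (q : Ξ) : 𝓧 := glueClass β q.1 ((φL).path q.2.1) ((φR).path q.2.2)

/-- The affine coordinate of a glued path. -/
def glueCoord (r : ℝ) (f g : Ω) : Ω := (φR).shDiff Δ 0 (-ℓ r) + Sob.gamma (W := Δ) β.cut r f +
    Sob.gamma (W := Δ) β.co r (Sob.S one_le_two (-ℓ r) g)

variable {a b c}

lemma glueCoord_smooth [ScGood T] {U : Set (T.L 0)} {r : T.L 0 → ℝ} {f g : T.L 0 → Ω}
    (hr : ScSmoothOn T Λ U r) (h0 : ∀ x ∈ U, 0 < r x) (hf : ScSmoothOn T ΔΘ U f)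
    (hg : ScSmoothOn T ΔΘ U g) :
    ScSmoothOn T ΔΘ U fun x => 𝓖 (r x) (f x) (g x) := by
  have hR : ScSmoothOn T Λ U fun x => -ℓ (r x) := hr.contDiff isOpen_Ioi contDiffOn_len.neg h0
  exact (((φR).smooth_shDiff Δ hR).add (hr.gamma β.cut hf fun x hx => (h0 x hx).le)).add
    (hr.gamma β.co (hR.shift hg) fun x hx => (h0 x hx).le)

lemma glueCoord_apply (hr : r ≠ 0) (f g : Ω) (s : ℝ) : (𝓖 r f g).1 s = refR β b c (s - ℓ r) - refR β b c s +
      glue β (ℓ r) (f.1, g.1) s := by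
  have h1 := (φR).shDiff_apply Δ 0 (-ℓ r) s; have h2 := gammaFam_apply (W := Δ) β.cut hr f s
  have h3 := (gammaFam_apply (W := Δ) β.co hr (Sob.S one_le_two (-ℓ r) g) s).trans (congrArg _ (Sob.S_apply one_le_two (-ℓ r) g s))
  refine (congrArg₂ (· + ·) (congrArg₂ (· + ·) h1 h2) h3).trans ?_; rw [glue_apply, add_assoc]
  rfl

lemma path_glueCoord (h0 : 0 < r) (h1 : r < 1) (f g : Ω) : (φU).path (𝓖 r f g : Ω) = ((φL).path f).glue β (ℓ r) ((φR).path g) := by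
  refine Subtype.ext (funext fun s => ?_)
  change refU β a b c s + (𝓖 r f g).1 s = glue β (ℓ r) ((refL β a b, refR β b c) + (f.1, g.1)) s
  rw [glueCoord_apply β d o h0.ne', map_add, Pi.add_apply, glue_ref β a b c (len_pos h0 h1), refU]; abel

lemma gcls_of_ne (hr : r ≠ 0) (f g : Ω) : 𝓒 (r, f, g) = .unbroken (((φL).path f).glue β (ℓ r) ((φR).path g)).cls := if_neg hr

lemma gcls_zero (f g : Ω) : 𝓒 (0, f, g) = .broken ((φL).path f).cls ((φR).path g).cls := if_pos rfl

lemma gcls_eq (hq : q ∈ brDom N δ) (h0 : q.1 ≠ 0) : 𝓒 q = 𝓤 (𝓖 q.1 q.2.1 q.2.2 : Ω) := by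
  rw [ucls, path_glueCoord β d o (lt_of_le_of_ne hq.1 h0.symm) hq.2]; exact gcls_of_ne β h0 _ _

lemma ucls_ne_gcls (f f' g' : Ω) : 𝓤 f ≠ 𝓒 (0, f', g') := by
  rw [gcls_zero, ucls]; exact fun h => nomatch h

lemma exists_eq_cls (x : 𝓧) : (∃ f : Ω, x = 𝓤 f) ∨ ∃ f g : Ω, x = 𝓒 (0, f, g) := by
  cases x with
  | unbroken x =>
    obtain ⟨w, rfl⟩ := PathSpace.cls_surjective x
    exact .inl ⟨(φU).coord w, by rw [ucls, IsTransition.path_coord]⟩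
  | broken x y =>
    obtain ⟨w, rfl⟩ := PathSpace.cls_surjective x; obtain ⟨w', rfl⟩ := PathSpace.cls_surjective y
    exact .inr ⟨(φL).coord w, (φR).coord w', by
      rw [gcls_zero, IsTransition.path_coord, IsTransition.path_coord]⟩

variable (N δ) in
/-- The scale of the parameters `(r, f, g)`. -/
def parScale (d : StrictMono δ) (o : δ 0 = 0) : ScScale := (Λ).sum ((ΔΘ).sum ΔΘ)

instance : ScGood (𝓞) := inferInstanceAs (ScGood ((Λ).sum _))

lemma parScale.smooth_r (U : Set Ξ) : ScSmoothOn (𝓞) Λ U fun q : Ξ => q.1 := ScOp.smooth (E := (𝓞)) (F := Λ) ScOp.fst U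

lemma parScale.smooth_f (U : Set Ξ) : ScSmoothOn (𝓞) ΔΘ U fun q : Ξ => q.2.1 :=
  ScOp.smooth (E := (𝓞)) (F := ΔΘ) (ScOp.fst.comp ScOp.snd) U

lemma parScale.smooth_g (U : Set Ξ) : ScSmoothOn (𝓞) ΔΘ U fun q : Ξ => q.2.2 :=
  ScOp.smooth (E := (𝓞)) (F := ΔΘ) (ScOp.snd.comp ScOp.snd) U

lemma contOn_glueCoord : ContinuousOn (fun q : Ξ => (𝓖 q.1 q.2.1 q.2.2 : Ω)) {q | 0 < q.1} :=
  (glueCoord_smooth β d o (parScale.smooth_r d o _) (fun _ hx => hx) (parScale.smooth_f d o _) (parScale.smooth_g d o _)).continuousOn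

lemma contAt_glueCoord (hq : 0 < q.1) : ContinuousAt (fun q : Ξ => (𝓖 q.1 q.2.1 q.2.2 : Ω)) q :=
  (contOn_glueCoord β d o).continuousAt ((isOpen_lt continuous_const continuous_fst).mem_nhds hq)

lemma isOpen_brTraj_iff {V : Set 𝓧} : IsOpen V ↔ (∀ f : Ω, 𝓤 f ∈ V → ∀ᶠ f' in 𝓝 f, 𝓤 f' ∈ V) ∧
    ∀ q ∈ brDom N δ, 𝓒 q ∈ V → ∀ᶠ q' in 𝓝[brDom N δ] q, 𝓒 q' ∈ V := by
  refine isOpen_sup.trans (and_congr ?_ ?_)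
  · refine isOpen_coinduced.trans (isOpen_coinduced.trans ?_)
    exact ((φU).homeo (d := δ 0)).isOpen_preimage.symm.trans isOpen_iff_mem_nhds
  · let e : Ico (0 : ℝ) 1 × Ψ a b × Ψ b c → Ξ := fun p =>
      (p.1, (φL).homeo.symm p.2.1, (φR).homeo.symm p.2.2)
    have he : Topology.IsEmbedding e := Topology.IsEmbedding.subtypeVal.prodMap
      ((φL).homeo.symm.isEmbedding.prodMap (φR).homeo.symm.isEmbedding)
    have hcls : ∀ p, glueClass β p.1.1 p.2.1 p.2.2 = 𝓒 (e p) := fun p => by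
      change _ = glueClass β p.1.1 ((φL).path ((φL).coord p.2.1)) ((φR).path ((φR).coord p.2.2))
      rw [IsTransition.path_coord, IsTransition.path_coord]
    have hr : range e = brDom N δ := by
      ext q; refine ⟨?_, fun hq => ⟨(⟨q.1, hq⟩, (φL).path q.2.1, (φR).path q.2.2), ?_⟩⟩
      · rintro ⟨p, rfl⟩; exact p.1.2
      · exact Prod.ext rfl (Prod.ext ((φL).coord_path _) ((φR).coord_path _))
    refine isOpen_coinduced.trans (isOpen_iff_mem_nhds.trans ?_)
    have h1 : ∀ p, (fun p : Ico (0 : ℝ) 1 × Ψ a b × Ψ b c =>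
        glueClass β p.1.1 p.2.1 p.2.2) ⁻¹' V ∈ 𝓝 p ↔ ∀ᶠ q in 𝓝[brDom N δ] (e p), 𝓒 q ∈ V := fun p => by
      rw [← hr, ← he.map_nhds_eq, eventually_map]; simp only [← hcls]
      rfl
    simp only [h1]; rw [← hr]; refine ⟨?_, fun h p hp => h (e p) ⟨p, rfl⟩ (hcls p ▸ hp)⟩
    rintro h _ ⟨p, rfl⟩ hp; exact h p (show glueClass β p.1.1 p.2.1 p.2.2 ∈ V from (hcls p).symm ▸ hp)

lemma cont_ucls : Continuous (𝓤 : Ω → 𝓧) := continuous_def.2 fun _ hV => isOpen_iff_mem_nhds.2 ((isOpen_brTraj_iff β).1 hV).1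

lemma contOn_gcls : ContinuousOn (𝓒 : Ξ → 𝓧) (brDom N δ) := fun q hq => by
  refine tendsto_def.2 fun S hS => ?_; obtain ⟨V, hVS, hV, hqV⟩ := mem_nhds_iff.1 hS
  exact (((isOpen_brTraj_iff β).1 hV).2 q hq hqV).mono fun _ h => hVS h

end Coords

/-! ### The topology of the space of broken and unbroken trajectories -/

lemma scSmoothOn_const (T : ScScale) (U : Set (T.L 0)) (x : ℝ) : ScSmoothOn T Λ U fun _ => x :=
  ScPt.smooth T (F := Λ) ⟨fun _ => x, fun _ => rfl⟩ U

section Shift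

variable (d : StrictMono δ) (o : δ 0 = 0) {a b c : Vec N} {φ : Φ} (hφ : IsTransition a b φ)

/-- The time shift in the affine coordinate. -/
def IsTransition.shCoord (hφ : IsTransition a b φ) (t : ℝ) (f : Ω) : Ω := hφ.shDiff Δ 0 t + Sob.S one_le_two t f

lemma IsTransition.shCoord_apply (t : ℝ) (f : Ω) (s : ℝ) :
    (hφ.shCoord d o t f).1 s = φ (s + t) + f.1 (s + t) - φ s := by
  refine (congrArg₂ (· + ·) (hφ.shDiff_apply Δ 0 t s) (Sob.S_apply _ t f s)).trans ?_; abel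

lemma IsTransition.path_shCoord (t : ℝ) (f : Ω) : hφ.path (hφ.shCoord d o t f) = (hφ.path f).shift t :=
  Subtype.ext (funext fun s => (congrArg _ (hφ.shCoord_apply d o t f s)).trans (add_sub_cancel _ _))

lemma IsTransition.shCoord_smooth [ScGood T] {U : Set (T.L 0)}
    {t : T.L 0 → ℝ} {f : T.L 0 → Ω} (ht : ScSmoothOn T Λ U t)
    (hf : ScSmoothOn T ΔΘ U f) :
    ScSmoothOn T ΔΘ U fun x => hφ.shCoord d o (t x) (f x) :=
  (hφ.smooth_shDiff Δ ht).add (ht.shift hf)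

lemma IsTransition.cont_shCoord :
    Continuous fun p : ℝ × Ω => hφ.shCoord d o p.1 p.2 :=
  ((hφ.cont_shDiff Δ 0).comp continuous_fst).add (Sob.cont_S _)

end Shift

section Topology

variable (β : Cutoff) (d : StrictMono δ) (o : δ 0 = 0) {a b c : Vec N}

lemma ucls_shift (t : ℝ) (f : Ω) : 𝓤 ((φU).shCoord d o t f) = 𝓤 f := by rw [ucls, IsTransition.path_shCoord, PathSpace.cls_shift, ucls]

lemma exists_shCoord (hφ : IsTransition a b φ) {f f' : Ω} (h : (hφ.path f).cls = (hφ.path f').cls) : ∃ t, f' = hφ.shCoord d o t f := by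
  obtain ⟨t, ht⟩ := PathSpace.cls_eq_iff.1 h; refine ⟨t, ?_⟩
  rw [← hφ.coord_path f', ← hφ.coord_path (hφ.shCoord d o t f), hφ.path_shCoord]
  exact congrArg _ (Subtype.ext (funext ht))

lemma exists_shCoord_of_ucls {f f' : Ω} (h : 𝓤 f = 𝓤 f') : ∃ t, f' = (φU).shCoord d o t f := exists_shCoord d o _ (BrokenTraj.unbroken.inj h)

/-- The first component of the pair that glues to `G`. -/
def cutL (r : ℝ) (G : Ω) : Ω := Sob.gamma (W := Δ) β.cutP r G

/-- The second component of the pair that glues to `G`. -/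
def cutR (r : ℝ) (G : Ω) : Ω := Sob.S one_le_two (ℓ r) (Sob.gamma (W := Δ) β.cutQ r G)

lemma cutL_apply (hr : r ≠ 0) (G : Ω) (s : ℝ) :
    (cutL β d o r G).1 s = β.cutP.toFun (s - ℓ r / 2) • G.1 s := gammaFam_apply (W := Δ) β.cutP hr G s

lemma cutR_apply (hr : r ≠ 0) (G : Ω) (s : ℝ) : (cutR β d o r G).1 s = β.cutQ.toFun (s + ℓ r - ℓ r / 2) • G.1 (s + ℓ r) :=
  (Sob.S_apply _ _ _ s).trans (gammaFam_apply (W := Δ) β.cutQ hr G _)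

lemma glue_cut (hr : r ≠ 0) (G : Ω) : glue β (ℓ r) ((cutL β d o r G).1, (cutR β d o r G).1) = G.1 := by
  funext s; rw [glue_apply, cutL_apply β d o hr, cutR_apply β d o hr, sub_add_cancel]
  change β _ • (β _ / β.gam _) • _ + (1 - β _) • ((1 - β _) / β.gam _) • _ = _
  rw [smul_smul, smul_smul, ← add_smul, mul_div_assoc', mul_div_assoc', ← add_div]
  exact (congrArg (· • G.1 s) (div_self (β.gam_pos _).ne')).trans (one_smul ℝ (G.1 s))

lemma antiglue_cut (hr : r ≠ 0) (G : Ω) : antiglue β (ℓ r) ((cutL β d o r G).1, (cutR β d o r G).1) = 0 := by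
  funext s; rw [antiglue_apply, cutL_apply β d o hr, cutR_apply β d o hr, sub_add_cancel]
  change -((1 - β _) • (β _ / β.gam _) • _) + β _ • ((1 - β _) / β.gam _) • _ = 0; module

lemma cut_zero (r : ℝ) : cutL β d o r (0 : Ω) = 0 ∧ cutR β d o r (0 : Ω) = 0 := ⟨map_zero _,
    (congrArg _ (map_zero _)).trans (map_zero _)⟩

lemma cont_cut (r : ℝ) : Continuous (fun G : Ω => cutL β d o r G) ∧ Continuous fun G : Ω => cutR β d o r G := by
  have h χ := ((gammaFam N Δ χ).map 0 r).continuous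
  exact ⟨h _, (Sob.S _ (ℓ r)).continuous.comp (h _)⟩

lemma glueCoord_add (hr : r ≠ 0) (f g f' g' : Ω) (s : ℝ) : (𝓖 r (f + f') (g + g')).1 s =
    (𝓖 r f g).1 s + glue β (ℓ r) (f'.1, g'.1) s := by
  rw [glueCoord_apply β d o hr, glueCoord_apply β d o hr, add_assoc]
  exact congrArg _ (congrFun (map_add _ (f.1, g.1) (f'.1, g'.1)) s)

lemma glueCoord_add_cut (hr : r ≠ 0) (f g y : Ω) : 𝓖 r (f + cutL β d o r (y - 𝓖 r f g)) (g + cutR β d o r (y - 𝓖 r f g)) = y := by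
  refine Sob.ext fun s => ?_; rw [glueCoord_add β d o hr, glue_cut β d o hr]; exact add_sub_cancel _ _

/-- The conditions under which a pair of paths can be cut differently. -/
def RecutOk (A t t' r : ℝ) : Prop := 0 ≤ r ∧ (t' - t, r) ∈ recutDom ∧ |t| ≤ A ∧ |t'| ≤ A ∧ (0 < r → 4 + 4 * A ≤ ℓ r + (t' - t))

lemma ev_recutOk {t t' r : ι → ℝ} {t₀' A : ℝ} (ht : Tendsto t l (𝓝 t₀))
    (ht' : Tendsto t' l (𝓝 t₀')) (hr : Tendsto r l (𝓝 0)) (h0 : ∀ᶠ i in l, 0 ≤ r i) (hA : |t₀| < A) (hA' : |t₀'| < A) :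
    ∀ᶠ i in l, RecutOk A (t i) (t' i) (r i) := by
  have h2 := tendsto_len.eventually_ge_atTop (4 + 6 * A); rw [eventually_nhdsWithin_iff] at h2
  filter_upwards [h0, (((ht'.sub ht).prodMk_nhds hr).eventually (isOpen_recutDom.mem_nhds (mem_recutDom_zero _))), ht.abs.eventually (gt_mem_nhds hA), ht'.abs.eventually (gt_mem_nhds hA'), hr.eventually h2]
    with i h3 h4 h5 h6 h7
  refine ⟨h3, h4, h5.le, h6.le, fun h => ?_⟩; have h8 := h7 h; linarith [neg_abs_le (t' i), le_abs_self (t i)]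

variable (a b c) in
/-- The parameters after a change of the cut. -/
def recutPt (A t t' : ℝ) (q : Ξ) : Ξ := (recPar (t' - t) q.1, recutL (W := Δ) β φL φR (A + 1) q.1 t t' q.2.1 q.2.2,
    recutR (W := Δ) β φL φR (A + 1) q.1 t t' q.2.1 q.2.2)

lemma gcls_recut {A : ℝ} (h : RecutOk A t t' q.1) : 𝓒 (recutPt β d o a b c A t t' q) = 𝓒 q := by
  obtain ⟨r, f, g⟩ := q; obtain ⟨h0, h1, h2, h3, h4⟩ := h; rcases eq_or_lt_of_le h0 with hr | hr
  · change 0 = r at hr; subst hr; rw [recutPt, recPar_zero, gcls_zero, gcls_zero]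
    refine congrArg₂ _ (PathSpace.cls_eq_iff.2 ⟨t, fun s => ?_⟩).symm (PathSpace.cls_eq_iff.2 ⟨t', fun s => ?_⟩).symm
    · exact (congrArg _ (recutL_zero (W := Δ) β _ φR (A + 1) t t' f g s)).trans (add_sub_cancel _ _)
    · exact (congrArg _ (recutR_zero (W := Δ) β φL _ (A + 1) t t' f g s)).trans (add_sub_cancel _ _)
  · rw [recutPt, gcls_of_ne β (recPar_pos h1 hr).ne', gcls_of_ne β (ne_of_gt hr)]
    exact congrArg _ (PathSpace.cls_eq_iff.2 ⟨t, fun s => glue_recut (W := Δ) β _ _ hr h1 h2 h3 (h4 hr) f g s⟩).symm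

lemma recutPt_smooth {A : ℝ} [ScGood T] {U : Set (T.L 0)} {t t' : T.L 0 → ℝ} {q : T.L 0 → Ξ}
    (ht : ScSmoothOn T Λ U t) (ht' : ScSmoothOn T Λ U t')
    (hq : ScSmoothOn T (𝓞) U q) (h : ∀ x ∈ U, RecutOk A (t x) (t' x) (q x).1) :
    ScSmoothOn T (𝓞) U fun x => recutPt β d o a b c A (t x) (t' x) (q x) := by
  have hr := (parScale.smooth_r d o univ).comp_univ hq; have hf := (parScale.smooth_f d o univ).comp_univ hq
  have hg := (parScale.smooth_g d o univ).comp_univ hq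
  have h0 := fun x hx => (h x hx).1
  have hd := fun x hx => (h x hx).2.1
  exact ScSmoothOn.pair (recPar_smooth hr ht ht' hd)
    (ScSmoothOn.pair (recutL_smooth β _ _ _ hr h0 ht ht' hd hf hg) (recutR_smooth β _ _ _ hr h0 ht ht' hd hf hg))

lemma recutPt_zero (A t t' : ℝ) (f g : Ω) : recutPt β d o a b c A t t' (0, f, g) =
    (0, (φL).shCoord d o t f, (φR).shCoord d o t' g) := by
  refine Prod.ext (recPar_zero _) (Prod.ext (Sob.ext fun s => ?_) (Sob.ext fun s => ?_))
  · exact (recutL_zero (W := Δ) β _ φR _ t t' f g s).trans (IsTransition.shCoord_apply d o _ t f s).symm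
  · exact (recutR_zero (W := Δ) β φL _ _ t t' f g s).trans (IsTransition.shCoord_apply d o _ t' g s).symm

lemma exists_recut (d : StrictMono δ) (o : δ 0 = 0) {f g f' g' : Ω} (h : 𝓒 (0, f, g) = 𝓒 (0, f', g')) :
    ∃ G : Ξ → Ξ, Tendsto G (𝓝[brDom N δ] (0, f', g')) (𝓝[brDom N δ] (0, f, g)) ∧ ∀ᶠ q in 𝓝[brDom N δ] (0, f', g'), 𝓒 (G q) = 𝓒 q := by
  rw [gcls_zero, gcls_zero] at h; obtain ⟨h1, h2⟩ := BrokenTraj.broken.inj h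
  obtain ⟨t, ht⟩ := exists_shCoord d o _ h1.symm
  obtain ⟨t', ht'⟩ := exists_shCoord d o _ h2.symm; let A := max |t| |t'| + 1
  have hA : |t| < A := (le_max_left _ _).trans_lt (lt_add_one _)
  have hA' : |t'| < A := (le_max_right _ _).trans_lt (lt_add_one _)
  have hfst : Tendsto (fun q : Ξ => q.1) (𝓝[brDom N δ] (0, f', g')) (𝓝 0) :=
    (continuous_fst.tendsto _).mono_left nhdsWithin_le_nhds
  have hok := ev_recutOk tendsto_const_nhds tendsto_const_nhds hfst
    (eventually_mem_nhdsWithin.mono fun q hq => hq.1) hA hA'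
  have hmem : ((0, f', g') : Ξ) ∈ {q : Ξ | RecutOk A t t' q.1} := by
    refine ⟨le_rfl, mem_recutDom_zero _, hA.le, hA'.le, fun h => (lt_irrefl _ h).elim⟩
  have hc : Tendsto (recutPt β d o a b c A t t') (𝓝[brDom N δ] (0, f', g')) (𝓝 (0, f, g)) := by
    rw [ht, ht', ← recutPt_zero β d o A]
    exact ((recutPt_smooth β d o (a := a) (b := b) (c := c) (A := A) (scSmoothOn_const _ _ t) (scSmoothOn_const _ _ t') ((ScOp.id (𝓞)).smooth _) fun q hq => hq).continuousOn _ hmem).mono_left (le_inf nhdsWithin_le_nhds (le_principal_iff.2 hok))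
  refine ⟨recutPt β d o a b c A t t', tendsto_nhdsWithin_iff.2 ⟨hc, ?_⟩, hok.mono fun q hq => gcls_recut β d o hq⟩
  filter_upwards [hok, (continuous_fst.tendsto _).comp hc (gt_mem_nhds one_pos)] with q h3 h4
  exact ⟨div_nonneg h3.1 (le_of_lt h3.2.1.2), h4⟩

lemma open_image_ucls (d : StrictMono δ) (o : δ 0 = 0) {S : Set Ω} (hS : IsOpen S) : IsOpen (𝓤 '' S) := by
  have h1 : ∀ f : Ω, 𝓤 f ∈ 𝓤 '' S → ∀ᶠ f' in 𝓝 f, 𝓤 f' ∈ 𝓤 '' S := by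
    rintro f ⟨f₀, hf₀, h⟩; obtain ⟨t, rfl⟩ := exists_shCoord_of_ucls β d o h.symm
    filter_upwards [(((φU).cont_shCoord d o).comp (Continuous.prodMk_right t)).tendsto f (hS.mem_nhds hf₀)] with f' hf'
    exact ⟨_, hf', ucls_shift β d o t f'⟩
  refine (isOpen_brTraj_iff β).2 ⟨h1, fun q hq hqS => ?_⟩
  by_cases h0 : q.1 = 0
  · obtain ⟨r, f, g⟩ := q; change r = 0 at h0; subst h0; obtain ⟨f₀, -, h⟩ := hqS
    exact (ucls_ne_gcls β f₀ f g h).elim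
  · have hpos := lt_of_le_of_ne hq.1 (Ne.symm h0); rw [gcls_eq β d o hq h0] at hqS
    filter_upwards [mem_nhdsWithin_of_mem_nhds ((contAt_glueCoord β d o hpos).eventually (h1 _ hqS)),
      self_mem_nhdsWithin, mem_nhdsWithin_of_mem_nhds ((isOpen_lt continuous_const continuous_fst).mem_nhds hpos)]
      with q' h2 h3 h4
    rwa [gcls_eq β d o h3 (ne_of_gt h4)]

lemma open_image_gcls (d : StrictMono δ) (o : δ 0 = 0) {S : Set Ξ} (hS : IsOpen S) : IsOpen (𝓒 '' (S ∩ brDom N δ)) := by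
  have h1 : ∀ q ∈ S ∩ brDom N δ, q.1 ≠ 0 → 𝓒 '' (S ∩ brDom N δ) ∈ 𝓝 (𝓒 q) := by
    intro q hq h0; let y₀ : Ω := 𝓖 q.1 q.2.1 q.2.2
    let G := fun y => (q.1, q.2.1 + cutL β d o q.1 (y - y₀), q.2.2 + cutR β d o q.1 (y - y₀))
    have hGc : Continuous G := by
      have h := cont_cut β d o (N := N) q.1
      exact continuous_const.prodMk ((continuous_const.add (h.1.comp (continuous_id.sub continuous_const))).prodMk
        (continuous_const.add (h.2.comp (continuous_id.sub continuous_const))))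
    have hGq : G y₀ = q := by
      change (q.1, q.2.1 + _, q.2.2 + _) = q
      rw [sub_self, (cut_zero β d o q.1).1, (cut_zero β d o q.1).2, add_zero, add_zero]
    have hG : ∀ y, 𝓒 (G y) = 𝓤 y := fun y => by
      rw [gcls_eq β d o (show G y ∈ brDom N δ from hq.2) h0]
      exact congrArg _ (glueCoord_add_cut β d o h0 q.2.1 q.2.2 y)
    have h2 := open_image_ucls β d o (a := a) (b := b) (c := c) (hS.preimage hGc); rw [gcls_eq β d o hq.2 h0]
    refine mem_of_superset (h2.mem_nhds ⟨y₀, show G y₀ ∈ S from hGq ▸ hq.1, rfl⟩) ?_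
    rintro _ ⟨y, hy, rfl⟩; exact ⟨G y, ⟨hy, hq.2⟩, hG y⟩
  refine (isOpen_brTraj_iff β).2 ⟨?_, ?_⟩
  · rintro f ⟨⟨r, f', g'⟩, hq, h⟩; have h0 : r ≠ 0 := by
      rintro rfl; exact ucls_ne_gcls β f f' g' h.symm
    exact (cont_ucls β).continuousAt.eventually_mem (h ▸ h1 _ hq h0)
  · rintro q' hq' ⟨q, hq, h⟩
    by_cases h0 : q.1 = 0
    · obtain ⟨r, f, g⟩ := q; obtain ⟨r', f', g'⟩ := q'; change r = 0 at h0; subst h0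
      by_cases h0' : r' = 0
      · subst h0'; obtain ⟨G, hG, hG'⟩ := exists_recut β d o h
        filter_upwards [hG (inter_mem (mem_nhdsWithin_of_mem_nhds (hS.mem_nhds hq.1)) self_mem_nhdsWithin), hG'] with x h2 h3
        exact ⟨_, h2, h3⟩
      · rw [gcls_eq β d o hq' h0'] at h; exact (ucls_ne_gcls β _ f g h.symm).elim
    · exact ((contOn_gcls β) q' hq').eventually_mem (h ▸ h1 _ hq h0)

end Topology

lemma exists_ultrafilter_prod {Z Z' X : Type*} [TopologicalSpace X] {π : Z → X} {π' : Z' → X} {F : Filter Z} {F' : Filter Z'}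
    {x y : X} (h : 𝓝 x ≤ map π F) (h' : 𝓝 y ≤ map π' F') (hne : (𝓝 x ⊓ 𝓝 y).NeBot) :
    ∃ l : Ultrafilter (Z × Z'), Tendsto Prod.fst (l : Filter (Z × Z')) F ∧ Tendsto Prod.snd (l : Filter (Z × Z')) F' ∧
      ∀ᶠ p in (l : Filter (Z × Z')), π p.1 = π' p.2 := by
  let L := (F ×ˢ F') ⊓ 𝓟 {p | π p.1 = π' p.2}; have hL : L.NeBot := by
    refine inf_principal_neBot_iff.2 fun U hU => ?_; obtain ⟨S, hS, S', hS', hSU⟩ := mem_prod_iff.1 hU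
    obtain ⟨_, ⟨z, hz, rfl⟩, z', hz', e⟩ := hne.nonempty_of_mem (inter_mem_inf (h (image_mem_map hS)) (h' (image_mem_map hS')))
    exact ⟨(z, z'), hSU ⟨hz, hz'⟩, e.symm⟩
  refine ⟨Ultrafilter.of L, ?_, ?_, ?_⟩
  · exact tendsto_fst.mono_left ((Ultrafilter.of_le L).trans inf_le_left)
  · exact tendsto_snd.mono_left ((Ultrafilter.of_le L).trans inf_le_left)
  · exact (Ultrafilter.of_le L).trans inf_le_right (mem_principal_self _)

lemma TendstoUniformly.tendstoLeft {y : ι → Φ} {u : Φ}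
    (h : TendstoUniformly y u l) : TendstoLeft y l u := fun _ => h.tendstoUniformlyOn

lemma tendsto_neg_comp {u : Φ} : (Tendsto u atTop (𝓝 a) → Tendsto (fun s => u (-s)) atBot (𝓝 a)) ∧
    (Tendsto u atBot (𝓝 a) → Tendsto (fun s => u (-s)) atTop (𝓝 a)) :=
  ⟨fun h => h.comp tendsto_neg_atBot_atTop, fun h => h.comp tendsto_neg_atTop_atBot⟩

section Hausdorff

variable (β : Cutoff) {a b c : Vec N}

lemma IsTransition.tendstoUniformly (o : δ 0 = 0) (hφ : IsTransition a b φ)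
    {f : ι → Ω} (h : Tendsto f l (𝓝 f₀)) : TendstoUniformly (fun i s => φ s + (f i).1 s) (fun s => φ s + f₀.1 s) l :=
  PathSpace.tendstoUniformly o.ge ((hφ.homeo.continuous.tendsto f₀).comp h)

variable (a b c) in
/-- The glued path, or the first path if `r = 0`. -/
def leftPart (q : Ξ) (s : ℝ) : Vec N := open Classical in if q.1 = 0 then refL β a b s + q.2.1.1 s else
    glue β (ℓ q.1) (refL β a b + q.2.1.1, refR β b c + q.2.2.1) s

variable (a b c) in
/-- The glued path, or the second path if `r = 0`, in the time of the second path. -/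
def rightPart (q : Ξ) (s : ℝ) : Vec N := open Classical in if q.1 = 0 then refR β b c s + q.2.2.1 s else
    glue β (ℓ q.1) (refL β a b + q.2.1.1, refR β b c + q.2.2.1) (s + ℓ q.1)

lemma exists_shift_of_gcls {q' : Ξ} (h : 𝓒 q = 𝓒 q') :
    (q.1 = 0 ↔ q'.1 = 0) ∧ ∃ τ τ', (∀ s, leftPart β a b c q' s = leftPart β a b c q (s + τ)) ∧
      (∀ s, rightPart β a b c q' s = rightPart β a b c q (s + τ')) ∧
      (q.1 ≠ 0 → τ' = τ + ℓ q'.1 - ℓ q.1) := by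
  obtain ⟨r, f, g⟩ := q; obtain ⟨r', f', g'⟩ := q'
  by_cases h0 : r = 0 <;> by_cases h0' : r' = 0
  · subst h0 h0'; refine ⟨Iff.rfl, ?_⟩; rw [gcls_zero, gcls_zero] at h
    obtain ⟨τ, hτ⟩ := PathSpace.cls_eq_iff.1 (BrokenTraj.broken.inj h).1
    obtain ⟨τ', hτ'⟩ := PathSpace.cls_eq_iff.1 (BrokenTraj.broken.inj h).2
    refine ⟨τ, τ', fun s => ?_, fun s => ?_, fun h => (h rfl).elim⟩
    · rw [leftPart, leftPart, if_pos rfl, if_pos rfl]; exact hτ s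
    · rw [rightPart, rightPart, if_pos rfl, if_pos rfl]; exact hτ' s
  · subst h0; rw [gcls_zero, gcls_of_ne β h0'] at h; exact nomatch h
  · subst h0'; rw [gcls_zero, gcls_of_ne β h0] at h; exact nomatch h
  · refine ⟨⟨fun h => (h0 h).elim, fun h => (h0' h).elim⟩, ?_⟩; rw [gcls_of_ne β h0, gcls_of_ne β h0'] at h
    obtain ⟨τ, hτ⟩ := PathSpace.cls_eq_iff.1 (BrokenTraj.unbroken.inj h)
    refine ⟨τ, τ + ℓ r' - ℓ r, fun s => ?_, fun s => ?_, fun _ => rfl⟩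
    · rw [leftPart, leftPart, if_neg h0, if_neg h0']; exact hτ s
    · rw [rightPart, rightPart, if_neg h0, if_neg h0']; refine (hτ _).trans (congrArg _ ?_); ring

lemma ev_len {r : ι → ℝ} (hr : Tendsto r l (𝓝 0)) (h0 : ∀ᶠ i in l, 0 ≤ r i) (M : ℝ) : ∀ᶠ i in l, r i ≠ 0 → M ≤ ℓ (r i) := by
  have h2 := tendsto_len.eventually_ge_atTop M; rw [eventually_nhdsWithin_iff] at h2
  filter_upwards [hr.eventually h2, h0] with i h3 h4 h5; exact h3 (lt_of_le_of_ne h4 (Ne.symm h5))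

lemma tendstoLeft_leftPart (o : δ 0 = 0) {q : ι → Ξ} {f g : Ω} (h : Tendsto q l (𝓝 (0, f, g))) (h0 : ∀ᶠ i in l, 0 ≤ (q i).1) :
    TendstoLeft (fun i => leftPart β a b c (q i)) l fun s => refL β a b s + f.1 s := fun M => by
  have h1 := (φL).tendstoUniformly o (((continuous_fst.comp continuous_snd).tendsto ((0, f, g) : Ξ)).comp h)
  refine h1.tendstoUniformlyOn.congr ?_
  filter_upwards [ev_len ((continuous_fst.tendsto ((0, f, g) : Ξ)).comp h) h0 (2 * M + 2)] with i hi s hs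
  change (q i).1 ≠ 0 → _ ≤ ℓ (q i).1 at hi
  change refL β a b s + (q i).2.1.1 s = leftPart β a b c (q i) s; rw [leftPart]
  split_ifs with hq
  · rfl
  · rw [glue_apply, β.eq_one _ (by linarith [hi hq, mem_Iic.1 hs])]
    change _ = (1 : ℝ) • (refL β a b s + (q i).2.1.1 s) + (1 - 1 : ℝ) • _; module

lemma tendstoLeft_rightPart (o : δ 0 = 0) {q : ι → Ξ} {f g : Ω} (h : Tendsto q l (𝓝 (0, f, g))) (h0 : ∀ᶠ i in l, 0 ≤ (q i).1) :
    TendstoLeft (fun i s => rightPart β a b c (q i) (-s)) l fun s => refR β b c (-s) + g.1 (-s) := fun M => by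
  refine (((φR).tendstoUniformly o (((continuous_snd.comp continuous_snd).tendsto _).comp h)).comp fun s : ℝ => -s).tendstoUniformlyOn.congr ?_
  filter_upwards [ev_len ((continuous_fst.tendsto _).comp h) h0 (2 * M + 2)] with i hi s hs
  change refR β b c (-s) + (q i).2.2.1 (-s) = rightPart β a b c (q i) (-s); rw [rightPart]
  split_ifs with hq
  · rfl
  · rw [glue_apply, β.eq_zero (by grind), add_sub_cancel_right]
    change _ = (0 : ℝ) • _ + (1 - 0 : ℝ) • (refR β b c (-s) + (q i).2.2.1 (-s)); module

lemma IsTransition.path_facts (o : δ 0 = 0) (hφ : IsTransition a b φ) (f : Ω) :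
    Continuous (fun s => φ s + f.1 s) ∧ Tendsto (fun s => φ s + f.1 s) atBot (𝓝 a) ∧ Tendsto (fun s => φ s + f.1 s) atTop (𝓝 b) :=
  ⟨(hφ.path f).contDiff.continuous, (hφ.path f).tendsto_atBot o.ge, (hφ.path f).tendsto_atTop o.ge⟩

lemma exists_shift_glued (o : δ 0 = 0) (hab : a ≠ b) (hbc : b ≠ c) (l : Ultrafilter ι)
    {q q' : ι → Ξ} {f g f' g' : Ω} (h : Tendsto q l (𝓝 (0, f, g))) (h0 : ∀ᶠ i in (l : Filter ι), 0 ≤ (q i).1)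
    (h' : Tendsto q' l (𝓝 (0, f', g'))) (h0' : ∀ᶠ i in (l : Filter ι), 0 ≤ (q' i).1) {τ τ' : ι → ℝ}
    (hL : ∀ᶠ i in (l : Filter ι), ∀ s, leftPart β a b c (q' i) s = leftPart β a b c (q i) (s + τ i))
    (hR : ∀ᶠ i in (l : Filter ι), ∀ s, rightPart β a b c (q' i) s = rightPart β a b c (q i) (s + τ' i)) :
    ∃ t t', Tendsto τ l (𝓝 t) ∧ Tendsto τ' l (𝓝 t') ∧ (∀ s, refL β a b s + f'.1 s = refL β a b (s + t) + f.1 (s + t)) ∧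
      ∀ s, refR β b c s + g'.1 s = refR β b c (s + t') + g.1 (s + t') := by
  obtain ⟨u1, u2, u3⟩ := (φL).path_facts o f; obtain ⟨u1', u2', u3'⟩ := (φL).path_facts o f'
  obtain ⟨v1, v2, v3⟩ := (φR).path_facts o g; obtain ⟨v1', v2', v3'⟩ := (φR).path_facts o g'
  obtain ⟨t, ht, hut⟩ := exists_shift l (tendstoLeft_leftPart β o h h0) (tendstoLeft_leftPart β o h' h0') u1 u1' u2 u2' u3 u3' hab hab hL
  obtain ⟨t', ht', hvt⟩ := exists_shift l (tendstoLeft_rightPart β o h h0)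
    (tendstoLeft_rightPart β o h' h0') (v1.comp continuous_neg) (v1'.comp continuous_neg) (tendsto_neg_comp.1 v3)
    (tendsto_neg_comp.1 v3') (tendsto_neg_comp.2 v2) (tendsto_neg_comp.2 v2') hbc.symm hbc.symm
    (hR.mono fun i hi s => by rw [hi, neg_add, neg_neg])
  refine ⟨t, -t', ht, ?_, hut, fun s => ?_⟩
  · have h1 := ht'.neg; simp only [neg_neg] at h1; exact h1
  · have h1 := hvt (-s); simp only [neg_neg, neg_add] at h1; exact h1

lemma nhds_ucls (d : StrictMono δ) (o : δ 0 = 0) (f : Ω) : 𝓝 (𝓤 f) ≤ map 𝓤 (𝓝 f) :=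
  IsOpenMap.nhds_le (fun _ => open_image_ucls β d o) f

lemma nhds_gcls (d : StrictMono δ) (o : δ 0 = 0) (hq : q ∈ brDom N δ) : 𝓝 (𝓒 q) ≤ map 𝓒 (𝓝[brDom N δ] q) := fun S hS => by
  obtain ⟨U, hU, hqU, hUS⟩ := mem_nhdsWithin.1 (mem_map.1 hS)
  exact mem_of_superset ((open_image_gcls β d o hU).mem_nhds ⟨q, ⟨hqU, hq⟩, rfl⟩) (image_subset_iff.2 hUS)

lemma zero_mem_brDom (f g : Ω) : (0, f, g) ∈ brDom N δ := ⟨le_rfl, one_pos⟩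

lemma disjoint_nhds_cls (d : StrictMono δ) (o : δ 0 = 0) (hab : a ≠ b) (hbc : b ≠ c) (hac : a ≠ c) (f f' g' : Ω) :
    ¬ (𝓝 (𝓤 f) ⊓ 𝓝 (𝓒 (0, f', g'))).NeBot := fun hne => by
  obtain ⟨l, h1, h2, h3⟩ := exists_ultrafilter_prod (nhds_ucls β d o f) (nhds_gcls β d o (zero_mem_brDom f' g')) hne
  rw [tendsto_nhdsWithin_iff] at h2
  have h4 : ∀ᶠ p in (l : Filter (Ω × Ξ)), ∃ t, ∀ s, leftPart β a b c p.2 s = refU β a b c (s + t) + p.1.1 (s + t) := by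
    filter_upwards [h3] with p hp; obtain ⟨f, r, f', g'⟩ := p
    by_cases h0 : r = 0
    · subst h0; exact (ucls_ne_gcls β f f' g' hp).elim
    · rw [ucls, gcls_of_ne β h0] at hp
      obtain ⟨t, ht⟩ := PathSpace.cls_eq_iff.1 (BrokenTraj.unbroken.inj hp); refine ⟨t, fun s => ?_⟩
      rw [leftPart, if_neg h0]; exact ht s
  choose! τ hτ using fun (p : Ω × Ξ) (hp : ∃ t, ∀ s, leftPart β a b c p.2 s = refU β a b c (s + t) + p.1.1 (s + t)) => hp
  obtain ⟨u1, u2, u3⟩ := (φU).path_facts o f; obtain ⟨u1', u2', u3'⟩ := (φL).path_facts o f'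
  obtain ⟨t, -, ht⟩ := exists_shift l (τ := τ) ((φU).tendstoUniformly o h1).tendstoLeft
    (tendstoLeft_leftPart β o h2.1 (h2.2.mono fun p hp => hp.1)) u1 u1' u2 u2' u3 u3' hac hab (h4.mono fun p hp => hτ p hp)
  exact hbc (tendsto_nhds_unique u3' (((u3.comp (tendsto_atTop_add_const_right _ t tendsto_id)).congr fun s => (ht s).symm)))

lemma BrokenTraj.t2Space (d : StrictMono δ) (o : δ 0 = 0) (hab : a ≠ b) (hbc : b ≠ c) (hac : a ≠ c) : T2Space 𝓧 := by
  refine t2_iff_nhds.2 fun {x y} hne => ?_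
  rcases exists_eq_cls β x with ⟨f, rfl⟩ | ⟨f, g, rfl⟩ <;> rcases exists_eq_cls β y with ⟨f', rfl⟩ | ⟨f', g', rfl⟩
  · obtain ⟨l, h1, h2, h3⟩ := exists_ultrafilter_prod (nhds_ucls β d o f) (nhds_ucls β d o f') hne
    choose! τ hτ using fun (p : ΩΩ) (hp : ∃ t : ℝ, ∀ s, ((φU).path p.2).1 s = ((φU).path p.1).1 (s + t)) => hp
    obtain ⟨u1, u2, u3⟩ := (φU).path_facts o f; obtain ⟨u1', u2', u3'⟩ := (φU).path_facts o f'
    obtain ⟨t, -, ht⟩ := exists_shift l ((φU).tendstoUniformly o h1).tendstoLeft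
      ((φU).tendstoUniformly o h2).tendstoLeft u1 u1' u2 u2' u3 u3' hac hac
      ((h3.mono fun p hp => PathSpace.cls_eq_iff.1 (BrokenTraj.unbroken.inj hp)).mono fun p hp => hτ p hp)
    exact congrArg BrokenTraj.unbroken (PathSpace.cls_eq_iff.2 ⟨t, ht⟩)
  · exact (disjoint_nhds_cls β d o hab hbc hac f f' g' hne).elim
  · exact (disjoint_nhds_cls β d o hab hbc hac f' f g (by grind)).elim
  · obtain ⟨l, h1, h2, h3⟩ := exists_ultrafilter_prod (nhds_gcls β d o (zero_mem_brDom f g)) (nhds_gcls β d o (zero_mem_brDom f' g')) hne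
    rw [tendsto_nhdsWithin_iff] at h1 h2; choose! τ τ' hτ using fun (p : Ξ × Ξ) hp =>
      (exists_shift_of_gcls β hp).2
    obtain ⟨t, t', -, -, ht, ht'⟩ := exists_shift_glued β o hab hbc l h1.1 (h1.2.mono fun p hp => hp.1)
      h2.1 (h2.2.mono fun p hp => hp.1) (h3.mono fun p hp => (hτ p hp).1) (h3.mono fun p hp => (hτ p hp).2.1)
    rw [gcls_zero, gcls_zero]
    exact congrArg₂ _ (PathSpace.cls_eq_iff.2 ⟨t, ht⟩) (PathSpace.cls_eq_iff.2 ⟨t', ht'⟩)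

lemma BrokenTraj.secondCountableTopology (d : StrictMono δ) (o : δ 0 = 0) : SecondCountableTopology 𝓧 := by
  let π : Ω ⊕ brDom N δ → 𝓧 := Sum.elim 𝓤 fun q => 𝓒 q.1
  have h1 : Continuous π := (cont_ucls β).sumElim (continuousOn_iff_continuous_domRestrict.1 (contOn_gcls β))
  have h2 : IsOpenMap π := isOpenMap_sum.2 ⟨fun _ => open_image_ucls β d o, fun S hS => by
    obtain ⟨U, hU, rfl⟩ := isOpen_induced_iff.1 hS
    have e : (fun q => π (Sum.inr q)) '' (Subtype.val ⁻¹' U) = 𝓒 '' (U ∩ brDom N δ) := by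
      rw [inter_comm, ← Subtype.image_preimage_coe, image_image]
      rfl
    rw [e]; exact open_image_gcls β d o hU⟩
  have h3 : Function.Surjective π := fun x => by
    rcases exists_eq_cls β x with ⟨f, rfl⟩ | ⟨f, g, rfl⟩
    · exact ⟨.inl f, rfl⟩
    · exact ⟨.inr ⟨_, zero_mem_brDom f g⟩, rfl⟩
  exact (h2.isQuotientMap h1 h3).secondCountableTopology h2

lemma isOpenEmbedding_unbroken (d : StrictMono δ) (o : δ 0 = 0) :
    Topology.IsOpenEmbedding (BrokenTraj.unbroken : Traj (δ 0) a c → 𝓧) := by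
  refine .of_continuous_injective_isOpenMap (continuous_def.2 fun V hV => (isOpen_sup.1 hV).1)
    (fun x y h => BrokenTraj.unbroken.inj h) fun S hS => ?_
  have e : BrokenTraj.unbroken '' S = 𝓤 '' ((fun f : Ω => ((φU).path f).cls) ⁻¹' S) := by
    ext x; constructor
    · rintro ⟨y, hy, rfl⟩; obtain ⟨w, rfl⟩ := PathSpace.cls_surjective y; refine ⟨(φU).coord w, ?_, ?_⟩
      · rwa [mem_preimage, IsTransition.path_coord]
      · rw [ucls, IsTransition.path_coord]
    · rintro ⟨f, hf, rfl⟩; exact ⟨_, hf, rfl⟩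
  rw [e]; exact open_image_ucls β d o (hS.preimage (PathSpace.cont_cls.comp (φU).homeo.continuous))

lemma denseRange_unbroken : DenseRange (BrokenTraj.unbroken : Traj (δ 0) a c → 𝓧) := fun x => by
  rcases exists_eq_cls β x with ⟨f, rfl⟩ | ⟨f, g, rfl⟩
  · exact subset_closure ⟨_, rfl⟩
  · have h1 : Tendsto (fun r : ℝ => (r, f, g)) (𝓝[>] 0) (𝓝[brDom N δ] (0, f, g)) := by
      refine tendsto_nhdsWithin_iff.2 ⟨((Continuous.prodMk_left (f, g)).tendsto (0 : ℝ)).mono_left nhdsWithin_le_nhds, ?_⟩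
      filter_upwards [self_mem_nhdsWithin, mem_nhdsWithin_of_mem_nhds (gt_mem_nhds one_pos)] with r h h'
      exact ⟨le_of_lt h, h'⟩
    refine mem_closure_of_tendsto (Tendsto.comp (contOn_gcls β _ (zero_mem_brDom f g)) h1) ?_
    filter_upwards [self_mem_nhdsWithin] with r h; exact ⟨_, (gcls_of_ne β (ne_of_gt h) f g).symm⟩

lemma isEmbedding_broken (d : StrictMono δ) (o : δ 0 = 0) :
    Topology.IsEmbedding (fun p : Traj (δ 0) a b × Traj (δ 0) b c => (BrokenTraj.broken p.1 p.2 : 𝓧)) := by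
  have hq (p q : Vec N) : IsOpenQuotientMap (PathSpace.cls : Ψ p q → Traj (δ 0) p q) :=
    ⟨PathSpace.cls_surjective, PathSpace.cont_cls, PathSpace.isOpenMap_cls d o⟩
  have hc : Continuous (fun p : Traj (δ 0) a b × Traj (δ 0) b c => (BrokenTraj.broken p.1 p.2 : 𝓧)) := by
    refine ((hq a b).prodMap (hq b c)).isQuotientMap.continuous_iff.2 ?_
    have h1 : Continuous fun p : Ψ a b × Ψ b c =>
        𝓒 _ :=
      (contOn_gcls β).comp_continuous (continuous_const.prodMk (((φL).homeo.symm.continuous.comp continuous_fst).prodMk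
          ((φR).homeo.symm.continuous.comp continuous_snd))) fun p => zero_mem_brDom _ _
    refine h1.congr fun p => ?_; rw [gcls_zero]
    exact congrArg₂ _ (congrArg _ (IsTransition.path_coord _ _)) (congrArg _ (IsTransition.path_coord _ _))
  refine ⟨isInducing_iff_nhds.2 fun x => le_antisymm (hc.tendsto x).le_comap fun S hS => ?_, fun x y h => ?_⟩
  · obtain ⟨U, hUS, hU, hxU⟩ := mem_nhds_iff.1 hS
    let V : Set Ξ := {q | (((φL).path q.2.1).cls, ((φR).path q.2.2).cls) ∈ U}
    have hV : IsOpen V := hU.preimage ((PathSpace.cont_cls.comp ((φL).homeo.continuous.comp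
      (continuous_fst.comp continuous_snd))).prodMk (PathSpace.cont_cls.comp
        ((φR).homeo.continuous.comp (continuous_snd.comp continuous_snd))))
    refine ⟨_, (open_image_gcls β d o hV).mem_nhds ?_, ?_⟩
    · obtain ⟨⟨w, hw⟩, w', hw'⟩ := And.intro (PathSpace.cls_surjective x.1) (PathSpace.cls_surjective x.2)
      refine ⟨(0, (φL).coord w, (φR).coord w'), ⟨?_, zero_mem_brDom _ _⟩, ?_⟩
      · change _ ∈ U
        rwa [IsTransition.path_coord, IsTransition.path_coord, hw, hw']
      · rw [gcls_zero, IsTransition.path_coord, IsTransition.path_coord, hw, hw']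
    · rintro y ⟨⟨r, f, g⟩, ⟨hqV, -⟩, h⟩
      by_cases h0 : r = 0
      · subst h0; rw [gcls_zero] at h; refine hUS ?_; obtain ⟨e1, e2⟩ := BrokenTraj.broken.inj h
        have : y = (((φL).path f).cls, ((φR).path g).cls) := Prod.ext e1.symm e2.symm; rw [this]; exact hqV
      · rw [gcls_of_ne β h0] at h; exact nomatch h
  · obtain ⟨e1, e2⟩ := BrokenTraj.broken.inj h; exact Prod.ext e1 e2

end Hausdorff

/-! ### Charts with local lifts -/

/-- A family of points of `X` that is parametrized by a subset `D` of a sc-space. -/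
structure Model (X : Type) where
  M : ScScale
  D : Set (M.L 0)
  base : Set (M.L 0)
  cls : M.L 0 → X

section Abstract

variable {X : Type} (κ κ' : PolyfoldChart X) (m : Model X)

/-- The domain of the retraction of a splicing. -/
def Splicing.dom (S : Splicing) : Set (S.total.L 0) := {p : S.A × S.E.L 0 | p.1 ∈ S.V}

/-- The chart has local sc-smooth inverses on the model. -/
def HasLift : Prop := ∀ x ∈ m.base, ∀ p ∈ κ.O, κ.ψ p = m.cls x → ∃ U, IsOpen U ∧ x ∈ U ∧
  ∃ G : m.M.L 0 → κ.S.total.L 0, ScSmoothOn m.M κ.S.total (m.D ∩ U) G ∧ G x = p ∧ ∀ y ∈ m.D ∩ U, G y ∈ κ.S.core ∧ κ.ψ (G y) = m.cls y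

/-- The chart factors locally through the model. -/
def HasParam (p : κ.S.total.L 0) : Prop := ∃ U, IsOpen U ∧ p ∈ U ∧
  ∃ F : κ.S.total.L 0 → m.M.L 0, ScSmoothOn κ.S.total m.M (κ.S.dom ∩ U) F ∧ F p ∈ m.base ∧
    ∀ x ∈ κ.S.dom ∩ U, F x ∈ m.D ∧ κ.ψ (κ.S.retract x) = m.cls (F x)

variable {κ κ' m}

lemma ContinuousOn.exists_isOpen {Y Z : Type*} [TopologicalSpace Y] [TopologicalSpace Z] {f : Y → Z} {s : Set Y} {t : Set Z}
    (h : ContinuousOn f s) (ht : IsOpen t) : ∃ u, IsOpen u ∧ ∀ y ∈ s, y ∈ u ↔ f y ∈ t := by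
  obtain ⟨u, hu, e⟩ := continuousOn_iff'.1 h t ht
  exact ⟨u, hu, fun y hy => ⟨fun h => (e.symm.subset ⟨h, hy⟩).1, fun h => (e.subset ⟨h, hy⟩).1⟩⟩

lemma IsScSplicing.retract_mem {S : Splicing} (hS : IsScSplicing S) {p : S.A × S.E.L 0} (hp : p.1 ∈ S.V) :
    S.retract p ∈ S.core := ⟨hp, hS.idem _ hp _⟩

lemma Splicing.retract_eq {S : Splicing} {p : S.A × S.E.L 0} (hp : p ∈ S.core) : S.retract p = p := Prod.ext rfl hp.2

lemma IsScSplicing.contOn_retract {S : Splicing} (hS : IsScSplicing S) : ContinuousOn S.retract {p : S.A × S.E.L 0 | p.1 ∈ S.V} :=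
  continuousOn_fst.prodMk (ScSmoothOn.continuousOn (E := S.total) hS.smooth)

lemma HasParam.continuousWithinAt [TopologicalSpace X] {p : κ.S.A × κ.S.E.L 0} (hp : p ∈ κ.S.core)
    (hc : ContinuousOn m.cls m.D) (h : HasParam κ m p) : ContinuousWithinAt κ.ψ κ.S.core p := by
  obtain ⟨U, hU, hpU, F, hF, -, h⟩ := h; have hx : p ∈ κ.S.dom ∩ U := ⟨hp.1, hpU⟩
  have h1 : ContinuousWithinAt (m.cls ∘ F) (κ.S.dom ∩ U) p :=
    ContinuousWithinAt.comp (hc _ (h p hx).1) (hF.continuousOn p hx) fun x hx => (h x hx).1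
  refine (h1.mono_of_mem_nhdsWithin (inter_mem (mem_of_superset self_mem_nhdsWithin fun x hx => hx.1)
    (mem_nhdsWithin_of_mem_nhds (hU.mem_nhds hpU)))).congr_of_eventuallyEq ?_ ?_
  · filter_upwards [self_mem_nhdsWithin, mem_nhdsWithin_of_mem_nhds (hU.mem_nhds hpU)] with x h2 h3
    exact (congrArg κ.ψ (Splicing.retract_eq h2)).symm.trans (h x ⟨h2.1, h3⟩).2
  · exact (congrArg κ.ψ (Splicing.retract_eq hp)).symm.trans (h p hx).2

lemma HasLift.nhds_le [TopologicalSpace X] {x : m.M.L 0} (hx : x ∈ m.base) (hxD : x ∈ m.D) {p : κ.S.A × κ.S.E.L 0}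
    (hp : p ∈ κ.O) (he : κ.ψ p = m.cls x) (hn : 𝓝 (m.cls x) ≤ map m.cls (𝓝[m.D] x)) (h : HasLift κ m) :
    𝓝 (κ.ψ p) ≤ map κ.ψ (𝓝[κ.S.core] p) := by
  obtain ⟨U, hU, hxU, G, hG, rfl, h⟩ := h x hx p hp he
  have h1 : Tendsto G (𝓝[m.D] x) (𝓝[κ.S.core] (G x)) := by
    have h2 : m.D ∩ U ∈ 𝓝[m.D] x := inter_mem_nhdsWithin _ (hU.mem_nhds hxU)
    refine tendsto_nhdsWithin_iff.2 ⟨(hG.continuousOn x ⟨hxD, hxU⟩).mono_of_mem_nhdsWithin h2, ?_⟩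
    filter_upwards [h2] with y hy using (h y hy).1
  intro S hS
  refine he ▸ hn (mem_map.2 (mem_of_superset (inter_mem (h1 hS) (inter_mem_nhdsWithin _ (hU.mem_nhds hxU))) ?_))
  rintro y ⟨hy, hy'⟩; exact mem_preimage.2 ((h y hy').2 ▸ hy)

lemma isChart_of_lift [TopologicalSpace X] (hS : IsScSplicing κ.S) {W : Set (κ.S.A × κ.S.E.L 0)} (hW : IsOpen W)
    (hO : κ.O = κ.S.core ∩ W) (hc : ContinuousOn κ.ψ κ.O) (hinj : InjOn κ.ψ κ.O)
    (hn : ∀ p ∈ κ.O, 𝓝 (κ.ψ p) ≤ map κ.ψ (𝓝[κ.S.core] p)) : IsPolyfoldChart κ where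
  splicing := hS
  isOpen := ⟨W, hW, hO⟩
  openEmbedding := by
    refine .of_continuous_injective_isOpenMap (continuousOn_iff_continuous_domRestrict.1 hc)
      (fun x y h => Subtype.ext (hinj x.2 y.2 h)) (IsOpenMap.of_nhds_le fun p => ?_)
    refine (hn p p.2).trans ?_; have h1 : ∀ x ∈ κ.O, 𝓝[κ.S.core] x = 𝓝[κ.O] x := fun x hx => by
      rw [hO] at hx ⊢; exact (nhdsWithin_inter_of_mem' (mem_nhdsWithin_of_mem_nhds (hW.mem_nhds hx.2))).symm
    rw [h1 p p.2, nhdsWithin_eq_map_subtype_coe p.2, Filter.map_map]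
    rfl

lemma IsPolyfoldChart.injOn [TopologicalSpace X] (h : IsPolyfoldChart κ) : InjOn κ.ψ κ.O := fun x hx y hy e =>
  congrArg Subtype.val (@h.openEmbedding.injective ⟨x, hx⟩ ⟨y, hy⟩ e)

lemma isScTransition_of_lift [TopologicalSpace X] (h : IsPolyfoldChart κ) (h' : IsPolyfoldChart κ')
    [ScGood κ.S.total] [ScGood κ'.S.total] (hd : ScDom κ.S.total κ.S.dom)
    (H : ∀ p ∈ κ.S.dom, κ.S.retract p ∈ κ.O → ∃ m : Model X, ScGood m.M ∧
      (∀ U, IsOpen U → ScDom m.M (m.D ∩ U)) ∧ HasParam κ m p ∧ HasLift κ' m) :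
    IsScTransition κ κ' := by
  obtain ⟨W, hW, hO⟩ := h.isOpen; obtain ⟨W', hW', hO'⟩ := h'.isOpen
  obtain ⟨u, hu, hu'⟩ := h.splicing.contOn_retract.exists_isOpen hW
  have hmem : ∀ p ∈ κ.S.dom, (p ∈ u ↔ κ.S.retract p ∈ κ.O) := fun p hp => (hu' p hp).trans
    ⟨fun h1 => hO ▸ ⟨h.splicing.retract_mem hp, h1⟩, fun h1 => (hO ▸ h1 : κ.S.retract p ∈ κ.S.core ∩ W).2⟩
  have hψ : ContinuousOn (fun p => κ.ψ (κ.S.retract p)) (κ.S.dom ∩ u) :=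
    (continuousOn_iff_continuous_domRestrict.2 h.openEmbedding.continuous).comp
      (h.splicing.contOn_retract.mono inter_subset_left) fun p hp => (hmem p hp.1).1 hp.2
  have hr : κ'.ψ '' κ'.O = range fun p : κ'.O => κ'.ψ p := image_eq_range _ _
  obtain ⟨v, hv, hv'⟩ := hψ.exists_isOpen (hr ▸ h'.openEmbedding.isOpen_range : IsOpen (κ'.ψ '' κ'.O))
  have hdom : {p : κ.S.A × κ.S.E.L 0 | p.1 ∈ κ.S.V ∧ κ.S.retract p ∈ κ.O ∧ κ.ψ (κ.S.retract p) ∈ κ'.ψ '' κ'.O} =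
      κ.S.dom ∩ (u ∩ v) := by
    ext p; constructor
    · rintro ⟨h1, h2, h3⟩; have h4 := (hmem p h1).2 h2; exact ⟨h1, h4, (hv' p ⟨h1, h4⟩).2 h3⟩
    · rintro ⟨h1, h2, h3⟩; exact ⟨h1, (hmem p h1).1 h2, (hv' p ⟨h1, h2⟩).1 h3⟩
  refine ScSmoothOn.mono (U := κ.S.dom ∩ (u ∩ v)) ?_ hdom.subset
  refine ScSmoothOn.of_local (hd.inter (hu.inter hv)) fun p hp => ?_
  obtain ⟨m, hm, hmd, ⟨U, hU, hpU, F, hF, hFb, hF'⟩, hL⟩ := H p hp.1 ((hmem p hp.1).1 hp.2.1)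
  obtain ⟨p', hp', e⟩ := (hv' p ⟨hp.1, hp.2.1⟩).1 hp.2.2
  obtain ⟨U', hU', hxU', G, hG, hGp, hG'⟩ := hL (F p) hFb p' hp' (e.trans (hF' p ⟨hp.1, hpU⟩).2)
  obtain ⟨w, hw, hw'⟩ := hF.continuousOn.exists_isOpen hU'
  have hGF : ScSmoothOn κ.S.total κ'.S.total (κ.S.dom ∩ (U ∩ w)) (G ∘ F) :=
    hG.comp (hF.mono fun x hx => ⟨hx.1, hx.2.1⟩) (hmd U' hU') fun x hx =>
      ⟨(hF' x ⟨hx.1, hx.2.1⟩).1, (hw' x ⟨hx.1, hx.2.1⟩).1 hx.2.2⟩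
  have hpw : p ∈ κ.S.dom ∩ (U ∩ w) := ⟨hp.1, hpU, (hw' p ⟨hp.1, hpU⟩).2 hxU'⟩
  obtain ⟨z, hz, hz'⟩ := hGF.continuousOn.exists_isOpen hW'
  refine ⟨U ∩ w ∩ z, (hU.inter hw).inter hz, ⟨hpw.2, (hz' p hpw).2 ?_⟩, ?_⟩
  · exact (congrArg (· ∈ W') hGp).mpr (hO' ▸ hp' : p' ∈ κ'.S.core ∩ W').2
  · refine (hGF.mono fun x hx => ⟨hx.1.1, hx.2.1⟩).congr fun x hx => ?_
    have hx1 : x ∈ κ.S.dom ∩ (U ∩ w) := ⟨hx.1.1, hx.2.1⟩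
    have h1 := hG' (F x) ⟨(hF' x ⟨hx1.1, hx1.2.1⟩).1, (hw' x ⟨hx1.1, hx1.2.1⟩).1 hx1.2.2⟩
    have h2 : G (F x) ∈ κ'.O := hO' ▸ ⟨h1.1, (hz' x hx1).1 hx.2.2⟩
    refine Eq.trans ?_ (h'.injOn.leftInvOn_invFunOn h2)
    exact congrArg _ ((hF' x ⟨hx1.1, hx1.2.1⟩).2.trans h1.2.symm)

end Abstract

/-! ### Coordinates with respect to smooth paths -/

section Slice

variable (d : StrictMono δ) (o : δ 0 = 0) (hφ : IsTransition a b φ)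

lemma IsTransition.deriv_path (f : Ω) (s : ℝ) : deriv (hφ.path f).1 s = deriv φ s + deriv f.1 s :=
  deriv_add (hφ.1.differentiable (by simp) s) ((f.contDiff_one le_rfl).1.differentiable (by simp) s)

lemma IsTransition.exists_crossing_fun {p : Vec N}
    (h0 : dot n ((hφ.path f₀).1 t₀ - p) = 0) (h : dot n (deriv (hφ.path f₀).1 t₀) ≠ 0) :
    ∃ (U : Set Ω) (τ : Ω → ℝ), IsOpen U ∧ f₀ ∈ U ∧ ScSmoothOn ΔΘ Λ U τ ∧ τ f₀ = t₀ ∧ ∀ f ∈ U, dot n ((hφ.path f).1 (τ f) - p) = 0 := by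
  wlog hp : 0 < dot n (deriv (hφ.path f₀).1 t₀) generalizing n
  · obtain ⟨U, τ, h1, h2, h3, h4, h5⟩ := this (n := -n) (by rw [inner_neg_left, h0, neg_zero])
      (by rw [inner_neg_left]; exact neg_ne_zero.2 h)
      (by rw [inner_neg_left]; exact neg_pos.2 (lt_of_le_of_ne (not_lt.1 hp) h))
    exact ⟨U, τ, h1, h2, h3, h4, fun f hf => by simpa using h5 f hf⟩
  rw [hφ.deriv_path] at hp; obtain ⟨κ, hκ, ε, hε, hs⟩ := exists_slope (hφ.1.of_le (by simp)) o.ge le_rfl f₀ hp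
  have hs' : ∀ f : Ω, ‖f - f₀‖ < ε → ∀ s, |s - t₀| ≤ ε → κ ≤ dot n (deriv φ s + deriv f.1 s) := fun f hf s h =>
    hs f hf n (by simpa using hε) s h
  have hs2 : ∀ f : Ω, ‖f - f₀‖ < ε → ∀ s, |s - t₀| ≤ ε → κ ≤ dot n (deriv (hφ.path f).1 s) := fun f hf s h => by
    rw [hφ.deriv_path]; exact hs' f hf s h
  have hd : ∀ f : Ω, Differentiable ℝ (hφ.path f).1 := fun f => (hφ.path f).contDiff.differentiable (by simp)
  let U : Set Ω := {f | ‖f - f₀‖ < ε ∧ |dot n ((hφ.path f).1 t₀ - p)| < κ * ε}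
  have hc : ∀ f : Ω, ∃ t, f ∈ U → |t - t₀| ≤ ε ∧ dot n ((hφ.path f).1 t - p) = 0 := fun f => by
    by_cases hf : f ∈ U
    · obtain ⟨t, ht⟩ := exists_crossing (hd f) hε (hs2 f hf.1) hf.2.le; exact ⟨t, fun _ => ht⟩
    · exact ⟨0, fun h => (hf h).elim⟩
  choose τ hτ using hc; have hU : IsOpen U := by
    have h1 : Continuous fun f : Ω => |dot n ((hφ.path f).1 t₀ - p)| :=
      (continuous_const.inner ((continuous_const.add (Sob.ev o.ge one_le_two t₀).continuous).sub continuous_const)).abs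
    exact (isOpen_lt (continuous_id.sub continuous_const).norm continuous_const).inter (isOpen_lt h1 continuous_const)
  have hf₀ : f₀ ∈ U := ⟨by simpa using hε, by rw [h0, abs_zero]; positivity⟩
  refine ⟨U, τ, hU, hf₀, crossing_smooth (W := Δ) hφ.1 hκ hU (fun f hf => hs' f hf.1) (fun f hf => (hτ f hf).1)
    (fun f hf => (hτ f hf).2), ?_, fun f hf => (hτ f hf).2⟩
  refine eq_of_slope (hd f₀) hκ (hs2 f₀ hf₀.1) (hτ f₀ hf₀).1 (by simpa using hε.le) ?_
  have h1 := (hτ f₀ hf₀).2; rw [inner_sub_right, sub_eq_zero] at h1 h0; rw [h1, h0]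

/-- The coordinate of a smooth path. -/
def IsTransition.coordPt (hφ : IsTransition a b φ) (hu : IsSmoothPath δ u) : ScPt ΔΘ where
  pt m := (⟨u.1 - φ, by
    obtain ⟨φ', hφ', hw⟩ := hu.1; rw [← sub_add_sub_cancel u.1 φ' φ]; have h := hφ'.sub_smooth hφ
    exact Submodule.add_mem _ (hw m) (mem_sobolev_of_compactSupp h.1 h.2)⟩ : Sob N (m + 2) (δ m))
  comm m := Sob.ext fun s => congrFun ((Δ).incl_apply _) s

/-- The coordinate of a path near `u`, projected to the slice at `u`. -/
def IsTransition.slCoord (hφ : IsTransition a b φ) (u : Ψ a b) (f : Ω) :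
    (𝓔u).L 0 := (slProj d o (deriv u.1 0)).map 0 (f - hφ.coord u : Ω)

lemma inner_add_sliceSob (x : (𝓔u).L 0) : dot (deriv u.1 0) ((u.add (sliceSob x)).1 0 - u.1 0) = 0 :=
  (congrArg _ (add_sub_cancel_left _ _)).trans (inner_sliceSob d x)

lemma IsTransition.add_slCoord {f : Ω} (h : dot (deriv u.1 0) ((hφ.path f).1 0 - u.1 0) = 0) :
    u.add (sliceSob (hφ.slCoord d o u f)) = hφ.path f := by
  have h1 : sliceSob (hφ.slCoord d o u f) = f - hφ.coord u := by
    refine slIncl_slProj d o (Eq.trans (congrArg _ ?_) h)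
    change f.1 0 - (u.1 0 - φ 0) = φ 0 + f.1 0 - u.1 0; abel
  rw [h1]; refine Subtype.ext (funext fun s => ?_); change u.1 s + (f.1 s - (u.1 s - φ s)) = φ s + f.1 s; abel

lemma IsTransition.slCoord_coord (x : (𝓔u).L 0) : hφ.slCoord d o u (hφ.coord (u.add (sliceSob x))) = x := by
  rw [slCoord, hφ.coord_add, add_sub_cancel_left]; exact slProj_slIncl d o _ 0 x

lemma IsTransition.path_shCoord_zero (t : ℝ) (f : Ω) :
    (hφ.path (hφ.shCoord d o t f)).1 0 = (hφ.path f).1 t :=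
  (congrFun (congrArg Subtype.val (hφ.path_shCoord d o t f)) 0).trans (congrArg (hφ.path f).1 (zero_add t))

lemma IsTransition.exists_shift_of_cls {w : Ψ a b} {f : Ω} (h : w.cls = (hφ.path f).cls) :
    ∃ t, hφ.coord w = hφ.shCoord d o t f ∧ w = (hφ.path f).shift t := by
  obtain ⟨t, ht⟩ := exists_shCoord d o hφ (f := f) (f' := hφ.coord w) (h.symm.trans (congrArg _ (hφ.path_coord w).symm))
  exact ⟨t, ht, (hφ.path_coord w).symm.trans ((congrArg hφ.path ht).trans (hφ.path_shCoord d o t f))⟩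

variable [ScGood T] {U : Set (T.L 0)}

lemma IsTransition.slCoord_smooth (hu : IsSmoothPath δ u) {f : T.L 0 → Ω} (hf : ScSmoothOn T ΔΘ U f) :
    ScSmoothOn T 𝓔u U fun x => hφ.slCoord d o u (f x) :=
  (slProj d o (deriv u.1 0)).comp_smooth (hf.sub ((hφ.coordPt d o hu).smooth T U))

lemma IsTransition.cont_slCoord : Continuous (hφ.slCoord d o u) :=
  ((slProj d o (deriv u.1 0)).map 0).continuous.comp (continuous_id.sub continuous_const : Continuous fun f : Ω => f - hφ.coord u)

lemma IsTransition.coord_add_smooth (hu : IsSmoothPath δ u)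
    {x : T.L 0 → (𝓔u).L 0} (hx : ScSmoothOn T 𝓔u U x) :
    ScSmoothOn T ΔΘ U fun y => hφ.coord (u.add (sliceSob (x y))) := by
  have := (banach_sliceScale d o (deriv u.1 0)).scGood
  refine (((hφ.coordPt d o hu).smooth T U).add ((slIncl d o (deriv u.1 0)).comp_smooth hx)).congr fun y _ => ?_
  exact hφ.coord_add u _

lemma IsTransition.exists_slice_fun {a' b' : Vec N} (hφ : IsTransition a' b' φ)
    {x : (𝓔u).L 0} (h : dot (deriv u.1 0) (deriv (u.add (sliceSob x)).1 0) ≠ 0)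
    (hw : ∀ᶠ s in 𝓝 0, (u.add (sliceSob x)).1 s = (hφ.path f₀).1 (s + t)) :
    ∃ (U : Set Ω) (τ : Ω → ℝ), IsOpen U ∧ f₀ ∈ U ∧ ScSmoothOn ΔΘ Λ U τ ∧ τ f₀ = t ∧
      ∀ f ∈ U, dot (deriv u.1 0) ((hφ.path f).1 (τ f) - u.1 0) = 0 := by
  have h1 := hw.self_of_nhds; rw [zero_add] at h1
  refine hφ.exists_crossing_fun d o (h1 ▸ inner_add_sliceSob d x) ?_
  rw [EventuallyEq.deriv_eq hw, deriv_comp_add_const, zero_add] at h; exact h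

end Slice

/-! ### Lifts to the charts -/

section Lifts

variable (d : StrictMono δ) (o : δ 0 = 0) {a b c : Vec N}

variable (β a b c) in
/-- Unbroken trajectories, given by affine coordinates. -/
def unbrModel : Model 𝓧 := ⟨ΔΘ, univ, univ, 𝓤⟩

variable (β a b c) in
/-- Trajectories near a broken one, given by a gluing parameter and affine coordinates. -/
def brokenModel : Model 𝓧 := ⟨(𝓞), brDom N δ, {q : Ξ | q.1 = 0}, 𝓒⟩

lemma scDom_brokenModel {U : Set Ξ} (hU : IsOpen U) : ScDom (𝓞) (brDom N δ ∩ U) := by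
  refine ScDom.inter (OpFam.scDom_of_interior _ ordConnected_Ico ?_) hU; rw [interior_Ico]
  exact nonempty_Ioo.2 one_pos

lemma hasLift_trajChart {u : Ψ a c} {O : Set (𝓟)}
    (hu : IsSmoothPath δ u) (hT : ∀ p ∈ O, dot (deriv u.1 0) (deriv (u.add (sliceSob p.2)).1 0) ≠ 0) :
    HasLift (trajChart d u O).unbroken (unbrModel β d o a b c) := by
  rintro (f₀ : Ω) - p hp he
  obtain ⟨t, ht, hw⟩ := (φU).exists_shift_of_cls d o (f := f₀) (BrokenTraj.unbroken.inj he)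
  obtain ⟨U, τ, hU, hf₀, hτ, hτ0, h⟩ := (φU).exists_slice_fun d o (hT p hp)
    (Eventually.of_forall fun s => congrFun (congrArg Subtype.val hw) s)
  have hG : ScSmoothOn ΔΘ ((ScScale.const (Fin 0 → ℝ)).sum 𝓔u) U
      fun f : Ω => ((0, (φU).slCoord d o u ((φU).shCoord d o (τ f) f)) : 𝓟) := by
    have := (banach_sliceScale d o (deriv u.1 0)).scGood
    let z : ScPt (ScScale.const (Fin 0 → ℝ)) := ⟨fun _ => (0 : Fin 0 → ℝ), fun _ => rfl⟩
    exact (z.smooth _ U).pair ((φU).slCoord_smooth d o hu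
      ((φU).shCoord_smooth d o (T := ΔΘ) (f := fun f : Ω => f) hτ ((ScOp.id ΔΘ).smooth U)))
  refine ⟨U, hU, hf₀, _, hG.mono inter_subset_right, ?_, fun (f : Ω) hf => ⟨⟨mem_univ _, rfl⟩, ?_⟩⟩
  · refine Prod.ext (Subsingleton.elim (α := Fin 0 → ℝ) _ _) ?_
    change (φU).slCoord d o u ((φU).shCoord d o (τ f₀) f₀) = p.2; rw [hτ0, ← ht]
    exact (φU).slCoord_coord d o p.2
  · have h1 := (φU).add_slCoord d o (u := u) (f := (φU).shCoord d o (τ f) f)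
      ((congrArg (fun x => dot (deriv u.1 0) (x - u.1 0)) ((φU).path_shCoord_zero d o (τ f) f)).trans (h f hf.2))
    refine (congrArg (fun w : Ψ a c => (BrokenTraj.unbroken w.cls : 𝓧)) h1).trans ?_
    exact ucls_shift β d o (τ f) f

lemma hasLift_trajChart_broken {u : Ψ a c} {O : Set (𝓟)} : HasLift (trajChart d u O).unbroken (brokenModel β d o a b c) := by
  rintro ⟨r, f, g⟩ (rfl : r = 0) p hp he
  refine (ucls_ne_gcls β ((φU).coord (u.add (sliceSob p.2))) f g (Eq.trans ?_ he)).elim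
  rw [ucls, IsTransition.path_coord]
  rfl

lemma hasParam_trajChart {u : Ψ a c} {O : Set (𝓟)} (hu : IsSmoothPath δ u) (p : 𝓟) :
    HasParam (trajChart d u O).unbroken (unbrModel β d o a b c) p := by
  have := (banach_sliceScale d o (deriv u.1 0)).scGood
  have hF := (φU).coord_add_smooth d o hu (T := (ScScale.const (Fin 0 → ℝ)).sum 𝓔u)
    (ScOp.smooth (E := (ScScale.const (Fin 0 → ℝ)).sum 𝓔u) (F := 𝓔u) ScOp.snd univ)
  refine ⟨univ, isOpen_univ, mem_univ _, _, hF.mono (subset_univ _), mem_univ _, fun x _ => ⟨mem_univ _, ?_⟩⟩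
  refine Eq.trans ?_ (congrArg (fun w : Ψ a c => (BrokenTraj.unbroken w.cls : 𝓧)) ((φU).path_coord (u.add (sliceSob x.2))).symm)
  rfl

/-! ### Charts at broken trajectories -/

variable (u : Ψ a b) (v : Ψ b c)

/-- The model space of the chart at `(u, v)`. -/
abbrev pairAt : ScScale := pairScale d (deriv u.1 0) (deriv v.1 0)

/-- The splicing of the chart at `(u, v)`. -/
abbrev splicingAt : Splicing := gluingSplicing β d (deriv u.1 0) (deriv v.1 0)

variable (β) in
/-- The gluing parameter and the affine coordinates of a point of the chart at `(u, v)`. -/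
def chartPt (p : 𝓠) : Ξ := (p.1, (φL).coord (u.add (sliceSob p.2.1)), (φR).coord (v.add (sliceSob p.2.2)))

variable (β) in
/-- The point of the splicing core with given gluing parameter and affine coordinates. -/
def coreLift (q : Ξ) : 𝓠 := (𝓚).retract (q.1, ((φL).slCoord d o u q.2.1, (φR).slCoord d o v q.2.2))

variable (β) in
/-- The affine coordinates belong to paths that cross the slices at time `0`. -/
def OnSlice (q : Ξ) : Prop :=
  dot (deriv u.1 0) (((φL).path q.2.1).1 0 - u.1 0) = 0 ∧ dot (deriv v.1 0) (((φR).path q.2.2).1 0 - v.1 0) = 0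

variable {u v}

lemma onSlice_chartPt (p : 𝓠) : OnSlice β u v (Υ p) :=
  ⟨(congrArg (fun w : Ψ a b => dot (deriv u.1 0) (w.1 0 - u.1 0)) ((φL).path_coord _)).trans (inner_add_sliceSob d p.2.1),
    (congrArg (fun w : Ψ b c => dot (deriv v.1 0) (w.1 0 - v.1 0)) ((φR).path_coord _)).trans (inner_add_sliceSob d p.2.2)⟩

lemma gcls_chartPt (p : 𝓠) : 𝓒 (Υ p) = glueClass β p.1 (u.add (sliceSob p.2.1)) (v.add (sliceSob p.2.2)) :=
  congrArg₂ (glueClass β p.1) ((φL).path_coord _) ((φR).path_coord _)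

lemma glueClass_retract (o : δ 0 = 0) {p : 𝓠} (hp : p.1 ∈ Ico 0 glBound) :
    glueClass β p.1 (u.add (sliceSob ((𝓚).retract p).2.1)) (v.add (sliceSob ((𝓚).retract p).2.2)) =
    glueClass β p.1 (u.add (sliceSob p.2.1)) (v.add (sliceSob p.2.2)) := by
  obtain ⟨r, e⟩ := p; rcases eq_or_lt_of_le hp.1 with h0 | h0
  · change 0 = r at h0; subst h0
    exact congrArg (fun e : (𝓐).L 0 => glueClass β 0 (u.add (sliceSob e.1)) (v.add (sliceSob e.2))) (glProj_zero β d e)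
  · have h1 := (isCompl_ker β d o (n := deriv u.1 0) (n' := deriv v.1 0) h0 hp.2).2 e
    have h2 := (mem_kerGlue β d (ne_of_gt h0) _).1 h1.2
    rw [glueClass, glueClass, if_neg (ne_of_gt h0), if_neg (ne_of_gt h0)]
    refine congrArg (fun w : Ψ a c => (BrokenTraj.unbroken w.cls : 𝓧)) (Subtype.ext ?_)
    let e' : (𝓐).L 0 := pairSplice β d o r 0 e
    have h3 : gluingProj β d (deriv u.1 0) (deriv v.1 0) r e = e' := glProj_eq β d o h0 hp.2 e
    have h4 : glue β (ℓ r) (u.1 + (sliceSob e'.1).1, v.1 + (sliceSob e'.2).1) =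
        glue β (ℓ r) (u.1 + (sliceSob e.1).1, v.1 + (sliceSob e.2).1) := by
      rw [eq_comm, ← sub_eq_zero, ← map_sub, ← h2]; refine congrArg _ (Prod.ext ?_ ?_)
      · exact add_sub_add_left_eq_sub _ _ _
      · exact add_sub_add_left_eq_sub _ _ _
    exact (congrArg (fun e : (𝓐).L 0 =>
      glue β (ℓ r) (u.1 + (sliceSob e.1).1, v.1 + (sliceSob e.2).1)) h3).trans h4

lemma coreLift_mem (hq : q.1 ∈ Ico 0 glBound) : coreLift β d o u v q ∈ (𝓚).core := (isScSplicing_glSplicing β d o).retract_mem hq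

lemma coreLift_cls (hq : q.1 ∈ Ico 0 glBound) (h : OnSlice β u v q) :
    glueClass β (coreLift β d o u v q).1 (u.add (sliceSob (coreLift β d o u v q).2.1))
      (v.add (sliceSob (coreLift β d o u v q).2.2)) = 𝓒 q :=
  (glueClass_retract d o (u := u) (v := v) (p := (q.1, ((φL).slCoord d o u q.2.1, (φR).slCoord d o v q.2.2))) hq).trans
    (congrArg₂ (glueClass β q.1) ((φL).add_slCoord d o h.1) ((φR).add_slCoord d o h.2))

lemma coreLift_chartPt {p : 𝓠} (hp : p ∈ (𝓚).core) : coreLift β d o u v (Υ p) = p := by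
  have h1 : ((φL).slCoord d o u (Υ p).2.1, (φR).slCoord d o v (Υ p).2.2) = p.2 :=
    Prod.ext ((φL).slCoord_coord d o p.2.1) ((φR).slCoord_coord d o p.2.2)
  refine Eq.trans ?_ (Splicing.retract_eq hp); exact congrArg (fun e : (𝓐).L 0 => (𝓚).retract (p.1, e)) h1

lemma contOn_coreLift : ContinuousOn (coreLift β d o u v) {q | q.1 ∈ Ico 0 glBound} :=
  (isScSplicing_glSplicing β d o).contOn_retract.comp (continuous_fst.prodMk
    ((((φL).cont_slCoord d o).comp (continuous_fst.comp continuous_snd)).prodMk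
      (((φR).cont_slCoord d o).comp (continuous_snd.comp continuous_snd)))).continuousOn fun _ hq => hq

lemma coreLift_smooth (hu : IsSmoothPath δ u) (hv : IsSmoothPath δ v) [ScGood T] {U : Set (T.L 0)}
    {q : T.L 0 → Ξ} (hq : ScSmoothOn T (𝓞) U q) (h : ∀ x ∈ U, (q x).1 ∈ Ico 0 glBound) :
    ScSmoothOn T (𝓚).total U fun x => coreLift β d o u v (q x) := by
  have := (banach_sliceScale d o (deriv u.1 0)).scGood; have := (banach_sliceScale d o (deriv v.1 0)).scGood
  have : ScGood 𝓐 := (banach_pairScale d o).scGood; have hr := (parScale.smooth_r d o univ).comp_univ hq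
  have hf := (parScale.smooth_f d o univ).comp_univ hq; have hg := (parScale.smooth_g d o univ).comp_univ hq
  have h1 : ScSmoothOn T ((Λ).sum 𝓐) U fun x => ((q x).1, (((φL).slCoord d o u (q x).2.1, (φR).slCoord d o v (q x).2.2) : (𝓐).L 0)) :=
    hr.pair (((φL).slCoord_smooth d o hu hf).pair ((φR).slCoord_smooth d o hv hg))
  have h2 : ScSmoothOn ((Λ).sum 𝓐) 𝓐 {p : 𝓠 | p.1 ∈ Ico 0 glBound}
      fun p : 𝓠 => gluingProj β d (deriv u.1 0) (deriv v.1 0) p.1 p.2 :=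
    (isScSplicing_glSplicing β d o).smooth
  exact ScSmoothOn.pair (F := Λ) (G := 𝓐) hr (h2.comp h1
    (OpFam.scDom_of_interior _ ordConnected_Ico (by rw [interior_Ico]; exact nonempty_Ioo.2 glBound_pos)) h)

end Lifts

section Lifts

variable (d : StrictMono δ) (o : δ 0 = 0)
  (u : Ψ a b) (v : Ψ b c)

lemma glue_eq_left (h : s + 1 ≤ R / 2) (f g : Φ) : glue β R (f, g) s = f s := by
  rw [glue_apply, β.eq_one _ (by linarith), one_smul, sub_self, zero_smul, add_zero]

lemma glue_eq_right (h : 1 ≤ s + R / 2) (f g : Φ) : glue β R (f, g) (s + R) = g s := by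
  rw [glue_apply, β.eq_zero (by linarith), zero_smul, zero_add, sub_zero, one_smul, add_sub_cancel_right]

lemma recutRho_at_zero {W : Weights} {A c : ℝ} (h : r ≠ 0 → 1 + |c| ≤ ℓ r / 2) (Y Z : ϑ) : (recutRho β A r c Y Z).1 0 = 0 := by
  rcases eq_or_ne r 0 with rfl | hr
  · rw [recutRho_zero]
    rfl
  · have h1 := abs_le.1 (le_refl |c|); have h2 := h hr
    rw [recutRho_apply _ _ hr, β.eq_one (0 - ℓ r / 2 + c) (by linarith [le_abs_self c]),
      β.eq_one (0 - ℓ r / 2) (by linarith [abs_nonneg c]), sub_self, zero_mul, mul_zero, zero_smul]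

lemma path_recutPt {A : ℝ} (h : RecutOk A t t' q.1) : ((φL).path (recutPt β d o a b c A t t' q).2.1).1 0 = ((φL).path q.2.1).1 t ∧
    ((φR).path (recutPt β d o a b c A t t' q).2.2).1 0 = ((φR).path q.2.2).1 t' := by
  have h1 : recPar (t' - t) q.1 ≠ 0 → 1 + |(t + t') / 2| ≤ ℓ (recPar (t' - t) q.1) / 2 := fun hr => by
    have h0 : 0 < q.1 := lt_of_le_of_ne h.1 fun h0 => hr (by rw [← h0, recPar_zero])
    have h2 : |(t + t') / 2| ≤ A := by
      rw [abs_le]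
      constructor <;> linarith [(abs_le.1 h.2.2.1).1, (abs_le.1 h.2.2.1).2, (abs_le.1 h.2.2.2.1).1, (abs_le.1 h.2.2.2.1).2]
    rw [len_recPar h.2.1 h0]; linarith [h.2.2.2.2 h0, (abs_nonneg t).trans h.2.2.1]
  constructor
  · refine Eq.trans ?_ ((φL).path_shCoord_zero d o t q.2.1); refine congrArg (refL β a b 0 + ·) ?_
    exact (congrArg (((φL).shCoord d o t q.2.1).1 0 + ·) (recutRho_at_zero h1 _ _)).trans (add_zero _)
  · refine Eq.trans ?_ ((φR).path_shCoord_zero d o t' q.2.2); refine congrArg (refR β b c 0 + ·) ?_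
    refine (congrArg (((φR).shCoord d o t' q.2.2).1 0 + ·) ?_).trans (add_zero _)
    exact (Sob.J_apply _ 0).trans ((congrArg _ neg_zero).trans (recutRho_at_zero (by rwa [abs_neg]) _ _))

variable (β) in
/-- The gluing parameter and the coordinates of paths that glue to a given path, shifted by `t`, such that `0` in the
second path corresponds to the time `t'`. -/
def cutPt (t t' : ℝ) (f : Ω) : Ξ :=
  let G : Ω := (φU).shCoord d o t f - 𝓖 (glParam (t' - t)) ((φL).coord u) ((φR).coord v)
  (glParam (t' - t), (φL).coord u + cutL β d o (glParam (t' - t)) G, (φR).coord v + cutR β d o (glParam (t' - t)) G)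

lemma glParam_mem (h : 2 < R) : glParam R ∈ Ioo 0 glBound := ⟨glParam_pos (by linarith), glParam_lt h⟩

lemma shift_cutPt (f : Ω) (h : 2 < t' - t) : ((φU).path f).shift t =
    ((φL).path (cutPt β d o u v t t' f).2.1).glue β (t' - t) ((φR).path (cutPt β d o u v t t' f).2.2) := by
  have h1 := glParam_mem h
  rw [← (φU).path_shCoord d o, ← len_glParam (R := t' - t) (by linarith), ← path_glueCoord β d o h1.1 (h1.2.trans glBound_lt_one)]
  exact congrArg (φU).path (glueCoord_add_cut β d o (ne_of_gt h1.1) _ _ _).symm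

lemma gcls_cutPt (f : Ω) (h : 2 < t' - t) : 𝓒 (cutPt β d o u v t t' f) = 𝓤 f := by
  refine (gcls_of_ne β (ne_of_gt (glParam_mem h).1) _ _).trans (congrArg BrokenTraj.unbroken ?_)
  rw [len_glParam (by linarith)]
  exact (congrArg PathSpace.cls (shift_cutPt d o u v f h)).symm.trans (PathSpace.cls_shift t _)

lemma path_cutPt (f : Ω) (h : 2 < t' - t) : ((φL).path (cutPt β d o u v t t' f).2.1).1 0 = ((φU).path f).1 t ∧
    ((φR).path (cutPt β d o u v t t' f).2.2).1 0 = ((φU).path f).1 t' := by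
  have h1 := fun s => congrFun (congrArg Subtype.val (shift_cutPt (β := β) d o u v f h)) s; constructor
  · exact (glue_eq_left (by linarith) _ _).symm.trans ((h1 0).symm.trans (congrArg ((φU).path f).1 (zero_add t)))
  · exact (glue_eq_right (by linarith) _ _).symm.trans ((h1 (0 + (t' - t))).symm.trans (congrArg ((φU).path f).1 (by ring)))

variable {u v}

lemma cutPt_eq {p : 𝓠} (hp : p ∈ (𝓚).core) (h0 : p.1 ≠ 0) {f : Ω} (hf : (φU).shCoord d o t f = 𝓖 p.1 (Υ p).2.1 (Υ p).2.2)
    (hR : t' - t = ℓ p.1) : cutPt β d o u v t t' f = Υ p := by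
  obtain ⟨r, e⟩ := p; change r ≠ 0 at h0; have hr : 0 < r := lt_of_le_of_ne hp.1.1 (Ne.symm h0)
  let x : Ω := sliceSob e.1; let y : Ω := sliceSob e.2; have h1 : antiglue β (ℓ r) (x.1, y.1) = 0 := by
    refine (mem_kerAntiglue β d h0 e).1 ?_
    have h2 := ((isCompl_ker β d o (n := deriv u.1 0) (n' := deriv v.1 0) hr hp.1.2).2 e).1
    rw [← glProj_eq β d o hr hp.1.2] at h2
    exact (congrArg (· ∈ kerAntiglue β d (deriv u.1 0) (deriv v.1 0) r) hp.2).mp h2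
  let G : Ω := 𝓖 r ((φL).coord u + x) ((φR).coord v + y) - 𝓖 r ((φL).coord u) ((φR).coord v)
  have hG : G.1 = glue β (ℓ r) (x.1, y.1) := funext fun s =>
    (congrArg (· - _) (glueCoord_add β d o h0 _ _ _ _ s)).trans (add_sub_cancel_left _ _)
  have h2 := eq_zero_of_glue_antiglue β (R := ℓ r) (f := (cutL β d o r G).1 - x.1) (g := (cutR β d o r G).1 - y.1)
    (by rw [← Prod.mk_sub_mk, map_sub, glue_cut β d o h0, hG, sub_self])
    (by rw [← Prod.mk_sub_mk, map_sub, antiglue_cut β d o h0, h1, sub_self])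
  have h3 : cutL β d o r G = x := Subtype.ext (sub_eq_zero.1 h2.1)
  have h4 : cutR β d o r G = y := Subtype.ext (sub_eq_zero.1 h2.2)
  have h5 : (φL).coord (u.add x) = (φL).coord u + x := (φL).coord_add u x
  have h6 : (φR).coord (v.add y) = (φR).coord v + y := (φR).coord_add v y
  have hf' : (φU).shCoord d o t f = 𝓖 r ((φL).coord u + x) ((φR).coord v + y) := hf.trans (congrArg₂ (𝓖 r) h5 h6)
  have hc : Υ (r, e) = (r, (φL).coord u + x, (φR).coord v + y) := Prod.ext rfl (Prod.ext h5 h6)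
  rw [hc, ← h3, ← h4, cutPt, hR, glParam_len, hf']

lemma cutPt_smooth (hu : IsSmoothPath δ u) (hv : IsSmoothPath δ v) [ScGood T] {U : Set (T.L 0)} {t t' : T.L 0 → ℝ}
    {f : T.L 0 → Ω} (ht : ScSmoothOn T Λ U t) (ht' : ScSmoothOn T Λ U t')
    (hf : ScSmoothOn T ΔΘ U f) (h : ∀ x ∈ U, 2 < t' x - t x) :
    ScSmoothOn T (𝓞) U fun x => cutPt β d o u v (t x) (t' x) (f x) := by
  have hd := ht'.sub ht; have h0 : ∀ x ∈ U, 0 < t' x - t x := fun x hx => two_pos.trans (h x hx)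
  have hr : ScSmoothOn T Λ U fun x => glParam (t' x - t x) := hd.contDiff isOpen_Ioi contDiffOn_glParam h0
  have hr0 : ∀ x ∈ U, 0 < glParam (t' x - t x) := fun x hx => glParam_pos (h0 x hx)
  have hu' := ((φL).coordPt d o hu).smooth T U; have hv' := ((φR).coordPt d o hv).smooth T U
  have hG := ((φU).shCoord_smooth d o ht hf).sub (glueCoord_smooth β d o (b := b) (c := c) hr hr0 hu' hv')
  have hR : ScSmoothOn T Λ U fun x => ℓ (glParam (t' x - t x)) := hr.contDiff isOpen_Ioi contDiffOn_len hr0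
  exact hr.pair ((hu'.add (hr.gamma β.cutP hG fun x hx => (hr0 x hx).le)).pair
    (hv'.add (hR.shift (hr.gamma β.cutQ hG fun x hx => (hr0 x hx).le))))

lemma chartPt_smooth (hu : IsSmoothPath δ u) (hv : IsSmoothPath δ v) (U : Set (𝓠)) : ScSmoothOn ((Λ).sum 𝓐) (𝓞) U Υ := by
  have := (banach_sliceScale d o (deriv u.1 0)).scGood; have := (banach_sliceScale d o (deriv v.1 0)).scGood
  have : ScGood 𝓐 := (banach_pairScale d o).scGood; let E := (Λ).sum 𝓐
  have h1 := ScOp.smooth (E := E) (F := 𝓔u) (ScOp.fst.comp (F := 𝓐) ScOp.snd) U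
  have h2 := ScOp.smooth (E := E) (F := 𝓔v) (ScOp.snd.comp (F := 𝓐) ScOp.snd) U
  have h3 := ScOp.smooth (E := E) (F := Λ) ScOp.fst U
  exact h3.pair (((φL).coord_add_smooth d o hu h1).pair ((φR).coord_add_smooth d o hv h2))

end Lifts

section Lifts

variable (d : StrictMono δ) (o : δ 0 = 0) {O : Set (𝓠)}

/-- The path `u + h` crosses the slice at `u` transversally. -/
def Transversal (x : (𝓔u).L 0) : Prop := dot (deriv u.1 0) (deriv (u.add (sliceSob x)).1 0) ≠ 0

lemma hasLift_brChart_broken (hu : IsSmoothPath δ u) (hv : IsSmoothPath δ v)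
    (hO : O ⊆ (𝓚).core) (hT : ∀ p ∈ O, Transversal d p.2.1 ∧ Transversal d p.2.2) :
    HasLift (brokenChart β d u v O) (brokenModel β d o a b c) := by
  rintro ⟨r, (f₀ : Ω), (g₀ : Ω)⟩ (rfl : r = 0) ⟨r, e⟩ hp he
  have he : glueClass β r (u.add (sliceSob e.1)) (v.add (sliceSob e.2)) = 𝓒 (0, f₀, g₀) := he
  obtain rfl : r = 0 := by
    by_contra h
    have h1 : (BrokenTraj.unbroken _ : 𝓧) = .broken _ _ := (if_neg h).symm.trans (he.trans (if_pos rfl))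
    exact nomatch h1
  obtain ⟨h1, h2⟩ := BrokenTraj.broken.inj ((if_pos rfl).symm.trans (he.trans (gcls_zero β f₀ g₀)))
  obtain ⟨t, ht, hw⟩ := (φL).exists_shift_of_cls d o h1; obtain ⟨t', ht', hw'⟩ := (φR).exists_shift_of_cls d o h2
  obtain ⟨U, τ, hU, hf₀, hτ, hτ0, h⟩ := (φL).exists_slice_fun d o (hT _ hp).1
    (Eventually.of_forall fun s => congrFun (congrArg Subtype.val hw) s)
  obtain ⟨U', τ', hU', hg₀, hτ', hτ0', h'⟩ := (φR).exists_slice_fun d o (hT _ hp).2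
    (Eventually.of_forall fun s => congrFun (congrArg Subtype.val hw') s)
  let x : Ξ := (0, f₀, g₀); let A := max |t| |t'| + 1
  have hr : Tendsto (fun q : Ξ => q.1) (𝓝[brDom N δ] x) (𝓝 0) := (continuous_fst.tendsto x).mono_left nhdsWithin_le_nhds
  have h3 : Tendsto (fun q : Ξ => τ q.2.1) (𝓝[brDom N δ] x) (𝓝 t) := by
    have h4 : Tendsto τ (𝓝 f₀) (𝓝 t) := hτ0 ▸ hτ.continuousOn.continuousAt (hU.mem_nhds hf₀)
    exact h4.comp (((continuous_fst.comp continuous_snd).tendsto x).mono_left nhdsWithin_le_nhds)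
  have h3' : Tendsto (fun q : Ξ => τ' q.2.2) (𝓝[brDom N δ] x) (𝓝 t') := by
    have h4 : Tendsto τ' (𝓝 g₀) (𝓝 t') := hτ0' ▸ hτ'.continuousOn.continuousAt (hU'.mem_nhds hg₀)
    exact h4.comp (((continuous_snd.comp continuous_snd).tendsto x).mono_left nhdsWithin_le_nhds)
  have h5 : Tendsto (fun q : Ξ => recPar (τ' q.2.2 - τ q.2.1) q.1) (𝓝[brDom N δ] x) (𝓝 0) := by
    have h6 := (contDiffOn_recPar.continuousOn.continuousAt (isOpen_recutDom.mem_nhds (mem_recutDom_zero (t' - t)))).tendsto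
    rw [recPar_zero] at h6; exact h6.comp ((h3'.sub h3).prodMk_nhds hr)
  obtain ⟨V, hV, hxV, hV'⟩ := mem_nhdsWithin.1 ((ev_recutOk h3 h3' hr (eventually_mem_nhdsWithin.mono fun q hq => hq.1)
    ((le_max_left |t| |t'|).trans_lt (lt_add_one _)) ((le_max_right |t| |t'|).trans_lt (lt_add_one _))).and
      (h5.eventually (gt_mem_nhds glBound_pos)))
  let D : Set Ξ := {q | q.2.1 ∈ U ∧ q.2.2 ∈ U'} ∩ V
  have hD : IsOpen D := ((hU.preimage (continuous_fst.comp continuous_snd)).inter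
    (hU'.preimage (continuous_snd.comp continuous_snd))).inter hV
  have hok : ∀ q ∈ brDom N δ ∩ D, RecutOk A (τ q.2.1) (τ' q.2.2) q.1 ∧ recPar (τ' q.2.2 - τ q.2.1) q.1 ∈ Ico 0 glBound := fun q hq =>
    have h6 := hV' ⟨hq.2.2, hq.1⟩
    ⟨h6.1, div_nonneg h6.1.1 (le_of_lt h6.1.2.1.2), h6.2⟩
  have hG := coreLift_smooth d o hu hv (β := β) (recutPt_smooth β d o (a := a) (b := b) (c := c) (A := A)
    (hτ.comp (parScale.smooth_f d o (brDom N δ ∩ D)) hU.scDom fun q hq => hq.2.1.1)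
    (hτ'.comp (parScale.smooth_g d o (brDom N δ ∩ D)) hU'.scDom fun q hq => hq.2.1.2)
    ((ScOp.id (𝓞)).smooth _) fun q hq => (hok q hq).1) fun q hq => (hok q hq).2
  refine ⟨D, hD, ⟨⟨hf₀, hg₀⟩, hxV⟩, _, hG, ?_, fun q hq => ⟨coreLift_mem d o (hok q hq).2, ?_⟩⟩
  · refine Eq.trans (congrArg (coreLift β d o u v) ?_) (coreLift_chartPt d o (hO hp))
    change recutPt β d o a b c A (τ f₀) (τ' g₀) (0, f₀, g₀) = Υ (0, e); rw [hτ0, hτ0']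
    exact (recutPt_zero β d o A t t' f₀ g₀).trans (Prod.ext rfl (Prod.ext ht.symm ht'.symm))
  · have h6 := path_recutPt d o (β := β) (a := a) (b := b) (c := c) (hok q hq).1
    refine (coreLift_cls d o (hok q hq).2 ⟨?_, ?_⟩).trans (gcls_recut β d o (hok q hq).1)
    · exact (congrArg (fun y => dot (deriv u.1 0) (y - u.1 0)) h6.1).trans (h _ hq.2.1.1)
    · exact (congrArg (fun y => dot (deriv v.1 0) (y - v.1 0)) h6.2).trans (h' _ hq.2.1.2)

lemma mem_brDom (h : q.1 ∈ Ico 0 glBound) : q ∈ brDom N δ := ⟨h.1, h.2.trans glBound_lt_one⟩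

lemma hasLift_brChart (hu : IsSmoothPath δ u) (hv : IsSmoothPath δ v)
    (hO : O ⊆ (𝓚).core) (hT : ∀ p ∈ O, Transversal d p.2.1 ∧ Transversal d p.2.2) :
    HasLift (brokenChart β d u v O) (unbrModel β d o a b c) := by
  rintro (f₀ : Ω) - p hp he; have hV : p.1 ∈ Ico 0 glBound := (hO hp).1
  have he : 𝓒 (Υ p) = 𝓤 f₀ := (gcls_chartPt d p).trans he
  have h0 : p.1 ≠ 0 := fun h0 => ucls_ne_gcls β f₀ (Υ p).2.1 (Υ p).2.2 (he.symm.trans (congrArg (fun r => 𝓒 (r, (Υ p).2)) h0))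
  have hR := two_lt_len (lt_of_le_of_ne hV.1 h0.symm) hV.2; rw [gcls_eq β d o (mem_brDom hV) h0] at he
  obtain ⟨t, ht⟩ := exists_shCoord_of_ucls β d o he.symm
  have hw : ∀ s, glue β (ℓ p.1) ((u.add (sliceSob p.2.1)).1, (v.add (sliceSob p.2.2)).1) s = ((φU).path f₀).1 (s + t) := fun s => by
    have h1 : ((φU).path f₀).shift t = (u.add (sliceSob p.2.1)).glue β (ℓ p.1) (v.add (sliceSob p.2.2)) := by
      rw [← IsTransition.path_shCoord d o, ← ht]
      exact (path_glueCoord β d o (lt_of_le_of_ne hV.1 h0.symm) (hV.2.trans glBound_lt_one) _ _).trans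
        (congrArg₂ (PathSpace.glue β _) ((φL).path_coord _) ((φR).path_coord _))
    exact (congrFun (congrArg Subtype.val h1) s).symm
  obtain ⟨U, τ, hU, hf₀, hτ, hτ0, h⟩ := (φU).exists_slice_fun d o (t := t) (f₀ := f₀) (hT _ hp).1 (by
    filter_upwards [gt_mem_nhds (show (0 : ℝ) < ℓ p.1 / 2 - 1 by linarith)] with s hs
    exact (glue_eq_left (by linarith) _ _).symm.trans (hw s))
  obtain ⟨U', τ', hU', hf₀', hτ', hτ0', h'⟩ := (φU).exists_slice_fun d o (t := ℓ p.1 + t) (f₀ := f₀) (hT _ hp).2 (by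
    filter_upwards [lt_mem_nhds (show 1 - ℓ p.1 / 2 < 0 by linarith)] with s hs
    exact (glue_eq_right (by linarith) _ _).symm.trans ((hw _).trans (congrArg _ (add_assoc _ _ _))))
  let D : Set Ω := (U ∩ U') ∩ (fun f => τ' f - τ f) ⁻¹' Ioi 2
  have hc : ContinuousOn (fun f => (τ' f - τ f : ℝ)) (U ∩ U') := (hτ'.continuousOn.mono inter_subset_right).sub
    (hτ.continuousOn.mono inter_subset_left)
  have hD : IsOpen D := hc.isOpen_inter_preimage (hU.inter hU') isOpen_Ioi
  have hG := coreLift_smooth d o hu hv (β := β) (cutPt_smooth d o hu hv (β := β) (T := ΔΘ) (U := D) (f := fun f : Ω => f)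
    (hτ.mono fun f hf => hf.1.1) (hτ'.mono fun f hf => hf.1.2) ((ScOp.id ΔΘ).smooth D) fun f hf => hf.2)
    fun f hf => Ioo_subset_Ico_self (glParam_mem hf.2)
  refine ⟨D, hD, ⟨⟨hf₀, hf₀'⟩, ?_⟩, _, hG.mono inter_subset_right, ?_, fun (f : Ω) hf =>
    ⟨coreLift_mem d o (Ioo_subset_Ico_self (glParam_mem hf.2.2)), ?_⟩⟩
  · change 2 < τ' f₀ - τ f₀; rw [hτ0, hτ0']; linarith
  · refine Eq.trans (congrArg (coreLift β d o u v) ?_) (coreLift_chartPt d o (hO hp))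
    exact cutPt_eq d o (hO hp) h0 (by rw [hτ0, ← ht]; rfl) (by rw [hτ0, hτ0', add_sub_cancel_right])
  · have h6 := path_cutPt d o u v (β := β) f hf.2.2
    refine (coreLift_cls d o (Ioo_subset_Ico_self (glParam_mem hf.2.2)) ⟨?_, ?_⟩).trans (gcls_cutPt d o u v f hf.2.2)
    · exact (congrArg (fun y => dot (deriv u.1 0) (y - u.1 0)) h6.1).trans (h _ hf.2.1.1)
    · exact (congrArg (fun y => dot (deriv v.1 0) (y - v.1 0)) h6.2).trans (h' _ hf.2.1.2)

lemma hasParam_brChart (hu : IsSmoothPath δ u) (hv : IsSmoothPath δ v) {p : 𝓠} (hp : p.1 ∈ Ico 0 glBound) :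
    (p.1 = 0 → HasParam (brokenChart β d u v O) (brokenModel β d o a b c) p) ∧
    (p.1 ≠ 0 → HasParam (brokenChart β d u v O) (unbrModel β d o a b c) p) := by
  have : ScGood 𝓐 := (banach_pairScale d o).scGood; constructor
  · intro h0; exact ⟨univ, isOpen_univ, mem_univ _, _, chartPt_smooth d o hu hv _, h0, fun x hx =>
      ⟨mem_brDom (q := Υ x) hx.1, (glueClass_retract d o hx.1).trans (gcls_chartPt d x).symm⟩⟩
  · intro h0; let U : Set (𝓠) := {x | 0 < x.1}; have h1 := chartPt_smooth d o hu hv (β := β) U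
    have h2 := glueCoord_smooth β d o (b := b) (c := c) (T := (Λ).sum 𝓐) (U := U)
      ((parScale.smooth_r d o univ).comp_univ h1) (fun x hx => hx)
      ((parScale.smooth_f d o univ).comp_univ h1)
      ((parScale.smooth_g d o univ).comp_univ h1)
    refine ⟨U, isOpen_lt continuous_const continuous_fst, lt_of_le_of_ne hp.1 h0.symm, _, h2.mono inter_subset_right, mem_univ _,
      fun x hx => ⟨mem_univ _, ?_⟩⟩
    exact (glueClass_retract d o hx.1).trans ((gcls_chartPt d x).symm.trans
      (gcls_eq β d o (mem_brDom (q := Υ x) hx.1) (ne_of_gt hx.2)))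

end Lifts

/-! ### Injectivity implies transversality -/

section Transversality

variable (d : StrictMono δ) (o : δ 0 = 0)

lemma bumpFn_eq_one (h : |s| ≤ 1) : bumpFn s = 1 := by
  rw [bumpFn, stepFn_eq_one (by grind), stepFn_eq_one (by grind), one_mul]

lemma IsTransition.exists_double_crossing (hφ : IsTransition a b φ) {p : Vec N} (hn : n ≠ 0) {f : Ω}
    (h0 : dot n ((hφ.path f).1 0 - p) = 0) (h : dot n (deriv (hφ.path f).1 0) = 0) :
    ∃ F : ℝ → Ω, Tendsto F (𝓝[≠] 0) (𝓝 f) ∧ ∀ᶠ s in 𝓝[≠] 0,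
      dot n ((hφ.path (F s)).1 0 - p) = 0 ∧ dot n ((hφ.path (F s)).1 s - p) = 0 := by
  have hq : ContDiff ℝ ∞ fun s => (s * bumpFn s) • n := (contDiff_id.mul contDiff_bumpFn).smul contDiff_const
  let q : Ω := Sob.ofSmooth hq compactSupp_bumpFn.mul_left.smul_right
  let g : ℝ → ℝ := fun s => dot n ((hφ.path f).1 s - p)
  let c : ℝ → ℝ := fun s => -((s⁻¹ * g s) / dot n n); have hg : HasDerivAt g 0 0 := by
    have h1 := (hasDerivAt_const (0 : ℝ) n).inner ℝ ((((hφ.path f).contDiff.differentiable (by simp)) 0).hasDerivAt.sub_const p)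
    rwa [h, inner_zero_left, add_zero] at h1
  have hc : Tendsto c (𝓝[≠] 0) (𝓝 0) := by
    have h1 := ((hasDerivAt_iff_tendsto_slope_zero.1 hg).div_const (dot n n)).neg; simpa [c, g, h0] using h1
  have hF : ∀ s t, dot n ((hφ.path (f + c s • q)).1 t - p) = g t + c s * (t * bumpFn t * dot n n) := fun s t => by
    have h1 : (hφ.path (f + c s • q)).1 t - p = ((hφ.path f).1 t - p) + c s • (t * bumpFn t) • n := by
      change φ t + (f.1 t + c s • (t * bumpFn t) • n) - p = φ t + f.1 t - p + c s • (t * bumpFn t) • n; abel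
    rw [h1, inner_add_right, inner_smul_right, inner_smul_right]
  refine ⟨fun s => f + c s • q, by simpa using (hc.smul_const q).const_add f, ?_⟩
  filter_upwards [self_mem_nhdsWithin, mem_nhdsWithin_of_mem_nhds (Metric.closedBall_mem_nhds (0 : ℝ) one_pos)] with s hs hs1
  rw [mem_closedBall_zero_iff] at hs1; have hs0 : s ≠ 0 := hs
  have hnn : (dot n n : ℝ) ≠ 0 := inner_self_ne_zero.2 hn; refine ⟨(hF s 0).trans ?_, (hF s s).trans ?_⟩
  · rw [zero_mul, zero_mul, mul_zero, add_zero]; exact h0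
  · rw [bumpFn_eq_one hs1]; simp only [c]; field_simp; ring

lemma IsTransition.shCoord_zero (hφ : IsTransition a b φ) (f : Ω) : hφ.shCoord d o 0 f = f :=
  Sob.ext fun s => by rw [hφ.shCoord_apply, add_zero, add_sub_cancel_left]

lemma IsTransition.eq_zero_of_shCoord (hφ : IsTransition a b φ) (hab : a ≠ b) {f : Ω} (h : hφ.shCoord d o t f = f) : t = 0 :=
  eq_zero_of_periodic ((hφ.path f).tendsto_atBot o.ge) ((hφ.path f).tendsto_atTop o.ge) hab
    fun s => congrFun (congrArg Subtype.val (((congrArg hφ.path h).symm).trans (hφ.path_shCoord d o t f))) s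

lemma transversal_of_injOn (o : δ 0 = 0) (hφ : IsTransition a b φ) (hab : a ≠ b)
    (hu : IsSmoothPath δ u) {W : Set ((𝓔u).L 0)} (hW : IsOpen W)
    (hinj : ∀ x ∈ W, ∀ y ∈ W, (u.add (sliceSob x)).cls = (u.add (sliceSob y)).cls → x = y)
    {x : (𝓔u).L 0} (hx : x ∈ W) : Transversal d x := fun h => by
  let f := hφ.coord (u.add (sliceSob x)); have hf : hφ.path f = u.add (sliceSob x) := hφ.path_coord _
  obtain ⟨F, hF, hF'⟩ := hφ.exists_double_crossing (p := u.1 0) hu.2 (f := f)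
    ((congrArg (fun w : Ψ a b => dot (deriv u.1 0) (w.1 0 - u.1 0)) hf).trans (inner_add_sliceSob d x))
    ((congrArg (fun w : Ψ a b => dot (deriv u.1 0) (deriv w.1 0)) hf).trans h)
  have hfx := hφ.slCoord_coord d o x
  have hs : Tendsto (fun s : ℝ => s) (𝓝[≠] 0) (𝓝 0) := tendsto_id.mono_left nhdsWithin_le_nhds
  have h1 := ((hφ.cont_slCoord d o (u := u)).tendsto f).comp hF
  have h2 := ((hφ.cont_slCoord d o (u := u)).tendsto _).comp
    (((hφ.cont_shCoord d o).tendsto (0, f)).comp (hs.prodMk_nhds hF))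
  rw [hφ.shCoord_zero, hfx] at h2; rw [hfx] at h1
  obtain ⟨s, ⟨⟨⟨h3, h4⟩, h5⟩, h6⟩, hs0⟩ := (((hF'.and (h1 (hW.mem_nhds hx))).and (h2 (hW.mem_nhds hx))).and self_mem_nhdsWithin).exists
  have h7 := hφ.add_slCoord d o h3; have h8 := hφ.add_slCoord d o (u := u)
    ((congrArg (fun y => dot (deriv u.1 0) (y - u.1 0)) (hφ.path_shCoord_zero d o s (F s))).trans h4)
  exact hs0 (hφ.eq_zero_of_shCoord d o hab ((hφ.coord_path _).symm.trans ((congrArg hφ.coord (h7.symm.trans ((congrArg (fun x => u.add (sliceSob x)) (hinj _ h5 _ h6 ((congrArg PathSpace.cls h7).trans ((PathSpace.cls_shift s _).symm.trans (congrArg PathSpace.cls (h8.trans (hφ.path_shCoord d o s (F s)))).symm)))).trans h8))).symm.trans (hφ.coord_path _))))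

lemma IsTransition.tendsto_shCoord (hφ : IsTransition a b φ) {l : Filter ℝ} {t : ℝ → ℝ} {f : ℝ → Ω}
    (ht : Tendsto t l (𝓝 0)) (hf : Tendsto f l (𝓝 f₀)) : Tendsto (fun i => hφ.shCoord d o (t i) (f i)) l (𝓝 f₀) := by
  have h1 := ((hφ.cont_shCoord d o).tendsto (0, f₀)).comp (ht.prodMk_nhds hf); rwa [hφ.shCoord_zero] at h1

variable {O : Set (𝓠)}

lemma chartPt_coreLift_zero {f g : Ω} (h : OnSlice β u v (0, f, g)) : Υ (coreLift β d o u v (0, f, g)) = (0, f, g) := by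
  have h1 : coreLift β d o u v (0, f, g) = (0, ((φL).slCoord d o u f, (φR).slCoord d o v g)) := Prod.ext rfl (glProj_zero β d _)
  rw [h1]
  exact Prod.ext rfl (Prod.ext ((congrArg (φL).coord ((φL).add_slCoord d o h.1)).trans ((φL).coord_path f))
    ((congrArg (φR).coord ((φR).add_slCoord d o h.2)).trans ((φR).coord_path g)))

/-- `Q i` represents the class of `(r, f i, g i)`, with the first path shifted by `t i` and the second one by `t' i`. -/
def IsReparam (u : Ψ a b) (v : Ψ b c) (r : ℝ) (t t' : ℝ) (f g : Ω) (q : Ξ) : Prop := q.1 ∈ Ico 0 glBound ∧ 𝓒 q = 𝓒 (r, f, g) ∧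
    ((φL).path q.2.1).1 0 = ((φL).path f).1 t ∧ ((φR).path q.2.2).1 0 = ((φR).path g).1 t' ∧
    (OnSlice β u v q → OnSlice β u v (r, f, g) → coreLift β d o u v q = coreLift β d o u v (r, f, g) → t = t')

lemma isReparam_zero (hab : a ≠ b) (hbc : b ≠ c) (t t' : ℝ) (f g : Ω) :
    IsReparam (β := β) d o u v 0 t t' f g (0, (φL).shCoord d o t f, (φR).shCoord d o t' g) := by
  refine ⟨⟨le_rfl, glBound_pos⟩, ?_, (φL).path_shCoord_zero d o _ _, (φR).path_shCoord_zero d o _ _, fun h1 h2 h3 => ?_⟩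
  · rw [gcls_zero, gcls_zero, IsTransition.path_shCoord, IsTransition.path_shCoord, PathSpace.cls_shift, PathSpace.cls_shift]
  · have h4 := (chartPt_coreLift_zero d o h1).symm.trans ((congrArg Υ h3).trans (chartPt_coreLift_zero d o h2))
    have h5 := congrArg Prod.snd h4
    rw [(φL).eq_zero_of_shCoord d o hab (congrArg Prod.fst h5), (φR).eq_zero_of_shCoord d o hbc (congrArg Prod.snd h5)]

lemma tendsto_reparam_zero {p : 𝓠} (h0 : p.1 = 0) {l : Filter ℝ} {t t' : ℝ → ℝ} {f g : ℝ → Ω}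
    (ht : Tendsto t l (𝓝 0)) (ht' : Tendsto t' l (𝓝 0)) (hf : Tendsto f l (𝓝 (Υ p).2.1))
    (hg : Tendsto g l (𝓝 (Υ p).2.2)) :
    Tendsto (fun i => ((0 : ℝ), (φL).shCoord d o (t i) (f i), (φR).shCoord d o (t' i) (g i))) l (𝓝 (Υ p)) := by
  have h1 := (φL).tendsto_shCoord d o ht hf; have h2 := (φR).tendsto_shCoord d o ht' hg
  have h3 := (tendsto_const_nhds (x := p.1)).prodMk_nhds (h1.prodMk_nhds h2); rw [h0] at h3
  exact h3.trans (le_of_eq (congrArg 𝓝 (Prod.ext h0.symm rfl)))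

lemma tendsto_cutPt (hu : IsSmoothPath δ u) (hv : IsSmoothPath δ v) (hR : 2 < R) {l : Filter ℝ} {t t' : ℝ → ℝ} {y : ℝ → Ω}
    {y₀ : Ω} (ht : Tendsto t l (𝓝 0)) (ht' : Tendsto t' l (𝓝 R)) (hy : Tendsto y l (𝓝 y₀)) (hd : ∀ᶠ i in l, 2 < t' i - t i) :
    Tendsto (fun i => cutPt β d o u v (t i) (t' i) (y i)) l (𝓝 (cutPt β d o u v 0 R y₀)) := by
  let Q : (ℝ × ℝ) × Ω → Ξ := fun z => cutPt β d o u v z.1.1 z.1.2 z.2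
  have hQ : ContinuousOn Q {z | 2 < z.1.2 - z.1.1} := by
    let T := (ScScale.const (ℝ × ℝ)).sum ΔΘ; let U : Set ((ℝ × ℝ) × Ω) := {z | 2 < z.1.2 - z.1.1}
    have h1 := ScOp.smooth (E := T) ScOp.fst U
    exact (cutPt_smooth d o hu hv
      ((ScOp.const (ContinuousLinearMap.fst ℝ ℝ ℝ)).comp_smooth h1)
      ((ScOp.const (ContinuousLinearMap.snd ℝ ℝ ℝ)).comp_smooth h1)
      (ScOp.smooth (E := T) ScOp.snd U) fun z hz => hz).continuousOn
  exact Tendsto.comp (f := fun i => ((t i, t' i), y i)) (hQ _ (by change 2 < R - 0; rwa [sub_zero]))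
    (tendsto_nhdsWithin_iff.2 ⟨(ht.prodMk_nhds ht').prodMk_nhds hy, hd⟩)

lemma tendsto_glueCoord (hr : 0 < r) {l : Filter ℝ} {f g : ℝ → Ω} {g₀ : Ω} (hf : Tendsto f l (𝓝 f₀)) (hg : Tendsto g l (𝓝 g₀)) :
    Tendsto (fun i => (𝓖 r (f i) (g i) : Ω)) l (𝓝 (𝓖 r f₀ g₀)) := by
  have h1 : ContinuousAt (fun q : Ξ => (𝓖 q.1 q.2.1 q.2.2 : Ω)) (r, f₀, g₀) := contAt_glueCoord β d o hr
  exact h1.tendsto.comp (f := fun i => (r, f i, g i)) (tendsto_const_nhds.prodMk_nhds (hf.prodMk_nhds hg))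

lemma tendsto_reparam (hu : IsSmoothPath δ u) (hv : IsSmoothPath δ v) {p : 𝓠}
    (hp : p ∈ (𝓚).core) (h0 : p.1 ≠ 0) {l : Filter ℝ} {t t' : ℝ → ℝ} {f g : ℝ → Ω} (ht : Tendsto t l (𝓝 0))
    (ht' : Tendsto t' l (𝓝 0)) (hf : Tendsto f l (𝓝 (Υ p).2.1)) (hg : Tendsto g l (𝓝 (Υ p).2.2)) :
    Tendsto (fun i => cutPt β d o u v (t i) (ℓ p.1 + t' i) (𝓖 p.1 (f i) (g i))) l (𝓝 (Υ p)) := by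
  have hV := hp.1; have hr := lt_of_le_of_ne hV.1 h0.symm
  have hR := two_lt_len hr hV.2; let y₀ : Ω := 𝓖 p.1 (Υ p).2.1 (Υ p).2.2
  have ht1 : Tendsto (fun i => ℓ p.1 + t' i) l (𝓝 (ℓ p.1)) := by simpa using ht'.const_add _
  exact (tendsto_cutPt d o hu hv hR ht ht1 (tendsto_glueCoord d o hr hf hg) ((ht1.sub ht).eventually (lt_mem_nhds (by rwa [sub_zero])))).trans
    (le_of_eq (congrArg 𝓝 (cutPt_eq d o hp h0 ((φU).shCoord_zero d o y₀) (sub_zero _))))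

lemma isReparam_cutPt (hV : r ∈ Ico 0 glBound) (h0 : r ≠ 0) (h1 : 2 < ℓ r + t' - t)
    (h2 : t < ℓ r / 2 - 1) (h3 : 1 - ℓ r / 2 < t') (f g : Ω) :
    IsReparam (β := β) d o u v r t t' f g (cutPt β d o u v t (ℓ r + t') (𝓖 r f g)) := by
  have hr : 0 < r := lt_of_le_of_ne hV.1 h0.symm; have h4 := path_cutPt d o u v (β := β) (𝓖 r f g) h1
  have h5 := fun s => congrFun (congrArg Subtype.val (path_glueCoord (a := a) (b := b) (c := c) β d o hr (hV.2.trans glBound_lt_one) f g)) s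
  refine ⟨Ioo_subset_Ico_self (glParam_mem h1), (gcls_cutPt d o u v _ h1).trans
    (gcls_eq (q := (r, f, g)) β d o (mem_brDom hV) h0).symm, ?_, ?_, fun _ _ h6 => ?_⟩
  · exact h4.1.trans ((h5 _).trans (glue_eq_left (by linarith) _ _))
  · refine h4.2.trans ((congrArg ((φU).path (𝓖 r f g)).1 (add_comm _ t')).trans ((h5 _).trans (glue_eq_right (by linarith) _ _)))
  · have h7 : glParam _ = r := congrArg Prod.fst h6
    have h8 := len_glParam (R := ℓ r + t' - t) (by linarith); rw [h7] at h8; linarith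

lemma ev_coreLift_mem {W : Set (𝓠)} (hW : IsOpen W) (hO : O = (𝓚).core ∩ W) {p : 𝓠} (hp : p ∈ O) {l : Filter ℝ} {q : ℝ → Ξ}
    (hq : Tendsto q l (𝓝 (Υ p))) (hq' : ∀ᶠ i in l, (q i).1 ∈ Ico 0 glBound) :
    ∀ᶠ i in l, coreLift β d o u v (q i) ∈ O := by
  have hpc := hO ▸ hp
  have h3 := (contOn_coreLift d o (β := β) (u := u) (v := v) (Υ p) hpc.1.1).tendsto.comp (tendsto_nhdsWithin_iff.2 ⟨hq, hq'⟩)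
  rw [coreLift_chartPt d o hpc.1] at h3; filter_upwards [h3 (hW.mem_nhds hpc.2), hq'] with i h4 h5
  exact hO ▸ ⟨coreLift_mem d o h5, h4⟩

lemma ev_shift_eq (o : δ 0 = 0) (hab : a ≠ b) (hbc : b ≠ c) (hu : IsSmoothPath δ u) (hv : IsSmoothPath δ v)
    {W : Set (𝓠)} (hW : IsOpen W) (hO : O = (𝓚).core ∩ W)
    (hinj : InjOn (brokenChart β d u v O).ψ O) {p : 𝓠}
    (hp : p ∈ O) {l : Filter ℝ} {t t' : ℝ → ℝ} {f g : ℝ → Ω} (ht : Tendsto t l (𝓝 0)) (ht' : Tendsto t' l (𝓝 0))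
    (hf : Tendsto f l (𝓝 (Υ p).2.1)) (hg : Tendsto g l (𝓝 (Υ p).2.2))
    (h1 : ∀ᶠ i in l, OnSlice β u v (p.1, f i, g i)) (h2 : ∀ᶠ i in l, dot (deriv u.1 0) (((φL).path (f i)).1 (t i) - u.1 0) = 0 ∧
      dot (deriv v.1 0) (((φR).path (g i)).1 (t' i) - v.1 0) = 0) : ∀ᶠ i in l, t i = t' i := by
  have hpc := (hO ▸ hp).1; have hV := hpc.1
  obtain ⟨Q, hQ, hQ'⟩ : ∃ Q : ℝ → Ξ, Tendsto Q l (𝓝 (Υ p)) ∧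
      ∀ᶠ i in l, IsReparam (β := β) d o u v p.1 (t i) (t' i) (f i) (g i) (Q i) := by
    rcases eq_or_ne p.1 0 with h0 | h0
    · refine ⟨_, tendsto_reparam_zero d o h0 ht ht' hf hg, Eventually.of_forall fun i => ?_⟩
      rw [h0]; exact isReparam_zero d o hab hbc _ _ _ _
    · have hR := two_lt_len (lt_of_le_of_ne hV.1 h0.symm) hV.2
      refine ⟨_, tendsto_reparam d o hu hv hpc h0 ht ht' hf hg, ?_⟩
      filter_upwards [(ht.sub ht').eventually (gt_mem_nhds (show (0 : ℝ) - 0 < ℓ p.1 - 2 by linarith)),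
        ht.eventually (gt_mem_nhds (show 0 < ℓ p.1 / 2 - 1 by linarith)),
        ht'.eventually (lt_mem_nhds (show 1 - ℓ p.1 / 2 < 0 by linarith))] with i h3 h4 h5
      exact isReparam_cutPt d o hV h0 (by linarith) h4 h5 _ _
  have hq := (tendsto_const_nhds (x := p.1)).prodMk_nhds (hf.prodMk_nhds hg)
  filter_upwards [ev_coreLift_mem d o hW hO hp hQ (hQ'.mono fun i h => h.1),
    ev_coreLift_mem d o hW hO hp hq (Eventually.of_forall fun i => hV), hQ', h1, h2] with i h3 h4 h5 h10 h11
  have h12 : OnSlice β u v (Q i) := ⟨(congrArg (fun y => dot (deriv u.1 0) (y - u.1 0)) h5.2.2.1).trans h11.1,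
    (congrArg (fun y => dot (deriv v.1 0) (y - v.1 0)) h5.2.2.2.1).trans h11.2⟩
  exact h5.2.2.2.2 h12 h10 (hinj h3 h4 ((coreLift_cls d o h5.1 h12).trans
    (h5.2.1.trans (coreLift_cls d o (q := (p.1, f i, g i)) hV h10).symm)))

lemma transversal_of_brChart (o : δ 0 = 0) (hab : a ≠ b) (hbc : b ≠ c) (hu : IsSmoothPath δ u) (hv : IsSmoothPath δ v)
    (h : IsPolyfoldChart (brokenChart β d u v O)) : ∀ p ∈ O, Transversal d p.2.1 ∧ Transversal d p.2.2 := fun p hp => by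
  obtain ⟨W, hW, hO⟩ := h.isOpen; have hs := onSlice_chartPt (β := β) d p; let f₀ : Ω := (Υ p).2.1
  let g₀ : Ω := (Υ p).2.2
  have hid : Tendsto (fun s : ℝ => s) (𝓝[≠] 0) (𝓝 0) := tendsto_id.mono_left nhdsWithin_le_nhds
  have hf₀ : Tendsto (fun _ : ℝ => f₀) (𝓝[≠] 0) (𝓝 f₀) := tendsto_const_nhds
  have hg₀ : Tendsto (fun _ : ℝ => g₀) (𝓝[≠] 0) (𝓝 g₀) := tendsto_const_nhds
  have h0' : Tendsto (fun _ : ℝ => (0 : ℝ)) (𝓝[≠] 0) (𝓝 0) := tendsto_const_nhds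
  have hs1 := hs.1
  have hs2 := hs.2
  have hd1 :=
    congrArg (fun w : Ψ a b => (dot (deriv u.1 0) (deriv w.1 0) : ℝ)) ((φL).path_coord (u.add (sliceSob p.2.1)))
  have hd2 :=
    congrArg (fun w : Ψ b c => (dot (deriv v.1 0) (deriv w.1 0) : ℝ)) ((φR).path_coord (v.add (sliceSob p.2.2)))
  constructor
  · intro h0; obtain ⟨F, hF, hF'⟩ := (φL).exists_double_crossing hu.2 hs1 (hd1.trans h0)
    obtain ⟨s, h2, h3⟩ := ((ev_shift_eq d o hab hbc hu hv hW hO h.injOn hp (f := F) hid h0' hF hg₀ (hF'.mono fun s hs' => ⟨hs'.1, hs2⟩) (hF'.mono fun s hs' => ⟨hs'.2, hs2⟩)).and self_mem_nhdsWithin).exists; exact h3 h2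
  · intro h0; obtain ⟨F, hF, hF'⟩ := (φR).exists_double_crossing hv.2 hs2 (hd2.trans h0)
    obtain ⟨s, h2, h3⟩ := ((ev_shift_eq d o hab hbc hu hv hW hO h.injOn hp (g := F) h0' hid hf₀ hF (hF'.mono fun s hs' => ⟨hs1, hs'.1⟩) (hF'.mono fun s hs' => ⟨hs1, hs'.2⟩)).and self_mem_nhdsWithin).exists; exact h3 h2.symm

end Transversality

/-! ### Small time shifts -/

lemma ev_norm_lt {α V : Type*} [NormedAddCommGroup V] {F : Filter α} {P : α → V → Prop}
    (H : ∀ (l : Ultrafilter α) (τ : α → V), ↑l ≤ F → (∀ᶠ p in (l : Filter α), P p (τ p)) → Tendsto τ l (𝓝 0)) (hε : 0 < ε) :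
    ∀ᶠ p in F, ∀ t, P p t → ‖t‖ < ε := by
  by_contra hF
  have hF : ∃ᶠ p in F, ∃ t, P p t ∧ ε ≤ ‖t‖ := fun h => hF (h.mono fun p hp t ht => lt_of_not_ge fun h' => hp ⟨t, ht, h'⟩)
  have : (F ⊓ 𝓟 {p | ∃ t, P p t ∧ ε ≤ ‖t‖}).NeBot := frequently_mem_iff_neBot.1 hF
  let l := Ultrafilter.of (F ⊓ 𝓟 {p | ∃ t, P p t ∧ ε ≤ ‖t‖})
  have hl := Ultrafilter.of_le (F ⊓ 𝓟 {p | ∃ t, P p t ∧ ε ≤ ‖t‖})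
  have hl1 : ∀ᶠ p in (l : Filter α), ∃ t, P p t ∧ ε ≤ ‖t‖ := le_principal_iff.1 (hl.trans inf_le_right)
  choose! τ hτ using fun (p : α) (h : ∃ t, P p t ∧ ε ≤ ‖t‖) => h
  have h1 := H l τ (hl.trans inf_le_left) (hl1.mono fun p hp => (hτ p hp).1)
  obtain ⟨p, h2, h3⟩ := (((tendsto_zero_iff_norm_tendsto_zero.1 h1).eventually (gt_mem_nhds hε)).and hl1).exists
  exact (hτ p h3).2.not_gt h2

section Existence

variable (d : StrictMono δ) (o : δ 0 = 0)

lemma IsTransition.ev_shift_lt (o : δ 0 = 0) (hφ : IsTransition a b φ) (hab : a ≠ b) (f₁ : Ω) (hε : 0 < ε) :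
    ∀ᶠ p : ΩΩ in 𝓝 (f₁, f₁), ∀ t : ℝ, (∀ s, (hφ.path p.2).1 s = (hφ.path p.1).1 (s + t)) → ‖t‖ < ε := by
  refine ev_norm_lt (fun l τ hl h => ?_) hε; obtain ⟨u1, u2, u3⟩ := hφ.path_facts o f₁
  have h1 : Tendsto (fun p : ΩΩ => p.1) l (𝓝 f₁) := (continuous_fst.tendsto (f₁, f₁)).mono_left hl
  have h2 : Tendsto (fun p : ΩΩ => p.2) l (𝓝 f₁) := (continuous_snd.tendsto (f₁, f₁)).mono_left hl
  obtain ⟨t, ht, ht'⟩ := exists_shift l (τ := τ) (hφ.tendstoUniformly o h1).tendstoLeft (hφ.tendstoUniformly o h2).tendstoLeft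
    u1 u1 u2 u2 u3 u3 hab hab h
  rwa [eq_zero_of_periodic u2 u3 hab ht'] at ht

lemma ev_shift_lt_glued (o : δ 0 = 0) (hab : a ≠ b) (hbc : b ≠ c) (f₁ g₁ : Ω) (hε : 0 < ε) :
    ∀ᶠ p : Ξ × Ξ in 𝓝 ((0, f₁, g₁), (0, f₁, g₁)), 0 ≤ p.1.1 → 0 ≤ p.2.1 → ∀ t : ℝ × ℝ,
      (∀ s, leftPart β a b c p.2 s = leftPart β a b c p.1 (s + t.1)) ∧
      (∀ s, rightPart β a b c p.2 s = rightPart β a b c p.1 (s + t.2)) → ‖t‖ < ε := by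
  refine (ev_norm_lt (P := fun (p : Ξ × Ξ) (t : ℝ × ℝ) => (0 ≤ p.1.1 ∧ 0 ≤ p.2.1) ∧
    (∀ s, leftPart β a b c p.2 s = leftPart β a b c p.1 (s + t.1)) ∧
      ∀ s, rightPart β a b c p.2 s = rightPart β a b c p.1 (s + t.2)) (fun l τ hl h => ?_) hε).mono fun p hp h1 h2 t ht => hp t ⟨⟨h1, h2⟩, ht⟩
  obtain ⟨-, u2, u3⟩ := (φL).path_facts o f₁; obtain ⟨-, v2, v3⟩ := (φR).path_facts o g₁
  have h1 : Tendsto (fun p : Ξ × Ξ => p.1) l (𝓝 (0, f₁, g₁)) := (continuous_fst.tendsto ((0, f₁, g₁), (0, f₁, g₁))).mono_left hl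
  have h2 : Tendsto (fun p : Ξ × Ξ => p.2) l (𝓝 (0, f₁, g₁)) := (continuous_snd.tendsto ((0, f₁, g₁), (0, f₁, g₁))).mono_left hl
  obtain ⟨t, t', ht, ht', h3, h4⟩ := exists_shift_glued β o hab hbc l (τ := fun p => (τ p).1) (τ' := fun p => (τ p).2) h1
    (h.mono fun p hp => hp.1.1) h2 (h.mono fun p hp => hp.1.2) (h.mono fun p hp => hp.2.1) (h.mono fun p hp => hp.2.2)
  rw [eq_zero_of_periodic u2 u3 hab h3] at ht; rw [eq_zero_of_periodic v2 v3 hbc h4] at ht'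
  exact ht.prodMk_nhds ht'

lemma IsTransition.cont_deriv_path (o : δ 0 = 0) (hφ : IsTransition a b φ) :
    Continuous fun f : Ω => deriv (hφ.path f).1 0 := by
  have h : (fun f : Ω => deriv (hφ.path f).1 0) = fun f : Ω =>
      deriv φ 0 + Sob.ev o.ge le_rfl 0 (Sob.D (k := 1) (δ := δ 0) le_rfl le_rfl le_rfl f) := funext fun f => hφ.deriv_path f 0
  rw [h]
  exact continuous_const.add ((Sob.ev o.ge le_rfl 0).continuous.comp (Sob.D le_rfl le_rfl le_rfl).continuous)

lemma IsTransition.exists_transversal_ball (o : δ 0 = 0) (hφ : IsTransition a b φ) (h : deriv (hφ.path f₁).1 0 ≠ 0) :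
    ∃ ε > 0, ∀ u : Ψ a b, ‖hφ.coord u - f₁‖ < ε → ∀ f : Ω, ‖f - f₁‖ < ε →
      dot (deriv u.1 0) (deriv (hφ.path f).1 0) ≠ 0 ∧ ∀ (p : Vec N) (t : ℝ), |t| < ε →
        dot (deriv u.1 0) ((hφ.path f).1 0 - p) = 0 → dot (deriv u.1 0) ((hφ.path f).1 t - p) = 0 → t = 0 := by
  have h0 : 0 < dot (deriv (hφ.path f₁).1 0) (deriv φ 0 + deriv f₁.1 0) := by
    rw [← hφ.deriv_path]; exact real_inner_self_pos.2 h
  obtain ⟨κ, hκ, ε, hε, H⟩ := exists_slope (hφ.1.of_le (by simp)) o.ge le_rfl f₁ h0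
  obtain ⟨ε', hε', H'⟩ := Metric.eventually_nhds_iff.1
    ((hφ.cont_deriv_path o).continuousAt.eventually (Metric.ball_mem_nhds (deriv (hφ.path f₁).1 0) hε))
  refine ⟨min ε ε', lt_min hε hε', fun u hu f hf => ?_⟩
  have h1 : ‖deriv u.1 0 - deriv (hφ.path f₁).1 0‖ < ε := by
    have h2 := H' (y := hφ.coord u) (by rw [dist_eq_norm]; exact hu.trans_le (min_le_right _ _))
    rw [dist_eq_norm] at h2
    exact (congrArg (fun w : Ψ a b => ‖deriv w.1 0 - deriv (hφ.path f₁).1 0‖) (hφ.path_coord u)).symm.trans_lt h2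
  have h2 : ∀ s, |s - 0| ≤ ε → κ ≤ dot (deriv u.1 0) (deriv (hφ.path f).1 s) := fun s hs => by
    rw [hφ.deriv_path]; exact H f (hf.trans_le (min_le_left _ _)) _ h1 s hs
  refine ⟨(hκ.trans_le (h2 0 (by simpa using hε.le))).ne', fun p t ht e1 e2 => ?_⟩
  refine eq_of_slope ((hφ.path f).contDiff.differentiable (by simp)) hκ h2 (by rw [sub_zero]; exact (ht.trans_le (min_le_left _ _)).le)
    (by simpa using hε.le) ?_
  rw [inner_sub_right, sub_eq_zero] at e1 e2; rw [e1, e2]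

/-! ### Charts at unbroken trajectories -/

lemma isChart_trajChart_iff (o : δ 0 = 0) {u : Ψ a c} {O : Set (𝓟)} :
    IsPolyfoldChart (trajChart d u O).unbroken (X := 𝓧) ↔ IsPolyfoldChart (trajChart d u O) :=
  ⟨fun h => ⟨h.1, h.2, (Topology.IsOpenEmbedding.of_comp_iff _ (isOpenEmbedding_unbroken β d o)).1 h.3⟩,
    fun h => ⟨h.1, h.2, (isOpenEmbedding_unbroken β d o).comp h.3⟩⟩

lemma exists_trajChart (d : StrictMono δ) (o : δ 0 = 0) (hac : a ≠ c) (h : deriv ((φU).path f₁).1 0 ≠ 0) :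
    ∃ ε > 0, ∀ u : Ψ a c, IsSmoothPath δ u → ‖(φU).coord u - f₁‖ < ε →
      IsPolyfoldChart (trajChart d u {p | ‖(φU).coord (u.add (sliceSob p.2)) - f₁‖ < ε}) := by
  obtain ⟨ε₁, hε₁, H1⟩ := (φU).exists_transversal_ball o h
  obtain ⟨ε₂, hε₂, H2⟩ := Metric.eventually_nhds_iff.1 ((φU).ev_shift_lt o hac f₁ hε₁)
  refine ⟨min ε₁ ε₂, lt_min hε₁ hε₂, fun u hu hu' => (isChart_trajChart_iff (β := β) (b := b) d o).1 ?_⟩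
  let O : Set (𝓟) := {p | ‖(φU).coord (u.add (sliceSob p.2)) - f₁‖ < min ε₁ ε₂}; have hO : IsOpen O := by
    have h1 : Continuous fun p : 𝓟 => (φU).coord u + sliceSob p.2 :=
      continuous_const.add (((slIncl d o (deriv u.1 0)).map 0).continuous.comp continuous_snd)
    have h2 : O = {p | ‖(φU).coord u + sliceSob p.2 - f₁‖ < min ε₁ ε₂} := by simp only [O, IsTransition.coord_add]
    rw [h2]; exact isOpen_lt (h1.sub continuous_const).norm continuous_const
  have hP := fun p => hasParam_trajChart (β := β) (b := b) (O := O) d o hu p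
  have hT : ∀ p ∈ O, dot (deriv u.1 0) (deriv (u.add (sliceSob p.2)).1 0) ≠ 0 := fun p hp => by
    have h1 := (H1 u (hu'.trans_le (min_le_left _ _)) _ (hp.trans_le (min_le_left _ _))).1
    rwa [(φU).path_coord] at h1
  have hcore : ∀ p, p ∈ (trivialSplicing 𝓔u).core := fun p => ⟨mem_univ _, rfl⟩
  refine isChart_of_lift (κ := (trajChart d u O).unbroken (β := β) (b := b))
    (isScSplicing_trivialSplicing (banach_sliceScale d o _)) hO (Eq.symm (inter_eq_right.2 fun p _ => hcore p)) (fun p hp => ?_)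
    (fun p hp p' hp' he => ?_) fun p hp => ?_
  · exact ((hP p).continuousWithinAt (hcore p) (cont_ucls β).continuousOn).mono fun p _ => hcore p
  · obtain ⟨t, ht⟩ := PathSpace.cls_eq_iff.1 (BrokenTraj.unbroken.inj he)
    let f := (φU).coord (u.add (sliceSob p.2)); let f' := (φU).coord (u.add (sliceSob p'.2))
    have e1 : (φU).path f = u.add (sliceSob p.2) := (φU).path_coord _
    have e2 : (φU).path f' = u.add (sliceSob p'.2) := (φU).path_coord _
    have h1 : ‖t‖ < ε₁ := H2 (y := (f, f')) (max_lt (by rw [dist_eq_norm]; exact hp.trans_le (min_le_right _ _))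
      (by rw [dist_eq_norm]; exact hp'.trans_le (min_le_right _ _))) t (by rw [e1, e2]; exact ht)
    have h2 := (H1 u (hu'.trans_le (min_le_left _ _)) f (hp.trans_le (min_le_left _ _))).2 (u.1 0) t h1
      ((congrArg (fun w : Ψ a c => dot (deriv u.1 0) (w.1 0 - u.1 0)) e1).trans (inner_add_sliceSob d p.2)) (by
        have h3 := ht 0; rw [zero_add] at h3; rw [e1, ← h3]; exact inner_add_sliceSob d p'.2)
    refine Prod.ext (Subsingleton.elim (α := Fin 0 → ℝ) _ _) (Subtype.ext (Sob.ext fun s => ?_))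
    have h3 := ht s; rw [h2, add_zero] at h3; exact (add_left_cancel h3).symm
  · let f := (φU).coord (u.add (sliceSob p.2))
    refine HasLift.nhds_le (m := unbrModel β d o a b c) (x := f) (mem_univ _) (mem_univ _) hp
      (congrArg (fun w : Ψ a c => (BrokenTraj.unbroken w.cls : 𝓧)) ((φU).path_coord _).symm) ?_ (hasLift_trajChart d o hu hT)
    change 𝓝 (𝓤 f) ≤ map 𝓤 (𝓝[univ] f); rw [nhdsWithin_univ]; exact nhds_ucls β d o f

end Existence

/-! ### Charts at broken trajectories -/

section Existence

variable (d : StrictMono δ) (o : δ 0 = 0)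

lemma leftPart_eq (h : q.1 ≠ 0 → s + 1 ≤ ℓ q.1 / 2) : leftPart β a b c q s = ((φL).path q.2.1).1 s := by
  rw [leftPart]
  split_ifs with h0
  · rfl
  · exact glue_eq_left (h h0) _ _

lemma rightPart_eq (h : q.1 ≠ 0 → 1 ≤ s + ℓ q.1 / 2) : rightPart β a b c q s = ((φR).path q.2.2).1 s := by
  rw [rightPart]
  split_ifs with h0
  · rfl
  · exact glue_eq_right (h h0) _ _

lemma antiglue_eq_zero_of_mem_core (o : δ 0 = 0) {p : 𝓠} (hp : p ∈ (𝓚).core) (h0 : p.1 ≠ 0) :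
    antiglue β (ℓ p.1) ((sliceSob p.2.1).1, (sliceSob p.2.2).1) = 0 := by
  obtain ⟨r, e⟩ := p; change r ≠ 0 at h0; have hr : 0 < r := lt_of_le_of_ne hp.1.1 (Ne.symm h0)
  refine (mem_kerAntiglue β d h0 e).1 ?_
  have h2 := ((isCompl_ker β d o (n := deriv u.1 0) (n' := deriv v.1 0) hr hp.1.2).2 e).1
  rw [← glProj_eq β d o hr hp.1.2] at h2
  exact (congrArg (· ∈ kerAntiglue β d (deriv u.1 0) (deriv v.1 0) r) hp.2).mp h2

lemma core_ext (o : δ 0 = 0) {p p' : 𝓠} (hp : p ∈ (𝓚).core) (hp' : p' ∈ (𝓚).core) (h : p'.1 = p.1)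
    (hL : ∀ s, leftPart β a b c (Υ p') s = leftPart β a b c (Υ p) s)
    (hR : ∀ s, rightPart β a b c (Υ p') s = rightPart β a b c (Υ p) s) : p' = p := by
  obtain ⟨r, x, y⟩ := p; obtain ⟨r', x', y'⟩ := p'; obtain rfl : r' = r := h
  have e1 : (φL).path ((φL).coord (u.add (sliceSob x))) = u.add (sliceSob x) := (φL).path_coord _
  have e1' : (φL).path ((φL).coord (u.add (sliceSob x'))) = u.add (sliceSob x') := (φL).path_coord _
  have e2 : (φR).path ((φR).coord (v.add (sliceSob y))) = v.add (sliceSob y) := (φR).path_coord _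
  have e2' : (φR).path ((φR).coord (v.add (sliceSob y'))) = v.add (sliceSob y') := (φR).path_coord _
  suffices h : (sliceSob x').1 = (sliceSob x).1 ∧ (sliceSob y').1 = (sliceSob y).1 from
    Prod.ext rfl (Prod.ext (Subtype.ext (Subtype.ext h.1)) (Subtype.ext (Subtype.ext h.2)))
  rcases eq_or_ne r' 0 with h0 | h0
  · constructor
    · funext s; have h1 := hL s; rw [leftPart_eq fun h => (h h0).elim, leftPart_eq fun h => (h h0).elim] at h1
      exact add_left_cancel ((congrFun (congrArg Subtype.val e1') s).symm.trans (h1.trans (congrFun (congrArg Subtype.val e1) s)))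
    · funext s; have h1 := hR s
      rw [rightPart_eq fun h => (h h0).elim, rightPart_eq fun h => (h h0).elim] at h1
      exact add_left_cancel ((congrFun (congrArg Subtype.val e2') s).symm.trans (h1.trans (congrFun (congrArg Subtype.val e2) s)))
  · have h1 : glue β (ℓ r') ((u.add (sliceSob x')).1, (v.add (sliceSob y')).1) =
        glue β (ℓ r') ((u.add (sliceSob x)).1, (v.add (sliceSob y)).1) := by
      rw [← e1, ← e1', ← e2, ← e2']; funext s; exact (if_neg h0).symm.trans ((hL s).trans (if_neg h0))
    have h2 := antiglue_eq_zero_of_mem_core d o hp h0; have h2' := antiglue_eq_zero_of_mem_core d o hp' h0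
    have h3 := eq_zero_of_glue_antiglue β (R := ℓ r') (f := (sliceSob x').1 - (sliceSob x).1)
      (g := (sliceSob y').1 - (sliceSob y).1) ?_ ?_
    · exact ⟨sub_eq_zero.1 h3.1, sub_eq_zero.1 h3.2⟩
    · refine Eq.trans ?_ ((map_sub (glue β (ℓ r')) _ _).trans (sub_eq_zero.2 h1))
      refine congrArg _ (Prod.ext ?_ ?_)
      · exact (add_sub_add_left_eq_sub (sliceSob x').1 (sliceSob x).1 u.1).symm
      · exact (add_sub_add_left_eq_sub (sliceSob y').1 (sliceSob y).1 v.1).symm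
    · exact (map_sub (antiglue β (ℓ r')) ((sliceSob x').1, (sliceSob y').1) ((sliceSob x).1, (sliceSob y).1)).trans
        (sub_eq_zero.2 (h2'.trans h2.symm))

lemma exists_le_len (M : ℝ) : ∃ ε > 0, ∀ r, 0 ≤ r → r < ε → r ≠ 0 → M ≤ ℓ r := by
  obtain ⟨ε, hε, h⟩ := Metric.mem_nhdsWithin_iff.1 (ev_len (r := fun r => r)
    (tendsto_id.mono_left nhdsWithin_le_nhds : Tendsto _ (𝓝[≥] (0 : ℝ)) _) self_mem_nhdsWithin M)
  exact ⟨ε, hε, fun r h0 h1 => h ⟨by simpa [abs_of_nonneg h0] using h1, h0⟩⟩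

lemma exists_injective_ball (d : StrictMono δ) (o : δ 0 = 0) (hab : a ≠ b) (hbc : b ≠ c) {g₁ : Ω} (hf : deriv ((φL).path f₁).1 0 ≠ 0)
    (hg : deriv ((φR).path g₁).1 0 ≠ 0) : ∃ ε > 0, ∀ (u : Ψ a b) (v : Ψ b c),
      ‖(φL).coord u - f₁‖ < ε → ‖(φR).coord v - g₁‖ < ε → ∀ p ∈ (𝓚).core,
        dist (Υ p) (0, f₁, g₁) < ε → (Transversal d p.2.1 ∧ Transversal d p.2.2) ∧
        ∀ p' ∈ (𝓚).core, dist (Υ p') (0, f₁, g₁) < ε →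
        𝓒 (Υ p) = 𝓒 (Υ p') → p' = p := by
  obtain ⟨ε₁, hε₁, H1⟩ := (φL).exists_transversal_ball o hf; obtain ⟨ε₂, hε₂, H2⟩ := (φR).exists_transversal_ball o hg
  obtain ⟨ε₃, hε₃, H3⟩ := exists_le_len (2 * (max ε₁ ε₂ + 1))
  obtain ⟨ε₄, hε₄, H4⟩ := Metric.eventually_nhds_iff.1 (ev_shift_lt_glued (β := β) o hab hbc f₁ g₁ (lt_min hε₁ hε₂))
  refine ⟨min (min ε₁ ε₂) (min ε₃ ε₄), lt_min (lt_min hε₁ hε₂) (lt_min hε₃ hε₄), fun u v hu hv p hp hpε => ?_⟩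
  simp only [lt_min_iff] at hu hv hpε; let q := Υ p; have hq := hpε
  change (dist q _ < _ ∧ dist q _ < _) ∧ dist q _ < _ ∧ dist q _ < _ at hq; have hL : ‖q.2.1 - f₁‖ < ε₁ := by
    rw [← dist_eq_norm]; exact ((le_max_left _ _).trans (le_max_right _ _)).trans_lt hq.1.1
  have hR : ‖q.2.2 - g₁‖ < ε₂ := by
    rw [← dist_eq_norm]; exact ((le_max_right _ _).trans (le_max_right _ _)).trans_lt hq.1.2
  have H1' := H1 u hu.1.1 q.2.1 hL; have H2' := H2 v hv.1.2 q.2.2 hR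
  have eL : (φL).path q.2.1 = u.add (sliceSob p.2.1) := (φL).path_coord _
  have eR : (φR).path q.2.2 = v.add (sliceSob p.2.2) := (φR).path_coord _
  have hT : Transversal d p.2.1 ∧ Transversal d p.2.2 := ⟨fun h => H1'.1
    ((congrArg (fun w : Ψ a b => (dot (deriv u.1 0) (deriv w.1 0) : ℝ)) eL).trans h), fun h => H2'.1
    ((congrArg (fun w : Ψ b c => (dot (deriv v.1 0) (deriv w.1 0) : ℝ)) eR).trans h)⟩
  refine ⟨hT, fun p' hp' hpε' he => ?_⟩; simp only [lt_min_iff] at hpε'; let q' := Υ p'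
  obtain ⟨h0, τ, τ', h1, h2, h3⟩ := exists_shift_of_gcls β he; have hq0 : 0 ≤ q.1 := hp.1.1
  have hq0' : 0 ≤ q'.1 := hp'.1.1
  have h4 := H4 (y := (q, q')) (max_lt hq.2.2 hpε'.2.2) hq0 hq0' (τ, τ') ⟨h1, h2⟩
  have hτ : |τ| < min ε₁ ε₂ := (le_max_left _ _).trans_lt h4
  have hτ' : |τ'| < min ε₁ ε₂ := (le_max_right _ _).trans_lt h4
  have hdist : ∀ q : Ξ, 0 ≤ q.1 → dist q (0, f₁, g₁) < ε₃ → q.1 ≠ 0 → 2 * (max ε₁ ε₂ + 1) ≤ ℓ q.1 := fun q h h' =>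
    H3 q.1 h (by have := (le_max_left _ _).trans_lt h'; rwa [Real.dist_eq, sub_zero, abs_of_nonneg h] at this)
  have hR1 := hdist q hq0 hq.2.1; have hR1' := hdist q' hq0' hpε'.2.1
  have hm : ∀ t, |t| < min ε₁ ε₂ → -max ε₁ ε₂ < t ∧ t < max ε₁ ε₂ := fun t ht =>
    ⟨by linarith [(abs_lt.1 ht).1, min_le_max (a := ε₁) (b := ε₂)], (abs_lt.1 ht).2.trans_le min_le_max⟩
  have hM : 0 < max ε₁ ε₂ := hε₁.trans_le (le_max_left _ _); have hs := onSlice_chartPt (β := β) d p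
  have hs' := onSlice_chartPt (β := β) d p'; have hτ0 : τ = 0 := by
    refine H1'.2 (u.1 0) τ (hτ.trans_le (min_le_left _ _)) hs.1 ?_; have e1 := h1 0
    rw [zero_add, leftPart_eq (fun h => by linarith [hR1' h]), leftPart_eq (fun h => by linarith [hR1 h, (hm τ hτ).2])] at e1
    exact (congrArg (fun y => dot (deriv u.1 0) (y - u.1 0)) e1.symm).trans hs'.1
  have hτ0' : τ' = 0 := by
    refine H2'.2 (v.1 0) τ' (hτ'.trans_le (min_le_right _ _)) hs.2 ?_; have e1 := h2 0
    rw [zero_add, rightPart_eq (fun h => by linarith [hR1' h]), rightPart_eq (fun h => by linarith [hR1 h, (hm τ' hτ').1])] at e1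
    exact (congrArg (fun y => dot (deriv v.1 0) (y - v.1 0)) e1.symm).trans hs'.2
  have hr : q'.1 = q.1 := by
    by_cases hq : q.1 = 0
    · rw [hq, h0.1 hq]
    · have h5 : τ' = τ + ℓ q'.1 - ℓ q.1 := h3 hq; rw [← glParam_len q'.1, ← glParam_len q.1]
      exact congrArg glParam (by linarith)
  exact core_ext d o hp hp' hr (fun s => (h1 s).trans (by rw [hτ0, add_zero])) fun s => (h2 s).trans (by rw [hτ0', add_zero])

lemma cont_chartPt (o : δ 0 = 0) : Continuous Υ := by
  have h1 : Continuous fun p : 𝓠 => (φL).coord u + sliceSob p.2.1 :=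
    continuous_const.add (((slIncl d o (deriv u.1 0)).map 0).continuous.comp (continuous_fst.comp continuous_snd))
  have h2 : Continuous fun p : 𝓠 => (φR).coord v + sliceSob p.2.2 :=
    continuous_const.add (((slIncl d o (deriv v.1 0)).map 0).continuous.comp (continuous_snd.comp continuous_snd))
  have h3 : Υ = fun p => (p.1, (φL).coord u + sliceSob p.2.1, (φR).coord v + sliceSob p.2.2) :=
    funext fun p => Prod.ext rfl (Prod.ext ((φL).coord_add u _) ((φR).coord_add v _))
  rw [h3]; exact continuous_fst.prodMk (h1.prodMk h2)

lemma exists_brChart (d : StrictMono δ) (o : δ 0 = 0) (hab : a ≠ b) (hbc : b ≠ c) {g₁ : Ω} (hf : deriv ((φL).path f₁).1 0 ≠ 0)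
    (hg : deriv ((φR).path g₁).1 0 ≠ 0) : ∃ ε > 0, ∀ (u : Ψ a b) (v : Ψ b c),
      IsSmoothPath δ u → IsSmoothPath δ v → ‖(φL).coord u - f₁‖ < ε → ‖(φR).coord v - g₁‖ < ε →
      IsPolyfoldChart (brokenChart β d u v ((𝓚).core ∩ {p | dist (Υ p) (0, f₁, g₁) < ε})) := by
  obtain ⟨ε, hε, H⟩ := exists_injective_ball d o hab hbc hf hg; refine ⟨ε, hε, fun u v hu hv hu' hv' => ?_⟩
  let W : Set (𝓠) := {p | dist (Υ p) (0, f₁, g₁) < ε}; let O := (𝓚).core ∩ W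
  have hW : IsOpen W := isOpen_lt ((cont_chartPt d o).dist continuous_const) continuous_const
  have hT : ∀ p ∈ O, Transversal d p.2.1 ∧ Transversal d p.2.2 := fun p hp => (H u v hu' hv' p hp.1 hp.2).1
  refine isChart_of_lift (κ := brokenChart β d u v O) (isScSplicing_glSplicing β d o) hW rfl (fun p hp => ?_)
    (fun p hp p' hp' he => ?_) fun p hp => ?_
  · obtain ⟨h1, h2⟩ := hasParam_brChart (β := β) (O := O) d o hu hv (p := p) hp.1.1
    rcases eq_or_ne p.1 0 with h0 | h0
    · exact ((h1 h0).continuousWithinAt hp.1 (contOn_gcls β)).mono inter_subset_left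
    · exact ((h2 h0).continuousWithinAt hp.1 (cont_ucls β).continuousOn).mono inter_subset_left
  · exact ((H u v hu' hv' p hp.1 hp.2).2 p' hp'.1 hp'.2 ((gcls_chartPt d p).trans (he.trans (gcls_chartPt d p').symm))).symm
  · have hq := mem_brDom (N := N) (δ := δ) (q := Υ p) hp.1.1; rcases eq_or_ne p.1 0 with h0 | h0
    · exact HasLift.nhds_le (m := brokenModel β d o a b c) (x := Υ p) h0 hq hp (gcls_chartPt d p).symm
        (nhds_gcls β d o hq) (hasLift_brChart_broken d o hu hv inter_subset_left hT)
    · let y : Ω := 𝓖 p.1 (Υ p).2.1 (Υ p).2.2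
      refine HasLift.nhds_le (m := unbrModel β d o a b c) (x := y) (mem_univ _) (mem_univ _) hp
        ((gcls_chartPt d p).symm.trans (gcls_eq β d o hq h0)) ?_ (hasLift_brChart d o hu hv inter_subset_left hT)
      change 𝓝 (𝓤 y) ≤ map 𝓤 (𝓝[univ] y); rw [nhdsWithin_univ]; exact nhds_ucls β d o y

end Existence

/-! ### The atlas -/

section Atlas

variable (d : StrictMono δ) (o : δ 0 = 0)

lemma IsTransition.exists_smooth_near (o : δ 0 = 0) (hφ : IsTransition a b φ) (f₁ : Ω) (hε : 0 < ε) :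
    ∃ u : Ψ a b, (∃ φ, IsTransition a b φ ∧ ∀ m, u.1 - φ ∈ sobolev N (m + 2) (δ m)) ∧
      ‖hφ.coord u - f₁‖ < ε ∧ u.1 0 = (hφ.path f₁).1 0 := by
  let B : Vec N →ₗ[ℝ] Ω := { toFun := Sob.bump
                             map_add' := fun v w => Sob.ext fun s => smul_add _ _ _
                             map_smul' := fun r v => Sob.ext fun s => smul_comm _ _ _ }
  have hB : Continuous B := B.continuous_of_finiteDimensional
  have hG : Continuous fun g : Ω => g + B (f₁.1 0 - g.1 0) :=
    continuous_id.add (hB.comp (continuous_const.sub (Sob.ev o.ge one_le_two 0).continuous))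
  have h1 : ∀ᶠ g : Ω in 𝓝 f₁, ‖g + B (f₁.1 0 - g.1 0) - f₁‖ < ε := by
    have h2 : Tendsto (fun g : Ω => ‖g + B (f₁.1 0 - g.1 0) - f₁‖) (𝓝 f₁) (𝓝 ‖f₁ + B (f₁.1 0 - f₁.1 0) - f₁‖) :=
      (hG.sub continuous_const).norm.tendsto f₁
    simp only [sub_self, map_zero, add_zero, norm_zero] at h2; exact h2.eventually (gt_mem_nhds hε)
  obtain ⟨g, hg, hgs, hgc⟩ := mem_closure_iff_nhds.1 (Sob.mem_closure_smooth o.ge one_le_two f₁) _ h1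
  refine ⟨hφ.path (g + B (f₁.1 0 - g.1 0)), ⟨φ, hφ, fun m => ?_⟩, by rw [hφ.coord_path]; exact hg, ?_⟩
  · change φ + (g + B (f₁.1 0 - g.1 0)).1 - φ ∈ _; rw [add_sub_cancel_left]
    exact Submodule.add_mem _ (mem_sobolev_of_compactSupp hgs hgc)
      (mem_sobolev_of_compactSupp (contDiff_bumpFn.smul contDiff_const) compactSupp_bumpFn.smul_right)
  · change φ 0 + (g.1 0 + bumpFn 0 • (f₁.1 0 - g.1 0)) = φ 0 + f₁.1 0
    rw [bumpFn_eq_one (by simp), one_smul, add_sub_cancel]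

lemma IsTransition.exists_slice (d : StrictMono δ) (o : δ 0 = 0) (hφ : IsTransition a b φ) (h : deriv (hφ.path f₁).1 0 ≠ 0) (hε : 0 < ε) :
    ∃ u : Ψ a b, IsSmoothPath δ u ∧ ‖hφ.coord u - f₁‖ < ε ∧ ∃ x : (𝓔u).L 0, u.add (sliceSob x) = hφ.path f₁ := by
  obtain ⟨ε', hε', H⟩ := hφ.exists_transversal_ball o h
  obtain ⟨u, h1, h2, h3⟩ := hφ.exists_smooth_near o f₁ (lt_min hε hε')
  refine ⟨u, ⟨h1, fun h4 => (H u (h2.trans_le (min_le_right _ _)) f₁ (by rwa [sub_self, norm_zero])).1 ?_⟩,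
    h2.trans_le (min_le_left _ _), hφ.slCoord d o u f₁, hφ.add_slCoord d o ?_⟩
  · rw [h4, inner_zero_left]
  · rw [h3, sub_self, inner_zero_right]

lemma IsTransition.exists_shift_deriv_ne (d : StrictMono δ) (o : δ 0 = 0) (hφ : IsTransition a b φ) (hab : a ≠ b) (f : Ω) :
    ∃ f₁ : Ω, (hφ.path f₁).cls = (hφ.path f).cls ∧ deriv (hφ.path f₁).1 0 ≠ 0 := by
  obtain ⟨t, ht⟩ : ∃ t, deriv (hφ.path f).1 t ≠ 0 := by
    by_contra! h; have h1 := is_const_of_deriv_eq_zero ((hφ.path f).contDiff.differentiable (by simp)) h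
    have h2 : ∀ l : Filter ℝ, l.NeBot → ∀ x, Tendsto (hφ.path f).1 l (𝓝 x) → (hφ.path f).1 0 = x := fun l _ x hx =>
      tendsto_nhds_unique (tendsto_const_nhds.congr fun s => h1 0 s) hx
    exact hab ((h2 atBot inferInstance a ((hφ.path f).tendsto_atBot o.ge)).symm.trans
      (h2 atTop inferInstance b ((hφ.path f).tendsto_atTop o.ge)))
  refine ⟨hφ.shCoord d o t f, (congrArg PathSpace.cls (hφ.path_shCoord d o t f)).trans (PathSpace.cls_shift t _), ?_⟩
  have h1 : (hφ.path (hφ.shCoord d o t f)).1 = fun s => (hφ.path f).1 (s + t) := congrArg Subtype.val (hφ.path_shCoord d o t f)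
  rwa [h1, deriv_comp_add_const, zero_add]

lemma zero_mem_core (u : Ψ a b) (v : Ψ b c) (x : (𝓐).L 0) : ((0, x) : 𝓠) ∈ (𝓚).core := ⟨⟨le_rfl, glBound_pos⟩, glProj_zero β d x⟩

lemma add_sliceSob_zero (u : Ψ a b) : u.add (sliceSob (0 : (𝓔u).L 0)) = u := Subtype.ext (add_zero u.1)

lemma mem_trajBall (hφ : IsTransition a b φ) (h : ‖hφ.coord u - f₁‖ < ε) :
    (0 : 𝓟) ∈ {p : 𝓟 | ‖hφ.coord (u.add (sliceSob p.2)) - f₁‖ < ε} :=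
  (congrArg (fun w => ‖hφ.coord w - f₁‖) (add_sliceSob_zero d u)).trans_lt h

lemma chartPt_zero (u : Ψ a b) (v : Ψ b c) : Υ (0 : 𝓠) = (0, (φL).coord u, (φR).coord v) :=
  Prod.ext rfl (Prod.ext (congrArg (φL).coord (add_sliceSob_zero d u)) (congrArg (φR).coord (add_sliceSob_zero d v)))

lemma mem_brokenBall {g₁ : Ω} (hε : 0 < ε) (h : ‖(φL).coord u - f₁‖ < ε) (h' : ‖(φR).coord v - g₁‖ < ε) :
    (0 : 𝓠) ∈ (𝓚).core ∩ {p | dist (Υ p) (0, f₁, g₁) < ε} := by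
  have h1 : dist ((0 : ℝ), (φL).coord u, (φR).coord v) (0, f₁, g₁) < ε :=
    max_lt (by rwa [dist_self]) (max_lt (by rwa [dist_eq_norm]) (by rwa [dist_eq_norm]))
  exact ⟨zero_mem_core d u v 0, (congrArg (dist · ((0 : ℝ), f₁, g₁)) (chartPt_zero d u v)).trans_lt h1⟩

lemma exists_isChart_trajChart (β : Cutoff) (b : Vec N) (o : δ 0 = 0) (hac : a ≠ c) {u : Ψ a c} (hu : IsSmoothPath δ u) :
    ∃ O, 0 ∈ O ∧ IsPolyfoldChart (trajChart d u O) := by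
  have h1 : deriv ((φU).path ((φU).coord u)).1 0 ≠ 0 :=
    fun h => hu.2 ((congrArg (fun w : Ψ a c => deriv w.1 0) ((φU).path_coord u)).symm.trans h)
  obtain ⟨ε, hε, H⟩ := exists_trajChart (β := β) (b := b) d o hac h1
  have h2 : ‖(φU).coord u - (φU).coord u‖ < ε := by rwa [sub_self, norm_zero]
  exact ⟨_, mem_trajBall d φU h2, H u hu h2⟩

lemma exists_isChart_brChart (o : δ 0 = 0) (hab : a ≠ b) (hbc : b ≠ c)
    (hu : IsSmoothPath δ u) (hv : IsSmoothPath δ v) : ∃ O, 0 ∈ O ∧ IsPolyfoldChart (brokenChart β d u v O) := by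
  have h1 : deriv ((φL).path ((φL).coord u)).1 0 ≠ 0 :=
    fun h => hu.2 ((congrArg (fun w : Ψ a b => deriv w.1 0) ((φL).path_coord u)).symm.trans h)
  have h2 : deriv ((φR).path ((φR).coord v)).1 0 ≠ 0 :=
    fun h => hv.2 ((congrArg (fun w : Ψ b c => deriv w.1 0) ((φR).path_coord v)).symm.trans h)
  obtain ⟨ε, hε, H⟩ := exists_brChart (β := β) d o hab hbc h1 h2
  have h3 : ∀ f : Ω, ‖f - f‖ < ε := fun f => by rwa [sub_self, norm_zero]
  exact ⟨_, mem_brokenBall d hε (h3 _) (h3 _), H u v hu hv (h3 _) (h3 _)⟩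

lemma exists_mem_trajCharts (o : δ 0 = 0) (hac : a ≠ c) (f : Ω) : ∃ κ ∈ allCharts β d a b c, 𝓤 f ∈ κ.ψ '' κ.O := by
  obtain ⟨f₁, h1, h2⟩ := (φU).exists_shift_deriv_ne d o hac f
  obtain ⟨ε, hε, H⟩ := exists_trajChart (β := β) (b := b) d o hac h2
  obtain ⟨u, hu, hu', y, hy⟩ := (φU).exists_slice d o h2 hε
  let O : Set (𝓟) := {p | ‖(φU).coord (u.add (sliceSob p.2)) - f₁‖ < ε}
  have h3 : ((0 : Fin 0 → ℝ), y) ∈ O := by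
    refine (congrArg (fun w => ‖(φU).coord w - f₁‖) hy).trans_lt ?_
    rwa [(φU).coord_path, sub_self, norm_zero]
  exact ⟨(trajChart d u O).unbroken, .inr ⟨_, ⟨u, O, hu, mem_trajBall d (φU) hu', H u hu hu', rfl⟩, rfl⟩, ((0 : Fin 0 → ℝ), y), h3,
    congrArg BrokenTraj.unbroken ((congrArg PathSpace.cls hy).trans h1)⟩

lemma exists_mem_brCharts (o : δ 0 = 0) (hab : a ≠ b) (hbc : b ≠ c) (f g : Ω) : ∃ κ ∈ allCharts β d a b c, 𝓒 (0, f, g) ∈ κ.ψ '' κ.O := by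
  obtain ⟨f₁, h1, h2⟩ := (φL).exists_shift_deriv_ne d o hab f
  obtain ⟨g₁, h1', h2'⟩ := (φR).exists_shift_deriv_ne d o hbc g
  obtain ⟨ε, hε, H⟩ := exists_brChart (β := β) d o hab hbc h2 h2'
  obtain ⟨u, hu, hu', y, hy⟩ := (φL).exists_slice d o h2 hε
  obtain ⟨v, hv, hv', z, hz⟩ := (φR).exists_slice d o h2' hε; let p : 𝓠 := (0, y, z)
  let O : Set (𝓠) := (𝓚).core ∩ {p | dist (Υ p) (0, f₁, g₁) < ε}; have h3 : Υ p = (0, f₁, g₁) :=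
    Prod.ext rfl (Prod.ext ((congrArg (φL).coord hy).trans ((φL).coord_path _)) ((congrArg (φR).coord hz).trans ((φR).coord_path _)))
  have h4 : p ∈ O := ⟨zero_mem_core d u v (y, z), ((congrArg (dist · ((0 : ℝ), f₁, g₁)) h3).trans (dist_self _)).trans_lt hε⟩
  refine ⟨brokenChart β d u v O, .inl ⟨u, v, O, hu, hv, mem_brokenBall d hε hu' hv', H u v hu hv hu' hv', rfl⟩, p, h4, ?_⟩
  rw [gcls_zero, ← h1, ← h1']; exact ((gcls_chartPt d p).symm.trans (congrArg 𝓒 h3)).trans (gcls_zero β f₁ g₁)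

lemma exists_mem_allCharts (o : δ 0 = 0) (hab : a ≠ b) (hbc : b ≠ c) (hac : a ≠ c) (x : 𝓧) :
    ∃ κ ∈ allCharts β d a b c, x ∈ κ.ψ '' κ.O := by
  rcases exists_eq_cls β x with ⟨f, rfl⟩ | ⟨f, g, rfl⟩
  · exact exists_mem_trajCharts d o hac f
  · exact exists_mem_brCharts d o hab hbc f g

/-- The properties of the charts that give the sc-smoothness of the transition maps. -/
structure IsModelled (β : Cutoff) (d : StrictMono δ) (o : δ 0 = 0) (a b c : Vec N) (κ : PolyfoldChart 𝓧) : Prop where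
  chart : IsPolyfoldChart κ
  good : ScGood κ.S.total
  dom : ScDom κ.S.total κ.S.dom
  param : ∀ p ∈ κ.S.dom, HasParam κ (unbrModel β d o a b c) p ∨ HasParam κ (brokenModel β d o a b c) p
  lift : HasLift κ (unbrModel β d o a b c)
  lift_broken : HasLift κ (brokenModel β d o a b c)

lemma IsModelled.isScTransition {κ κ' : PolyfoldChart 𝓧} (h : IsModelled β d o a b c κ) (h' : IsModelled β d o a b c κ') :
    IsScTransition κ κ' := by
  have := h.good; have := h'.good
  refine isScTransition_of_lift h.chart h'.chart h.dom fun p hp _ => (h.param p hp).elim (fun hm => ⟨_, ?_, fun U hU => ?_, hm, h'.lift⟩)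
    fun hm => ⟨_, ?_, fun U hU => scDom_brokenModel d o hU, hm, h'.lift_broken⟩
  · exact inferInstanceAs (ScGood ΔΘ)
  · exact (isOpen_univ.inter hU).scDom
  · exact inferInstanceAs (ScGood (𝓞))

lemma isModelled_trajChart (hac : a ≠ c) {u : Ψ a c} (hu : IsSmoothPath δ u) {O : Set (𝓟)} (h : IsPolyfoldChart (trajChart d u O)) :
    IsModelled β d o a b c (trajChart d u O).unbroken where
  chart := (isChart_trajChart_iff d o).2 h
  good := by
    have := (banach_sliceScale d o (deriv u.1 0)).scGood
    exact inferInstanceAs (ScGood ((ScScale.const (Fin 0 → ℝ)).sum 𝓔u))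
  dom := (isOpen_univ : IsOpen (univ : Set (𝓟))).scDom (E := (ScScale.const (Fin 0 → ℝ)).sum 𝓔u)
  param p _ := .inl (hasParam_trajChart d o hu p)
  lift := by
    obtain ⟨W, hW, hO⟩ := h.isOpen; have hO' : ∀ p : 𝓟, p ∈ W → p ∈ O := fun p hp => by
      have : p ∈ (trivialSplicing 𝓔u).core ∩ W := ⟨⟨mem_univ _, rfl⟩, hp⟩
      exact (hO.symm ▸ this : p ∈ (trajChart d u O).O)
    have hO2 : ∀ p ∈ O, p ∈ W := fun p hp => (hO ▸ hp : p ∈ (trivialSplicing 𝓔u).core ∩ W).2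
    refine hasLift_trajChart d o hu fun p hp => transversal_of_injOn d o (φU) hac hu
      (W := {x | ((0 : Fin 0 → ℝ), x) ∈ W}) (hW.preimage (continuous_const.prodMk continuous_id)) (fun x hx y hy e => ?_) ?_
    · exact congrArg Prod.snd (h.injOn (hO' _ hx) (hO' _ hy) e)
    · have h1 : ((0 : Fin 0 → ℝ), p.2) = p := Prod.ext (Subsingleton.elim (α := Fin 0 → ℝ) _ _) rfl
      change ((0 : Fin 0 → ℝ), p.2) ∈ W; exact h1 ▸ hO2 p hp
  lift_broken := hasLift_trajChart_broken d o

lemma isModelled_brChart (hab : a ≠ b) (hbc : b ≠ c) (hu : IsSmoothPath δ u)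
    (hv : IsSmoothPath δ v) {O : Set (𝓠)} (h : IsPolyfoldChart (brokenChart β d u v O)) :
    IsModelled β d o a b c (brokenChart β d u v O) where
  chart := h
  good := by
    have := (banach_pairScale d (n := deriv u.1 0) (n' := deriv v.1 0) o).scGood
    exact inferInstanceAs (ScGood ((Λ).sum 𝓐))
  dom := by
    have := (banach_pairScale d (n := deriv u.1 0) (n' := deriv v.1 0) o).scGood
    have h1 : (interior (Ico 0 glBound)).Nonempty := by
      rw [interior_Ico]; exact nonempty_Ioo.2 glBound_pos
    exact OpFam.scDom_of_interior 𝓐 ordConnected_Ico h1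
  param p hp := by
    obtain ⟨h1, h2⟩ := hasParam_brChart (β := β) (O := O) d o hu hv (p := p) hp
    exact (eq_or_ne p.1 0).elim (fun h0 => .inr (h1 h0)) fun h0 => .inl (h2 h0)
  lift := by
    obtain ⟨W, hW, hO⟩ := h.isOpen
    exact hasLift_brChart d o hu hv (fun p hp => (hO ▸ hp : p ∈ (𝓚).core ∩ W).1) (transversal_of_brChart d o hab hbc hu hv h)
  lift_broken := by
    obtain ⟨W, hW, hO⟩ := h.isOpen
    exact hasLift_brChart_broken d o hu hv (fun p hp => (hO ▸ hp : p ∈ (𝓚).core ∩ W).1) (transversal_of_brChart d o hab hbc hu hv h)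

lemma isModelled_of_mem (hab : a ≠ b) (hbc : b ≠ c) (hac : a ≠ c) {κ : PolyfoldChart 𝓧} (h : κ ∈ allCharts β d a b c) :
    IsModelled β d o a b c κ := by
  rcases h with ⟨u, v, O, hu, hv, -, h, rfl⟩ | ⟨_, ⟨u, O, hu, -, h, rfl⟩, rfl⟩
  · exact isModelled_brChart d o hab hbc hu hv h
  · exact isModelled_trajChart d o hac hu h

lemma isPfoldAtlas_allCharts (o : δ 0 = 0) (hab : a ≠ b) (hbc : b ≠ c) (hac : a ≠ c) : IsPolyfoldAtlas (allCharts β d a b c) where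
  t2 := BrokenTraj.t2Space β d o hab hbc hac
  secondCountable := BrokenTraj.secondCountableTopology β d o
  chart κ hκ := (isModelled_of_mem d o hab hbc hac hκ).chart
  compatible κ hκ κ' hκ' := by
    have h := isModelled_of_mem d o hab hbc hac hκ; have h' := isModelled_of_mem d o hab hbc hac hκ'
    exact ⟨h.isScTransition d o h', h'.isScTransition d o h⟩
  cover := exists_mem_allCharts d o hab hbc hac

lemma IsPolyfoldAtlas.exists_isPfoldStructure {X : Type} [TopologicalSpace X] {𝒜 : Set (PolyfoldChart X)} (h : IsPolyfoldAtlas 𝒜) :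
    ∃ M, IsPolyfoldStructure M ∧ 𝒜 ⊆ M := by
  obtain ⟨M, h1, h2⟩ := zorn_subset_nonempty {𝒜 : Set (PolyfoldChart X) | IsPolyfoldAtlas 𝒜} (fun C hC hchain hne => by
    obtain ⟨𝒜₀, h0⟩ := hne
    refine ⟨⋃₀ C, ⟨h.t2, h.secondCountable, ?_, ?_, fun x => ?_⟩, fun s hs => subset_sUnion_of_mem hs⟩
    · rintro κ ⟨s, hs, hκ⟩; exact (hC hs).chart κ hκ
    · rintro κ ⟨s, hs, hκ⟩ κ' ⟨s', hs', hκ'⟩; rcases hchain.total hs hs' with hle | hle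
      · exact (hC hs').compatible κ (hle hκ) κ' hκ'
      · exact (hC hs).compatible κ hκ κ' (hle hκ')
    · obtain ⟨κ, hκ, hx⟩ := (hC h0).cover x; exact ⟨κ, ⟨_, h0, hκ⟩, hx⟩) 𝒜 h
  exact ⟨M, h2, h1⟩

end Atlas

end

theorem mainTheorem9 (N : ℕ) (β : Cutoff) (δ : ℕ → ℝ) (hδ : StrictMono δ) (hδ0 : δ 0 = 0)
    (a b c : Vec N) (hab : a ≠ b) (hbc : b ≠ c) (hac : a ≠ c) :
    (∀ (u : PathSpace (δ 0) a b) (v : PathSpace (δ 0) b c),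
      IsSmoothPath δ u → IsSmoothPath δ v →
        ∃ O, 0 ∈ O ∧ IsPolyfoldChart (brokenChart β hδ u v O)) ∧
    (∀ u : PathSpace (δ 0) a c, IsSmoothPath δ u →
      ∃ O, 0 ∈ O ∧ IsPolyfoldChart (trajChart hδ u O)) ∧
    IsPolyfoldAtlas (allCharts β hδ a b c) ∧
    (∃ 𝓜, IsPolyfoldStructure 𝓜 ∧ allCharts β hδ a b c ⊆ 𝓜) ∧
    Topology.IsOpenEmbedding (BrokenTraj.unbroken : Traj (δ 0) a c → BrokenTraj β (δ 0) a b c) ∧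
    DenseRange (BrokenTraj.unbroken : Traj (δ 0) a c → BrokenTraj β (δ 0) a b c) ∧
    Topology.IsEmbedding (fun p : Traj (δ 0) a b × Traj (δ 0) b c =>
      (BrokenTraj.broken p.1 p.2 : BrokenTraj β (δ 0) a b c)) := by
  exact ⟨fun u v hu hv => exists_isChart_brChart hδ hδ0 hab hbc hu hv,
    fun u hu => exists_isChart_trajChart hδ β b hδ0 hac hu, isPfoldAtlas_allCharts hδ hδ0 hab hbc hac,
    (isPfoldAtlas_allCharts hδ hδ0 hab hbc hac).exists_isPfoldStructure, isOpenEmbedding_unbroken β hδ hδ0,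
    denseRange_unbroken β, isEmbedding_broken β hδ hδ0⟩
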